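/- Let $n\in\mathbb N$ and $\alpha\in(2,3)$. For real $s>0$ let $C^{s}(\mathbb R/\mathbb Z,\mathbb R^n)$ be the space of $\lfloor s\rfloor$ times continuously differentiable maps whose derivative of order $\lfloor s\rfloor$ is Hölder continuous with exponent $s-\lfloor s\rfloor$ (for integer $s$: the usual $C^s$), with the usual norm, and let $H^{s}=W^{s,2}$ be the Sobolev space on the circle. For a space $X$ of such maps let $X_{i,r}$ be the set of $C^1$ curves in $X$ that are injective on $\mathbb R/\mathbb Z$ and regular ($\gamma'\neq 0$ everywhere). For a regular curve $\gamma$ write $P^\perp_{\gamma'}u=u-\langle u,\tfrac{\gamma'}{|\gamma'|}\rangle\tfrac{\gamma'}{|\gamma'|}$, let $\kappa=\partial_s^2\gamma$, $\partial_s=|\gamma'|^{-1}\partial_x$, be the curvature vector, let $d_\gamma(x,y)$ be the length of the shorter arc of $\gamma$ between $\gamma(x)$ and $\gamma(y)$, and let $\mathrm{p.v.}\int_{-1/2}^{1/2}=\lim_{\varepsilon\downarrow0}\int_{[-1/2,1/2]\setminus[-\varepsilon,\varepsilon]}$. Put $$(H^\alpha\gamma)(x)=\mathrm{p.v.}\int_{-1/2}^{1/2}P^\perp_{\gamma'(x)}\Big\{2\alpha\frac{\gamma(x+w)-\gamma(x)}{|\gamma(x+w)-\gamma(x)|^{2+\alpha}}-(\alpha-2)\frac{\kappa(x)}{d_\gamma(x+w,x)^\alpha}-2\frac{\kappa(x)}{|\gamma(x+w)-\gamma(x)|^\alpha}\Big\}|\gamma'(x+w)|\,dw,$$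 the $L^2$-gradient (first variation) of O'Hara's energy $E^\alpha(\gamma)=\iint\big(|\gamma(x)-\gamma(y)|^{-\alpha}-d_\gamma(x,y)^{-\alpha}\big)|\gamma'(x)||\gamma'(y)|\,dx\,dy$, and $$(Q^\alpha\gamma)(x)=\mathrm{p.v.}\int_{-1/2}^{1/2}\Big(2\,\frac{\gamma(x+w)-\gamma(x)-w\gamma'(x)}{w^2}-\gamma''(x)\Big)\frac{dw}{|w|^\alpha}.$$ Then there is a single mapping $F^\alpha$ which, for every non-integer $\beta>0$, is a real-analytic map from $C^{\alpha+\beta}_{i,r}(\mathbb R/\mathbb Z,\mathbb R^n)$ to $C^{\beta}(\mathbb R/\mathbb Z,\mathbb R^n)$, such that $$H^\alpha\gamma=\frac{\alpha}{|\gamma'|^{\alpha+1}}P^\perp_{\gamma'}(Q^\alpha\gamma)+F^\alpha\gamma\qquad\text{for all }\gamma\in H^{\alpha+1}_{i,r}(\mathbb R/\mathbb Z,\mathbb R^n).$$ More precisely, for such $\gamma$ the principal value $(Q^\alpha\gamma)(x)$ exists for almost every $x$, and at every $x$ where it exists, $(H^\alpha\gamma)(x)$ exists as well and the identity holds at $x$.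 -/

import Mathlib

open scoped NNReal ENNReal InnerProductSpace Topology
open MeasureTheory Filter

namespace OHara

/-- `ℝⁿ` with its Euclidean norm. Maps `ℝ/ℤ → ℝⁿ` are represented by `1`-periodic maps
`ℝ → ℝⁿ`. -/
abbrev Eucl (n : ℕ) : Type := EuclideanSpace ℝ (Fin n)

/-! ### Hölder spaces on the circle -/

/-- The fractional part of `s`, as the Hölder exponent of the top derivative. -/
noncomputable def holderExp (s : ℝ) : ℝ≥0 := ⟨Int.fract s, Int.fract_nonneg s⟩

/-- `f ∈ C^s(ℝ/ℤ, ℝⁿ)` for a real `s ≥ 0`: `f` has period `1`, is `⌊s⌋` times continuously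
differentiable, and its derivative of order `⌊s⌋` is Hölder continuous with exponent `s - ⌊s⌋`.
(For an integer `s` the last condition says that this derivative is bounded, which holds for every
continuous periodic function, so that `C^s` is then the usual space of `s` times continuously
differentiable functions.) -/
structure MemC {n : ℕ} (s : ℝ) (f : ℝ → Eucl n) : Prop where
  periodic : Function.Periodic f 1
  contDiff : ContDiff ℝ (⌊s⌋₊ : ℕ) f
  memHolder : MemHolder (holderExp s) (iteratedDeriv ⌊s⌋₊ f)

/-- The Hölder norm `∑_{j ≤ ⌊s⌋} sup |f^{(j)}| + [f^{(⌊s⌋)}]_{s - ⌊s⌋}`. -/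
noncomputable def holderNorm {n : ℕ} (s : ℝ) (f : ℝ → Eucl n) : ℝ :=
  (∑ j ∈ Finset.range (⌊s⌋₊ + 1), ⨆ x : ℝ, ‖iteratedDeriv j f x‖) +
    (nnHolderNorm (holderExp s) (iteratedDeriv ⌊s⌋₊ f) : ℝ)

section HolderSpace

variable {n : ℕ} {s : ℝ} {f g : ℝ → Eucl n}

theorem periodic_iteratedDeriv (hf : Function.Periodic f 1) (j : ℕ) :
    Function.Periodic (iteratedDeriv j f) 1 := by
  intro x
  have h : (fun z => f (z + 1)) = f := funext hf
  have h2 := congrFun (iteratedDeriv_comp_add_const j f 1) x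
  simp only [h] at h2
  exact h2.symm

theorem MemC.contDiffAt (hf : MemC s f) {j : ℕ} (hj : j ≤ ⌊s⌋₊) (x : ℝ) :
    ContDiffAt ℝ (j : ℕ) f x :=
  (hf.contDiff.of_le (by exact_mod_cast hj)).contDiffAt

theorem MemC.bddAbove (hf : MemC s f) {j : ℕ} (hj : j ≤ ⌊s⌋₊) :
    BddAbove (Set.range fun x : ℝ => ‖iteratedDeriv j f x‖) := by
  have hc : Continuous (iteratedDeriv j f) :=
    hf.contDiff.continuous_iteratedDeriv j (by exact_mod_cast hj)
  have hp : Function.Periodic (fun x : ℝ => ‖iteratedDeriv j f x‖) 1 := fun x => by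
    simp only [periodic_iteratedDeriv hf.periodic j x]
  exact (hp.compact_of_continuous one_ne_zero hc.norm).bddAbove

theorem MemC.iteratedDeriv_add (hf : MemC s f) (hg : MemC s g) {j : ℕ} (hj : j ≤ ⌊s⌋₊) :
    iteratedDeriv j (f + g) = iteratedDeriv j f + iteratedDeriv j g :=
  funext fun x => by
    simpa using _root_.iteratedDeriv_add (hf.contDiffAt hj x) (hg.contDiffAt hj x)

theorem iteratedDeriv_smul' (c : ℝ) (j : ℕ) :
    iteratedDeriv j (c • f) = c • iteratedDeriv j f :=
  funext fun x => by
    simp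

theorem iteratedDeriv_zero' (j : ℕ) : iteratedDeriv j (0 : ℝ → Eucl n) = 0 := by
  funext x
  simp [iteratedDeriv_eq_iteratedFDeriv]

theorem MemC.zero : MemC s (0 : ℝ → Eucl n) where
  periodic := fun _ => rfl
  contDiff := contDiff_const
  memHolder := by
    rw [iteratedDeriv_zero']
    exact memHolder_zero

theorem MemC.add (hf : MemC s f) (hg : MemC s g) : MemC s (f + g) where
  periodic := hf.periodic.add hg.periodic
  contDiff := hf.contDiff.add hg.contDiff
  memHolder := by
    rw [hf.iteratedDeriv_add hg le_rfl]
    exact hf.memHolder.add hg.memHolder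

theorem MemC.smul (c : ℝ) (hf : MemC s f) : MemC s (c • f) where
  periodic := fun x => by simp [hf.periodic x]
  contDiff := contDiff_const.smul hf.contDiff
  memHolder := by
    rw [iteratedDeriv_smul']
    exact hf.memHolder.smul

/-- The functions of class `C^s`, as a subspace of all functions. -/
def holderSubmodule (n : ℕ) (s : ℝ) : Submodule ℝ (ℝ → Eucl n) where
  carrier := {f | MemC s f}
  add_mem' := fun hf hg => hf.add hg
  zero_mem' := MemC.zero
  smul_mem' := fun c _ hf => hf.smul c

/-- The Hölder space `C^s(ℝ/ℤ, ℝⁿ)`. -/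
def HolderSpace (n : ℕ) (s : ℝ) : Type := holderSubmodule n s

noncomputable instance : AddCommGroup (HolderSpace n s) :=
  inferInstanceAs (AddCommGroup (holderSubmodule n s))

noncomputable instance : Module ℝ (HolderSpace n s) :=
  inferInstanceAs (Module ℝ (holderSubmodule n s))

/-- The function underlying an element of `C^s(ℝ/ℤ, ℝⁿ)`. -/
def HolderSpace.toFun (u : HolderSpace n s) : ℝ → Eucl n := Subtype.val u

theorem HolderSpace.memC (u : HolderSpace n s) : MemC s u.toFun := Subtype.property u

noncomputable instance : Norm (HolderSpace n s) := ⟨fun u => holderNorm s u.toFun⟩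

theorem HolderSpace.core : NormedSpace.Core ℝ (HolderSpace n s) where
  norm_nonneg u := by
    change 0 ≤ holderNorm s u.toFun
    exact add_nonneg (Finset.sum_nonneg fun j _ => Real.iSup_nonneg fun x => norm_nonneg _)
      NNReal.zero_le_coe
  norm_smul c u := by
    change holderNorm s (c • u.toFun) = ‖c‖ * holderNorm s u.toFun
    have hu := u.memC
    unfold holderNorm
    rw [mul_add, Finset.mul_sum]
    congr 1
    · refine Finset.sum_congr rfl fun j _ => ?_
      rw [iteratedDeriv_smul',
        Real.mul_iSup_of_nonneg (norm_nonneg c)]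
      exact congrArg iSup (funext fun x => by simp [norm_smul])
    · rw [iteratedDeriv_smul', hu.memHolder.nnHolderNorm_smul]
      simp
  norm_triangle u v := by
    change holderNorm s (u.toFun + v.toFun) ≤ holderNorm s u.toFun + holderNorm s v.toFun
    have hu := u.memC
    have hv := v.memC
    have h1 : ∀ j ∈ Finset.range (⌊s⌋₊ + 1),
        (⨆ x : ℝ, ‖iteratedDeriv j (u.toFun + v.toFun) x‖) ≤
          (⨆ x : ℝ, ‖iteratedDeriv j u.toFun x‖) + ⨆ x : ℝ, ‖iteratedDeriv j v.toFun x‖ := by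
      intro j hj
      have hj' : j ≤ ⌊s⌋₊ := by simpa [Nat.lt_succ_iff] using hj
      rw [hu.iteratedDeriv_add hv hj']
      exact ciSup_le fun x => (norm_add_le _ _).trans
        (add_le_add (le_ciSup (hu.bddAbove hj') x) (le_ciSup (hv.bddAbove hj') x))
    have h2 : (nnHolderNorm (holderExp s) (iteratedDeriv ⌊s⌋₊ (u.toFun + v.toFun)) : ℝ) ≤
        nnHolderNorm (holderExp s) (iteratedDeriv ⌊s⌋₊ u.toFun) +
          nnHolderNorm (holderExp s) (iteratedDeriv ⌊s⌋₊ v.toFun) := by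
      rw [hu.iteratedDeriv_add hv le_rfl]
      exact_mod_cast hu.memHolder.nnHolderNorm_add_le hv.memHolder
    have h3 := Finset.sum_le_sum h1
    rw [Finset.sum_add_distrib] at h3
    unfold holderNorm
    linarith
  norm_eq_zero_iff u := by
    constructor
    · intro h
      change holderNorm s u.toFun = 0 at h
      have hu := u.memC
      have hnn : ∀ j ∈ Finset.range (⌊s⌋₊ + 1),
          0 ≤ ⨆ x : ℝ, ‖iteratedDeriv j u.toFun x‖ :=
        fun j _ => Real.iSup_nonneg fun x => norm_nonneg _
      have hs := Finset.sum_nonneg hnn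
      have h0 : (0 : ℕ) ∈ Finset.range (⌊s⌋₊ + 1) := by simp
      have hle := Finset.single_le_sum hnn h0
      have hh : (0 : ℝ) ≤ nnHolderNorm (holderExp s) (iteratedDeriv ⌊s⌋₊ u.toFun) :=
        NNReal.zero_le_coe
      unfold holderNorm at h
      apply Subtype.ext
      funext x
      have hx := le_ciSup (hu.bddAbove (Nat.zero_le _)) x
      have hz : ‖u.toFun x‖ ≤ 0 := by
        simp only [iteratedDeriv_zero] at hx hle
        linarith
      exact norm_le_zero_iff.1 hz
    · rintro rfl
      change holderNorm s (0 : ℝ → Eucl n) = 0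
      simp [holderNorm, iteratedDeriv_zero']

noncomputable instance : NormedAddCommGroup (HolderSpace n s) :=
  NormedAddCommGroup.ofCore HolderSpace.core

noncomputable instance : NormedSpace ℝ (HolderSpace n s) :=
  NormedSpace.ofCore HolderSpace.core

end HolderSpace

/-! ### Injective regular curves and Sobolev spaces on the circle -/

/-- Injective (embedded) regular closed curves of class `C¹`, parametrized over `ℝ/ℤ`. -/
structure IsInjRegular {n : ℕ} (γ : ℝ → Eucl n) : Prop where
  periodic : Function.Periodic γ 1
  contDiff : ContDiff ℝ 1 γ
  regular : ∀ x, deriv γ x ≠ 0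
  injective : Set.InjOn γ (Set.Ico 0 1)

/-- The set of injective regular curves in `C^s(ℝ/ℤ, ℝⁿ)`. -/
def injRegular (n : ℕ) (s : ℝ) : Set (HolderSpace n s) := {u | IsInjRegular u.toFun}

/-- `f ∈ H^s(ℝ/ℤ, ℝⁿ)`, the `L²`-based Sobolev space of order `s`:
`∑ₖ (1 + k²)^s |f̂(k)|² < ∞`, for each of the coordinates of `f`. -/
structure MemSobolev {n : ℕ} (s : ℝ) (f : ℝ → Eucl n) : Prop where
  periodic : Function.Periodic f 1
  memLp : MemLp f 2 (volume.restrict (Set.Ioc (0 : ℝ) 1))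
  summable : ∀ i : Fin n, Summable fun k : ℤ =>
    (1 + (k : ℝ) ^ 2) ^ s *
      ‖fourierCoeffOn (zero_lt_one : (0 : ℝ) < 1) (fun x => ((f x i : ℝ) : ℂ)) k‖ ^ 2

/-! ### The gradient of O'Hara's energy and the operator `Q^α` -/

/-- `P^⊥_v u`, the orthogonal projection of `u` onto the orthogonal complement of `v ≠ 0`. -/
noncomputable def normalProj {n : ℕ} (v u : Eucl n) : Eucl n :=
  u - ⟪u, ‖v‖⁻¹ • v⟫_ℝ • (‖v‖⁻¹ • v)

/-- The curvature vector `κ = ∂ₛ² γ`, where `∂ₛ = |γ'|⁻¹ ∂ₓ`. -/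
noncomputable def curvature {n : ℕ} (γ : ℝ → Eucl n) (x : ℝ) : Eucl n :=
  ‖deriv γ x‖⁻¹ • deriv (fun t => ‖deriv γ t‖⁻¹ • deriv γ t) x

/-- `d_γ(x, y)`: the length of the shorter of the two arcs of the closed curve `γ` that join the
points of parameters `x` and `y` (which matter only modulo `1`). -/
noncomputable def arcDist {n : ℕ} (γ : ℝ → Eucl n) (x y : ℝ) : ℝ :=
  min (∫ t in x..(x + Int.fract (y - x)), ‖deriv γ t‖)
    ((∫ t in (0 : ℝ)..1, ‖deriv γ t‖) - ∫ t in x..(x + Int.fract (y - x)), ‖deriv γ t‖)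

/-- The principal value `p.v. ∫_{-1/2}^{1/2} g(w) dw`, that is
`lim_{ε ↓ 0} ∫_{[-1/2, 1/2] \ [-ε, ε]} g(w) dw`, exists and equals `v`. -/
def HasPV {n : ℕ} (g : ℝ → Eucl n) (v : Eucl n) : Prop :=
  Tendsto (fun ε : ℝ => ∫ w in Set.Icc (-(1 / 2) : ℝ) (1 / 2) \ Set.Icc (-ε) ε, g w)
    (𝓝[>] 0) (𝓝 v)

/-- `(H^α γ)(x)` exists and equals `v`. -/
def HasH {n : ℕ} (α : ℝ) (γ : ℝ → Eucl n) (x : ℝ) (v : Eucl n) : Prop :=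
  HasPV (fun w => ‖deriv γ (x + w)‖ • normalProj (deriv γ x)
    ((2 * α / ‖γ (x + w) - γ x‖ ^ (2 + α)) • (γ (x + w) - γ x)
      - ((α - 2) / arcDist γ (x + w) x ^ α) • curvature γ x
      - (2 / ‖γ (x + w) - γ x‖ ^ α) • curvature γ x)) v

/-- `(Q^α γ)(x)` exists and equals `v`. -/
def HasQ {n : ℕ} (α : ℝ) (γ : ℝ → Eucl n) (x : ℝ) (v : Eucl n) : Prop :=
  HasPV (fun w => (1 / |w| ^ α) •
    ((2 / w ^ 2) • (γ (x + w) - γ x - w • deriv γ x) - iteratedDeriv 2 γ x)) v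

end OHara

/-! The two integrands are compared before anything is integrated. Let `dIntegrand` be the integrand
of `H^α` minus `α |γ'|^{-α-1} P^⊥` of the integrand of `Q^α`. The lower order term is the limit of
its truncated integrals (`lowerOrder`), an expression that does not mention `β`, so a single map
serves for all `β`. Write `γ(x+w) = γ + w γ' + (w²/2)(γ'' + R)`. The projection kills `γ'`, so only
`P^⊥γ''` and `P^⊥R` occur (`dIntegrand_eq`).

The factor of `P^⊥R` is `|w|^{-α}` times a difference of powers that vanishes at `w = 0`, hence
`w|w|^{-α}` times a regular function. In the factor of `P^⊥γ''` the powers are expanded to second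
order. Order zero cancels once the arc length term is compared with `(|γ'||w|)^{-α}`. Order one
gives a constant times the odd function `w|w|^{-α}`, invisible to symmetric truncation, and
`w|w|^{-α}` times Taylor remainders. Order two carries `w²|w|^{-α}`, integrable since `α < 3`. For
`γ ∈ C^{α+b}` the remainders are `O(|w|^η)` with `η > α - 2`, so everything that is left converges
absolutely (`dIntegrand_eq_reg`), except the arc length term, which is integrated explicitly by
taking arc length as the variable (`tendsto_integral_arcDist`).

Analyticity for `0 < b < 1`: the regular functions live in `UH`, a Banach algebra of families in
`C^b` with parameters `(w, t)`, where `t` is the variable of Taylor's formula with integral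
remainder. Powers of elements bounded below are analytic by the binomial series
(`UH.analyticAt_rpow`), the lower bounds come from a bi-Lipschitz constant (`IsInjRegular.isBiLip`),
and the singular integrals are bounded bilinear operators (`RemKernel.integral_abs_sub_le`,
`kernelOp`). So `baseMap` is composed of analytic maps.

Larger `β`: the lower order term `F` commutes with translations, so `(Fγ)' = DF(γ)γ'`. If `F` is
analytic from `C^s` to `C^β`, then so is `γ ↦ DF(γ)γ'` from `C^{s+1}` to `C^β`, and integration
makes `F` analytic from `C^{s+1}` to `C^{β+1}` (`hasDerivAt_lowerOrder`,
`isAnalyticLowerOrder_succ`).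

Sobolev curves: `H^{α+1}` embeds into `C^{α+b}` for small `b`, so the limit that defines `F` exists
at every point and `H^α γ` exists wherever `Q^α γ` does. For the latter, adding the integrands at
`w` and `-w` turns the truncation `T_ε` of `Q^α` into a Fourier multiplier. It is compared with
`A_ε`, the symmetric difference quotient of a function of bounded variation whose derivative has the
full symbol; `A_ε` converges almost everywhere. By Parseval, `T_ε - A_ε` and `ε ∂_ε T_ε` are almost
everywhere square integrable for `dε/ε`, which forces `T_ε` to the limit of `A_ε`
(`tendsto_of_square_functions`). -/

namespace OHara

/-! ### Hölder spaces: bounds, inclusions, derivatives and primitives -/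

section HolderBasics

variable {n : ℕ} {s : ℝ} {f g : ℝ → Eucl n}

/-- The element of `C^s` with a given underlying function. -/
def HolderSpace.ofFun (f : ℝ → Eucl n) (hf : MemC s f) : HolderSpace n s := ⟨f, hf⟩

@[simp] theorem HolderSpace.toFun_ofFun (hf : MemC s f) : (HolderSpace.ofFun f hf).toFun = f := rfl

theorem HolderSpace.ext {u v : HolderSpace n s} (h : ∀ x, u.toFun x = v.toFun x) : u = v :=
  Subtype.ext (funext h)

theorem HolderSpace.toFun_add (u v : HolderSpace n s) : (u + v).toFun = u.toFun + v.toFun := rfl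

theorem HolderSpace.toFun_sub (u v : HolderSpace n s) : (u - v).toFun = u.toFun - v.toFun := rfl

theorem HolderSpace.toFun_smul (c : ℝ) (u : HolderSpace n s) : (c • u).toFun = c • u.toFun := rfl

theorem HolderSpace.norm_def (u : HolderSpace n s) : ‖u‖ = holderNorm s u.toFun := rfl

theorem coe_holderExp (s : ℝ) : (holderExp s : ℝ) = Int.fract s := rfl

theorem holderWith_of_bound {K : ℝ} (hK : 0 ≤ K)
    (h : ∀ x y, ‖f x - f y‖ ≤ K * |x - y| ^ Int.fract s) :
    HolderWith K.toNNReal (holderExp s) f := by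
  intro x y
  rw [edist_dist, edist_dist, coe_holderExp, ENNReal.ofReal_rpow_of_nonneg dist_nonneg
    (Int.fract_nonneg s)]
  change _ ≤ ENNReal.ofReal K * _
  rw [← ENNReal.ofReal_mul hK]
  apply ENNReal.ofReal_le_ofReal
  rw [dist_eq_norm, Real.dist_eq]
  exact h x y

theorem memC_of_bounds {K : ℝ} (hp : Function.Periodic f 1) (hc : ContDiff ℝ (⌊s⌋₊ : ℕ) f)
    (hK : 0 ≤ K) (h : ∀ x y, ‖iteratedDeriv ⌊s⌋₊ f x - iteratedDeriv ⌊s⌋₊ f y‖ ≤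
      K * |x - y| ^ Int.fract s) : MemC s f :=
  ⟨hp, hc, (holderWith_of_bound hK h).memHolder⟩

theorem holderNorm_le {M K : ℝ} (hK : 0 ≤ K)
    (hM : ∀ j ≤ ⌊s⌋₊, ∀ x, ‖iteratedDeriv j f x‖ ≤ M)
    (h : ∀ x y, ‖iteratedDeriv ⌊s⌋₊ f x - iteratedDeriv ⌊s⌋₊ f y‖ ≤
      K * |x - y| ^ Int.fract s) : holderNorm s f ≤ (⌊s⌋₊ + 1) * M + K := by
  unfold holderNorm
  have h1 : (nnHolderNorm (holderExp s) (iteratedDeriv ⌊s⌋₊ f) : ℝ) ≤ K := by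
    have := (holderWith_of_bound hK h).nnholderNorm_le
    rw [← NNReal.coe_le_coe, Real.coe_toNNReal _ hK] at this
    exact this
  have h2 : ∑ j ∈ Finset.range (⌊s⌋₊ + 1), ⨆ x : ℝ, ‖iteratedDeriv j f x‖ ≤
      (⌊s⌋₊ + 1) * M := by
    have : ∑ j ∈ Finset.range (⌊s⌋₊ + 1), ⨆ x : ℝ, ‖iteratedDeriv j f x‖ ≤
        ∑ j ∈ Finset.range (⌊s⌋₊ + 1), M :=
      Finset.sum_le_sum fun j hj => ciSup_le (hM j (by simpa [Nat.lt_succ_iff] using hj))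
    simpa using this
  linarith

theorem HolderSpace.norm_iteratedDeriv_le (u : HolderSpace n s) {j : ℕ} (hj : j ≤ ⌊s⌋₊) (x : ℝ) :
    ‖iteratedDeriv j u.toFun x‖ ≤ ‖u‖ := by
  have h1 := le_ciSup (u.memC.bddAbove hj) x
  have h2 : (⨆ x : ℝ, ‖iteratedDeriv j u.toFun x‖) ≤
      ∑ j ∈ Finset.range (⌊s⌋₊ + 1), ⨆ x : ℝ, ‖iteratedDeriv j u.toFun x‖ :=
    Finset.single_le_sum (f := fun j => ⨆ x : ℝ, ‖iteratedDeriv j u.toFun x‖)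
      (fun j _ => Real.iSup_nonneg fun x => norm_nonneg _) (by simpa [Nat.lt_succ_iff] using hj)
  have h3 : (0 : ℝ) ≤ nnHolderNorm (holderExp s) (iteratedDeriv ⌊s⌋₊ u.toFun) :=
    NNReal.zero_le_coe
  rw [HolderSpace.norm_def, holderNorm]
  linarith

theorem HolderSpace.norm_iteratedDeriv_sub_le (u : HolderSpace n s) (x y : ℝ) :
    ‖iteratedDeriv ⌊s⌋₊ u.toFun x - iteratedDeriv ⌊s⌋₊ u.toFun y‖ ≤
      ‖u‖ * |x - y| ^ Int.fract s := by
  have h := u.memC.memHolder.holderWith.dist_le x y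
  rw [dist_eq_norm, Real.dist_eq, coe_holderExp] at h
  refine h.trans (mul_le_mul_of_nonneg_right ?_ (by positivity))
  rw [HolderSpace.norm_def, holderNorm]
  linarith [Finset.sum_nonneg (s := Finset.range (⌊s⌋₊ + 1))
    (f := fun j => ⨆ x : ℝ, ‖iteratedDeriv j u.toFun x‖)
      (fun j _ => Real.iSup_nonneg fun x => norm_nonneg _)]

theorem HolderSpace.norm_apply_le (u : HolderSpace n s) (x : ℝ) : ‖u.toFun x‖ ≤ ‖u‖ := by
  simpa using u.norm_iteratedDeriv_le (Nat.zero_le _) x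

theorem HolderSpace.continuous (u : HolderSpace n s) : Continuous u.toFun :=
  u.memC.contDiff.continuous

/-- Hölder continuity of a bounded function gets weaker with the exponent. -/
theorem holder_weaken {E : Type*} [SeminormedAddCommGroup E] {g : ℝ → E} {M K η b : ℝ}
    (hM : ∀ x, ‖g x‖ ≤ M) (hK : 0 ≤ K) (hb : 0 ≤ b) (hbη : b ≤ η)
    (h : ∀ x y, ‖g x - g y‖ ≤ K * |x - y| ^ η) (x y : ℝ) :
    ‖g x - g y‖ ≤ (2 * M + K) * |x - y| ^ b := by
  have hM0 : 0 ≤ M := (norm_nonneg _).trans (hM 0)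
  rcases eq_or_ne x y with rfl | hxy
  · simp only [sub_self, norm_zero]; positivity
  have hpos : 0 < |x - y| := abs_pos.2 (sub_ne_zero.2 hxy)
  rcases le_or_gt |x - y| 1 with h1 | h1
  · calc ‖g x - g y‖ ≤ K * |x - y| ^ η := h x y
      _ ≤ K * |x - y| ^ b := by
        gcongr ?_ * ?_
        exact Real.rpow_le_rpow_of_exponent_ge hpos h1 hbη
      _ ≤ _ := by gcongr; linarith
  · calc ‖g x - g y‖ ≤ ‖g x‖ + ‖g y‖ := norm_sub_le _ _
      _ ≤ (2 * M + K) * 1 := by linarith [hM x, hM y]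
      _ ≤ _ := by gcongr; exact Real.one_le_rpow h1.le hb

theorem norm_sub_le_of_iteratedDeriv_bound {M : ℝ} {j : ℕ} (hf : ContDiff ℝ (j + 1 : ℕ) f)
    (hM : ∀ x, ‖iteratedDeriv (j + 1) f x‖ ≤ M) (x y : ℝ) :
    ‖iteratedDeriv j f x - iteratedDeriv j f y‖ ≤ M * |x - y| := by
  have hd : Differentiable ℝ (iteratedDeriv j f) :=
    hf.differentiable_iteratedDeriv j (by exact_mod_cast Nat.lt_succ_self j)
  have := Convex.norm_image_sub_le_of_norm_deriv_le (f := iteratedDeriv j f) (s := Set.univ)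
    (C := M) (x := y) (y := x) (fun z _ => hd z)
    (fun z _ => by rw [← iteratedDeriv_succ]; exact hM z) convex_univ trivial trivial
  simpa [Real.norm_eq_abs] using this

/-- Either both orders have the same integer part and only the exponent drops, or one more
derivative is bounded and the derivative of order `⌊s'⌋` is Lipschitz. `holder_weaken` then lowers
the exponent. -/
theorem HolderSpace.bounds_of_le {s' : ℝ} (u : HolderSpace n s) (hs' : 0 ≤ s') (h : s' ≤ s)
    (x y : ℝ) : ‖iteratedDeriv ⌊s'⌋₊ u.toFun x - iteratedDeriv ⌊s'⌋₊ u.toFun y‖ ≤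
      (3 * ‖u‖) * |x - y| ^ Int.fract s' := by
  have hfl : ⌊s'⌋₊ ≤ ⌊s⌋₊ := Nat.floor_mono h
  have key : ∀ η, Int.fract s' ≤ η →
      (∀ x y, ‖iteratedDeriv ⌊s'⌋₊ u.toFun x - iteratedDeriv ⌊s'⌋₊ u.toFun y‖ ≤
      ‖u‖ * |x - y| ^ η) → ‖iteratedDeriv ⌊s'⌋₊ u.toFun x - iteratedDeriv ⌊s'⌋₊ u.toFun y‖ ≤
      (3 * ‖u‖) * |x - y| ^ Int.fract s' := by
    intro η hη hh
    have := holder_weaken (fun z => u.norm_iteratedDeriv_le hfl z) (norm_nonneg u)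
      (Int.fract_nonneg s') hη hh x y
    refine this.trans (le_of_eq (by ring))
  rcases hfl.eq_or_lt with heq | hlt
  · refine key (Int.fract s) ?_ ?_
    · have h1 := natCast_floor_eq_intCast_floor hs' (R := ℝ)
      have h2 := natCast_floor_eq_intCast_floor (hs'.trans h) (R := ℝ)
      rw [Int.fract, Int.fract, ← h1, ← h2, heq]
      linarith
    · rw [heq]; exact u.norm_iteratedDeriv_sub_le
  · refine key 1 (Int.fract_lt_one s').le fun x y => ?_
    rw [Real.rpow_one]
    exact norm_sub_le_of_iteratedDeriv_bound (u.memC.contDiff.of_le (by exact_mod_cast hlt))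
      (fun z => u.norm_iteratedDeriv_le hlt z) x y

theorem HolderSpace.memC_of_le {s' : ℝ} (u : HolderSpace n s) (hs' : 0 ≤ s') (h : s' ≤ s) :
    MemC s' u.toFun :=
  memC_of_bounds u.memC.periodic
    (u.memC.contDiff.of_le (by exact_mod_cast Nat.floor_mono h))
    (by positivity) (u.bounds_of_le hs' h)

/-- The inclusion `C^s ⊆ C^{s'}` for `s' ≤ s`. -/
noncomputable def HolderSpace.incl {s' : ℝ} (hs' : 0 ≤ s') (h : s' ≤ s) :
    HolderSpace n s →L[ℝ] HolderSpace n s' :=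
  LinearMap.mkContinuous
    { toFun := fun u => ofFun u.toFun (u.memC_of_le hs' h)
      map_add' := fun _ _ => rfl
      map_smul' := fun _ _ => rfl } (⌊s'⌋₊ + 1 + 3) fun u => by
    have := holderNorm_le (s := s') (f := u.toFun) (M := ‖u‖) (by positivity)
      (fun j hj x => u.norm_iteratedDeriv_le (hj.trans (Nat.floor_mono h)) x)
      (u.bounds_of_le hs' h)
    refine this.trans (le_of_eq (by ring))

@[simp] theorem HolderSpace.toFun_incl {s' : ℝ} (hs' : 0 ≤ s') (h : s' ≤ s)
    (u : HolderSpace n s) : (incl hs' h u).toFun = u.toFun := rfl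

theorem floor_add_one_real (hs : 0 ≤ s) : ⌊s + 1⌋₊ = ⌊s⌋₊ + 1 := Nat.floor_add_one hs

theorem MemC.deriv (hs : 0 ≤ s) (hf : MemC (s + 1) f) : MemC s (deriv f) := by
  have h1 := hf.contDiff
  have h2 := hf.memHolder
  rw [floor_add_one_real hs] at h1 h2
  refine ⟨?_, ?_, ?_⟩
  · have := periodic_iteratedDeriv hf.periodic 1
    rwa [iteratedDeriv_one] at this
  · exact_mod_cast ((contDiff_succ_iff_deriv (n := (⌊s⌋₊ : ℕ))).1 (by exact_mod_cast h1)).2.2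
  · rw [iteratedDeriv_succ'] at h2
    have : holderExp (s + 1) = holderExp s := by
      apply NNReal.eq; simp [coe_holderExp]
    rwa [this] at h2

/-- The derivative as a map `C^{s+1} → C^s`. -/
noncomputable def HolderSpace.derivL (hs : 0 ≤ s) : HolderSpace n (s + 1) →L[ℝ] HolderSpace n s :=
  LinearMap.mkContinuous
    { toFun := fun u => ofFun (deriv u.toFun) (u.memC.deriv hs)
      map_add' := fun u v => by
        have h1 : (1 : ℕ) ≤ ⌊s + 1⌋₊ := by rw [floor_add_one_real hs]; omega
        refine HolderSpace.ext fun x => ?_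
        have := congrFun (u.memC.iteratedDeriv_add v.memC h1) x
        simpa [HolderSpace.toFun_add, iteratedDeriv_one] using this
      map_smul' := fun c u => by
        refine HolderSpace.ext fun x => ?_
        have := congrFun (iteratedDeriv_smul' (f := u.toFun) c 1) x
        rw [iteratedDeriv_one, iteratedDeriv_one] at this
        exact this } (⌊s⌋₊ + 1 + 1) fun u => by
    have := holderNorm_le (s := s) (f := deriv u.toFun) (M := ‖u‖) (K := ‖u‖) (by positivity)
      (fun j hj x => by
        rw [← iteratedDeriv_succ']
        exact u.norm_iteratedDeriv_le (by rw [floor_add_one_real hs]; omega) x)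
      (fun x y => by
        have := u.norm_iteratedDeriv_sub_le x y
        rw [floor_add_one_real hs, iteratedDeriv_succ'] at this
        simpa using this)
    refine this.trans (le_of_eq (by ring))

@[simp] theorem HolderSpace.toFun_derivL (hs : 0 ≤ s) (u : HolderSpace n (s + 1)) :
    (derivL hs u).toFun = deriv u.toFun := rfl

theorem MemC.const (c : Eucl n) : MemC s fun _ => c :=
  memC_of_bounds (K := 0) (fun _ => rfl) contDiff_const le_rfl fun x y => by
    simp only [iteratedDeriv_const]; simp

theorem norm_const_le (c : Eucl n) :
    ‖(HolderSpace.ofFun (fun _ => c) (MemC.const c) : HolderSpace n s)‖ ≤ (⌊s⌋₊ + 1) * ‖c‖ := by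
  have := holderNorm_le (s := s) (f := fun _ : ℝ => c) (M := ‖c‖) (K := 0) le_rfl
      (fun j _ x => by rw [iteratedDeriv_const]; split_ifs <;> simp)
      (fun x y => by simp only [iteratedDeriv_const]; simp)
  rwa [add_zero] at this

theorem MemC.comp_add_const (hf : MemC s f) (h : ℝ) : MemC s fun x => f (x + h) := by
  refine ⟨fun x => ?_, ?_, ?_⟩
  · have := hf.periodic (x + h)
    simp only [← this]; congr 1; ring
  · exact hf.contDiff.comp (contDiff_id.add contDiff_const)
  · rw [iteratedDeriv_comp_add_const]
    obtain ⟨C, hC⟩ := hf.memHolder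
    exact ⟨C, fun x y => by simpa using hC (x + h) (y + h)⟩

/-- Translation of an element of `C^s`. -/
def HolderSpace.translate (h : ℝ) (u : HolderSpace n s) : HolderSpace n s :=
  ofFun (fun x => u.toFun (x + h)) (u.memC.comp_add_const h)

/-- The periodic function with prescribed derivative `z - ∫₀¹ z` and value `c` at `0`. -/
noncomputable def primitive (c : Eucl n) (z : ℝ → Eucl n) (x : ℝ) : Eucl n :=
  c + (∫ t in (0 : ℝ)..x, z t) - x • ∫ t in (0 : ℝ)..1, z t

theorem hasDerivAt_primitive (c : Eucl n) {z : ℝ → Eucl n} (hz : Continuous z) (x : ℝ) :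
    HasDerivAt (primitive c z) (z x - ∫ t in (0 : ℝ)..1, z t) x := by
  have h1 : HasDerivAt (fun x => ∫ t in (0 : ℝ)..x, z t) (z x) x :=
    intervalIntegral.integral_hasDerivAt_right (hz.intervalIntegrable _ _)
      (hz.stronglyMeasurableAtFilter _ _) hz.continuousAt
  have h2 := (hasDerivAt_id x).smul_const (∫ t in (0 : ℝ)..1, z t)
  rw [one_smul] at h2
  exact (h1.const_add c).sub h2

theorem primitive_periodic (c : Eucl n) {z : ℝ → Eucl n} (hz : Continuous z)
    (hp : Function.Periodic z 1) : Function.Periodic (primitive c z) 1 := by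
  intro x
  have h1 : ∫ t in (0 : ℝ)..(x + 1), z t = (∫ t in (0 : ℝ)..x, z t) + ∫ t in (0 : ℝ)..1, z t := by
    rw [← intervalIntegral.integral_add_adjacent_intervals (hz.intervalIntegrable 0 x)
      (hz.intervalIntegrable x (x + 1)), hp.intervalIntegral_add_eq x 0, zero_add]
  simp only [primitive, h1, add_smul, one_smul]
  abel

theorem iteratedDeriv_succ_primitive (c : Eucl n) {z : ℝ → Eucl n} (hz : Continuous z) (j : ℕ) :
    iteratedDeriv (j + 1) (primitive c z) =
      iteratedDeriv j (fun x => z x - ∫ t in (0 : ℝ)..1, z t) := by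
  rw [iteratedDeriv_succ']
  congr 1
  exact funext fun x => (hasDerivAt_primitive c hz x).deriv

theorem HolderSpace.memC_sub_const (z : HolderSpace n s) (d : Eucl n) :
    MemC s (fun x => z.toFun x - d) :=
  (z - ofFun _ (MemC.const d)).memC

theorem HolderSpace.norm_integral_le (z : HolderSpace n s) :
    ‖∫ t in (0 : ℝ)..1, z.toFun t‖ ≤ ‖z‖ := by
  have := intervalIntegral.norm_integral_le_of_norm_le_const (a := 0) (b := 1) (C := ‖z‖)
    (f := z.toFun) fun x _ => z.norm_apply_le x
  simpa using this

theorem HolderSpace.norm_sub_mean_le (z : HolderSpace n s) :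
    ‖ofFun _ (z.memC_sub_const (∫ t in (0 : ℝ)..1, z.toFun t))‖ ≤ (⌊s⌋₊ + 2) * ‖z‖ := by
  calc _ ≤ ‖z‖ + ‖(ofFun _ (MemC.const (∫ t in (0 : ℝ)..1, z.toFun t)) : HolderSpace n s)‖ :=
        norm_sub_le z (ofFun _ (MemC.const _))
    _ ≤ ‖z‖ + (⌊s⌋₊ + 1) * ‖z‖ := by
        gcongr
        exact (norm_const_le _).trans (by gcongr; exact z.norm_integral_le)
    _ = _ := by ring

theorem HolderSpace.memC_primitive (hs : 0 ≤ s) (c : Eucl n) (z : HolderSpace n s) :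
    MemC (s + 1) (primitive c z.toFun) := by
  have hw := z.memC_sub_const (∫ t in (0 : ℝ)..1, z.toFun t)
  have hd : _root_.deriv (primitive c z.toFun) = fun x => z.toFun x - ∫ t in (0 : ℝ)..1, z.toFun t :=
    funext fun x => (hasDerivAt_primitive c z.continuous x).deriv
  refine ⟨primitive_periodic c z.continuous z.memC.periodic, ?_, ?_⟩
  · rw [floor_add_one_real hs]
    have := (contDiff_succ_iff_deriv (n := (⌊s⌋₊ : ℕ)) (𝕜 := ℝ) (f := primitive c z.toFun)).2
      ⟨fun x => (hasDerivAt_primitive c z.continuous x).differentiableAt, by simp, ?_⟩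
    · exact_mod_cast this
    · rw [hd]; exact hw.contDiff
  · rw [floor_add_one_real hs, iteratedDeriv_succ_primitive c z.continuous]
    have : holderExp (s + 1) = holderExp s := by
      apply NNReal.eq; simp [coe_holderExp]
    rw [this]
    exact hw.memHolder

theorem HolderSpace.norm_primitive_le (hs : 0 ≤ s) (c : Eucl n) (z : HolderSpace n s) :
    ‖ofFun _ (z.memC_primitive hs c)‖ ≤
      (⌊s⌋₊ + 3) * (‖c‖ + (⌊s⌋₊ + 2) * ‖z‖) := by
  set w := ofFun _ (z.memC_sub_const (∫ t in (0 : ℝ)..1, z.toFun t)) with hw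
  have hwn := z.norm_sub_mean_le
  have hM : ∀ x, ‖primitive c z.toFun x‖ ≤ ‖c‖ + (⌊s⌋₊ + 2) * ‖z‖ := by
    intro x
    obtain ⟨y, hy, hxy⟩ := (primitive_periodic c z.continuous z.memC.periodic).exists_mem_Ico₀
      one_pos x
    rw [hxy]
    have h1 : ‖∫ t in (0 : ℝ)..y, z.toFun t‖ ≤ ‖z‖ := by
      have := intervalIntegral.norm_integral_le_of_norm_le_const (a := 0) (b := y) (C := ‖z‖)
        (f := z.toFun) fun x _ => z.norm_apply_le x
      refine this.trans ?_
      rw [sub_zero, abs_of_nonneg hy.1]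
      nlinarith [norm_nonneg z, hy.2]
    have h2 : ‖y • ∫ t in (0 : ℝ)..1, z.toFun t‖ ≤ ‖z‖ := by
      rw [norm_smul, Real.norm_eq_abs, abs_of_nonneg hy.1]
      nlinarith [norm_nonneg z, hy.2, hy.1, z.norm_integral_le,
        norm_nonneg (∫ t in (0 : ℝ)..1, z.toFun t)]
    have h3 : (0 : ℝ) ≤ ⌊s⌋₊ * ‖z‖ := by positivity
    calc ‖primitive c z.toFun y‖ ≤ ‖c‖ + ‖∫ t in (0 : ℝ)..y, z.toFun t‖ +
          ‖y • ∫ t in (0 : ℝ)..1, z.toFun t‖ :=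
          (norm_sub_le _ _).trans (by gcongr; exact norm_add_le _ _)
      _ ≤ _ := by linarith
  have hs1 : Int.fract (s + 1) = Int.fract s := by simp
  have := holderNorm_le (s := s + 1) (f := primitive c z.toFun)
    (M := ‖c‖ + (⌊s⌋₊ + 2) * ‖z‖) (K := (⌊s⌋₊ + 2) * ‖z‖) (by positivity) ?_ ?_
  · refine this.trans ?_
    rw [floor_add_one_real hs]
    push_cast
    have := norm_nonneg c
    nlinarith
  · intro j hj x
    cases j with
    | zero => simpa using hM x
    | succ j =>
      rw [iteratedDeriv_succ_primitive c z.continuous]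
      rw [floor_add_one_real hs] at hj
      exact (w.norm_iteratedDeriv_le (by omega) x).trans
        (hwn.trans (le_add_of_nonneg_left (norm_nonneg c)))
  · intro x y
    rw [floor_add_one_real hs, iteratedDeriv_succ_primitive c z.continuous, hs1]
    exact (w.norm_iteratedDeriv_sub_le x y).trans (by gcongr)

/-- The bounded operator `(y, z) ↦ y(0) + ∫₀ˣ (z - ∫₀¹ z)`, a left inverse of `u ↦ (u, u')`. -/
noncomputable def HolderSpace.primitiveL (hs : 0 ≤ s) :
    HolderSpace n s × HolderSpace n s →L[ℝ] HolderSpace n (s + 1) :=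
  LinearMap.mkContinuous
    { toFun := fun p => ofFun (primitive (p.1.toFun 0) p.2.toFun) (p.2.memC_primitive hs _)
      map_add' := fun p q => by
        refine HolderSpace.ext fun x => ?_
        have hi : ∀ a b, ∫ t in a..b, (p.2.toFun t + q.2.toFun t) =
            (∫ t in a..b, p.2.toFun t) + ∫ t in a..b, q.2.toFun t := fun a b =>
          intervalIntegral.integral_add (p.2.continuous.intervalIntegrable _ _)
            (q.2.continuous.intervalIntegrable _ _)
        simp only [toFun_ofFun, primitive, HolderSpace.toFun_add, Prod.fst_add, Prod.snd_add,
          Pi.add_apply, hi, smul_add]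
        abel
      map_smul' := fun c p => by
        refine HolderSpace.ext fun x => ?_
        simp only [toFun_ofFun, primitive, HolderSpace.toFun_smul, Prod.smul_fst, Prod.smul_snd,
          Pi.smul_apply, intervalIntegral.integral_smul, RingHom.id_apply]
        rw [smul_comm x c, smul_sub, smul_add] } ((⌊s⌋₊ + 3) * (⌊s⌋₊ + 3)) fun p => by
    refine (p.2.norm_primitive_le hs (p.1.toFun 0)).trans ?_
    rw [mul_assoc]
    gcongr
    have h1 := (p.1.norm_apply_le 0).trans (norm_fst_le p)
    have h2 : ((⌊s⌋₊ : ℝ) + 2) * ‖p.2‖ ≤ (⌊s⌋₊ + 2) * ‖p‖ := by gcongr; exact norm_snd_le p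
    linarith

@[simp] theorem HolderSpace.toFun_primitiveL (hs : 0 ≤ s) (p : HolderSpace n s × HolderSpace n s) :
    (primitiveL hs p).toFun = primitive (p.1.toFun 0) p.2.toFun := rfl

/-- The subtracted mean of `z = y'` is `y 1 - y 0`, which vanishes by periodicity. This recovers a
periodic function from its value at `0` and its derivative in the induction on the regularity. -/
theorem primitive_eq_of_hasDerivAt {y z : ℝ → Eucl n} (hz : Continuous z)
    (hy : Function.Periodic y 1) (h : ∀ x, HasDerivAt y (z x) x) : primitive (y 0) z = y := by
  have hi : ∀ a b, ∫ t in a..b, z t = y b - y a := fun a b =>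
    intervalIntegral.integral_eq_sub_of_hasDerivAt (fun x _ => h x) (hz.intervalIntegrable _ _)
  funext x
  have : y 1 = y 0 := by simpa using hy 0
  simp [primitive, hi, this]

end HolderBasics

/-! ### A Banach algebra of Hölder families, and analyticity of powers in it -/

section UniformHolder

/-- Families of `1`-periodic functions of `x`, measurable in the parameter `t`, with uniform bounds
in the Hölder space of exponent `b`. -/
structure IsUH {T : Type*} [MeasurableSpace T] (b : ℝ) (a : T → ℝ → ℝ) : Prop where
  periodic : ∀ t, Function.Periodic (a t) 1
  measurable : ∀ x, Measurable fun t => a t x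
  bdd : ∃ M, ∀ t x, |a t x| ≤ M
  holder : ∃ K, ∀ t x y, |a t x - a t y| ≤ K * |x - y| ^ b

variable {T : Type*} [MeasurableSpace T] {b : ℝ}

theorem IsUH.mul {f g : T → ℝ → ℝ} (hf : IsUH b f) (hg : IsUH b g) : IsUH b (f * g) := by
  obtain ⟨M, hM⟩ := hf.bdd
  obtain ⟨M', hM'⟩ := hg.bdd
  obtain ⟨K, hK⟩ := hf.holder
  obtain ⟨K', hK'⟩ := hg.holder
  refine ⟨fun t => (hf.periodic t).mul (hg.periodic t),
    fun x => (hf.measurable x).mul (hg.measurable x), ⟨M * M', fun t x => ?_⟩,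
    ⟨M * K' + K * M', fun t x y => ?_⟩⟩
  · have := (abs_nonneg _).trans (hM t x)
    simp only [Pi.mul_apply, abs_mul]
    gcongr
    exacts [hM t x, hM' t x]
  · have := (abs_nonneg _).trans (hM t x)
    have h0 := (abs_nonneg _).trans (hK t x y)
    calc |(f * g) t x - (f * g) t y| = |f t x * (g t x - g t y) + (f t x - f t y) * g t y| := by
          simp only [Pi.mul_apply]; congr 1; ring
      _ ≤ |f t x| * |g t x - g t y| + |f t x - f t y| * |g t y| := by
          rw [← abs_mul, ← abs_mul]; exact abs_add_le _ _
      _ ≤ M * (K' * |x - y| ^ b) + (K * |x - y| ^ b) * M' := by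
          gcongr
          exacts [hM t x, hK' t x y, hK t x y, hM' t y]
      _ = _ := by ring

theorem IsUH.add {f g : T → ℝ → ℝ} (hf : IsUH b f) (hg : IsUH b g) : IsUH b (f + g) := by
  obtain ⟨M, hM⟩ := hf.bdd
  obtain ⟨M', hM'⟩ := hg.bdd
  obtain ⟨K, hK⟩ := hf.holder
  obtain ⟨K', hK'⟩ := hg.holder
  refine ⟨fun t => (hf.periodic t).add (hg.periodic t),
    fun x => (hf.measurable x).add (hg.measurable x), ⟨M + M', fun t x => ?_⟩,
    ⟨K + K', fun t x y => ?_⟩⟩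
  · exact (abs_add_le _ _).trans (add_le_add (hM t x) (hM' t x))
  · calc |(f + g) t x - (f + g) t y| = |(f t x - f t y) + (g t x - g t y)| := by
          simp only [Pi.add_apply]; congr 1; ring
      _ ≤ _ := (abs_add_le _ _).trans (add_le_add (hK t x y) (hK' t x y))
      _ = _ := by ring

theorem IsUH.of_param {c : T → ℝ} (hc : Measurable c) {M : ℝ} (hM : ∀ t, |c t| ≤ M) :
    IsUH b fun t (_ : ℝ) => c t :=
  ⟨fun _ _ => rfl, fun _ => hc, ⟨M, fun t _ => hM t⟩, ⟨0, fun t x y => by simp⟩⟩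

/-- The subalgebra of families with uniform Hölder bounds. -/
def uhSubalgebra (T : Type*) [MeasurableSpace T] (b : ℝ) : Subalgebra ℝ (T → ℝ → ℝ) where
  carrier := {a | IsUH b a}
  mul_mem' := fun hf hg => hf.mul hg
  add_mem' := fun hf hg => hf.add hg
  algebraMap_mem' := fun r => IsUH.of_param (c := fun _ => r) measurable_const fun _ => le_rfl

/-- The Banach algebra of families of periodic functions with uniform Hölder bounds. -/
def UH (T : Type*) [MeasurableSpace T] (b : ℝ) : Type _ := uhSubalgebra T b

namespace UH

instance : CommRing (UH T b) := inferInstanceAs (CommRing (uhSubalgebra T b))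

instance : Algebra ℝ (UH T b) := inferInstanceAs (Algebra ℝ (uhSubalgebra T b))

/-- The underlying family of functions. -/
def toFun (a : UH T b) : T → ℝ → ℝ := Subtype.val a

/-- The element with a given underlying family. -/
def ofFun (a : T → ℝ → ℝ) (h : IsUH b a) : UH T b := ⟨a, h⟩

theorem isUH (a : UH T b) : IsUH b a.toFun := Subtype.property a

@[simp] theorem toFun_ofFun {a : T → ℝ → ℝ} (h : IsUH b a) : (ofFun a h).toFun = a := rfl

theorem ext {a a' : UH T b} (h : ∀ t x, a.toFun t x = a'.toFun t x) : a = a' :=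
  Subtype.ext (funext fun t => funext (h t))

/-- Evaluation as an algebra homomorphism. -/
def evalHom (t : T) (x : ℝ) : UH T b →ₐ[ℝ] ℝ :=
  ((Pi.evalAlgHom ℝ (fun _ : ℝ => ℝ) x).comp
    (Pi.evalAlgHom ℝ (fun _ : T => ℝ → ℝ) t)).comp (uhSubalgebra T b).val

@[simp] theorem toFun_add (a a' : UH T b) (t : T) (x : ℝ) :
    (a + a').toFun t x = a.toFun t x + a'.toFun t x := rfl

@[simp] theorem toFun_sub (a a' : UH T b) (t : T) (x : ℝ) :
    (a - a').toFun t x = a.toFun t x - a'.toFun t x := rfl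

@[simp] theorem toFun_mul (a a' : UH T b) (t : T) (x : ℝ) :
    (a * a').toFun t x = a.toFun t x * a'.toFun t x := rfl

@[simp] theorem toFun_smul (c : ℝ) (a : UH T b) (t : T) (x : ℝ) :
    (c • a).toFun t x = c * a.toFun t x := rfl

@[simp] theorem toFun_one (t : T) (x : ℝ) : (1 : UH T b).toFun t x = 1 := rfl

@[simp] theorem toFun_zero (t : T) (x : ℝ) : (0 : UH T b).toFun t x = 0 := rfl

@[simp] theorem toFun_pow (a : UH T b) (k : ℕ) (t : T) (x : ℝ) :
    (a ^ k).toFun t x = a.toFun t x ^ k := rfl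

@[simp] theorem toFun_sum {ι : Type*} (s : Finset ι) (a : ι → UH T b) (t : T) (x : ℝ) :
    (∑ i ∈ s, a i).toFun t x = ∑ i ∈ s, (a i).toFun t x :=
  map_sum (evalHom t x) a s

/-- The supremum norm. -/
noncomputable def supN (a : UH T b) : ℝ := ⨆ p : T × ℝ, |a.toFun p.1 p.2|

/-- The uniform Hölder seminorm. -/
noncomputable def holN (a : UH T b) : ℝ :=
  ⨆ p : T × ℝ × ℝ, |a.toFun p.1 p.2.1 - a.toFun p.1 p.2.2| / |p.2.1 - p.2.2| ^ b

theorem supN_nonneg (a : UH T b) : 0 ≤ a.supN := Real.iSup_nonneg fun _ => abs_nonneg _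

theorem holN_nonneg (a : UH T b) : 0 ≤ a.holN := Real.iSup_nonneg fun _ => by positivity

theorem abs_le_supN (a : UH T b) (t : T) (x : ℝ) : |a.toFun t x| ≤ a.supN := by
  obtain ⟨M, hM⟩ := a.isUH.bdd
  exact le_ciSup (f := fun p : T × ℝ => |a.toFun p.1 p.2|)
    ⟨M, by rintro _ ⟨p, rfl⟩; exact hM _ _⟩ (t, x)

theorem abs_sub_le_holN (a : UH T b) (t : T) (x y : ℝ) :
    |a.toFun t x - a.toFun t y| ≤ a.holN * |x - y| ^ b := by
  rcases eq_or_ne x y with rfl | hxy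
  · simp only [sub_self, abs_zero]
    exact mul_nonneg a.holN_nonneg (by positivity)
  have hpos : 0 < |x - y| ^ b := Real.rpow_pos_of_pos (abs_pos.2 (sub_ne_zero.2 hxy)) b
  rw [← div_le_iff₀ hpos]
  obtain ⟨K, hK⟩ := a.isUH.holder
  refine le_ciSup (f := fun p : T × ℝ × ℝ =>
    |a.toFun p.1 p.2.1 - a.toFun p.1 p.2.2| / |p.2.1 - p.2.2| ^ b) ⟨max K 0, ?_⟩ (t, x, y)
  rintro _ ⟨⟨t, x, y⟩, rfl⟩
  refine div_le_of_le_mul₀ (by positivity) (le_max_right _ _) ((hK t x y).trans ?_)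
  gcongr
  exact le_max_left _ _

theorem supN_le {a : UH T b} {M : ℝ} (hM : 0 ≤ M) (h : ∀ t x, |a.toFun t x| ≤ M) : a.supN ≤ M :=
  Real.iSup_le (fun _ => h _ _) hM

theorem holN_le {a : UH T b} {K : ℝ} (hK : 0 ≤ K)
    (h : ∀ t x y, |a.toFun t x - a.toFun t y| ≤ K * |x - y| ^ b) : a.holN ≤ K :=
  Real.iSup_le (fun _ => div_le_of_le_mul₀ (by positivity) hK (h _ _ _)) hK

noncomputable instance : Norm (UH T b) := ⟨fun a => a.supN + a.holN⟩

theorem norm_def (a : UH T b) : ‖a‖ = a.supN + a.holN := rfl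

theorem norm_le {a : UH T b} {M K : ℝ} (hM : 0 ≤ M) (hK : 0 ≤ K) (h : ∀ t x, |a.toFun t x| ≤ M)
    (h' : ∀ t x y, |a.toFun t x - a.toFun t y| ≤ K * |x - y| ^ b) : ‖a‖ ≤ M + K :=
  add_le_add (supN_le hM h) (holN_le hK h')

theorem norm_eq_zero_iff' (a : UH T b) : ‖a‖ = 0 ↔ a = 0 := by
  constructor
  · intro h
    refine ext fun t x => ?_
    have h1 := a.abs_le_supN t x
    have h2 := a.holN_nonneg
    rw [norm_def] at h
    exact abs_nonpos_iff.1 (by linarith)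
  · rintro rfl
    refine le_antisymm ?_ (add_nonneg (supN_nonneg _) (holN_nonneg _))
    have := norm_le (a := (0 : UH T b)) (M := 0) (K := 0) le_rfl le_rfl (by simp) (by simp)
    simpa using this

theorem norm_add_le' (a a' : UH T b) : ‖a + a'‖ ≤ ‖a‖ + ‖a'‖ := by
  have h1 := a.supN_nonneg
  have h2 := a.holN_nonneg
  have h3 := a'.supN_nonneg
  have h4 := a'.holN_nonneg
  have := norm_le (a := a + a') (M := a.supN + a'.supN) (K := a.holN + a'.holN)
    (by positivity) (by positivity)
    (fun t x => (abs_add_le _ _).trans (add_le_add (a.abs_le_supN t x) (a'.abs_le_supN t x)))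
    (fun t x y => by
      rw [toFun_add, toFun_add, add_sub_add_comm, add_mul]
      exact (abs_add_le _ _).trans
        (add_le_add (a.abs_sub_le_holN t x y) (a'.abs_sub_le_holN t x y)))
  rw [norm_def a, norm_def a']
  linarith

theorem norm_smul_le' (c : ℝ) (a : UH T b) : ‖c • a‖ ≤ |c| * ‖a‖ := by
  have h1 := a.supN_nonneg
  have h2 := a.holN_nonneg
  rw [norm_def a, mul_add]
  refine norm_le (by positivity) (by positivity) (fun t x => ?_) fun t x y => ?_
  · rw [toFun_smul, abs_mul]
    gcongr
    exact a.abs_le_supN t x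
  · rw [toFun_smul, toFun_smul, ← mul_sub, abs_mul, mul_assoc]
    gcongr
    exact a.abs_sub_le_holN t x y

theorem norm_mul_le' (a a' : UH T b) : ‖a * a'‖ ≤ ‖a‖ * ‖a'‖ := by
  have h1 := a.supN_nonneg
  have h2 := a.holN_nonneg
  have h3 := a'.supN_nonneg
  have h4 := a'.holN_nonneg
  have := norm_le (a := a * a') (M := a.supN * a'.supN)
    (K := a.supN * a'.holN + a.holN * a'.supN) (by positivity) (by positivity)
    (fun t x => by
      rw [toFun_mul, abs_mul]
      gcongr
      exacts [a.abs_le_supN t x, a'.abs_le_supN t x])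
    (fun t x y => by
      calc |(a * a').toFun t x - (a * a').toFun t y| =
          |a.toFun t x * (a'.toFun t x - a'.toFun t y) +
            (a.toFun t x - a.toFun t y) * a'.toFun t y| := by
            simp only [toFun_mul]; congr 1; ring
        _ ≤ |a.toFun t x| * |a'.toFun t x - a'.toFun t y| +
            |a.toFun t x - a.toFun t y| * |a'.toFun t y| := by
            rw [← abs_mul, ← abs_mul]; exact abs_add_le _ _
        _ ≤ a.supN * (a'.holN * |x - y| ^ b) + (a.holN * |x - y| ^ b) * a'.supN := by
            gcongr
            exacts [a.abs_le_supN t x, a'.abs_sub_le_holN t x y, a.abs_sub_le_holN t x y,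
              a'.abs_le_supN t y]
        _ = _ := by ring)
  rw [norm_def a, norm_def a']
  nlinarith [mul_nonneg h2 h4]

theorem core : NormedSpace.Core ℝ (UH T b) where
  norm_nonneg a := add_nonneg a.supN_nonneg a.holN_nonneg
  norm_smul c a := by
    refine le_antisymm (norm_smul_le' c a) ?_
    rcases eq_or_ne c 0 with rfl | hc
    · rw [norm_zero, zero_mul]
      exact add_nonneg (supN_nonneg _) (holN_nonneg _)
    have := norm_smul_le' c⁻¹ (c • a)
    rw [smul_smul, inv_mul_cancel₀ hc, one_smul, abs_inv] at this
    rw [Real.norm_eq_abs]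
    have hc' : 0 < |c| := abs_pos.2 hc
    rwa [← div_eq_inv_mul, le_div_iff₀' hc'] at this
  norm_triangle := norm_add_le'
  norm_eq_zero_iff := norm_eq_zero_iff'

noncomputable instance : NormedAddCommGroup (UH T b) := NormedAddCommGroup.ofCore core

noncomputable instance : NormedCommRing (UH T b) :=
  { (inferInstance : NormedAddCommGroup (UH T b)), (inferInstance : CommRing (UH T b)) with
    norm_mul_le := norm_mul_le' }

noncomputable instance : NormedAlgebra ℝ (UH T b) :=
  { (inferInstance : Algebra ℝ (UH T b)) with
    norm_smul_le := norm_smul_le' }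

theorem abs_apply_le (a : UH T b) (t : T) (x : ℝ) : |a.toFun t x| ≤ ‖a‖ :=
  (a.abs_le_supN t x).trans (le_add_of_nonneg_right a.holN_nonneg)

theorem abs_sub_apply_le (a : UH T b) (t : T) (x y : ℝ) :
    |a.toFun t x - a.toFun t y| ≤ ‖a‖ * |x - y| ^ b :=
  (a.abs_sub_le_holN t x y).trans (by
    gcongr
    exact le_add_of_nonneg_left a.supN_nonneg)

/-- Evaluation at a point, as a continuous linear map. -/
noncomputable def evalL (t : T) (x : ℝ) : UH T b →L[ℝ] ℝ :=
  LinearMap.mkContinuous (evalHom t x).toLinearMap 1 fun a => by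
    rw [one_mul]; exact a.abs_apply_le t x

@[simp] theorem evalL_apply (t : T) (x : ℝ) (a : UH T b) : evalL t x a = a.toFun t x := rfl

/-- A Cauchy sequence converges at each `(t, x)`; periodicity, measurability and both uniform bounds
survive pointwise limits. Completeness is what lets the binomial series be summed in the algebra. -/
instance : CompleteSpace (UH T b) := by
  refine Metric.complete_of_cauchySeq_tendsto fun u hu => ?_
  have hlim : ∀ t x, ∃ l, Tendsto (fun k => (u k).toFun t x) atTop (𝓝 l) := fun t x =>
    cauchySeq_tendsto_of_complete (hu.map (evalL t x).uniformContinuous)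
  choose a ha using hlim
  obtain ⟨B, hB⟩ := hu.isBounded_range.exists_norm_le
  have hB' : ∀ k, ‖u k‖ ≤ B := fun k => hB _ ⟨k, rfl⟩
  have hUH : IsUH b a := by
    refine ⟨fun t x => ?_, fun x => ?_, ⟨B, fun t x => ?_⟩, ⟨B, fun t x y => ?_⟩⟩
    · refine tendsto_nhds_unique (ha t (x + 1)) ?_
      simp only [(u _).isUH.periodic t x]
      exact ha t x
    · exact measurable_of_tendsto_metrizable (fun k => (u k).isUH.measurable x)
        (tendsto_pi_nhds.2 fun t => ha t x)
    · exact le_of_tendsto (ha t x).abs (Eventually.of_forall fun k =>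
        ((u k).abs_apply_le t x).trans (hB' k))
    · refine le_of_tendsto ((ha t x).sub (ha t y)).abs (Eventually.of_forall fun k =>
        ((u k).abs_sub_apply_le t x y).trans ?_)
      gcongr
      exact hB' k
  refine ⟨ofFun a hUH, Metric.tendsto_atTop.2 fun ε hε => ?_⟩
  obtain ⟨N, hN⟩ := Metric.cauchySeq_iff.1 hu (ε / 4) (by positivity)
  refine ⟨N, fun m hm => ?_⟩
  rw [dist_eq_norm]
  have hev : ∀ᶠ k in atTop, ‖u m - u k‖ ≤ ε / 4 := by
    filter_upwards [eventually_ge_atTop N] with k hk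
    rw [← dist_eq_norm]
    exact (hN m hm k hk).le
  have := norm_le (a := u m - ofFun a hUH) (M := ε / 4) (K := ε / 4) (by positivity)
    (by positivity) (fun t x => ?_) (fun t x y => ?_)
  · linarith
  · refine le_of_tendsto (tendsto_const_nhds.sub (ha t x)).abs ?_
    filter_upwards [hev] with k hk
    exact ((u m - u k).abs_apply_le t x).trans hk
  · refine le_of_tendsto ((tendsto_const_nhds.sub (ha t x)).sub
      (tendsto_const_nhds.sub (ha t y))).abs ?_
    filter_upwards [hev] with k hk
    refine ((u m - u k).abs_sub_apply_le t x y).trans ?_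
    gcongr

open Classical in
/-- The pointwise power `a ^ p`, where it belongs to the algebra. -/
noncomputable def rpow (p : ℝ) (a : UH T b) : UH T b :=
  if h : IsUH b (fun t x => a.toFun t x ^ p) then ofFun _ h else 0

theorem toFun_rpow_of {p : ℝ} {a : UH T b} (h : IsUH b (fun t x => a.toFun t x ^ p)) (t : T)
    (x : ℝ) : (rpow p a).toFun t x = a.toFun t x ^ p := by
  rw [rpow, dif_pos h]; rfl

end UH

/-- Mean value inequality. The derivative `p z^{p-1}` is monotone in absolute value, so the sum of
its endpoint values bounds it whatever the sign of `p - 1`. -/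
theorem Real.abs_rpow_sub_rpow_le {c M p x y : ℝ} (hc : 0 < c) (hx : x ∈ Set.Icc c M)
    (hy : y ∈ Set.Icc c M) :
    |x ^ p - y ^ p| ≤ |p| * (c ^ (p - 1) + M ^ (p - 1)) * |x - y| := by
  have := Convex.norm_image_sub_le_of_norm_hasDerivWithin_le (f := fun z : ℝ => z ^ p)
    (f' := fun z => p * z ^ (p - 1)) (s := Set.Icc c M) (C := |p| * (c ^ (p - 1) + M ^ (p - 1)))
    (fun z hz => (Real.hasDerivAt_rpow_const (Or.inl (hc.trans_le hz.1).ne')).hasDerivWithinAt)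
    (fun z hz => ?_) (convex_Icc c M) hy hx
  · exact this
  · have hz0 := hc.trans_le hz.1
    rw [Real.norm_eq_abs, abs_mul, abs_of_nonneg (Real.rpow_nonneg hz0.le _)]
    gcongr
    have hM0 : 0 ≤ M ^ (p - 1) := Real.rpow_nonneg (hz0.le.trans hz.2) _
    have hc0 : 0 ≤ c ^ (p - 1) := Real.rpow_nonneg hc.le _
    rcases le_total 0 (p - 1) with h | h
    · linarith [Real.rpow_le_rpow hz0.le hz.2 h]
    · linarith [Real.rpow_le_rpow_of_nonpos hc hz.1 h]

namespace UH

theorem isUH_rpow {a : UH T b} {c : ℝ} (hc : 0 < c) (h : ∀ t x, c ≤ a.toFun t x) (p : ℝ) :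
    IsUH b fun t x => a.toFun t x ^ p := by
  have hmem : ∀ t x, a.toFun t x ∈ Set.Icc c (‖a‖ + c) := fun t x =>
    ⟨h t x, by linarith [le_abs_self (a.toFun t x), a.abs_apply_le t x]⟩
  have hM : 0 < ‖a‖ + c := by linarith [norm_nonneg a]
  have hc1 : c ∈ Set.Icc c (‖a‖ + c) := ⟨le_rfl, by linarith [norm_nonneg a]⟩
  refine ⟨fun t x => by simp only [a.isUH.periodic t x],
    fun x => (a.isUH.measurable x).pow_const p,
    ⟨c ^ p + |p| * (c ^ (p - 1) + (‖a‖ + c) ^ (p - 1)) * (‖a‖ + c), fun t x => ?_⟩,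
    ⟨|p| * (c ^ (p - 1) + (‖a‖ + c) ^ (p - 1)) * ‖a‖, fun t x y => ?_⟩⟩
  · have h1 := Real.abs_rpow_sub_rpow_le (p := p) hc (hmem t x) hc1
    have h2 : |a.toFun t x - c| ≤ ‖a‖ + c := by
      rw [abs_of_nonneg (by linarith [h t x])]
      linarith [(hmem t x).2]
    have h3 : 0 ≤ c ^ p := by positivity
    calc |a.toFun t x ^ p| = |c ^ p + (a.toFun t x ^ p - c ^ p)| := by congr 1; ring
      _ ≤ c ^ p + |a.toFun t x ^ p - c ^ p| := by
        refine (abs_add_le _ _).trans_eq ?_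
        rw [abs_of_nonneg h3]
      _ ≤ _ := by
        gcongr
        exact h1.trans (by gcongr)
  · refine (Real.abs_rpow_sub_rpow_le (p := p) hc (hmem t x) (hmem t y)).trans ?_
    rw [mul_assoc _ ‖a‖]
    gcongr
    exact a.abs_sub_apply_le t x y

theorem toFun_rpow {a : UH T b} {c : ℝ} (hc : 0 < c) (h : ∀ t x, c ≤ a.toFun t x) (p : ℝ) (t : T)
    (x : ℝ) : (rpow p a).toFun t x = a.toFun t x ^ p :=
  toFun_rpow_of (isUH_rpow hc h p) t x

/-- The scalar coefficients are the same as for the real binomial series, so the radius of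
convergence is inherited from `ℝ`. -/
theorem one_le_radius_binomialSeries (p : ℝ) : 1 ≤ (binomialSeries (UH T b) p).radius := by
  refine ENNReal.le_of_forall_nnreal_lt fun r hr => ?_
  have h1 : (r : ℝ≥0∞) < (binomialSeries ℝ p).radius := hr.trans_le binomialSeries_radius_ge_one
  obtain ⟨C, _, hC⟩ := (binomialSeries ℝ p).norm_mul_pow_le_of_lt_radius h1
  refine FormalMultilinearSeries.le_radius_of_eventually_le _ C ?_
  -- The term of degree zero involves the norm of the unit of the algebra and is left out; finitely
  -- many terms do not affect the radius.
  filter_upwards [eventually_gt_atTop 0] with k hk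
  refine le_trans ?_ (hC k)
  gcongr
  have := FormalMultilinearSeries.ofScalars_norm (E := ℝ) (c := fun k => Ring.choose p k) k
  rw [binomialSeries, binomialSeries, this]
  exact FormalMultilinearSeries.ofScalars_norm_le (E := UH T b) (c := fun k => Ring.choose p k) k hk

/-- Evaluation at `(t, x)` is a continuous algebra homomorphism, so it carries the series in the
algebra to the numerical binomial series. -/
theorem toFun_binomialSeries_sum (p : ℝ) {h : UH T b} (hh : ‖h‖ < 1) (t : T) (x : ℝ) :
    ((binomialSeries (UH T b) p).sum h).toFun t x = (1 + h.toFun t x) ^ p := by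
  have hr := one_le_radius_binomialSeries (T := T) (b := b) p
  have hS := (binomialSeries (UH T b) p).hasFPowerSeriesOnBall (zero_lt_one.trans_le hr)
  have h1 := hS.hasSum (y := h) (by
    refine Metric.eball_subset_eball hr ?_
    rw [mem_eball_zero_iff, ← ofReal_norm, ENNReal.ofReal_lt_one]
    exact hh)
  have h2 := h1.mapL (evalL t x)
  have h3 := (Real.one_add_rpow_hasFPowerSeriesOnBall_zero (a := p)).hasSum (y := h.toFun t x) (by
    rw [mem_eball_zero_iff, ← ofReal_norm, ENNReal.ofReal_lt_one]
    exact (h.abs_apply_le t x).trans_lt hh)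
  simp only [zero_add] at h2 h3
  have h4 : (fun k => evalL t x (binomialSeries (UH T b) p k fun _ => h)) =
      fun k => binomialSeries ℝ p k fun _ => h.toFun t x := by
    funext k
    rw [binomialSeries_apply, binomialSeries_apply, evalL_apply, toFun_smul, smul_eq_mul]
    congr 1
    simp
  rw [h4] at h2
  exact h2.unique h3

/-- Near `a₀`, `a^p = a₀^p (1 + a₀⁻¹ (a - a₀))^p`, and the last factor is a binomial series in `a₀⁻¹
(a - a₀)`, whose norm is small. -/
theorem analyticAt_rpow {a₀ : UH T b} {c : ℝ} (hc : 0 < c) (h : ∀ t x, c ≤ a₀.toFun t x) (p : ℝ) :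
    AnalyticAt ℝ (rpow p) a₀ := by
  set inv := rpow (-1) a₀ with hinv
  have hinv' : ∀ t x, inv.toFun t x = (a₀.toFun t x)⁻¹ := fun t x => by
    rw [hinv, toFun_rpow hc h, Real.rpow_neg_one]
  have hr := one_le_radius_binomialSeries (T := T) (b := b) p
  have hS : AnalyticAt ℝ (binomialSeries (UH T b) p).sum 0 :=
    ((binomialSeries (UH T b) p).hasFPowerSeriesOnBall (zero_lt_one.trans_le hr)).analyticAt
  have hin : AnalyticAt ℝ (fun a : UH T b => inv * (a - a₀)) a₀ :=
    analyticAt_const.mul (analyticAt_id.sub analyticAt_const)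
  have hcomp : AnalyticAt ℝ (fun a : UH T b =>
      rpow p a₀ * (binomialSeries (UH T b) p).sum (inv * (a - a₀))) a₀ :=
    analyticAt_const.mul (AnalyticAt.fun_comp (by simpa using hS) hin)
  refine hcomp.congr ?_
  have hlt : ∀ᶠ a in 𝓝 a₀, ‖inv * (a - a₀)‖ < 1 := by
    have : Tendsto (fun a : UH T b => ‖inv * (a - a₀)‖) (𝓝 a₀) (𝓝 ‖inv * (a₀ - a₀)‖) :=
      (hin.continuousAt).norm
    exact this.eventually_lt_const (by simp)
  filter_upwards [hlt] with a ha
  have hpt : ∀ t x, (rpow p a₀ * (binomialSeries (UH T b) p).sum (inv * (a - a₀))).toFun t x =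
      a.toFun t x ^ p := by
    intro t x
    have hpos := hc.trans_le (h t x)
    have habs := (abs_lt.1 (((inv * (a - a₀)).abs_apply_le t x).trans_lt ha)).1
    rw [toFun_mul, toFun_binomialSeries_sum p ha, toFun_rpow hc h, ← Real.mul_rpow hpos.le
      (by linarith)]
    congr 1
    rw [toFun_mul, toFun_sub, hinv']
    field_simp
    ring
  -- The series identity itself shows that `a^p` is a member of the algebra, so `rpow` does not take
  -- its default value `0` near `a₀`; no separate lower bound for `a` is needed.
  have hUH : IsUH b fun t x => a.toFun t x ^ p := by
    have := (rpow p a₀ * (binomialSeries (UH T b) p).sum (inv * (a - a₀))).isUH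
    rwa [show (rpow p a₀ * (binomialSeries (UH T b) p).sum (inv * (a - a₀))).toFun =
      fun t x => a.toFun t x ^ p from funext fun t => funext fun x => hpt t x] at this
  exact ext fun t x => by rw [hpt, toFun_rpow_of hUH]

end UH

end UniformHolder

/-! ### Taylor remainders of a curve -/

section Remainders

variable {n : ℕ}

/-- The normalized second order Taylor remainder of a curve. -/
noncomputable def remR (γ : ℝ → Eucl n) (x w : ℝ) : Eucl n :=
  (2 / w ^ 2) • (γ (x + w) - γ x - w • deriv γ x) - iteratedDeriv 2 γ x

/-- The normalized first order Taylor remainder of the derivative of a curve. -/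
noncomputable def remS (γ : ℝ → Eucl n) (x w : ℝ) : Eucl n :=
  (1 / w) • (deriv γ (x + w) - deriv γ x) - iteratedDeriv 2 γ x

theorem hasDerivAt_of_contDiff_two {γ : ℝ → Eucl n} (h : ContDiff ℝ 2 γ) (x : ℝ) :
    HasDerivAt γ (deriv γ x) x :=
  (h.differentiable (by norm_num) x).hasDerivAt

theorem hasDerivAt_deriv_of_contDiff_two {γ : ℝ → Eucl n} (h : ContDiff ℝ 2 γ) (x : ℝ) :
    HasDerivAt (deriv γ) (iteratedDeriv 2 γ x) x := by
  have h1 : Differentiable ℝ (iteratedDeriv 1 γ) :=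
    h.differentiable_iteratedDeriv 1 (by norm_num)
  have h2 := (h1 x).hasDerivAt
  rwa [← iteratedDeriv_succ, iteratedDeriv_one] at h2

theorem norm_taylor_deriv_le {γ : ℝ → Eucl n} (h : ContDiff ℝ 2 γ) {x w M : ℝ}
    (hM : ∀ z ∈ Set.uIcc x (x + w), ‖iteratedDeriv 2 γ z - iteratedDeriv 2 γ x‖ ≤ M) :
    ∀ z ∈ Set.uIcc x (x + w),
      ‖deriv γ z - deriv γ x - (z - x) • iteratedDeriv 2 γ x‖ ≤ M * |z - x| := by
  intro z hz
  have hd : ∀ z, HasDerivAt (fun z => deriv γ z - (z - x) • iteratedDeriv 2 γ x)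
      (iteratedDeriv 2 γ z - iteratedDeriv 2 γ x) z := fun z => by
    have := (hasDerivAt_deriv_of_contDiff_two h z).sub
      (((hasDerivAt_id z).sub_const x).smul_const (iteratedDeriv 2 γ x))
    rwa [one_smul] at this
  have := Convex.norm_image_sub_le_of_norm_hasDerivWithin_le (s := Set.uIcc x (x + w)) (C := M)
    (fun z _ => (hd z).hasDerivWithinAt) hM (convex_uIcc _ _) Set.left_mem_uIcc hz
  simp only [sub_self, zero_smul, sub_zero] at this
  rw [Real.norm_eq_abs] at this
  rwa [sub_right_comm]

/-- Mean value inequality once more, for a function whose derivative is the remainder estimated in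
`norm_taylor_deriv_le`. Only the oscillation of `γ''` on the segment enters, so that the bound can
be reused for differences of translates. -/
theorem norm_taylor_le {γ : ℝ → Eucl n} (h : ContDiff ℝ 2 γ) {x w M : ℝ}
    (hM : ∀ z ∈ Set.uIcc x (x + w), ‖iteratedDeriv 2 γ z - iteratedDeriv 2 γ x‖ ≤ M) :
    ‖γ (x + w) - γ x - w • deriv γ x - (w ^ 2 / 2) • iteratedDeriv 2 γ x‖ ≤ M * w ^ 2 := by
  have hM0 : 0 ≤ M := (norm_nonneg _).trans (hM x Set.left_mem_uIcc)
  have hd : ∀ z, HasDerivAt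
      (fun z => γ z - (z - x) • deriv γ x - ((z - x) ^ 2 / 2) • iteratedDeriv 2 γ x)
      (deriv γ z - deriv γ x - (z - x) • iteratedDeriv 2 γ x) z := fun z => by
    have h1 := ((hasDerivAt_id z).sub_const x)
    have h2 : HasDerivAt (fun z : ℝ => (z - x) ^ 2 / 2) (z - x) z := by
      have := (h1.fun_pow 2).div_const 2
      refine this.congr_deriv ?_
      simp
    have := ((hasDerivAt_of_contDiff_two h z).sub (h1.smul_const (deriv γ x))).sub
      (h2.smul_const (iteratedDeriv 2 γ x))
    rwa [one_smul] at this
  have := Convex.norm_image_sub_le_of_norm_hasDerivWithin_le (s := Set.uIcc x (x + w))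
    (C := M * |w|)
    (fun z _ => (hd z).hasDerivWithinAt) (fun z hz => (norm_taylor_deriv_le h hM z hz).trans
      (mul_le_mul_of_nonneg_left (by simpa using Set.abs_sub_left_of_mem_uIcc hz) hM0)) (convex_uIcc _ _) Set.left_mem_uIcc (Set.right_mem_uIcc)
  simp only [sub_self, zero_smul, sub_zero, add_sub_cancel_left] at this
  rw [Real.norm_eq_abs, mul_assoc, abs_mul_abs_self, ← pow_two] at this
  refine le_trans (le_of_eq ?_) this
  congr 1
  module

theorem norm_remS_le {γ : ℝ → Eucl n} (h : ContDiff ℝ 2 γ) {x w M : ℝ} (hw : w ≠ 0)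
    (hM : ∀ z ∈ Set.uIcc x (x + w), ‖iteratedDeriv 2 γ z - iteratedDeriv 2 γ x‖ ≤ M) :
    ‖remS γ x w‖ ≤ M := by
  have h1 := norm_taylor_deriv_le h hM (x + w) Set.right_mem_uIcc
  rw [add_sub_cancel_left] at h1
  have h2 : remS γ x w =
      (1 / w) • (deriv γ (x + w) - deriv γ x - w • iteratedDeriv 2 γ x) := by
    rw [remS, smul_sub _ _ (w • _), smul_smul, one_div, inv_mul_cancel₀ hw, one_smul]
  rw [h2, norm_smul, norm_div, norm_one, Real.norm_eq_abs, div_mul_eq_mul_div, one_mul,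
    div_le_iff₀ (abs_pos.2 hw)]
  exact h1

theorem norm_remR_le {γ : ℝ → Eucl n} (h : ContDiff ℝ 2 γ) {x w M : ℝ} (hw : w ≠ 0)
    (hM : ∀ z ∈ Set.uIcc x (x + w), ‖iteratedDeriv 2 γ z - iteratedDeriv 2 γ x‖ ≤ M) :
    ‖remR γ x w‖ ≤ 2 * M := by
  have h1 := norm_taylor_le h hM
  have h2 : remR γ x w = (2 / w ^ 2) •
      (γ (x + w) - γ x - w • deriv γ x - (w ^ 2 / 2) • iteratedDeriv 2 γ x) := by
    rw [remR, smul_sub _ _ ((w ^ 2 / 2) • _), smul_smul]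
    congr 1
    rw [show 2 / w ^ 2 * (w ^ 2 / 2) = 1 by field_simp, one_smul]
  have hw2 : 0 < w ^ 2 := by positivity
  rw [h2, norm_smul, Real.norm_eq_abs, abs_of_nonneg (by positivity), div_mul_eq_mul_div,
    div_le_iff₀ hw2]
  linarith

theorem iteratedDeriv_two_sub_translate {γ : ℝ → Eucl n} (h : ContDiff ℝ 2 γ) (k x : ℝ) :
    iteratedDeriv 2 (fun z => γ (z + k) - γ z) x =
      iteratedDeriv 2 γ (x + k) - iteratedDeriv 2 γ x := by
  have h1 : ContDiff ℝ 2 (fun z => γ (z + k)) := h.comp (contDiff_id.add contDiff_const)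
  have := iteratedDeriv_sub (n := 2) (x := x) h1.contDiffAt h.contDiffAt
  rw [iteratedDeriv_comp_add_const] at this
  exact this

theorem deriv_sub_translate {γ : ℝ → Eucl n} (h : ContDiff ℝ 2 γ) (k x : ℝ) :
    deriv (fun z => γ (z + k) - γ z) x = deriv γ (x + k) - deriv γ x := by
  have h1 : HasDerivAt (fun z => γ (z + k)) (deriv γ (x + k)) x :=
    (hasDerivAt_of_contDiff_two h (x + k)).comp_add_const x k
  exact (h1.sub (hasDerivAt_of_contDiff_two h x)).deriv

/-- The remainder is linear in the curve and commutes with translations. A difference of remainders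
at two points is thus the remainder of `γ(· + k) - γ`, and Hölder bounds in `x` reduce to sup bounds
for another curve. -/
theorem remR_sub_translate {γ : ℝ → Eucl n} (h : ContDiff ℝ 2 γ) (k x w : ℝ) :
    remR (fun z => γ (z + k) - γ z) x w = remR γ (x + k) w - remR γ x w := by
  simp only [remR, iteratedDeriv_two_sub_translate h, deriv_sub_translate h]
  rw [show x + w + k = x + k + w by ring]
  module

theorem remS_sub_translate {γ : ℝ → Eucl n} (h : ContDiff ℝ 2 γ) (k x w : ℝ) :
    remS (fun z => γ (z + k) - γ z) x w = remS γ (x + k) w - remS γ x w := by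
  simp only [remS, iteratedDeriv_two_sub_translate h, deriv_sub_translate h]
  rw [show x + w + k = x + k + w by ring]
  module

end Remainders

/-! ### Hölder exponents and kernel bounds for the remainders -/

section Regularity

variable {n : ℕ} {α b : ℝ}

/-- The Hölder exponent `min 1 (α - 2 + b)` of the second derivative of a map in `C^{α+b}`. -/
noncomputable def expH (α b : ℝ) : ℝ := min 1 (α - 2 + b)

/-- The complementary exponent of `expH`. -/
noncomputable def expZ (α b : ℝ) : ℝ := α - 2 + b - expH α b

theorem expH_le_one : expH α b ≤ 1 := min_le_left _ _

theorem expZ_nonneg : 0 ≤ expZ α b := sub_nonneg.2 (min_le_right _ _)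

/-- With `η = expH` and `ζ = expZ` one has `η + ζ = α - 2 + b` and `ζ < α - 2 < η`. The second
inequality makes `|w|^{1-α+η}` integrable at `0`, the first makes `|w|^{1-α+ζ}` integrable at
infinity. -/
theorem lt_expH (hα : α ∈ Set.Ioo (2 : ℝ) 3) (hb : b ∈ Set.Ioo (0 : ℝ) 1) : α - 2 < expH α b :=
  lt_min (by linarith [hα.2]) (by linarith [hb.1])

theorem le_expH (hα : α ∈ Set.Ioo (2 : ℝ) 3) (hb : b ∈ Set.Ioo (0 : ℝ) 1) : b ≤ expH α b :=
  le_min hb.2.le (by linarith [hα.1])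

theorem expH_pos (hα : α ∈ Set.Ioo (2 : ℝ) 3) (hb : b ∈ Set.Ioo (0 : ℝ) 1) : 0 < expH α b :=
  hb.1.trans_le (le_expH hα hb)

theorem expZ_lt (hα : α ∈ Set.Ioo (2 : ℝ) 3) (hb : b ∈ Set.Ioo (0 : ℝ) 1) : expZ α b < α - 2 := by
  rw [expZ, expH]
  rcases min_cases 1 (α - 2 + b) with ⟨h, _⟩ | ⟨h, _⟩ <;> rw [h] <;> linarith [hα.1, hb.2]

theorem two_le_floor (hα : α ∈ Set.Ioo (2 : ℝ) 3) (hb : b ∈ Set.Ioo (0 : ℝ) 1) :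
    2 ≤ ⌊α + b⌋₊ := Nat.le_floor (by push_cast; linarith [hα.1, hb.1])

theorem HolderSpace.contDiff_two (hα : α ∈ Set.Ioo (2 : ℝ) 3) (hb : b ∈ Set.Ioo (0 : ℝ) 1)
    (u : HolderSpace n (α + b)) : ContDiff ℝ 2 u.toFun :=
  u.memC.contDiff.of_le (by exact_mod_cast two_le_floor hα hb)

theorem HolderSpace.norm_deriv_le (hα : α ∈ Set.Ioo (2 : ℝ) 3) (hb : b ∈ Set.Ioo (0 : ℝ) 1)
    (u : HolderSpace n (α + b)) (x : ℝ) : ‖deriv u.toFun x‖ ≤ ‖u‖ := by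
  rw [← iteratedDeriv_one]
  exact u.norm_iteratedDeriv_le (one_le_two.trans (two_le_floor hα hb)) x

theorem HolderSpace.norm_iteratedDeriv_two_le (hα : α ∈ Set.Ioo (2 : ℝ) 3)
    (hb : b ∈ Set.Ioo (0 : ℝ) 1) (u : HolderSpace n (α + b)) (x : ℝ) :
    ‖iteratedDeriv 2 u.toFun x‖ ≤ ‖u‖ := u.norm_iteratedDeriv_le (two_le_floor hα hb) x

theorem floor_fract_of_lt (hα : α ∈ Set.Ioo (2 : ℝ) 3) (hb : b ∈ Set.Ioo (0 : ℝ) 1)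
    (h : α + b < 3) : ⌊α + b⌋₊ = 2 ∧ Int.fract (α + b) = expH α b ∧ expZ α b = 0 := by
  have h0 : 0 ≤ α + b := by linarith [hα.1, hb.1]
  have h1 : ⌊α + b⌋₊ = 2 := (Nat.floor_eq_iff h0).2 ⟨by push_cast; linarith [hα.1, hb.1],
    by push_cast; linarith⟩
  have h2 : expH α b = α - 2 + b := min_eq_right (by linarith)
  refine ⟨h1, ?_, by rw [expZ, h2]; ring⟩
  rw [Int.fract, ← natCast_floor_eq_intCast_floor h0, h1, h2]
  push_cast; ring

theorem floor_fract_of_ge (hα : α ∈ Set.Ioo (2 : ℝ) 3) (hb : b ∈ Set.Ioo (0 : ℝ) 1)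
    (h : 3 ≤ α + b) : ⌊α + b⌋₊ = 3 ∧ Int.fract (α + b) = expZ α b ∧ expH α b = 1 := by
  have h0 : 0 ≤ α + b := by linarith [hα.1, hb.1]
  have h1 : ⌊α + b⌋₊ = 3 := (Nat.floor_eq_iff h0).2 ⟨by push_cast; linarith,
    by push_cast; linarith [hα.2, hb.2]⟩
  have h2 : expH α b = 1 := min_eq_left (by linarith)
  refine ⟨h1, ?_, h2⟩
  rw [Int.fract, ← natCast_floor_eq_intCast_floor h0, h1, expZ, h2]
  push_cast; ring

theorem HolderSpace.norm_iteratedDeriv_two_sub_le (hα : α ∈ Set.Ioo (2 : ℝ) 3)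
    (hb : b ∈ Set.Ioo (0 : ℝ) 1) (u : HolderSpace n (α + b)) (x y : ℝ) :
    ‖iteratedDeriv 2 u.toFun x - iteratedDeriv 2 u.toFun y‖ ≤ ‖u‖ * |x - y| ^ expH α b := by
  rcases lt_or_ge (α + b) 3 with h | h
  · obtain ⟨h1, h2, -⟩ := floor_fract_of_lt hα hb h
    have := u.norm_iteratedDeriv_sub_le x y
    rwa [h1, h2] at this
  · obtain ⟨h1, -, h3⟩ := floor_fract_of_ge hα hb h
    rw [h3, Real.rpow_one]
    refine norm_sub_le_of_iteratedDeriv_bound (u.memC.contDiff.of_le ?_)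
      (fun z => u.norm_iteratedDeriv_le ?_ z) x y
    · rw [h1]
    · rw [h1]

/-- If `α + b < 3` then `ζ = 0`, and two Hölder increments of length `|w|` suffice; they produce the
factor `2`. If `α + b ≥ 3` then `η = 1` and `γ'''` is `ζ`-Hölder, so the mean value inequality in
`w` applies to `γ''(· + k) - γ''`. -/
theorem HolderSpace.norm_second_difference_le (hα : α ∈ Set.Ioo (2 : ℝ) 3)
    (hb : b ∈ Set.Ioo (0 : ℝ) 1) (u : HolderSpace n (α + b)) (x w k : ℝ) :
    ‖(iteratedDeriv 2 u.toFun (x + w + k) - iteratedDeriv 2 u.toFun (x + w)) -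
      (iteratedDeriv 2 u.toFun (x + k) - iteratedDeriv 2 u.toFun x)‖ ≤
      2 * ‖u‖ * |w| ^ expH α b * |k| ^ expZ α b := by
  rcases lt_or_ge (α + b) 3 with h | h
  · obtain ⟨-, -, h3⟩ := floor_fract_of_lt hα hb h
    rw [h3, Real.rpow_zero, mul_one]
    have e1 := u.norm_iteratedDeriv_two_sub_le hα hb (x + w + k) (x + k)
    have e2 := u.norm_iteratedDeriv_two_sub_le hα hb (x + w) x
    rw [show x + w + k - (x + k) = w by ring] at e1
    rw [show x + w - x = w by ring] at e2
    rw [sub_sub_sub_comm]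
    refine (norm_sub_le _ _).trans ?_
    linarith
  · obtain ⟨h1, h2, h3⟩ := floor_fract_of_ge hα hb h
    rw [h3, Real.rpow_one]
    have hc : ContDiff ℝ (2 + 1 : ℕ) u.toFun := by
      have := u.memC.contDiff
      rwa [h1] at this
    have hd : ∀ z, HasDerivAt (iteratedDeriv 2 u.toFun) (iteratedDeriv 3 u.toFun z) z := fun z => by
      have := (hc.differentiable_iteratedDeriv 2 (by norm_num) z).hasDerivAt
      rwa [← iteratedDeriv_succ] at this
    have hg : ∀ z, HasDerivAt (fun z => iteratedDeriv 2 u.toFun (z + k) - iteratedDeriv 2 u.toFun z)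
        (iteratedDeriv 3 u.toFun (z + k) - iteratedDeriv 3 u.toFun z) z := fun z =>
      ((hd (z + k)).comp_add_const z k).sub (hd z)
    have := Convex.norm_image_sub_le_of_norm_hasDerivWithin_le (s := Set.univ)
      (C := ‖u‖ * |k| ^ expZ α b) (x := x) (y := x + w)
      (fun z _ => (hg z).hasDerivWithinAt) (fun z _ => ?_) convex_univ trivial trivial
    · rw [add_sub_cancel_left, Real.norm_eq_abs] at this
      refine this.trans ?_
      have : 0 ≤ ‖u‖ * |k| ^ expZ α b * |w| := by positivity
      linarith
    · have := u.norm_iteratedDeriv_sub_le (z + k) z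
      rwa [h1, h2, add_sub_cancel_left] at this

/-- Bounds for a family of functions that vanishes to some order at `w = 0`. -/
structure RemKernel (N η ζ : ℝ) (ρ : ℝ → ℝ → ℝ) : Prop where
  periodic : ∀ w, Function.Periodic (fun x => ρ x w) 1
  measurable : ∀ x, Measurable (ρ x)
  bound : ∀ x w, w ≠ 0 → |ρ x w| ≤ N * |w| ^ η
  diff_near : ∀ x y w, w ≠ 0 → |ρ x w - ρ y w| ≤ N * (|w| ^ η * |x - y| ^ ζ)
  diff_far : ∀ x y w, w ≠ 0 → |ρ x w - ρ y w| ≤ N * (|w| ^ ζ * |x - y| ^ η)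

theorem abs_coord_le (v : Eucl n) (i : Fin n) : |v i| ≤ ‖v‖ := PiLp.norm_apply_le v i

theorem periodic_deriv_of_periodic {γ : ℝ → Eucl n} (h : Function.Periodic γ 1) :
    Function.Periodic (deriv γ) 1 := by
  have := periodic_iteratedDeriv h 1
  rwa [iteratedDeriv_one] at this

theorem remR_periodic {γ : ℝ → Eucl n} (h : Function.Periodic γ 1) (w : ℝ) :
    Function.Periodic (fun x => remR γ x w) 1 := fun x => by
  simp only [remR, h x, periodic_deriv_of_periodic h x, periodic_iteratedDeriv h 2 x,
    add_right_comm x 1 w, h (x + w)]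

theorem remS_periodic {γ : ℝ → Eucl n} (h : Function.Periodic γ 1) (w : ℝ) :
    Function.Periodic (fun x => remS γ x w) 1 := fun x => by
  simp only [remS, periodic_deriv_of_periodic h x, periodic_iteratedDeriv h 2 x,
    add_right_comm x 1 w, periodic_deriv_of_periodic h (x + w)]

theorem measurable_remR {γ : ℝ → Eucl n} (h : ContDiff ℝ 2 γ) (x : ℝ) : Measurable (remR γ x) := by
  have : Measurable γ := h.continuous.measurable
  unfold remR
  fun_prop

theorem measurable_remS {γ : ℝ → Eucl n} (h : ContDiff ℝ 2 γ) (x : ℝ) : Measurable (remS γ x) := by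
  have : Measurable (deriv γ) := (h.continuous_deriv (by norm_num)).measurable
  unfold remS
  fun_prop


theorem abs_sub_le_of_mem_uIcc_add {x w z : ℝ} (hz : z ∈ Set.uIcc x (x + w)) : |z - x| ≤ |w| := by
  have := Set.abs_sub_left_of_mem_uIcc hz
  simpa using this

theorem HolderSpace.osc_le (hα : α ∈ Set.Ioo (2 : ℝ) 3) (hb : b ∈ Set.Ioo (0 : ℝ) 1)
    (u : HolderSpace n (α + b)) (x w : ℝ) : ∀ z ∈ Set.uIcc x (x + w),
    ‖iteratedDeriv 2 u.toFun z - iteratedDeriv 2 u.toFun x‖ ≤ ‖u‖ * |w| ^ expH α b := by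
  intro z hz
  refine (u.norm_iteratedDeriv_two_sub_le hα hb z x).trans ?_
  have := expH_pos hα hb
  exact mul_le_mul_of_nonneg_left (Real.rpow_le_rpow (abs_nonneg _)
    (abs_sub_le_of_mem_uIcc_add hz) this.le) (norm_nonneg _)

/-- A second difference is symmetric in its two increments, so the exponents `η` and `ζ` may be
attached to `w` and `k` in either way. The first version is used for small `|w|`, the second for
large `|w|`. -/
theorem HolderSpace.osc_translate_le (hα : α ∈ Set.Ioo (2 : ℝ) 3) (hb : b ∈ Set.Ioo (0 : ℝ) 1)
    (u : HolderSpace n (α + b)) (k x w : ℝ) : ∀ z ∈ Set.uIcc x (x + w),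
    ‖iteratedDeriv 2 (fun z => u.toFun (z + k) - u.toFun z) z -
      iteratedDeriv 2 (fun z => u.toFun (z + k) - u.toFun z) x‖ ≤
      2 * ‖u‖ * (|w| ^ expH α b * |k| ^ expZ α b) ∧
    ‖iteratedDeriv 2 (fun z => u.toFun (z + k) - u.toFun z) z -
      iteratedDeriv 2 (fun z => u.toFun (z + k) - u.toFun z) x‖ ≤
      2 * ‖u‖ * (|w| ^ expZ α b * |k| ^ expH α b) := by
  intro z hz
  have h0 := expH_pos hα hb
  have hz0 : 0 ≤ expZ α b := expZ_nonneg
  have hzw := abs_sub_le_of_mem_uIcc_add hz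
  rw [iteratedDeriv_two_sub_translate (u.contDiff_two hα hb),
    iteratedDeriv_two_sub_translate (u.contDiff_two hα hb)]
  constructor
  · have := u.norm_second_difference_le hα hb x (z - x) k
    rw [show x + (z - x) = z by ring] at this
    rw [← mul_assoc]
    exact this.trans (by gcongr)
  · have := u.norm_second_difference_le hα hb x k (z - x)
    rw [show x + k + (z - x) = z + k by ring, show x + (z - x) = z by ring,
      sub_sub_sub_comm] at this
    rw [mul_comm (|w| ^ _), ← mul_assoc]
    exact this.trans (by gcongr)

theorem HolderSpace.remKernel_remR (hα : α ∈ Set.Ioo (2 : ℝ) 3) (hb : b ∈ Set.Ioo (0 : ℝ) 1)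
    (u : HolderSpace n (α + b)) (i : Fin n) :
    RemKernel (4 * ‖u‖) (expH α b) (expZ α b) fun x w => remR u.toFun x w i := by
  have hc := u.contDiff_two hα hb
  have hc' : ∀ k, ContDiff ℝ 2 (fun z => u.toFun (z + k) - u.toFun z) := fun k =>
    (hc.comp (contDiff_id.add contDiff_const)).sub hc
  have hdiff : ∀ x y w, |remR u.toFun x w i - remR u.toFun y w i| ≤
      ‖remR (fun z => u.toFun (z + (x - y)) - u.toFun z) y w‖ := fun x y w => by
    rw [remR_sub_translate hc, show y + (x - y) = x by ring]
    exact abs_coord_le (remR u.toFun x w - remR u.toFun y w) i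
  refine ⟨fun w x => ?_, fun x => ?_, fun x w hw => ?_, fun x y w hw => ?_, fun x y w hw => ?_⟩
  · simp only [remR_periodic u.memC.periodic w x]
  · have := measurable_remR hc x
    fun_prop
  · have h1 := norm_remR_le hc hw (u.osc_le hα hb x w)
    refine (abs_coord_le _ i).trans (h1.trans ?_)
    have : 0 ≤ ‖u‖ * |w| ^ expH α b := by positivity
    linarith
  · have h1 := norm_remR_le (hc' (x - y)) hw fun z hz => (u.osc_translate_le hα hb _ y w z hz).1
    exact (hdiff x y w).trans (h1.trans (le_of_eq (by ring)))
  · have h1 := norm_remR_le (hc' (x - y)) hw fun z hz => (u.osc_translate_le hα hb _ y w z hz).2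
    exact (hdiff x y w).trans (h1.trans (le_of_eq (by ring)))

theorem HolderSpace.remKernel_remS (hα : α ∈ Set.Ioo (2 : ℝ) 3) (hb : b ∈ Set.Ioo (0 : ℝ) 1)
    (u : HolderSpace n (α + b)) (i : Fin n) :
    RemKernel (4 * ‖u‖) (expH α b) (expZ α b) fun x w => remS u.toFun x w i := by
  have hc := u.contDiff_two hα hb
  have hc' : ∀ k, ContDiff ℝ 2 (fun z => u.toFun (z + k) - u.toFun z) := fun k =>
    (hc.comp (contDiff_id.add contDiff_const)).sub hc
  have hdiff : ∀ x y w, |remS u.toFun x w i - remS u.toFun y w i| ≤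
      ‖remS (fun z => u.toFun (z + (x - y)) - u.toFun z) y w‖ := fun x y w => by
    rw [remS_sub_translate hc, show y + (x - y) = x by ring]
    exact abs_coord_le (remS u.toFun x w - remS u.toFun y w) i
  have h4 : ∀ c, 0 ≤ c → 2 * ‖u‖ * c ≤ 4 * ‖u‖ * c := fun c hc => by
    have : 0 ≤ ‖u‖ * c := by positivity
    linarith
  refine ⟨fun w x => ?_, fun x => ?_, fun x w hw => ?_, fun x y w hw => ?_, fun x y w hw => ?_⟩
  · simp only [remS_periodic u.memC.periodic w x]
  · have := measurable_remS hc x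
    fun_prop
  · have h1 := norm_remS_le hc hw (u.osc_le hα hb x w)
    refine (abs_coord_le _ i).trans (h1.trans ?_)
    have : 0 ≤ ‖u‖ * |w| ^ expH α b := by positivity
    linarith
  · have h1 := norm_remS_le (hc' (x - y)) hw fun z hz => (u.osc_translate_le hα hb _ y w z hz).1
    exact (hdiff x y w).trans (h1.trans (h4 _ (by positivity)))
  · have h1 := norm_remS_le (hc' (x - y)) hw fun z hz => (u.osc_translate_le hα hb _ y w z hz).2
    exact (hdiff x y w).trans (h1.trans (h4 _ (by positivity)))

end Regularity

/-! ### Integrals of even two-sided powers -/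

section EvenIntegrals

theorem integrable_comp_abs_of_integrableOn_Ioi {f : ℝ → ℝ} (hf : IntegrableOn f (Set.Ioi 0)) :
    Integrable fun x => f |x| := by
  have h1 : IntegrableOn (fun x => f |x|) (Set.Ioi 0) :=
    hf.congr_fun (fun x hx => by simp only [abs_of_pos (Set.mem_Ioi.1 hx)]) measurableSet_Ioi
  have h2 : IntegrableOn (fun x => f |x|) (Set.Iio 0) := by
    have := ((Measure.measurePreserving_neg (volume : Measure ℝ)).integrableOn_comp_preimage
      (Homeomorph.neg ℝ).measurableEmbedding (f := f) (s := Set.Ioi 0)).2 hf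
    rw [show (Neg.neg : ℝ → ℝ) ⁻¹' Set.Ioi 0 = Set.Iio 0 by ext; simp] at this
    exact this.congr_fun (fun x hx => by
      simp only [abs_of_neg (Set.mem_Iio.1 hx), Function.comp]) measurableSet_Iio
  have h3 : IntegrableOn (fun x => f |x|) (Set.Iic 0) := (integrableOn_Iic_iff_integrableOn_Iio).2 h2
  have := h3.union h1
  rwa [Set.Iic_union_Ioi, integrableOn_univ] at this

/-- A two-sided power: `A r^p` for `r ≤ κ` and `B r^{p'}` for `r > κ`. -/
noncomputable def splitPower (A B p p' κ r : ℝ) : ℝ := if r ≤ κ then A * r ^ p else B * r ^ p'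

theorem splitPower_integral {A B p p' κ : ℝ} (hp : -1 < p) (hp' : p' < -1) (hκ : 0 < κ) :
    (Integrable fun w => splitPower A B p p' κ |w|) ∧
    ∫ w, splitPower A B p p' κ |w| =
      2 * (A * (κ ^ (p + 1) / (p + 1)) + B * (κ ^ (p' + 1) / (-(p' + 1)))) := by
  have e1 : Set.EqOn (fun r => A * r ^ p) (splitPower A B p p' κ) (Set.Ioc 0 κ) := fun r hr => by
    simp only [splitPower, if_pos hr.2]
  have e2 : Set.EqOn (fun r => B * r ^ p') (splitPower A B p p' κ) (Set.Ioi κ) := fun r hr => by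
    simp only [splitPower, if_neg (not_le.2 (Set.mem_Ioi.1 hr))]
  have h1' : IntegrableOn (fun r : ℝ => A * r ^ p) (Set.Ioc 0 κ) :=
    ((intervalIntegrable_iff_integrableOn_Ioc_of_le hκ.le).1
      (intervalIntegral.intervalIntegrable_rpow' hp)).const_mul A
  have h2' : IntegrableOn (fun r : ℝ => B * r ^ p') (Set.Ioi κ) :=
    (integrableOn_Ioi_rpow_of_lt hp' hκ).const_mul B
  have h1 := h1'.congr_fun e1 measurableSet_Ioc
  have h2 := h2'.congr_fun e2 measurableSet_Ioi
  have hI : IntegrableOn (splitPower A B p p' κ) (Set.Ioi 0) := by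
    have := h1.union h2
    rwa [Set.Ioc_union_Ioi_eq_Ioi hκ.le] at this
  refine ⟨integrable_comp_abs_of_integrableOn_Ioi hI, ?_⟩
  rw [integral_comp_abs, ← Set.Ioc_union_Ioi_eq_Ioi hκ.le,
    setIntegral_union (Set.Ioc_disjoint_Ioi le_rfl) measurableSet_Ioi h1 h2,
    ← setIntegral_congr_fun measurableSet_Ioc e1, ← setIntegral_congr_fun measurableSet_Ioi e2,
    integral_const_mul, integral_const_mul, integral_Ioi_rpow_of_lt hp' hκ,
    ← intervalIntegral.integral_of_le hκ.le, integral_rpow (Or.inl hp),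
    Real.zero_rpow (by linarith), sub_zero]
  congr 3
  rw [div_neg, neg_div]

end EvenIntegrals

/-! ### Estimates of the singular integrals -/

section Kernels

/-- The interval `[-1/2, 1/2]`. -/
abbrev symInterval : Set ℝ := Set.Icc (-(1 / 2)) (1 / 2)

/-- The singular weight `w |w|^{-α}`. -/
noncomputable def oddWeight (α w : ℝ) : ℝ := w * |w| ^ (-α)

/-- The weight `w² |w|^{-α}`. -/
noncomputable def evenWeight (α w : ℝ) : ℝ := w ^ 2 * |w| ^ (-α)

variable {α b N η ζ : ℝ}

theorem abs_oddWeight {w : ℝ} (hw : w ≠ 0) : |oddWeight α w| = |w| ^ (1 - α) := by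
  have hw' : 0 < |w| := abs_pos.2 hw
  rw [oddWeight, abs_mul, abs_of_nonneg (Real.rpow_nonneg hw'.le _), sub_eq_add_neg,
    Real.rpow_add hw', Real.rpow_one]

theorem abs_evenWeight {w : ℝ} (hw : w ≠ 0) : |evenWeight α w| = |w| ^ (2 - α) := by
  have hw' : 0 < |w| := abs_pos.2 hw
  rw [evenWeight, abs_mul, abs_of_nonneg (Real.rpow_nonneg hw'.le _), sub_eq_add_neg,
    Real.rpow_add hw', Real.rpow_two, abs_pow]

theorem measurable_oddWeight : Measurable (oddWeight α) := by
  unfold oddWeight; fun_prop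

theorem measurable_evenWeight : Measurable (evenWeight α) := by
  unfold evenWeight; fun_prop

/-- The constant in the estimates of singular integrals. -/
noncomputable def kernelConst (α η ζ : ℝ) : ℝ := 2 * (1 / (2 - α + η) + 1 / (α - 2 - ζ))

theorem RemKernel.abs_mul_le {ρ : ℝ → ℝ → ℝ} (hρ : RemKernel N η ζ ρ) {x w : ℝ} (hw : w ≠ 0)
    (hw2 : |w| ≤ 1) :
    |oddWeight α w * ρ x w| ≤ N * splitPower 1 1 (1 - α + η) (1 - α + ζ) 1 |w| := by
  have hw' : 0 < |w| := abs_pos.2 hw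
  rw [splitPower, if_pos hw2, abs_mul, abs_oddWeight hw, Real.rpow_add hw']
  have := mul_le_mul_of_nonneg_left (hρ.bound x w hw) (Real.rpow_nonneg hw'.le (1 - α))
  linarith

theorem RemKernel.abs_sub_mul_le {ρ : ℝ → ℝ → ℝ} (hρ : RemKernel N η ζ ρ) {x y w : ℝ}
    (hw : w ≠ 0) : |oddWeight α w * ρ x w - oddWeight α w * ρ y w| ≤
      N * splitPower (|x - y| ^ ζ) (|x - y| ^ η) (1 - α + η) (1 - α + ζ) |x - y| |w| := by
  have hw' : 0 < |w| := abs_pos.2 hw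
  rw [← mul_sub, abs_mul, abs_oddWeight hw, splitPower]
  have h1 := mul_le_mul_of_nonneg_left (hρ.diff_near x y w hw) (Real.rpow_nonneg hw'.le (1 - α))
  have h2 := mul_le_mul_of_nonneg_left (hρ.diff_far x y w hw) (Real.rpow_nonneg hw'.le (1 - α))
  split_ifs
  · rw [Real.rpow_add hw']; linarith
  · rw [Real.rpow_add hw']; linarith

theorem RemKernel.integrableOn {ρ : ℝ → ℝ → ℝ} (hρ : RemKernel N η ζ ρ) (hη : α - 2 < η)
    (hζ : ζ < α - 2) (x : ℝ) :
    IntegrableOn (fun w => oddWeight α w * ρ x w) symInterval := by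
  -- On `[-1/2, 1/2]` one has `|w| ≤ 1`, so with `κ = 1` only the inner power matters; the outer one
  -- just makes the majorant integrable on the whole line.
  have h := (splitPower_integral (A := 1) (B := 1) (p := 1 - α + η) (p' := 1 - α + ζ) (κ := 1)
    (by linarith) (by linarith) one_pos).1
  refine Integrable.mono' (h.const_mul N).integrableOn
    (measurable_oddWeight.mul (hρ.measurable x)).aestronglyMeasurable ?_
  filter_upwards [ae_restrict_mem measurableSet_Icc, Measure.ae_ne (volume.restrict symInterval) 0]
    with w hw hw0
  exact hρ.abs_mul_le hw0 (abs_le.2 ⟨by linarith [hw.1], by linarith [hw.2]⟩)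

theorem RemKernel.integral_abs_le {ρ : ℝ → ℝ → ℝ} (hρ : RemKernel N η ζ ρ) (hη : α - 2 < η)
    (hζ : ζ < α - 2) (x : ℝ) (hN : 0 ≤ N) :
    ∫ w in symInterval, |oddWeight α w * ρ x w| ≤ kernelConst α η ζ * N := by
  have h := splitPower_integral (A := 1) (B := 1) (p := 1 - α + η) (p' := 1 - α + ζ) (κ := 1)
    (by linarith) (by linarith) one_pos
  calc ∫ w in symInterval, |oddWeight α w * ρ x w|
      ≤ ∫ w in symInterval, N * splitPower 1 1 (1 - α + η) (1 - α + ζ) 1 |w| := by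
        refine integral_mono_ae (hρ.integrableOn hη hζ x).abs (h.1.const_mul N).integrableOn ?_
        filter_upwards [ae_restrict_mem measurableSet_Icc,
          Measure.ae_ne (volume.restrict symInterval) 0] with w hw hw0
        exact hρ.abs_mul_le hw0 (abs_le.2 ⟨by linarith [hw.1], by linarith [hw.2]⟩)
    _ ≤ ∫ w, N * splitPower 1 1 (1 - α + η) (1 - α + ζ) 1 |w| := by
        refine setIntegral_le_integral (h.1.const_mul N) (Eventually.of_forall fun w => ?_)
        change 0 ≤ N * splitPower _ _ _ _ _ _
        unfold splitPower
        split_ifs <;> positivity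
    _ = kernelConst α η ζ * N := by
        rw [integral_const_mul, h.2, kernelConst, Real.one_rpow, Real.one_rpow]
        rw [show 1 - α + η + 1 = 2 - α + η by ring, show -(1 - α + ζ + 1) = α - 2 - ζ by ring]
        ring

/-- The integral is split at `|w| = |x - y|`. The near part is at most a multiple of `|x-y|^ζ ∫_{|w|
≤ |x-y|} |w|^{1-α+η}`, the far part of `|x-y|^η ∫_{|w| > |x-y|} |w|^{1-α+ζ}`. Both have the order
`|x-y|^{η+ζ+2-α} = |x-y|^b`. -/
theorem RemKernel.integral_abs_sub_le {ρ : ℝ → ℝ → ℝ} (hρ : RemKernel N η ζ ρ) (hη : α - 2 < η)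
    (hζ : ζ < α - 2) (hb : η + ζ + 2 - α = b) (x y : ℝ) (hN : 0 ≤ N) :
    ∫ w in symInterval, |oddWeight α w * ρ x w - oddWeight α w * ρ y w| ≤
      kernelConst α η ζ * N * |x - y| ^ b := by
  have hc : 0 ≤ kernelConst α η ζ := by
    have h1 : 0 < 2 - α + η := by linarith
    have h2 : 0 < α - 2 - ζ := by linarith
    unfold kernelConst; positivity
  rcases eq_or_ne x y with rfl | hxy
  · simp only [sub_self, abs_zero, integral_zero]; positivity
  have hk : 0 < |x - y| := abs_pos.2 (sub_ne_zero.2 hxy)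
  have h := splitPower_integral (A := |x - y| ^ ζ) (B := |x - y| ^ η) (p := 1 - α + η)
    (p' := 1 - α + ζ) (κ := |x - y|) (by linarith) (by linarith) hk
  calc ∫ w in symInterval, |oddWeight α w * ρ x w - oddWeight α w * ρ y w|
      ≤ ∫ w in symInterval,
        N * splitPower (|x - y| ^ ζ) (|x - y| ^ η) (1 - α + η) (1 - α + ζ) |x - y| |w| := by
        refine integral_mono_ae ((hρ.integrableOn hη hζ x).sub (hρ.integrableOn hη hζ y)).abs
          (h.1.const_mul N).integrableOn ?_
        filter_upwards [Measure.ae_ne (volume.restrict symInterval) 0] with w hw0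
        exact hρ.abs_sub_mul_le hw0
    _ ≤ ∫ w, N * splitPower (|x - y| ^ ζ) (|x - y| ^ η) (1 - α + η) (1 - α + ζ) |x - y| |w| := by
        refine setIntegral_le_integral (h.1.const_mul N) (Eventually.of_forall fun w => ?_)
        change 0 ≤ N * splitPower _ _ _ _ _ _
        unfold splitPower
        split_ifs <;> positivity
    _ = kernelConst α η ζ * N * |x - y| ^ b := by
        rw [integral_const_mul, h.2, kernelConst]
        rw [show 1 - α + η + 1 = 2 - α + η by ring, show -(1 - α + ζ + 1) = α - 2 - ζ by ring,
          show 1 - α + ζ + 1 = 2 - α + ζ by ring, ← mul_div_assoc, ← mul_div_assoc,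
          ← Real.rpow_add hk, ← Real.rpow_add hk, show ζ + (2 - α + η) = b by linarith,
          show η + (2 - α + ζ) = b by linarith]
        ring

end Kernels

/-! ### The parameters `(w, t)` and integral operators on families -/

section Parameters

/-- The parameter space of pairs `(w, t)`. -/
abbrev Param : Type := ℝ × ℝ

/-- The measure `dw dt` on `[-1/2, 1/2] × [0, 1]`. -/
noncomputable def paramMeasure : Measure Param :=
  (volume.restrict symInterval).prod (volume.restrict (Set.Icc 0 1))

open Classical in
/-- The first parameter, modified to take values in `[-1/2, 1/2] \ {0}`. -/
noncomputable def parW (t : Param) : ℝ := if t.1 ≠ 0 ∧ |t.1| ≤ 1 / 2 then t.1 else 1 / 2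

open Classical in
/-- The second parameter, modified to take values in `[0, 1]`. -/
noncomputable def parT (t : Param) : ℝ := if 0 ≤ t.2 ∧ t.2 ≤ 1 then t.2 else 0

theorem parW_ne_zero (t : Param) : parW t ≠ 0 := by
  unfold parW; split_ifs with h
  exacts [h.1, by norm_num]

theorem abs_parW_le (t : Param) : |parW t| ≤ 1 / 2 := by
  unfold parW; split_ifs with h
  exacts [h.2, by norm_num]

theorem parT_mem (t : Param) : parT t ∈ Set.Icc (0 : ℝ) 1 := by
  unfold parT; split_ifs with h
  exacts [h, by norm_num]

theorem measurable_parW : Measurable parW := by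
  refine Measurable.ite ?_ measurable_fst measurable_const
  refine MeasurableSet.inter ?_ ?_
  · exact (measurableSet_singleton (0 : ℝ)).compl.preimage measurable_fst
  · exact measurableSet_le (continuous_abs.measurable.comp measurable_fst) measurable_const

theorem measurable_parT : Measurable parT := by
  refine Measurable.ite ?_ measurable_snd measurable_const
  exact (measurableSet_Icc (a := (0 : ℝ)) (b := 1)).preimage measurable_snd

/-- Integrals do not notice the modification, while it makes the bounds valid only for `w ≠ 0`, `|w|
≤ 1/2` hold at every parameter, as membership in `UH` requires. -/
theorem ae_parW : ∀ᵐ t ∂paramMeasure, parW t = t.1 := by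
  have h : ∀ᵐ w ∂(volume.restrict symInterval), w ≠ 0 ∧ |w| ≤ 1 / 2 := by
    filter_upwards [ae_restrict_mem measurableSet_Icc,
      Measure.ae_ne (volume.restrict symInterval) 0] with w hw hw0
    exact ⟨hw0, abs_le.2 hw⟩
  filter_upwards [Measure.quasiMeasurePreserving_fst.ae h] with t ht
  rw [parW, if_pos ht]

theorem integral_param_fst (f : ℝ → ℝ) :
    ∫ t, f t.1 ∂paramMeasure = ∫ w in symInterval, f w := by
  rw [paramMeasure, integral_fun_fst]
  simp

theorem integral_param_parW (f : ℝ → ℝ) :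
    ∫ t, f (parW t) ∂paramMeasure = ∫ w in symInterval, f w := by
  rw [← integral_param_fst]
  refine integral_congr_ae ?_
  filter_upwards [ae_parW] with t ht
  rw [ht]

theorem integrable_param_parW {f : ℝ → ℝ} (hf : IntegrableOn f symInterval) :
    Integrable (fun t => f (parW t)) paramMeasure := by
  refine (Integrable.comp_fst hf (volume.restrict (Set.Icc (0 : ℝ) 1))).congr ?_
  filter_upwards [ae_parW] with t ht
  rw [ht]

variable {b N : ℝ}

/-- Kernels of integral operators that act on families with uniform Hölder bounds. -/
structure IsKernel (b N : ℝ) (k : Param → ℝ → ℝ) : Prop where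
  periodic : ∀ t, Function.Periodic (k t) 1
  integrable : ∀ x, Integrable (fun t => k t x) paramMeasure
  bound : ∀ x, ∫ t, |k t x| ∂paramMeasure ≤ N
  holder : ∀ x y, ∫ t, |k t x - k t y| ∂paramMeasure ≤ N * |x - y| ^ b

theorem IsKernel.nonneg {k : Param → ℝ → ℝ} (hk : IsKernel b N k) : 0 ≤ N :=
  (integral_nonneg fun _ => abs_nonneg _).trans (hk.bound 0)

theorem IsKernel.integrable_mul {k : Param → ℝ → ℝ} (hk : IsKernel b N k) (a : UH Param b)
    (x y : ℝ) : Integrable (fun t => a.toFun t x * k t y) paramMeasure :=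
  (hk.integrable y).bdd_mul (a.isUH.measurable x).aestronglyMeasurable
    (Eventually.of_forall fun t => a.abs_apply_le t x)

theorem IsKernel.abs_integral_mul_le {k : Param → ℝ → ℝ} (hk : IsKernel b N k) (a : UH Param b)
    (x : ℝ) : |∫ t, a.toFun t x * k t x ∂paramMeasure| ≤ N * ‖a‖ := by
  calc |∫ t, a.toFun t x * k t x ∂paramMeasure| ≤ ∫ t, ‖a‖ * |k t x| ∂paramMeasure := by
        refine norm_integral_le_of_norm_le (G := ℝ) ((hk.integrable x).abs.const_mul ‖a‖)
          (Eventually.of_forall fun t => ?_)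
        rw [Real.norm_eq_abs, abs_mul]
        gcongr
        exact a.abs_apply_le t x
    _ ≤ N * ‖a‖ := by
        rw [integral_const_mul, mul_comm]
        gcongr
        exact hk.bound x

theorem IsKernel.abs_integral_mul_sub_le {k : Param → ℝ → ℝ} (hk : IsKernel b N k)
    (a : UH Param b) (x y : ℝ) :
    |∫ t, a.toFun t x * k t x ∂paramMeasure - ∫ t, a.toFun t y * k t y ∂paramMeasure| ≤
      2 * N * ‖a‖ * |x - y| ^ b := by
  have hi : Integrable (fun t => ‖a‖ * |k t x - k t y| + ‖a‖ * |x - y| ^ b * |k t y|)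
      paramMeasure :=
    (((hk.integrable x).sub (hk.integrable y)).abs.const_mul _).add
      ((hk.integrable y).abs.const_mul _)
  rw [← integral_sub (hk.integrable_mul a x x) (hk.integrable_mul a y y)]
  calc |∫ t, (a.toFun t x * k t x - a.toFun t y * k t y) ∂paramMeasure|
      ≤ ∫ t, (‖a‖ * |k t x - k t y| + ‖a‖ * |x - y| ^ b * |k t y|) ∂paramMeasure := by
        refine norm_integral_le_of_norm_le (G := ℝ) hi (Eventually.of_forall fun t => ?_)
        rw [Real.norm_eq_abs, show a.toFun t x * k t x - a.toFun t y * k t y =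
          a.toFun t x * (k t x - k t y) + (a.toFun t x - a.toFun t y) * k t y by ring]
        refine (abs_add_le _ _).trans ?_
        rw [abs_mul, abs_mul]
        gcongr
        exacts [a.abs_apply_le t x, a.abs_sub_apply_le t x y]
    _ ≤ ‖a‖ * (N * |x - y| ^ b) + ‖a‖ * |x - y| ^ b * N := by
        have hi1 : Integrable (fun t => ‖a‖ * |k t x - k t y|) paramMeasure :=
          ((hk.integrable x).sub (hk.integrable y)).abs.const_mul _
        rw [integral_add hi1 ((hk.integrable y).abs.const_mul _), integral_const_mul, integral_const_mul]
        gcongr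
        exacts [hk.holder x y, hk.bound y]
    _ = _ := by ring

/-- The result of the integration is constant in the parameter: ordinary `C^b` functions are kept
inside the same algebra, so that they can be multiplied with genuine families. -/
theorem IsKernel.isUH {k : Param → ℝ → ℝ} (hk : IsKernel b N k) (a : UH Param b) :
    IsUH b fun (_ : Param) x => ∫ t, a.toFun t x * k t x ∂paramMeasure :=
  ⟨fun _ x => by simp only [hk.periodic _ x, a.isUH.periodic _ x], fun _ => measurable_const,
    ⟨_, fun _ x => hk.abs_integral_mul_le a x⟩, ⟨_, fun _ x y => hk.abs_integral_mul_sub_le a x y⟩⟩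

/-- The integral operators with kernels that depend linearly on a parameter. -/
noncomputable def kernelOp {E : Type*} [NormedAddCommGroup E] [NormedSpace ℝ E]
    (k : E →ₗ[ℝ] (Param → ℝ → ℝ)) {C : ℝ} (hk : ∀ u, IsKernel b (C * ‖u‖) (k u)) :
    E →L[ℝ] UH Param b →L[ℝ] UH Param b :=
  LinearMap.mkContinuous₂ (LinearMap.mk₂ ℝ (fun u a => UH.ofFun _ ((hk u).isUH a))
    (fun u v a => UH.ext fun _ x => by
      simp only [UH.toFun_ofFun, UH.toFun_add, map_add, Pi.add_apply, mul_add]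
      exact integral_add ((hk u).integrable_mul a x x) ((hk v).integrable_mul a x x))
    (fun c u a => UH.ext fun _ x => by
      simp only [UH.toFun_ofFun, UH.toFun_smul, map_smul, Pi.smul_apply, smul_eq_mul]
      rw [← integral_const_mul]
      congr 1; funext t; ring)
    (fun u a a' => UH.ext fun _ x => by
      simp only [UH.toFun_ofFun, UH.toFun_add, add_mul]
      exact integral_add ((hk u).integrable_mul a x x) ((hk u).integrable_mul a' x x))
    (fun c u a => UH.ext fun _ x => by
      simp only [UH.toFun_ofFun, UH.toFun_smul]
      rw [← integral_const_mul]
      congr 1; funext t; ring)) (3 * C) fun u a => by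
    have h0 := (hk u).nonneg
    have := UH.norm_le (a := UH.ofFun _ ((hk u).isUH a)) (M := C * ‖u‖ * ‖a‖)
      (K := 2 * (C * ‖u‖) * ‖a‖) (by positivity) (by positivity)
      (fun _ x => (hk u).abs_integral_mul_le a x)
      (fun _ x y => (hk u).abs_integral_mul_sub_le a x y)
    refine this.trans (le_of_eq (by ring))

theorem toFun_kernelOp {E : Type*} [NormedAddCommGroup E] [NormedSpace ℝ E]
    (k : E →ₗ[ℝ] (Param → ℝ → ℝ)) {C : ℝ} (hk : ∀ u, IsKernel b (C * ‖u‖) (k u)) (u : E)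
    (a : UH Param b) (t₀ : Param) (x : ℝ) :
    (kernelOp k hk u a).toFun t₀ x = ∫ t, a.toFun t x * k u t x ∂paramMeasure := rfl

variable {α η ζ : ℝ}

theorem RemKernel.isKernel {ρ : ℝ → ℝ → ℝ} (hρ : RemKernel N η ζ ρ) (hN : 0 ≤ N)
    (hη : α - 2 < η) (hζ : ζ < α - 2) (hb : η + ζ + 2 - α = b) :
    IsKernel b (kernelConst α η ζ * N) fun t x => oddWeight α (parW t) * ρ x (parW t) where
  periodic t x := by
    have := hρ.periodic (parW t) x
    simp only at this ⊢
    rw [this]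
  integrable x := integrable_param_parW (hρ.integrableOn hη hζ x)
  bound x := by
    rw [integral_param_parW fun w => |oddWeight α w * ρ x w|]
    exact hρ.integral_abs_le hη hζ x hN
  holder x y := by
    rw [integral_param_parW fun w => |oddWeight α w * ρ x w - oddWeight α w * ρ y w|]
    exact hρ.integral_abs_sub_le hη hζ hb x y hN

theorem integrableOn_evenWeight (hα : α ∈ Set.Ioo (2 : ℝ) 3) :
    IntegrableOn (evenWeight α) symInterval := by
  have h := (splitPower_integral (A := 1) (B := 1) (p := 2 - α) (p' := -2) (κ := 1)
    (by linarith [hα.2]) (by norm_num) one_pos).1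
  refine Integrable.mono' h.integrableOn measurable_evenWeight.aestronglyMeasurable ?_
  filter_upwards [ae_restrict_mem measurableSet_Icc, Measure.ae_ne (volume.restrict symInterval) 0]
    with w hw hw0
  rw [Real.norm_eq_abs, abs_evenWeight hw0, splitPower, if_pos, one_mul]
  exact abs_le.2 ⟨by linarith [hw.1], by linarith [hw.2]⟩

theorem isKernel_evenWeight (hα : α ∈ Set.Ioo (2 : ℝ) 3) (r : ℝ) :
    IsKernel b ((∫ w in symInterval, |evenWeight α w|) * ‖r‖)
      (LinearMap.toSpanSingleton ℝ (Param → ℝ → ℝ) (fun t _ => evenWeight α (parW t)) r) where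
  periodic t x := rfl
  integrable x := (integrable_param_parW (integrableOn_evenWeight hα)).const_mul r
  bound x := by
    simp only [LinearMap.toSpanSingleton_apply, Pi.smul_apply, smul_eq_mul, abs_mul]
    rw [integral_const_mul, integral_param_parW fun w => |evenWeight α w|, mul_comm,
      Real.norm_eq_abs]
  holder x y := by
    simp only [LinearMap.toSpanSingleton_apply, Pi.smul_apply, sub_self, abs_zero, integral_zero]
    exact mul_nonneg (mul_nonneg (integral_nonneg fun _ => abs_nonneg _) (norm_nonneg _))
      (by positivity)

/-- Integration against `w² |w|^{-α}`. -/
noncomputable def evenOp (hα : α ∈ Set.Ioo (2 : ℝ) 3) : UH Param b →L[ℝ] UH Param b :=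
  kernelOp _ (isKernel_evenWeight (b := b) hα) 1

theorem toFun_evenOp (hα : α ∈ Set.Ioo (2 : ℝ) 3) (a : UH Param b) (t₀ : Param) (x : ℝ) :
    (evenOp hα a).toFun t₀ x = ∫ t, a.toFun t x * evenWeight α (parW t) ∂paramMeasure := by
  rw [evenOp, toFun_kernelOp]
  simp

theorem UH.integrable_mul_evenWeight (hα : α ∈ Set.Ioo (2 : ℝ) 3) (a : UH Param b) (x : ℝ) :
    Integrable (fun t => a.toFun t x * evenWeight α (parW t)) paramMeasure := by
  have := (isKernel_evenWeight (b := b) hα 1).integrable_mul a x x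
  simpa using this

end Parameters

/-! ### The linear and bilinear building blocks -/

section Building

variable {n : ℕ} {α b : ℝ} {T : Type*} [MeasurableSpace T]

/-- Quantitative version of `IsUH`. -/
structure UHBound (b N : ℝ) (a : T → ℝ → ℝ) : Prop where
  periodic : ∀ t, Function.Periodic (a t) 1
  measurable : ∀ x, Measurable fun t => a t x
  bound : ∀ t x, |a t x| ≤ N
  holder : ∀ t x y, |a t x - a t y| ≤ N * |x - y| ^ b

theorem UHBound.isUH {N : ℝ} {a : T → ℝ → ℝ} (h : UHBound b N a) : IsUH b a :=
  ⟨h.periodic, h.measurable, ⟨N, h.bound⟩, ⟨N, h.holder⟩⟩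

/-- A continuous linear map into `UH`, from a linear map into families of functions. -/
noncomputable def UH.mkL {E : Type*} [NormedAddCommGroup E] [NormedSpace ℝ E]
    (Φ : E →ₗ[ℝ] (T → ℝ → ℝ)) {C : ℝ} (hC : 0 ≤ C) (h : ∀ u, UHBound b (C * ‖u‖) (Φ u)) :
    E →L[ℝ] UH T b :=
  LinearMap.mkContinuous
    { toFun := fun u => UH.ofFun (Φ u) (h u).isUH
      map_add' := fun u v => UH.ext fun t x => by
        simp only [UH.toFun_ofFun, UH.toFun_add, map_add, Pi.add_apply]
      map_smul' := fun c u => UH.ext fun t x => by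
        simp only [UH.toFun_ofFun, UH.toFun_smul, map_smul, Pi.smul_apply, smul_eq_mul,
          RingHom.id_apply] } (2 * C) fun u => by
    have := UH.norm_le (a := UH.ofFun (Φ u) (h u).isUH) (M := C * ‖u‖) (K := C * ‖u‖)
      (by positivity) (by positivity) (h u).bound (h u).holder
    exact this.trans (le_of_eq (by ring))

theorem norm_le_sum_abs (v : Eucl n) : ‖v‖ ≤ ∑ i, |v i| := by
  have h := (EuclideanSpace.basisFun (Fin n) ℝ).sum_repr v
  calc ‖v‖ = ‖∑ i, (EuclideanSpace.basisFun (Fin n) ℝ).repr v i •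
        EuclideanSpace.basisFun (Fin n) ℝ i‖ := by rw [h]
    _ ≤ ∑ i, |v i| := by
        refine (norm_sum_le _ _).trans (Finset.sum_le_sum fun i _ => ?_)
        rw [norm_smul, (EuclideanSpace.basisFun (Fin n) ℝ).orthonormal.1 i, mul_one]
        simp

/-- The vector valued function with given coordinates. -/
noncomputable def coordFun (t₀ : T) (a : Fin n → UH T b) (x : ℝ) : Eucl n :=
  WithLp.toLp 2 fun i => (a i).toFun t₀ x

theorem norm_coordFun_le (t₀ : T) (a : Fin n → UH T b) (x : ℝ) :
    ‖coordFun t₀ a x‖ ≤ n * ‖a‖ := by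
  refine (norm_le_sum_abs _).trans ?_
  have : ∑ i, |coordFun t₀ a x i| ≤ ∑ i : Fin n, ‖a‖ := Finset.sum_le_sum fun i _ =>
    ((a i).abs_apply_le t₀ x).trans (norm_le_pi_norm a i)
  simpa using this

theorem norm_coordFun_sub_le (t₀ : T) (a : Fin n → UH T b) (x y : ℝ) :
    ‖coordFun t₀ a x - coordFun t₀ a y‖ ≤ n * ‖a‖ * |x - y| ^ b := by
  refine (norm_le_sum_abs _).trans ?_
  have : ∑ i, |(coordFun t₀ a x - coordFun t₀ a y) i| ≤ ∑ i : Fin n, ‖a‖ * |x - y| ^ b :=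
    Finset.sum_le_sum fun i _ => ((a i).abs_sub_apply_le t₀ x y).trans (by
      gcongr; exact norm_le_pi_norm a i)
  refine this.trans (le_of_eq ?_)
  rw [Finset.sum_const, Finset.card_univ, Fintype.card_fin, nsmul_eq_mul, mul_assoc]

theorem floor_fract_of_mem (hb : b ∈ Set.Ioo (0 : ℝ) 1) : ⌊b⌋₊ = 0 ∧ Int.fract b = b :=
  ⟨Nat.floor_eq_zero.2 hb.2, Int.fract_eq_self.2 ⟨hb.1.le, hb.2⟩⟩

theorem memC_coordFun (hb : b ∈ Set.Ioo (0 : ℝ) 1) (t₀ : T) (a : Fin n → UH T b) :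
    MemC b (coordFun t₀ a) := by
  obtain ⟨h1, h2⟩ := floor_fract_of_mem hb
  have hbd := norm_coordFun_sub_le t₀ a
  have hW : HolderWith (n * ‖a‖).toNNReal (holderExp b) (coordFun t₀ a) :=
    holderWith_of_bound (by positivity) (by rwa [h2])
  refine memC_of_bounds (K := n * ‖a‖) (fun x => ?_) ?_ (by positivity) ?_
  · simp only [coordFun, (a _).isUH.periodic t₀ x]
  · rw [h1, Nat.cast_zero, contDiff_zero]
    refine hW.continuous ?_
    rw [← NNReal.coe_pos, coe_holderExp, h2]
    exact hb.1
  · rw [h1, h2]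
    simpa using hbd

/-- Elements of the Hölder space from their coordinates. -/
noncomputable def toHolder (hb : b ∈ Set.Ioo (0 : ℝ) 1) (t₀ : T) :
    (Fin n → UH T b) →L[ℝ] HolderSpace n b :=
  LinearMap.mkContinuous
    { toFun := fun a => HolderSpace.ofFun (coordFun t₀ a) (memC_coordFun hb t₀ a)
      map_add' := fun _ _ => rfl
      map_smul' := fun _ _ => rfl } (2 * n) fun a => by
    obtain ⟨h1, h2⟩ := floor_fract_of_mem hb
    have := holderNorm_le (s := b) (f := coordFun t₀ a) (M := n * ‖a‖) (K := n * ‖a‖)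
      (by positivity) (fun j hj x => by
        rw [h1, Nat.le_zero] at hj
        subst hj
        simpa using norm_coordFun_le t₀ a x) (by
        rw [h1, h2]; simpa using norm_coordFun_sub_le t₀ a)
    rw [h1] at this
    refine this.trans (le_of_eq ?_)
    push_cast; ring

theorem toFun_toHolder (hb : b ∈ Set.Ioo (0 : ℝ) 1) (t₀ : T) (a : Fin n → UH T b) (x : ℝ)
    (i : Fin n) : (toHolder hb t₀ a).toFun x i = (a i).toFun t₀ x := rfl

/-- The mean value over a period, for one value of the parameter. -/
noncomputable def meanOp (hb : 0 < b) (t₀ : T) : UH T b →L[ℝ] UH T b :=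
  have hc : ∀ a : UH T b, Continuous (a.toFun t₀) := fun a => by
    have : HolderWith ‖a‖.toNNReal b.toNNReal (a.toFun t₀) := fun x y => by
      rw [edist_dist, edist_dist, Real.coe_toNNReal _ hb.le,
        ENNReal.ofReal_rpow_of_nonneg dist_nonneg hb.le]
      change _ ≤ ENNReal.ofReal ‖a‖ * _
      rw [← ENNReal.ofReal_mul (norm_nonneg a)]
      exact ENNReal.ofReal_le_ofReal (a.abs_sub_apply_le t₀ x y)
    exact this.continuous (Real.toNNReal_pos.2 hb)
  UH.mkL (C := 1)
    { toFun := fun a _ _ => ∫ y in (0 : ℝ)..1, a.toFun t₀ y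
      map_add' := fun a a' => by
        funext t x
        exact intervalIntegral.integral_add ((hc a).intervalIntegrable _ _)
          ((hc a').intervalIntegrable _ _)
      map_smul' := fun c a => by
        funext t x
        exact intervalIntegral.integral_const_mul c _ } zero_le_one fun a =>
    { periodic := fun _ _ => rfl
      measurable := fun _ => measurable_const
      bound := fun t x => by
        have := intervalIntegral.norm_integral_le_of_norm_le_const (a := 0) (b := 1) (C := ‖a‖)
          (f := a.toFun t₀) fun x _ => a.abs_apply_le t₀ x
        simpa using this
      holder := fun t x y => by
        simp only [LinearMap.coe_mk, AddHom.coe_mk, sub_self, abs_zero]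
        positivity }

theorem toFun_meanOp (hb : 0 < b) (t₀ : T) (a : UH T b) (t : T) (x : ℝ) :
    (meanOp hb t₀ a).toFun t x = ∫ y in (0 : ℝ)..1, a.toFun t₀ y := rfl

variable (hα : α ∈ Set.Ioo (2 : ℝ) 3) (hb : b ∈ Set.Ioo (0 : ℝ) 1)

theorem HolderSpace.iteratedDeriv_add_apply (hα : α ∈ Set.Ioo (2 : ℝ) 3)
    (hb : b ∈ Set.Ioo (0 : ℝ) 1) (u v : HolderSpace n (α + b)) {j : ℕ} (hj : j ≤ 2) (x : ℝ) :
    iteratedDeriv j (u + v).toFun x = iteratedDeriv j u.toFun x + iteratedDeriv j v.toFun x :=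
  congrFun (u.memC.iteratedDeriv_add v.memC (hj.trans (two_le_floor hα hb))) x

theorem HolderSpace.deriv_add_apply (hα : α ∈ Set.Ioo (2 : ℝ) 3)
    (hb : b ∈ Set.Ioo (0 : ℝ) 1) (u v : HolderSpace n (α + b)) (x : ℝ) :
    deriv (u + v).toFun x = deriv u.toFun x + deriv v.toFun x := by
  have := HolderSpace.iteratedDeriv_add_apply hα hb u v one_le_two x
  rwa [iteratedDeriv_one, iteratedDeriv_one, iteratedDeriv_one] at this

theorem HolderSpace.iteratedDeriv_smul_apply (c : ℝ) (u : HolderSpace n α) (j : ℕ) (x : ℝ) :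
    iteratedDeriv j (c • u).toFun x = c • iteratedDeriv j u.toFun x :=
  congrFun (iteratedDeriv_smul' c j) x

theorem HolderSpace.deriv_smul_apply (c : ℝ) (u : HolderSpace n α) (x : ℝ) :
    deriv (c • u).toFun x = c • deriv u.toFun x := by
  have := HolderSpace.iteratedDeriv_smul_apply c u 1 x
  rwa [iteratedDeriv_one, iteratedDeriv_one] at this

theorem HolderSpace.remR_add (hα : α ∈ Set.Ioo (2 : ℝ) 3) (hb : b ∈ Set.Ioo (0 : ℝ) 1)
    (u v : HolderSpace n (α + b)) (x w : ℝ) :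
    remR (u + v).toFun x w = remR u.toFun x w + remR v.toFun x w := by
  simp only [remR, deriv_add_apply hα hb, iteratedDeriv_add_apply hα hb u v le_rfl]
  simp only [HolderSpace.toFun_add, Pi.add_apply]
  module

theorem HolderSpace.remS_add (hα : α ∈ Set.Ioo (2 : ℝ) 3) (hb : b ∈ Set.Ioo (0 : ℝ) 1)
    (u v : HolderSpace n (α + b)) (x w : ℝ) :
    remS (u + v).toFun x w = remS u.toFun x w + remS v.toFun x w := by
  simp only [remS, deriv_add_apply hα hb, iteratedDeriv_add_apply hα hb u v le_rfl]
  module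

theorem HolderSpace.remR_smul (c : ℝ) (u : HolderSpace n α) (x w : ℝ) :
    remR (c • u).toFun x w = c • remR u.toFun x w := by
  simp only [remR, deriv_smul_apply, iteratedDeriv_smul_apply]
  simp only [HolderSpace.toFun_smul, Pi.smul_apply]
  module

theorem HolderSpace.remS_smul (c : ℝ) (u : HolderSpace n α) (x w : ℝ) :
    remS (c • u).toFun x w = c • remS u.toFun x w := by
  simp only [remS, deriv_smul_apply, iteratedDeriv_smul_apply]
  module

/-- The linear map `u ↦ u'ᵢ`. -/
noncomputable def cP (i : Fin n) : HolderSpace n (α + b) →L[ℝ] UH Param b :=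
  UH.mkL (C := 3)
    { toFun := fun u _ x => deriv u.toFun x i
      map_add' := fun u v => by
        funext t x
        simp [HolderSpace.deriv_add_apply hα hb]
      map_smul' := fun c u => by
        funext t x
        simp [HolderSpace.deriv_smul_apply] } (by norm_num) fun u =>
    { periodic := fun t x => by
        simp [periodic_deriv_of_periodic u.memC.periodic x]
      measurable := fun x => measurable_const
      bound := fun t x => by
        refine (abs_coord_le _ i).trans ((u.norm_deriv_le hα hb x).trans ?_)
        linarith [norm_nonneg u]
      holder := fun t x y => by
        have := holder_weaken (η := 1) (u.norm_deriv_le hα hb) (norm_nonneg u) hb.1.le hb.2.le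
          (fun x y => by
            have := norm_sub_le_of_iteratedDeriv_bound (j := 1) (u.contDiff_two hα hb)
              (u.norm_iteratedDeriv_two_le hα hb) x y
            rwa [Real.rpow_one, ← iteratedDeriv_one]) x y
        refine (abs_coord_le (deriv u.toFun x - deriv u.toFun y) i).trans (this.trans_eq ?_)
        ring }

/-- The linear map `u ↦ u''ᵢ`. -/
noncomputable def cF (i : Fin n) : HolderSpace n (α + b) →L[ℝ] UH Param b :=
  UH.mkL (C := 3)
    { toFun := fun u _ x => iteratedDeriv 2 u.toFun x i
      map_add' := fun u v => by
        funext t x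
        simp [HolderSpace.iteratedDeriv_add_apply hα hb]
      map_smul' := fun c u => by
        funext t x
        simp [HolderSpace.iteratedDeriv_smul_apply] } (by norm_num) fun u =>
    { periodic := fun t x => by
        simp [periodic_iteratedDeriv u.memC.periodic 2 x]
      measurable := fun x => measurable_const
      bound := fun t x => by
        refine (abs_coord_le _ i).trans ((u.norm_iteratedDeriv_two_le hα hb x).trans ?_)
        linarith [norm_nonneg u]
      holder := fun t x y => by
        have := holder_weaken (u.norm_iteratedDeriv_two_le hα hb) (norm_nonneg u) hb.1.le
          (le_expH hα hb) (u.norm_iteratedDeriv_two_sub_le hα hb) x y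
        refine (abs_coord_le (iteratedDeriv 2 u.toFun x - iteratedDeriv 2 u.toFun y) i).trans
          (this.trans_eq ?_)
        ring }

/-- Since `|w| ≤ 1/2`, all nonnegative powers of `|w|` are at most `1`; the exponent `η ≥ b` in `x`
is then weakened to `b`, which costs the factor `3`. -/
theorem RemKernel.uhBound {N : ℝ} (hN : 0 ≤ N) {ρ : ℝ → ℝ → ℝ} (hα : α ∈ Set.Ioo (2 : ℝ) 3)
    (hb : b ∈ Set.Ioo (0 : ℝ) 1) (h : RemKernel N (expH α b) (expZ α b) ρ) :
    UHBound b (3 * N) fun (t : Param) x => ρ x (parW t) where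
  periodic t := h.periodic _
  measurable x := (h.measurable x).comp measurable_parW
  bound t x := by
    refine (h.bound x _ (parW_ne_zero t)).trans ?_
    have h1 : |parW t| ^ expH α b ≤ 1 := Real.rpow_le_one (abs_nonneg _)
      ((abs_parW_le t).trans (by norm_num)) (expH_pos hα hb).le
    nlinarith
  holder t x y := by
    have h1 : |parW t| ^ expH α b ≤ 1 := Real.rpow_le_one (abs_nonneg _)
      ((abs_parW_le t).trans (by norm_num)) (expH_pos hα hb).le
    have h2 : |parW t| ^ expZ α b ≤ 1 := Real.rpow_le_one (abs_nonneg _)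
      ((abs_parW_le t).trans (by norm_num)) expZ_nonneg
    have := holder_weaken (g := fun x => ρ x (parW t)) (M := N) (K := N) (η := expH α b)
      (fun x => (h.bound x _ (parW_ne_zero t)).trans (by nlinarith)) hN hb.1.le
      (le_expH hα hb) (fun x y => by
        refine (h.diff_far x y _ (parW_ne_zero t)).trans ?_
        have : 0 ≤ |x - y| ^ expH α b := by positivity
        gcongr
        nlinarith) x y
    refine this.trans_eq ?_
    ring

/-- The linear map that sends `u` to the `i`-th coordinate of `remR u`. -/
noncomputable def cR (i : Fin n) : HolderSpace n (α + b) →L[ℝ] UH Param b :=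
  UH.mkL (C := 12)
    { toFun := fun u t x => remR u.toFun x (parW t) i
      map_add' := fun u v => by
        funext t x
        simp [HolderSpace.remR_add hα hb]
      map_smul' := fun c u => by
        funext t x
        simp [HolderSpace.remR_smul] } (by norm_num) fun u => by
    have := (u.remKernel_remR hα hb i).uhBound (by positivity) hα hb
    rwa [← mul_assoc, show (3 : ℝ) * 4 = 12 by norm_num] at this

/-- The linear map that sends `u` to the `i`-th coordinate of `remS u`. -/
noncomputable def cS (i : Fin n) : HolderSpace n (α + b) →L[ℝ] UH Param b :=
  UH.mkL (C := 12)
    { toFun := fun u t x => remS u.toFun x (parW t) i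
      map_add' := fun u v => by
        funext t x
        simp [HolderSpace.remS_add hα hb]
      map_smul' := fun c u => by
        funext t x
        simp [HolderSpace.remS_smul] } (by norm_num) fun u => by
    have := (u.remKernel_remS hα hb i).uhBound (by positivity) hα hb
    rwa [← mul_assoc, show (3 : ℝ) * 4 = 12 by norm_num] at this

theorem expH_add_expZ : expH α b + expZ α b + 2 - α = b := by rw [expZ]; ring

/-- The bilinear singular integral operator with kernel `w |w|^{-α} (remR u)ᵢ`. -/
noncomputable def opR (i : Fin n) : HolderSpace n (α + b) →L[ℝ] UH Param b →L[ℝ] UH Param b :=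
  kernelOp (C := kernelConst α (expH α b) (expZ α b) * 4)
    { toFun := fun u t x => oddWeight α (parW t) * remR u.toFun x (parW t) i
      map_add' := fun u v => by
        funext t x
        simp [HolderSpace.remR_add hα hb, mul_add]
      map_smul' := fun c u => by
        funext t x
        simp [HolderSpace.remR_smul, mul_left_comm] } fun u => by
    rw [mul_assoc]
    exact (u.remKernel_remR hα hb i).isKernel (by positivity) (lt_expH hα hb) (expZ_lt hα hb)
      expH_add_expZ

/-- The bilinear singular integral operator with kernel `w |w|^{-α} (remS u)ᵢ`. -/
noncomputable def opS (i : Fin n) : HolderSpace n (α + b) →L[ℝ] UH Param b →L[ℝ] UH Param b :=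
  kernelOp (C := kernelConst α (expH α b) (expZ α b) * 4)
    { toFun := fun u t x => oddWeight α (parW t) * remS u.toFun x (parW t) i
      map_add' := fun u v => by
        funext t x
        simp [HolderSpace.remS_add hα hb, mul_add]
      map_smul' := fun c u => by
        funext t x
        simp [HolderSpace.remS_smul, mul_left_comm] } fun u => by
    rw [mul_assoc]
    exact (u.remKernel_remS hα hb i).isKernel (by positivity) (lt_expH hα hb) (expZ_lt hα hb)
      expH_add_expZ

/-- The parameter `w` as an element of the algebra. -/
noncomputable def eW : UH Param b :=
  UH.ofFun (fun t _ => parW t) (IsUH.of_param measurable_parW abs_parW_le)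

/-- The parameter `t` as an element of the algebra. -/
noncomputable def eT : UH Param b :=
  UH.ofFun (fun t _ => parT t) (IsUH.of_param (M := 1) measurable_parT fun t =>
    abs_le.2 ⟨by linarith [(parT_mem t).1], (parT_mem t).2⟩)

end Building

/-! ### Bi-Lipschitz curves -/

section BiLipschitz

variable {n : ℕ}

/-- A quantitative form of injectivity and regularity for closed curves. -/
def IsBiLip (γ : ℝ → Eucl n) : Prop :=
  ∃ c > 0, ∀ x w, |w| ≤ 1 / 2 → c * |w| ≤ ‖γ (x + w) - γ x‖

/-- The difference quotient extends continuously to `w = 0` as `Φ(x, w) = ∫₀¹ γ'(x + s w) ds`.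
Regularity excludes a zero at `w = 0`, injectivity excludes one at `0 < |w| ≤ 1/2`, and the minimum
of `|Φ|` over a compact fundamental domain is the constant. -/
theorem IsInjRegular.isBiLip {γ : ℝ → Eucl n} (h : IsInjRegular γ) : IsBiLip γ := by
  have hd : Continuous (deriv γ) := h.contDiff.continuous_deriv le_rfl
  set Φ : ℝ × ℝ → Eucl n := fun p => ∫ s in (0 : ℝ)..1, deriv γ (p.1 + s * p.2) with hΦ
  have hΦc : Continuous Φ := by
    apply intervalIntegral.continuous_parametric_intervalIntegral_of_continuous'
    exact hd.comp (f := fun q : (ℝ × ℝ) × ℝ => q.1.1 + q.2 * q.1.2) (by fun_prop)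
  have hΦw : ∀ x w, w • Φ (x, w) = γ (x + w) - γ x := by
    intro x w
    have hder : ∀ s ∈ Set.uIcc (0 : ℝ) 1,
        HasDerivAt (fun s => γ (x + s * w)) (w • deriv γ (x + s * w)) s := fun s _ => by
      have h1 : HasDerivAt (fun s : ℝ => x + s * w) w s := by
        simpa using ((hasDerivAt_id s).mul_const w).const_add x
      exact ((h.contDiff.differentiable (by norm_num) _).hasDerivAt.scomp s h1)
    have := intervalIntegral.integral_eq_sub_of_hasDerivAt hder
      (((hd.comp (f := fun s : ℝ => x + s * w) (by fun_prop)).const_smul w).intervalIntegrable _ _)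
    rw [intervalIntegral.integral_smul] at this
    simpa using this
  have hpos : ∀ p ∈ Set.Icc (0 : ℝ) 1 ×ˢ Set.Icc (-(1 / 2) : ℝ) (1 / 2), Φ p ≠ 0 := by
    rintro ⟨x, w⟩ ⟨_, hw⟩ h0
    rcases eq_or_ne w 0 with rfl | hw0
    · apply h.regular x
      simpa only [hΦ, mul_zero, add_zero, intervalIntegral.integral_const, sub_zero, one_smul]
        using h0
    · have h1 : γ (x + w) = γ x := by
        rw [← sub_eq_zero, ← hΦw x w, h0, smul_zero]
      have hfr : ∀ z, γ (Int.fract z) = γ z := fun z => by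
        have := h.periodic.sub_zsmul_eq (x := z) ⌊z⌋
        rwa [zsmul_one] at this
      rw [← hfr, ← hfr x] at h1
      have h2 := h.injective ⟨Int.fract_nonneg _, Int.fract_lt_one _⟩
        ⟨Int.fract_nonneg _, Int.fract_lt_one _⟩ h1
      -- Parameters with the same image differ by an integer, and `|w| ≤ 1/2` leaves only the
      -- integer `0`.
      obtain ⟨z, hz⟩ := Int.fract_eq_fract.1 h2
      rw [add_sub_cancel_left] at hz
      have h3 : |(z : ℝ)| < 1 := by
        rw [← hz]; exact (abs_le.2 ⟨hw.1, hw.2⟩).trans_lt (by norm_num)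
      have h4 : z = 0 := by
        have : |z| < 1 := by exact_mod_cast h3
        exact Int.abs_lt_one_iff.1 this
      exact hw0 (by rw [hz, h4, Int.cast_zero])
  obtain ⟨p, hp, hmin⟩ := (isCompact_Icc.prod isCompact_Icc).exists_isMinOn
    (s := Set.Icc (0 : ℝ) 1 ×ˢ Set.Icc (-(1 / 2) : ℝ) (1 / 2))
    ⟨(0, 0), by constructor <;> constructor <;> norm_num⟩ hΦc.norm.continuousOn
  refine ⟨‖Φ p‖, norm_pos_iff.2 (hpos p hp), fun x w hw => ?_⟩
  obtain ⟨y, hy, hxy⟩ : ∃ y ∈ Set.Ico (0 : ℝ) 1, Φ (x, w) = Φ (y, w) := by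
    have hper : Function.Periodic (fun x => Φ (x, w)) 1 := fun x => by
      simp only [hΦ, add_right_comm x 1, periodic_deriv_of_periodic h.periodic _]
    exact hper.exists_mem_Ico₀ one_pos x
  rw [← hΦw, norm_smul, Real.norm_eq_abs, hxy, mul_comm]
  gcongr
  exact hmin (Set.mk_mem_prod ⟨hy.1, hy.2.le⟩ (abs_le.1 hw))

theorem le_norm_deriv_of_biLip {γ : ℝ → Eucl n} {c : ℝ}
    (h : ∀ x w, |w| ≤ 1 / 2 → c * |w| ≤ ‖γ (x + w) - γ x‖) {x : ℝ}
    (hd : DifferentiableAt ℝ γ x) : c ≤ ‖deriv γ x‖ := by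
  have ht := (hasDerivAt_iff_tendsto_slope_zero.1 hd.hasDerivAt).norm
  refine ge_of_tendsto ht ?_
  have h1 : ∀ᶠ w : ℝ in 𝓝[≠] 0, |w| < 1 / 2 :=
    nhdsWithin_le_nhds ((continuous_abs.tendsto' 0 0 abs_zero).eventually_lt_const (by norm_num))
  filter_upwards [h1, self_mem_nhdsWithin] with w hw hw0
  have hw0' : 0 < |w| := abs_pos.2 hw0
  rw [norm_smul, norm_inv, Real.norm_eq_abs, ← div_eq_inv_mul, le_div_iff₀ hw0']
  exact h x w hw.le

/-- A perturbation of norm less than `c / 2` changes difference quotients by less than `c / 2`,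
because the norm dominates the supremum of the first derivative. Openness is what later allows
derivatives of analytic maps to be analytic on this set. -/
theorem isOpen_isBiLip {s : ℝ} (hs : 1 ≤ s) : IsOpen {u : HolderSpace n s | IsBiLip u.toFun} := by
  rw [Metric.isOpen_iff]
  rintro u ⟨c, hc, hu⟩
  refine ⟨c / 2, by positivity, fun v hv => ⟨c / 2, by positivity, fun x w hw => ?_⟩⟩
  rw [Metric.mem_ball, dist_eq_norm] at hv
  have hfl : 0 + 1 ≤ ⌊s⌋₊ := Nat.le_floor (by simpa using hs)
  have h1 := norm_sub_le_of_iteratedDeriv_bound (j := 0)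
    ((v - u).memC.contDiff.of_le (by exact_mod_cast hfl))
    (fun z => (v - u).norm_iteratedDeriv_le hfl z) (x + w) x
  rw [iteratedDeriv_zero, HolderSpace.toFun_sub, add_sub_cancel_left] at h1
  have h2 := hu x w hw
  have h3 : ‖v - u‖ * |w| ≤ c / 2 * |w| := by gcongr
  have h4 : ‖u.toFun (x + w) - u.toFun x‖ ≤ ‖v.toFun (x + w) - v.toFun x‖ +
      ‖(v.toFun - u.toFun) (x + w) - (v.toFun - u.toFun) x‖ := by
    refine le_trans (le_of_eq ?_) (norm_sub_le _ _)
    congr 1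
    simp only [Pi.sub_apply]
    abel
  linarith

end BiLipschitz

/-! ### The lower order term as an explicit analytic expression -/

section BaseMap

variable {n : ℕ} {α b : ℝ} (hα : α ∈ Set.Ioo (2 : ℝ) 3) (hb : b ∈ Set.Ioo (0 : ℝ) 1)
  (u : HolderSpace n (α + b))

/-- `(γ̂ - γ') / w`, where `γ̂ = (γ(x + w) - γ(x)) / w`. -/
noncomputable def eC (i : Fin n) : UH Param b := (1 / 2 : ℝ) • (cF hα hb i u + cR hα hb i u)

/-- `(γ'(x + w) - γ'(x)) / w`. -/
noncomputable def eS (i : Fin n) : UH Param b := cF hα hb i u + cS hα hb i u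

/-- `|γ'|²`. -/
noncomputable def eV0 : UH Param b := ∑ i, cP hα hb i u ^ 2

/-- `(|γ̂|² - |γ'|²) / w`. -/
noncomputable def eV1 : UH Param b :=
  ∑ i, ((2 : ℝ) • cP hα hb i u + eW * eC hα hb u i) * eC hα hb u i

/-- `(|γ'(x + w)|² - |γ'(x)|²) / w`. -/
noncomputable def eR1 : UH Param b :=
  ∑ i, ((2 : ℝ) • cP hα hb i u + eW * eS hα hb u i) * eS hα hb u i

/-- The segment from `|γ'|²` to `|γ̂|²`. -/
noncomputable def eV : UH Param b := eV0 hα hb u + eT * eW * eV1 hα hb u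

/-- The segment from `|γ'(x)|²` to `|γ'(x + w)|²`. -/
noncomputable def eR : UH Param b := eV0 hα hb u + eT * eW * eR1 hα hb u

/-- The product of powers along the segments. -/
noncomputable def ePow (a c : ℝ) : UH Param b :=
  UH.rpow a (eR hα hb u) * UH.rpow c (eV hα hb u)

/-- The first derivative of `ePow` along the segments, divided by `w`. -/
noncomputable def eM (a c : ℝ) : UH Param b :=
  a • (eR1 hα hb u * ePow hα hb u (a - 1) c) + c • (eV1 hα hb u * ePow hα hb u a (c - 1))

/-- The second derivative of `ePow` along the segments, divided by `w²`. -/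
noncomputable def eD (a c : ℝ) : UH Param b :=
  (a * (a - 1)) • (eR1 hα hb u ^ 2 * ePow hα hb u (a - 2) c) +
    (2 * a * c) • (eR1 hα hb u * eV1 hα hb u * ePow hα hb u (a - 1) (c - 1)) +
    (c * (c - 1)) • (eV1 hα hb u ^ 2 * ePow hα hb u a (c - 2))

/-- The length of the curve. -/
noncomputable def eLen : UH Param b :=
  meanOp hb.1 ((0, 0) : Param) (UH.rpow (1 / 2) (eV0 hα hb u))

/-- The scalar factor of the curvature in the lower order term. -/
noncomputable def eX : UH Param b :=
  -- First order Taylor terms: with `R = eR1` and `Z = eV1`, `α(R/2 - (2+α)Z/2) - 2(R/2 - αZ/2) =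
  -- (α-2)R/2 - α²Z/2`. Here `R` contains `2⟨γ', remS⟩` and `Z` contains `⟨γ', remR⟩`; the constant
  -- parts of `R` and `Z` are absent, since they multiply an odd weight.
  UH.rpow (-(3 + α) / 2) (eV0 hα hb u) *
      ((∑ j, cP hα hb j u * ((α - 2) • opS hα hb j u 1 - (α ^ 2 / 2) • opR hα hb j u 1)) +
        ((α - 2) / 2) • evenOp hα (∑ j, eS hα hb u j ^ 2) -
        (α ^ 2 / 2) • evenOp hα (∑ j, eC hα hb u j ^ 2)) +
    evenOp hα ((1 - eT) * (α • eD hα hb u (1 / 2) (-(2 + α) / 2) -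
      (2 : ℝ) • (UH.rpow (-1) (eV0 hα hb u) * eD hα hb u (1 / 2) (-α / 2)))) +
    -- The limit of the arc length term, in closed form.
    ((α - 2) * 2 ^ α / (α - 1)) • (UH.rpow (-1) (eV0 hα hb u) *
      (UH.rpow (1 - α) (eLen hα hb u) - UH.rpow ((1 - α) / 2) (eV0 hα hb u)))

/-- The lower order term before projection. -/
noncomputable def eY (i : Fin n) : UH Param b :=
  α • opR hα hb i u (eM hα hb u (1 / 2) (-(2 + α) / 2)) + cF hα hb i u * eX hα hb u

/-- The coordinates of the lower order term. -/
noncomputable def eZ (i : Fin n) : UH Param b :=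
  eY hα hb u i - UH.rpow (-1) (eV0 hα hb u) * (∑ j, cP hα hb j u * eY hα hb u j) * cP hα hb i u

/-- The lower order term, as a map `C^{α+b} → C^b` for `0 < b < 1`. -/
noncomputable def baseMap : HolderSpace n b :=
  toHolder hb ((0, 0) : Param) fun i => eZ hα hb u i

section Values

variable (t : Param) (x : ℝ)

theorem toFun_cP (i : Fin n) : (cP hα hb i u).toFun t x = deriv u.toFun x i := rfl

theorem toFun_cF (i : Fin n) : (cF hα hb i u).toFun t x = iteratedDeriv 2 u.toFun x i := rfl

theorem toFun_eW : (eW : UH Param b).toFun t x = parW t := rfl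

theorem toFun_eT : (eT : UH Param b).toFun t x = parT t := rfl

theorem sum_sq_coord (v : Eucl n) : ∑ i, v i ^ 2 = ‖v‖ ^ 2 := by
  rw [EuclideanSpace.norm_sq_eq]
  simp

theorem toFun_eV0 : (eV0 hα hb u).toFun t x = ‖deriv u.toFun x‖ ^ 2 := by
  rw [← sum_sq_coord, eV0, UH.toFun_sum]
  rfl

/-- The difference quotient of a curve. -/
noncomputable def quot (γ : ℝ → Eucl n) (x w : ℝ) : Eucl n := w⁻¹ • (γ (x + w) - γ x)

theorem quot_eq {γ : ℝ → Eucl n} {w : ℝ} (hw : w ≠ 0) :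
    quot γ x w = deriv γ x + w • ((1 / 2 : ℝ) • (iteratedDeriv 2 γ x + remR γ x w)) := by
  rw [quot, remR, add_sub_cancel, smul_smul, smul_smul,
    show w * (1 / 2) * (2 / w ^ 2) = w⁻¹ by field_simp, smul_sub _ _ (w • _), smul_smul,
    inv_mul_cancel₀ hw, one_smul]
  abel

theorem deriv_add_eq {γ : ℝ → Eucl n} {w : ℝ} (hw : w ≠ 0) :
    deriv γ (x + w) = deriv γ x + w • (iteratedDeriv 2 γ x + remS γ x w) := by
  rw [remS, add_sub_cancel, smul_smul, mul_one_div_cancel hw, one_smul, add_sub_cancel]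

theorem toFun_eC (i : Fin n) : (eC hα hb u i).toFun t x =
    1 / 2 * (iteratedDeriv 2 u.toFun x i + remR u.toFun x (parW t) i) := rfl

theorem toFun_eS (i : Fin n) : (eS hα hb u i).toFun t x =
    iteratedDeriv 2 u.toFun x i + remS u.toFun x (parW t) i := rfl

/-- This is `|p + w c|² = |p|² + w ⟨2p + w c, c⟩` with `p = γ'` and `p + w c` the difference
quotient; the factor `w` is split off algebraically, so no division by `w` occurs in the algebra. -/
theorem eV0_add_eV1 : (eV0 hα hb u).toFun t x + parW t * (eV1 hα hb u).toFun t x =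
    ‖quot u.toFun x (parW t)‖ ^ 2 := by
  rw [← sum_sq_coord, eV0, eV1, UH.toFun_sum, UH.toFun_sum, Finset.mul_sum,
    ← Finset.sum_add_distrib]
  refine Finset.sum_congr rfl fun i _ => ?_
  rw [quot_eq x (parW_ne_zero t)]
  simp only [UH.toFun_mul, UH.toFun_add, UH.toFun_pow, UH.toFun_smul, toFun_cP, toFun_eC, toFun_eW,
    PiLp.add_apply, PiLp.smul_apply, smul_eq_mul]
  ring

theorem eV0_add_eR1 : (eV0 hα hb u).toFun t x + parW t * (eR1 hα hb u).toFun t x =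
    ‖deriv u.toFun (x + parW t)‖ ^ 2 := by
  rw [← sum_sq_coord, eV0, eR1, UH.toFun_sum, UH.toFun_sum, Finset.mul_sum,
    ← Finset.sum_add_distrib]
  refine Finset.sum_congr rfl fun i _ => ?_
  rw [deriv_add_eq x (parW_ne_zero t)]
  simp only [UH.toFun_mul, UH.toFun_add, UH.toFun_pow, UH.toFun_smul, toFun_cP, toFun_eS, toFun_eW,
    PiLp.add_apply, PiLp.smul_apply, smul_eq_mul]
  ring

theorem toFun_eV : (eV hα hb u).toFun t x =
    (eV0 hα hb u).toFun t x + parT t * (parW t * (eV1 hα hb u).toFun t x) := by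
  simp only [eV, UH.toFun_add, UH.toFun_mul, toFun_eT, toFun_eW, mul_assoc]

theorem toFun_eR : (eR hα hb u).toFun t x =
    (eV0 hα hb u).toFun t x + parT t * (parW t * (eR1 hα hb u).toFun t x) := by
  simp only [eR, UH.toFun_add, UH.toFun_mul, toFun_eT, toFun_eW, mul_assoc]

end Values

section LowerBounds

variable {u} {c : ℝ} (hc : 0 < c)
  (hu : ∀ x w, |w| ≤ 1 / 2 → c * |w| ≤ ‖u.toFun (x + w) - u.toFun x‖)

include hc hu

theorem le_eV0 (t : Param) (x : ℝ) : c ^ 2 ≤ (eV0 hα hb u).toFun t x := by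
  rw [toFun_eV0]
  gcongr
  exact le_norm_deriv_of_biLip hu ((u.contDiff_two hα hb).differentiable (by norm_num) x)

omit hc in
theorem le_norm_quot (t : Param) (x : ℝ) : c ≤ ‖quot u.toFun x (parW t)‖ := by
  have hw : 0 < |parW t| := abs_pos.2 (parW_ne_zero t)
  rw [quot, norm_smul, norm_inv, Real.norm_eq_abs, ← div_eq_inv_mul, le_div_iff₀ hw]
  exact hu x _ (abs_parW_le t)

/-- A convex combination of `|γ'|²` and of the squared norm of the difference quotient, both at
least `c²`. Real powers along the whole segment are therefore legitimate and analytic. -/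
theorem le_eV (t : Param) (x : ℝ) : c ^ 2 ≤ (eV hα hb u).toFun t x := by
  have h0 := le_eV0 hα hb hc hu t x
  have h1 : c ^ 2 ≤ (eV0 hα hb u).toFun t x + parW t * (eV1 hα hb u).toFun t x := by
    rw [eV0_add_eV1]
    gcongr
    exact le_norm_quot hu t x
  have ht := parT_mem t
  rw [toFun_eV]
  nlinarith [mul_nonneg ht.1 (sub_nonneg.2 h1), mul_nonneg (sub_nonneg.2 ht.2) (sub_nonneg.2 h0)]

theorem le_eR (t : Param) (x : ℝ) : c ^ 2 ≤ (eR hα hb u).toFun t x := by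
  have h0 := le_eV0 hα hb hc hu t x
  have h1 : c ^ 2 ≤ (eV0 hα hb u).toFun t x + parW t * (eR1 hα hb u).toFun t x := by
    rw [eV0_add_eR1, ← toFun_eV0 hα hb u t]
    exact le_eV0 hα hb hc hu t _
  have ht := parT_mem t
  rw [toFun_eR]
  nlinarith [mul_nonneg ht.1 (sub_nonneg.2 h1), mul_nonneg (sub_nonneg.2 ht.2) (sub_nonneg.2 h0)]

theorem toFun_eLen (t : Param) (x : ℝ) :
    (eLen hα hb u).toFun t x = ∫ y in (0 : ℝ)..1, ‖deriv u.toFun y‖ := by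
  rw [eLen, toFun_meanOp]
  congr 1
  funext y
  rw [UH.toFun_rpow (by positivity) (le_eV0 hα hb hc hu), toFun_eV0, ← Real.sqrt_eq_rpow,
    Real.sqrt_sq (norm_nonneg _)]

theorem le_eLen (t : Param) (x : ℝ) : c ≤ (eLen hα hb u).toFun t x := by
  rw [toFun_eLen hα hb hc hu]
  have h1 : ∫ y in (0 : ℝ)..1, c ≤ ∫ y in (0 : ℝ)..1, ‖deriv u.toFun y‖ := by
    refine intervalIntegral.integral_mono_on zero_le_one (by simp) ?_ fun y _ => ?_
    · exact ((u.contDiff_two hα hb).continuous_deriv (by norm_num)).norm.intervalIntegrable _ _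
    · exact le_norm_deriv_of_biLip hu ((u.contDiff_two hα hb).differentiable (by norm_num) y)
  simpa using h1

end LowerBounds

section Analyticity

variable (u : HolderSpace n (α + b))

theorem analyticAt_real_smul {g : HolderSpace n (α + b) → UH Param b} (r : ℝ)
    (hg : AnalyticAt ℝ g u) : AnalyticAt ℝ (fun u => r • g u) u :=
  hg.fun_const_smul (c := r)

theorem analyticAt_uh_mul {f g : HolderSpace n (α + b) → UH Param b}
    (hf : AnalyticAt ℝ f u) (hg : AnalyticAt ℝ g u) : AnalyticAt ℝ (fun u => f u * g u) u :=
  hf.fun_mul hg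

theorem analyticAt_uh_add {f g : HolderSpace n (α + b) → UH Param b}
    (hf : AnalyticAt ℝ f u) (hg : AnalyticAt ℝ g u) : AnalyticAt ℝ (fun u => f u + g u) u :=
  hf.fun_add hg

theorem analyticAt_uh_sub {f g : HolderSpace n (α + b) → UH Param b}
    (hf : AnalyticAt ℝ f u) (hg : AnalyticAt ℝ g u) : AnalyticAt ℝ (fun u => f u - g u) u :=
  hf.fun_sub hg

theorem analyticAt_opR (i : Fin n) {g : HolderSpace n (α + b) → UH Param b}
    (hg : AnalyticAt ℝ g u) : AnalyticAt ℝ (fun u => opR hα hb i u (g u)) u :=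
  ((opR hα hb i).analyticAt_bilinear (u, g u)).comp₂ analyticAt_id hg

theorem analyticAt_opS (i : Fin n) {g : HolderSpace n (α + b) → UH Param b}
    (hg : AnalyticAt ℝ g u) : AnalyticAt ℝ (fun u => opS hα hb i u (g u)) u :=
  ((opS hα hb i).analyticAt_bilinear (u, g u)).comp₂ analyticAt_id hg

theorem analyticAt_evenOp {g : HolderSpace n (α + b) → UH Param b}
    (hg : AnalyticAt ℝ g u) : AnalyticAt ℝ (fun u => evenOp hα (g u)) u :=
  ((evenOp hα).analyticAt (g u)).fun_comp hg

theorem analyticAt_eC (i : Fin n) : AnalyticAt ℝ (fun u => eC hα hb u i) u :=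
  analyticAt_real_smul u _ (analyticAt_uh_add u ((cF hα hb i).analyticAt u)
    ((cR hα hb i).analyticAt u))

theorem analyticAt_eS (i : Fin n) : AnalyticAt ℝ (fun u => eS hα hb u i) u :=
  analyticAt_uh_add u ((cF hα hb i).analyticAt u) ((cS hα hb i).analyticAt u)

theorem analyticAt_eV0 : AnalyticAt ℝ (fun u => eV0 hα hb u) u :=
  Finset.analyticAt_fun_sum _ fun i _ => ((cP hα hb i).analyticAt u).fun_pow 2

theorem analyticAt_eV1 : AnalyticAt ℝ (fun u => eV1 hα hb u) u :=
  Finset.analyticAt_fun_sum _ fun i _ => analyticAt_uh_mul u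
    (analyticAt_uh_add u (analyticAt_real_smul u _ ((cP hα hb i).analyticAt u))
      (analyticAt_uh_mul u analyticAt_const (analyticAt_eC hα hb u i))) (analyticAt_eC hα hb u i)

theorem analyticAt_eR1 : AnalyticAt ℝ (fun u => eR1 hα hb u) u :=
  Finset.analyticAt_fun_sum _ fun i _ => analyticAt_uh_mul u
    (analyticAt_uh_add u (analyticAt_real_smul u _ ((cP hα hb i).analyticAt u))
      (analyticAt_uh_mul u analyticAt_const (analyticAt_eS hα hb u i))) (analyticAt_eS hα hb u i)

variable {u} {c : ℝ} (hc : 0 < c)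
  (hu : ∀ x w, |w| ≤ 1 / 2 → c * |w| ≤ ‖u.toFun (x + w) - u.toFun x‖)

include hc hu

theorem analyticAt_rpow_eV0 (p : ℝ) : AnalyticAt ℝ (fun u => UH.rpow p (eV0 hα hb u)) u :=
  (UH.analyticAt_rpow (pow_pos hc 2) (le_eV0 hα hb hc hu) p).fun_comp (analyticAt_eV0 hα hb u)

theorem analyticAt_ePow (p q : ℝ) : AnalyticAt ℝ (fun u => ePow hα hb u p q) u :=
  analyticAt_uh_mul u
    ((UH.analyticAt_rpow (pow_pos hc 2) (le_eR hα hb hc hu) p).fun_comp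
      (analyticAt_uh_add u (analyticAt_eV0 hα hb u)
        (analyticAt_uh_mul u analyticAt_const (analyticAt_eR1 hα hb u))))
    ((UH.analyticAt_rpow (pow_pos hc 2) (le_eV hα hb hc hu) q).fun_comp
      (analyticAt_uh_add u (analyticAt_eV0 hα hb u)
        (analyticAt_uh_mul u analyticAt_const (analyticAt_eV1 hα hb u))))

theorem analyticAt_eM (p q : ℝ) : AnalyticAt ℝ (fun u => eM hα hb u p q) u :=
  analyticAt_uh_add u
    (analyticAt_real_smul u _ (analyticAt_uh_mul u (analyticAt_eR1 hα hb u)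
      (analyticAt_ePow hα hb hc hu _ _)))
    (analyticAt_real_smul u _ (analyticAt_uh_mul u (analyticAt_eV1 hα hb u)
      (analyticAt_ePow hα hb hc hu _ _)))

theorem analyticAt_eD (p q : ℝ) : AnalyticAt ℝ (fun u => eD hα hb u p q) u :=
  analyticAt_uh_add u (analyticAt_uh_add u
    (analyticAt_real_smul u _ (analyticAt_uh_mul u ((analyticAt_eR1 hα hb u).fun_pow 2)
      (analyticAt_ePow hα hb hc hu _ _)))
    (analyticAt_real_smul u _ (analyticAt_uh_mul u
      (analyticAt_uh_mul u (analyticAt_eR1 hα hb u) (analyticAt_eV1 hα hb u))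
      (analyticAt_ePow hα hb hc hu _ _))))
    (analyticAt_real_smul u _ (analyticAt_uh_mul u ((analyticAt_eV1 hα hb u).fun_pow 2)
      (analyticAt_ePow hα hb hc hu _ _)))

theorem analyticAt_rpow_eLen (p : ℝ) : AnalyticAt ℝ (fun u => UH.rpow p (eLen hα hb u)) u :=
  (UH.analyticAt_rpow hc (le_eLen hα hb hc hu) p).fun_comp
    (((meanOp hb.1 _).analyticAt _).fun_comp (analyticAt_rpow_eV0 hα hb hc hu _))

theorem analyticAt_eX : AnalyticAt ℝ (fun u => eX hα hb u) u := by
  have hV0 := analyticAt_rpow_eV0 hα hb hc hu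
  refine analyticAt_uh_add u (analyticAt_uh_add u (analyticAt_uh_mul u (hV0 _)
    (analyticAt_uh_sub u (analyticAt_uh_add u ?_ (analyticAt_real_smul u _ ?_))
      (analyticAt_real_smul u _ ?_))) ?_) (analyticAt_real_smul u _ (analyticAt_uh_mul u (hV0 _)
        (analyticAt_uh_sub u (analyticAt_rpow_eLen hα hb hc hu _) (hV0 _))))
  · exact Finset.analyticAt_fun_sum _ fun j _ => analyticAt_uh_mul u ((cP hα hb j).analyticAt u)
      (analyticAt_uh_sub u (analyticAt_real_smul u _ (analyticAt_opS hα hb u j analyticAt_const))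
        (analyticAt_real_smul u _ (analyticAt_opR hα hb u j analyticAt_const)))
  · exact analyticAt_evenOp hα u
      (Finset.analyticAt_fun_sum _ fun j _ => (analyticAt_eS hα hb u j).fun_pow 2)
  · exact analyticAt_evenOp hα u
      (Finset.analyticAt_fun_sum _ fun j _ => (analyticAt_eC hα hb u j).fun_pow 2)
  · exact analyticAt_evenOp hα u (analyticAt_uh_mul u analyticAt_const
      (analyticAt_uh_sub u (analyticAt_real_smul u _ (analyticAt_eD hα hb hc hu _ _))
        (analyticAt_real_smul u _ (analyticAt_uh_mul u (hV0 _)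
          (analyticAt_eD hα hb hc hu _ _)))))

theorem analyticAt_eY (i : Fin n) : AnalyticAt ℝ (fun u => eY hα hb u i) u :=
  analyticAt_uh_add u
    (analyticAt_real_smul u _ (analyticAt_opR hα hb u i (analyticAt_eM hα hb hc hu _ _)))
    (analyticAt_uh_mul u ((cF hα hb i).analyticAt u) (analyticAt_eX hα hb hc hu))

theorem analyticAt_eZ (i : Fin n) : AnalyticAt ℝ (fun u => eZ hα hb u i) u :=
  analyticAt_uh_sub u (analyticAt_eY hα hb hc hu i)
    (analyticAt_uh_mul u (analyticAt_uh_mul u (analyticAt_rpow_eV0 hα hb hc hu _)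
      (Finset.analyticAt_fun_sum _ fun j _ => analyticAt_uh_mul u ((cP hα hb j).analyticAt u)
        (analyticAt_eY hα hb hc hu j))) ((cP hα hb i).analyticAt u))

end Analyticity


/-- Everything in the expression is a bounded linear or bilinear map, a product, or a power of an
element bounded below by the bi-Lipschitz constant. -/
theorem analyticAt_baseMap {u : HolderSpace n (α + b)} (hu : IsBiLip u.toFun) :
    AnalyticAt ℝ (baseMap hα hb (n := n)) u := by
  obtain ⟨c, hc, hu⟩ := hu
  have : AnalyticAt ℝ (fun u => fun i => eZ hα hb u i) u :=
    analyticAt_pi_iff.2 fun i => analyticAt_eZ hα hb hc hu i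
  exact ((toHolder hb _).analyticAt _).fun_comp this

end BaseMap

/-! ### Truncated integrals -/

section Truncation

/-- The domain `[-1/2, 1/2] \ [-ε, ε]` of the truncated integrals. -/
abbrev trunc (ε : ℝ) : Set ℝ := Set.Icc (-(1 / 2) : ℝ) (1 / 2) \ Set.Icc (-ε) ε

theorem trunc_eq {ε : ℝ} (h0 : 0 < ε) :
    trunc ε = Set.Ico (-(1 / 2)) (-ε) ∪ Set.Ioc ε (1 / 2) := by
  ext w
  simp only [Set.mem_sdiff, Set.mem_Icc, Set.mem_union, Set.mem_Ico, Set.mem_Ioc, not_and_or,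
    not_le]
  constructor
  · rintro ⟨⟨h2, h3⟩, h4 | h4⟩
    exacts [Or.inl ⟨h2, h4⟩, Or.inr ⟨h4, h3⟩]
  · rintro (⟨h2, h3⟩ | ⟨h2, h3⟩)
    exacts [⟨⟨h2, by linarith⟩, Or.inl h3⟩, ⟨⟨by linarith, h3⟩, Or.inr h2⟩]

theorem measurableSet_trunc (ε : ℝ) : MeasurableSet (trunc ε) :=
  measurableSet_Icc.diff measurableSet_Icc

theorem abs_pos_of_mem_trunc {ε w : ℝ} (hw : w ∈ trunc ε) : ε < |w| := by
  by_contra! h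
  exact hw.2 (abs_le.1 h)

variable {E : Type*} [NormedAddCommGroup E]

theorem integrableOn_trunc {g : ℝ → E} {ε : ℝ} (h0 : 0 < ε) (h1 : ε < 1 / 2)
    (hl : IntervalIntegrable g volume (-(1 / 2)) (-ε))
    (hr : IntervalIntegrable g volume ε (1 / 2)) : IntegrableOn g (trunc ε) := by
  rw [trunc_eq h0]
  refine IntegrableOn.union ?_ ?_
  · rw [integrableOn_Ico_iff_integrableOn_Ioo, ← integrableOn_Ioc_iff_integrableOn_Ioo]
    exact (intervalIntegrable_iff_integrableOn_Ioc_of_le (by linarith)).1 hl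
  · exact (intervalIntegrable_iff_integrableOn_Ioc_of_le (by linarith)).1 hr

theorem integral_trunc [NormedSpace ℝ E] {g : ℝ → E} {ε : ℝ} (h0 : 0 < ε) (h1 : ε < 1 / 2)
    (hl : IntervalIntegrable g volume (-(1 / 2)) (-ε))
    (hr : IntervalIntegrable g volume ε (1 / 2)) :
    ∫ w in trunc ε, g w = (∫ w in (-(1 / 2))..(-ε), g w) + ∫ w in ε..(1 / 2), g w := by
  have h := integrableOn_trunc h0 h1 hl hr
  rw [trunc_eq h0] at h ⊢
  rw [setIntegral_union ?_ measurableSet_Ioc (h.mono_set Set.subset_union_left)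
    (h.mono_set Set.subset_union_right), integral_Ico_eq_integral_Ioo,
    ← integral_Ioc_eq_integral_Ioo, intervalIntegral.integral_of_le (by linarith),
    intervalIntegral.integral_of_le (by linarith)]
  exact Set.disjoint_left.2 fun w h2 h3 => by linarith [h2.2, h3.1]

theorem integrableOn_trunc_of_continuousOn {g : ℝ → E} {ε : ℝ} (h0 : 0 < ε) (h1 : ε < 1 / 2)
    (hg : ContinuousOn g {0}ᶜ) : IntegrableOn g (trunc ε) := by
  refine integrableOn_trunc h0 h1 ?_ ?_
  · refine (hg.mono fun w hw => ?_).intervalIntegrable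
    rw [Set.uIcc_of_le (by linarith)] at hw
    exact (by linarith [hw.2] : w < 0).ne
  · refine (hg.mono fun w hw => ?_).intervalIntegrable
    rw [Set.uIcc_of_le (by linarith)] at hw
    exact (by linarith [hw.1] : 0 < w).ne'

theorem eventually_trunc : ∀ᶠ ε : ℝ in 𝓝[>] 0, 0 < ε ∧ ε < 1 / 2 := by
  filter_upwards [Ioo_mem_nhdsGT (show (0 : ℝ) < 1 / 2 by norm_num)] with ε hε using hε

theorem integral_trunc_odd {g : ℝ → ℝ} {ε : ℝ} (h0 : 0 < ε) (h1 : ε < 1 / 2)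
    (hg : ContinuousOn g {0}ᶜ) (hodd : ∀ w, g (-w) = -g w) : ∫ w in trunc ε, g w = 0 := by
  have hl : IntervalIntegrable g volume (-(1 / 2)) (-ε) := by
    refine (hg.mono fun w hw => ?_).intervalIntegrable
    rw [Set.uIcc_of_le (by linarith)] at hw
    exact (by linarith [hw.2] : w < 0).ne
  have hr : IntervalIntegrable g volume ε (1 / 2) := by
    refine (hg.mono fun w hw => ?_).intervalIntegrable
    rw [Set.uIcc_of_le (by linarith)] at hw
    exact (by linarith [hw.1] : 0 < w).ne'
  rw [integral_trunc h0 h1 hl hr]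
  have := intervalIntegral.integral_comp_neg (a := ε) (b := 1 / 2) g
  simp only [hodd, intervalIntegral.integral_neg] at this
  rw [← this]
  ring

theorem continuousOn_abs_rpow (p : ℝ) : ContinuousOn (fun w : ℝ => |w| ^ p) {0}ᶜ :=
  continuous_abs.continuousOn.rpow_const fun _ hw => Or.inl (abs_ne_zero.2 hw)

theorem integral_trunc_abs_rpow {α ε : ℝ} (hα : 2 < α) (h0 : 0 < ε) (h1 : ε < 1 / 2) :
    ∫ w in trunc ε, |w| ^ (-α) = 2 * (ε ^ (1 - α) - (1 / 2) ^ (1 - α)) / (α - 1) := by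
  have hr' : ∫ w in ε..(1 / 2), |w| ^ (-α) = (ε ^ (1 - α) - (1 / 2) ^ (1 - α)) / (α - 1) := by
    have h2 : ∫ w in ε..(1 / 2), |w| ^ (-α) = ∫ w in ε..(1 / 2), w ^ (-α) := by
      refine intervalIntegral.integral_congr fun w hw => ?_
      rw [Set.uIcc_of_le h1.le] at hw
      simp only [abs_of_nonneg (h0.le.trans hw.1)]
    rw [h2, integral_rpow (Or.inr ⟨by linarith, by
      rw [Set.uIcc_of_le h1.le]; exact fun h => by linarith [h.1]⟩),
      show -α + 1 = -(α - 1) by ring, show 1 - α = -(α - 1) by ring, div_neg, ← neg_div, neg_sub]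
  have hl' : ∫ w in (-(1 / 2))..(-ε), |w| ^ (-α) = ∫ w in ε..(1 / 2), |w| ^ (-α) := by
    have := intervalIntegral.integral_comp_neg (a := ε) (b := 1 / 2) (fun w : ℝ => |w| ^ (-α))
    simp only [abs_neg] at this
    exact this.symm
  have hg := continuousOn_abs_rpow (-α)
  rw [integral_trunc h0 h1 _ _, hl', hr']
  · ring
  · refine (hg.mono fun w hw => ?_).intervalIntegrable
    rw [Set.uIcc_of_le (by linarith)] at hw
    exact (by linarith [hw.2] : w < 0).ne
  · refine (hg.mono fun w hw => ?_).intervalIntegrable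
    rw [Set.uIcc_of_le (by linarith)] at hw
    exact (by linarith [hw.1] : 0 < w).ne'

end Truncation

/-! ### Arc length and the distance along the curve -/

section ArcLength

variable {n : ℕ}

/-- The sum is at least `2|p|` by the triangle inequality. With `a = |p+f|`, `b = |p-f|`, `P = |p|`,
the parallelogram law and `(a-P)² + (b-P)² ≥ 0` give `a + b - 2P ≤ |f|²/P`. The terms linear in `f`
cancel, which is the point. -/
theorem norm_add_norm_sub_le {p f : Eucl n} (hp : p ≠ 0) :
    |‖p + f‖ + ‖p - f‖ - 2 * ‖p‖| ≤ ‖f‖ ^ 2 / ‖p‖ := by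
  have hP : 0 < ‖p‖ := norm_pos_iff.2 hp
  have h1 : 2 * ‖p‖ ≤ ‖p + f‖ + ‖p - f‖ := by
    have := norm_add_le (p + f) (p - f)
    rw [show p + f + (p - f) = (2 : ℝ) • p by module, norm_smul] at this
    simpa using this
  have h2 := norm_add_sq_real p f
  have h3 := norm_sub_sq_real p f
  rw [abs_of_nonneg (by linarith), le_div_iff₀ hP]
  nlinarith [sq_nonneg (‖p + f‖ - ‖p‖), sq_nonneg (‖p - f‖ - ‖p‖)]

theorem abs_rpow_taylor_le {P z q : ℝ} (hP : 0 < P) (hz : |z - P| ≤ P / 2) :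
    |z ^ q - P ^ q - q * P ^ (q - 1) * (z - P)| ≤
      |q| * (|q - 1| * ((P / 2) ^ (q - 1 - 1) + (2 * P) ^ (q - 1 - 1))) * |z - P| ^ 2 := by
  have hz' := abs_le.1 hz
  have hsub : ∀ y ∈ Set.uIcc P z, |y - P| ≤ |z - P| := fun y hy => Set.abs_sub_left_of_mem_uIcc hy
  have hmem : ∀ y ∈ Set.uIcc P z, y ∈ Set.Icc (P / 2) (2 * P) := fun y hy => by
    have := abs_le.1 ((hsub y hy).trans hz)
    constructor <;> linarith [this.1, this.2]
  have hder : ∀ y ∈ Set.uIcc P z, HasDerivWithinAt (fun y => y ^ q - q * P ^ (q - 1) * y)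
      (q * y ^ (q - 1) - q * P ^ (q - 1)) (Set.uIcc P z) y := fun y hy => by
    have h1 := Real.hasDerivAt_rpow_const (x := y) (p := q)
      (Or.inl (by have := (hmem y hy).1; exact (by linarith : (0:ℝ) < y).ne'))
    exact (h1.sub (by simpa using (hasDerivAt_id y).const_mul (q * P ^ (q - 1)))).hasDerivWithinAt
  have := Convex.norm_image_sub_le_of_norm_hasDerivWithin_le (s := Set.uIcc P z)
    (C := |q| * (|q - 1| * ((P / 2) ^ (q - 1 - 1) + (2 * P) ^ (q - 1 - 1))) * |z - P|) hder
    (fun y hy => ?_) (convex_uIcc _ _) Set.left_mem_uIcc Set.right_mem_uIcc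
  · rw [Real.norm_eq_abs, Real.norm_eq_abs] at this
    rw [pow_two, ← mul_assoc]
    refine le_trans (le_of_eq ?_) this
    congr 1; ring
  · rw [← mul_sub, Real.norm_eq_abs, abs_mul, mul_assoc |q|]
    gcongr
    refine (Real.abs_rpow_sub_rpow_le (p := q - 1) (by positivity) (hmem y hy)
      (hmem P Set.left_mem_uIcc)).trans ?_
    gcongr ?_ * ?_
    exact hsub y hy

variable {γ : ℝ → Eucl n} {α η N : ℝ}

/-- Arc length from the point of parameter `x`. -/
noncomputable def arcLen (γ : ℝ → Eucl n) (x w : ℝ) : ℝ := ∫ v in (0 : ℝ)..w, ‖deriv γ (x + v)‖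

theorem hasDerivAt_arcLen (hγ : ContDiff ℝ 1 γ) (x w : ℝ) :
    HasDerivAt (arcLen γ x) ‖deriv γ (x + w)‖ w := by
  have hc : Continuous fun v => ‖deriv γ (x + v)‖ :=
    ((hγ.continuous_deriv le_rfl).comp (continuous_const.add continuous_id)).norm
  exact intervalIntegral.integral_hasDerivAt_right (hc.intervalIntegrable _ _)
    (hc.stronglyMeasurableAtFilter _ _) hc.continuousAt

theorem continuous_arcLen (hγ : ContDiff ℝ 1 γ) (x : ℝ) : Continuous (arcLen γ x) :=
  continuous_iff_continuousAt.2 fun w => (hasDerivAt_arcLen hγ x w).continuousAt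

theorem strictMono_arcLen (hγ : ContDiff ℝ 1 γ) (hreg : ∀ x, deriv γ x ≠ 0) (x : ℝ) :
    StrictMono (arcLen γ x) :=
  strictMono_of_hasDerivAt_pos (fun w => hasDerivAt_arcLen hγ x w)
    fun _ => norm_pos_iff.2 (hreg _)

theorem arcLen_zero (x : ℝ) : arcLen γ x 0 = 0 := by simp [arcLen]

theorem integral_norm_deriv (hγ : ContDiff ℝ 1 γ) (x a b : ℝ) :
    ∫ t in (x + a)..(x + b), ‖deriv γ t‖ = arcLen γ x b - arcLen γ x a := by
  have hc : Continuous fun v => ‖deriv γ (x + v)‖ :=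
    ((hγ.continuous_deriv le_rfl).comp (continuous_const.add continuous_id)).norm
  rw [arcLen, arcLen, intervalIntegral.integral_interval_sub_left (hc.intervalIntegrable _ _)
    (hc.intervalIntegrable _ _)]
  exact (intervalIntegral.integral_comp_add_left (fun t => ‖deriv γ t‖) x).symm

theorem arcLen_one (hγ : ContDiff ℝ 1 γ) (hp : Function.Periodic γ 1) (x : ℝ) :
    arcLen γ x 1 = ∫ t in (0 : ℝ)..1, ‖deriv γ t‖ := by
  have h := integral_norm_deriv hγ x 0 1
  have hper : Function.Periodic (fun t => ‖deriv γ t‖) 1 := fun t => by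
    simp only [periodic_deriv_of_periodic hp t]
  rw [arcLen_zero, sub_zero, add_zero] at h
  rw [← h, hper.intervalIntegral_add_eq x 0, zero_add]

theorem arcLen_add_one (hγ : ContDiff ℝ 1 γ) (hp : Function.Periodic γ 1) (x w : ℝ) :
    arcLen γ x (w + 1) = arcLen γ x w + ∫ t in (0 : ℝ)..1, ‖deriv γ t‖ := by
  have h := integral_norm_deriv hγ x w (w + 1)
  have hper : Function.Periodic (fun t => ‖deriv γ t‖) 1 := fun t => by
    simp only [periodic_deriv_of_periodic hp t]
  rw [← add_assoc, hper.intervalIntegral_add_eq (x + w) 0, zero_add] at h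
  linarith

theorem arcDist_of_pos (hγ : ContDiff ℝ 1 γ) (hp : Function.Periodic γ 1) (x : ℝ) {w : ℝ}
    (hw : w ∈ Set.Ioo (0 : ℝ) 1) :
    arcDist γ (x + w) x = min (arcLen γ x w)
      ((∫ t in (0 : ℝ)..1, ‖deriv γ t‖) - arcLen γ x w) := by
  have hf : Int.fract (x - (x + w)) = 1 - w := by
    rw [Int.fract_eq_iff]
    exact ⟨by linarith [hw.2], by linarith [hw.1], -1, by push_cast; ring⟩
  rw [arcDist, hf, add_assoc, integral_norm_deriv hγ, add_sub_cancel, arcLen_one hγ hp, min_comm]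
  congr 1
  ring

/-- For negative `w` the point of parameter `x + w` is reached from `x` after the arc up to `w + 1`;
this places both signs of `w` on one period `(0, 1)`. -/
theorem arcDist_of_neg (hγ : ContDiff ℝ 1 γ) (hp : Function.Periodic γ 1) (x : ℝ) {w : ℝ}
    (hw : w ∈ Set.Ioo (-1 : ℝ) 0) :
    arcDist γ (x + w) x = min (arcLen γ x (w + 1))
      ((∫ t in (0 : ℝ)..1, ‖deriv γ t‖) - arcLen γ x (w + 1)) := by
  have hf : Int.fract (x - (x + w)) = -w := by
    rw [Int.fract_eq_iff]
    exact ⟨by linarith [hw.2], by linarith [hw.1], 0, by push_cast; ring⟩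
  rw [arcDist, hf, add_assoc, integral_norm_deriv hγ, add_neg_cancel, arcLen_zero,
    arcLen_add_one hγ hp, min_comm]
  congr 1 <;> ring

end ArcLength

/-! ### The arc distance integral in the arc length variable -/

section ArcDistance

variable {n : ℕ} {γ : ℝ → Eucl n} {α : ℝ}

theorem integral_rpow_neg {α a b : ℝ} (hα : 1 < α) (ha : 0 < a) (hb : 0 < b) :
    ∫ s in a..b, s ^ (-α) = (a ^ (1 - α) - b ^ (1 - α)) / (α - 1) := by
  rw [integral_rpow (Or.inr ⟨by linarith, Set.notMem_uIcc_of_lt ha hb⟩), show -α + 1 = -(α - 1) by ring, show 1 - α = -(α - 1) by ring,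
    div_neg, ← neg_div, neg_sub]

theorem continuousOn_min_rpow {L : ℝ} :
    ContinuousOn (fun s : ℝ => (min s (L - s)) ^ (-α)) (Set.Ioo 0 L) := by
  refine ContinuousOn.rpow_const (by fun_prop) fun s hs => Or.inl ?_
  exact (lt_min hs.1 (by linarith [hs.2])).ne'

/-- The minimum switches branches at `L / 2`. Each half is an elementary power integral, and the
midpoint contributes the term with `(L / 2)^{1-α}` twice. -/
theorem integral_min_rpow {L a b : ℝ} (hα : 1 < α) (ha : 0 < a) (haL : a ≤ L / 2)
    (hb : L / 2 ≤ b) (hbL : b < L) :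
    ∫ s in a..b, (min s (L - s)) ^ (-α) =
      (a ^ (1 - α) + (L - b) ^ (1 - α) - 2 * (L / 2) ^ (1 - α)) / (α - 1) := by
  have hi : ∀ c d, c ∈ Set.Ioo 0 L → d ∈ Set.Ioo 0 L →
      IntervalIntegrable (fun s : ℝ => (min s (L - s)) ^ (-α)) volume c d := fun c d hc hd =>
    (continuousOn_min_rpow.mono fun s hs => ⟨(lt_min hc.1 hd.1).trans_le hs.1,
      hs.2.trans_lt (max_lt hc.2 hd.2)⟩).intervalIntegrable
  have hL : 0 < L := by linarith
  have hm : L / 2 ∈ Set.Ioo 0 L := ⟨by linarith, by linarith⟩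
  rw [← intervalIntegral.integral_add_adjacent_intervals (hi a (L / 2) ⟨ha, by linarith⟩ hm)
    (hi (L / 2) b hm ⟨by linarith, hbL⟩)]
  have h1 : ∫ s in a..(L / 2), (min s (L - s)) ^ (-α) = ∫ s in a..(L / 2), s ^ (-α) := by
    refine intervalIntegral.integral_congr fun s hs => ?_
    rw [Set.uIcc_of_le haL] at hs
    simp only [min_eq_left (show s ≤ L - s by linarith [hs.2])]
  have h2 : ∫ s in (L / 2)..b, (min s (L - s)) ^ (-α) = ∫ s in (L / 2)..b, (L - s) ^ (-α) := by
    refine intervalIntegral.integral_congr fun s hs => ?_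
    rw [Set.uIcc_of_le hb] at hs
    simp only [min_eq_right (show L - s ≤ s by linarith [hs.1])]
  rw [h1, h2, intervalIntegral.integral_comp_sub_left (fun s => s ^ (-α)) L,
    integral_rpow_neg hα ha (by linarith), integral_rpow_neg hα (by linarith) (by linarith),
    show L - L / 2 = L / 2 by ring]
  ring

variable (hγ : ContDiff ℝ 1 γ) (hp : Function.Periodic γ 1) (hreg : ∀ x, deriv γ x ≠ 0)

include hγ hp hreg

theorem arcLen_mem_Ioo (x : ℝ) {w : ℝ} (hw : w ∈ Set.Ioo (0 : ℝ) 1) :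
    arcLen γ x w ∈ Set.Ioo 0 (∫ t in (0 : ℝ)..1, ‖deriv γ t‖) := by
  rw [← arcLen_one hγ hp x, ← arcLen_zero (γ := γ) x]
  exact ⟨strictMono_arcLen hγ hreg x hw.1, strictMono_arcLen hγ hreg x hw.2⟩

omit hp hreg in
theorem continuous_norm_deriv_add (x : ℝ) : Continuous fun w => ‖deriv γ (x + w)‖ :=
  ((hγ.continuous_deriv le_rfl).comp (continuous_const.add continuous_id)).norm

theorem continuousOn_min_arcLen (x : ℝ) :
    ContinuousOn (fun w => (min (arcLen γ x w)
      ((∫ t in (0 : ℝ)..1, ‖deriv γ t‖) - arcLen γ x w)) ^ (-α) * ‖deriv γ (x + w)‖)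
      (Set.Ioo 0 1) :=
  (continuousOn_min_rpow.comp (continuous_arcLen hγ x).continuousOn fun _ hw =>
    arcLen_mem_Ioo hγ hp hreg x hw).mul (continuous_norm_deriv_add hγ x).continuousOn

theorem intervalIntegrable_min_arcLen (x : ℝ) {a b : ℝ} (ha : a ∈ Set.Ioo (0 : ℝ) 1)
    (hb : b ∈ Set.Ioo (0 : ℝ) 1) :
    IntervalIntegrable (fun w => (min (arcLen γ x w)
      ((∫ t in (0 : ℝ)..1, ‖deriv γ t‖) - arcLen γ x w)) ^ (-α) * ‖deriv γ (x + w)‖) volume a b :=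
  ((continuousOn_min_arcLen hγ hp hreg x).mono fun _ hw => ⟨(lt_min ha.1 hb.1).trans_le hw.1,
    hw.2.trans_lt (max_lt ha.2 hb.2)⟩).intervalIntegrable

theorem integral_min_arcLen (x : ℝ) {a b : ℝ} (ha : a ∈ Set.Ioo (0 : ℝ) 1)
    (hb : b ∈ Set.Ioo (0 : ℝ) 1) :
    ∫ w in a..b, (min (arcLen γ x w)
      ((∫ t in (0 : ℝ)..1, ‖deriv γ t‖) - arcLen γ x w)) ^ (-α) * ‖deriv γ (x + w)‖ =
    ∫ s in (arcLen γ x a)..(arcLen γ x b),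
      (min s ((∫ t in (0 : ℝ)..1, ‖deriv γ t‖) - s)) ^ (-α) := by
  have hsub : Set.uIcc a b ⊆ Set.Ioo 0 1 := fun w hw => ⟨(lt_min ha.1 hb.1).trans_le hw.1,
    hw.2.trans_lt (max_lt ha.2 hb.2)⟩
  refine intervalIntegral.integral_comp_mul_deriv''
    (g := fun s => (min s ((∫ t in (0 : ℝ)..1, ‖deriv γ t‖) - s)) ^ (-α))
    (continuous_arcLen hγ x).continuousOn
    (fun w _ => (hasDerivAt_arcLen hγ x w).hasDerivWithinAt)
    (continuous_norm_deriv_add hγ x).continuousOn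
    (continuousOn_min_rpow.mono ?_)
  rintro _ ⟨w, hw, rfl⟩
  exact arcLen_mem_Ioo hγ hp hreg x (hsub hw)

omit hreg in
theorem arcDist_integrand_pos (x : ℝ) {w : ℝ} (hw : w ∈ Set.Ioo (0 : ℝ) 1) :
    ‖deriv γ (x + w)‖ * (arcDist γ (x + w) x) ^ (-α) = (min (arcLen γ x w)
      ((∫ t in (0 : ℝ)..1, ‖deriv γ t‖) - arcLen γ x w)) ^ (-α) * ‖deriv γ (x + w)‖ := by
  rw [arcDist_of_pos hγ hp x hw, mul_comm]

omit hreg in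
theorem arcDist_integrand_neg (x : ℝ) {w : ℝ} (hw : w ∈ Set.Ioo (-1 : ℝ) 0) :
    ‖deriv γ (x + w)‖ * (arcDist γ (x + w) x) ^ (-α) = (min (arcLen γ x (w + 1))
      ((∫ t in (0 : ℝ)..1, ‖deriv γ t‖) - arcLen γ x (w + 1))) ^ (-α) *
        ‖deriv γ (x + (w + 1))‖ := by
  rw [arcDist_of_neg hγ hp x hw, mul_comm, ← add_assoc, periodic_deriv_of_periodic hp]

theorem intervalIntegrable_arcDist (x : ℝ) {ε : ℝ} (h0 : 0 < ε) (h1 : ε < 1 / 2) :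
    IntervalIntegrable (fun w => ‖deriv γ (x + w)‖ * (arcDist γ (x + w) x) ^ (-α)) volume
      (-(1 / 2)) (-ε) ∧
    IntervalIntegrable (fun w => ‖deriv γ (x + w)‖ * (arcDist γ (x + w) x) ^ (-α)) volume
      ε (1 / 2) := by
  constructor
  · have := (intervalIntegrable_min_arcLen (α := α) hγ hp hreg x (a := 1 / 2) (b := 1 - ε)
      ⟨by norm_num, by norm_num⟩ ⟨by linarith, by linarith⟩).comp_add_right 1
    rw [show (1 / 2 : ℝ) - 1 = -(1 / 2) by norm_num, show 1 - ε - 1 = -ε by ring] at this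
    refine this.congr fun w hw => ?_
    rw [Set.uIoc_of_le (by linarith)] at hw
    exact (arcDist_integrand_neg hγ hp x ⟨by linarith [hw.1], by linarith [hw.2]⟩).symm
  · refine (intervalIntegrable_min_arcLen (α := α) hγ hp hreg x (a := ε) (b := 1 / 2)
      ⟨by linarith, by linarith⟩ ⟨by norm_num, by norm_num⟩).congr fun w hw => ?_
    rw [Set.uIoc_of_le (by linarith)] at hw
    exact (arcDist_integrand_pos hγ hp x ⟨by linarith [hw.1], by linarith [hw.2]⟩).symm

theorem integrableOn_trunc_arcDist (x : ℝ) {ε : ℝ} (h0 : 0 < ε) (h1 : ε < 1 / 2) :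
    IntegrableOn (fun w => ‖deriv γ (x + w)‖ * (arcDist γ (x + w) x) ^ (-α)) (trunc ε) :=
  have h := intervalIntegrable_arcDist (α := α) hγ hp hreg x h0 h1
  integrableOn_trunc h0 h1 h.1 h.2

/-- Moving the negative half by one period turns the truncated interval into `[ε, 1 - ε]`, where the
distance along the curve is a function of arc length alone; then arc length becomes the variable of
integration. -/
theorem integral_trunc_arcDist (x : ℝ) {ε : ℝ} (h0 : 0 < ε) (h1 : ε < 1 / 2) :
    ∫ w in trunc ε, ‖deriv γ (x + w)‖ * (arcDist γ (x + w) x) ^ (-α) =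
      ∫ s in (arcLen γ x ε)..((∫ t in (0 : ℝ)..1, ‖deriv γ t‖) + arcLen γ x (-ε)),
        (min s ((∫ t in (0 : ℝ)..1, ‖deriv γ t‖) - s)) ^ (-α) := by
  have h := intervalIntegrable_arcDist (α := α) hγ hp hreg x h0 h1
  have hm : (1 / 2 : ℝ) ∈ Set.Ioo (0 : ℝ) 1 := ⟨by norm_num, by norm_num⟩
  have he : ε ∈ Set.Ioo (0 : ℝ) 1 := ⟨by linarith, by linarith⟩
  have he' : 1 - ε ∈ Set.Ioo (0 : ℝ) 1 := ⟨by linarith, by linarith⟩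
  set G := fun w => (min (arcLen γ x w)
      ((∫ t in (0 : ℝ)..1, ‖deriv γ t‖) - arcLen γ x w)) ^ (-α) * ‖deriv γ (x + w)‖ with hG
  have hl : ∫ w in (-(1 / 2))..(-ε), ‖deriv γ (x + w)‖ * (arcDist γ (x + w) x) ^ (-α) =
      ∫ w in (1 / 2)..(1 - ε), G w := by
    have h2 := intervalIntegral.integral_comp_add_right (a := -(1 / 2)) (b := -ε) G 1
    rw [show -(1 / 2 : ℝ) + 1 = 1 / 2 by norm_num, show -ε + 1 = 1 - ε by ring] at h2
    rw [← h2]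
    refine intervalIntegral.integral_congr fun w hw => ?_
    rw [Set.uIcc_of_le (by linarith)] at hw
    exact arcDist_integrand_neg hγ hp x ⟨by linarith [hw.1], by linarith [hw.2]⟩
  have hr : ∫ w in ε..(1 / 2), ‖deriv γ (x + w)‖ * (arcDist γ (x + w) x) ^ (-α) =
      ∫ w in ε..(1 / 2), G w := by
    refine intervalIntegral.integral_congr fun w hw => ?_
    rw [Set.uIcc_of_le h1.le] at hw
    exact arcDist_integrand_pos hγ hp x ⟨by linarith [hw.1], by linarith [hw.2]⟩
  rw [integral_trunc h0 h1 h.1 h.2, hl, hr, add_comm,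
    intervalIntegral.integral_add_adjacent_intervals
      (intervalIntegrable_min_arcLen hγ hp hreg x he hm)
      (intervalIntegrable_min_arcLen hγ hp hreg x hm he'),
    integral_min_arcLen hγ hp hreg x he he', show 1 - ε = -ε + 1 by ring,
    arcLen_add_one hγ hp, add_comm (arcLen γ x (-ε))]

end ArcDistance

/-! ### The limit of the arc length term -/

section Asymptotics

variable {n : ℕ} {γ : ℝ → Eucl n} {α η N : ℝ}

theorem abs_arcLen_sub_le {M : ℝ} (hγ : ContDiff ℝ 2 γ) (hM : ∀ y, ‖iteratedDeriv 2 γ y‖ ≤ M)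
    (x w : ℝ) : |arcLen γ x w - w * ‖deriv γ x‖| ≤ M * |w| * |w| := by
  have hc := continuous_norm_deriv_add' hγ x
  have h1 : arcLen γ x w - w * ‖deriv γ x‖ =
      ∫ v in (0 : ℝ)..w, (‖deriv γ (x + v)‖ - ‖deriv γ x‖) := by
    rw [intervalIntegral.integral_sub (hc.intervalIntegrable _ _) (by simp),
      intervalIntegral.integral_const, arcLen, sub_zero, smul_eq_mul]
  rw [h1, ← Real.norm_eq_abs]
  have := intervalIntegral.norm_integral_le_of_norm_le_const (a := 0) (b := w) (C := M * |w|)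
    (f := fun v => ‖deriv γ (x + v)‖ - ‖deriv γ x‖) fun v hv => ?_
  · simpa using this
  · refine (abs_norm_sub_norm_le _ _).trans ?_
    have h2 := Convex.norm_image_sub_le_of_norm_hasDerivWithin_le (s := Set.univ) (C := M)
      (fun z _ => (hasDerivAt_deriv_of_contDiff_two hγ z).hasDerivWithinAt) (fun z _ => hM z)
      convex_univ (Set.mem_univ x) (Set.mem_univ (x + v))
    rw [add_sub_cancel_left] at h2
    refine h2.trans (mul_le_mul_of_nonneg_left ?_ ((norm_nonneg _).trans (hM x)))
    have := Set.abs_sub_left_of_mem_uIcc (Set.uIoc_subset_uIcc hv)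
    simpa using this
where continuous_norm_deriv_add' {γ : ℝ → Eucl n} (hγ : ContDiff ℝ 2 γ) (x : ℝ) :
    Continuous fun w => ‖deriv γ (x + w)‖ :=
  ((hγ.continuous_deriv (by norm_num)).comp (continuous_const.add continuous_id)).norm

/-- The speeds at `v` and `-v` are `|γ' ± v γ''|` up to `N v^{1+η}`, and the terms of first order
cancel in their sum. Quadratic terms are absorbed into `v^{1+η}` because `v ≤ 1` and `η ≤ 1`. -/
theorem abs_arcLen_sub_arcLen_neg_le {M : ℝ} (hγ : ContDiff ℝ 2 γ)
    (hM : ∀ y, ‖iteratedDeriv 2 γ y‖ ≤ M) (hη : 0 < η) (hη1 : η ≤ 1)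
    (hN : ∀ y z, ‖iteratedDeriv 2 γ y - iteratedDeriv 2 γ z‖ ≤ N * |y - z| ^ η)
    {x ε : ℝ} (hx : deriv γ x ≠ 0) (h0 : 0 < ε) (h1 : ε < 1 / 2) :
    |arcLen γ x ε - arcLen γ x (-ε) - 2 * ε * ‖deriv γ x‖| ≤
      (M ^ 2 / ‖deriv γ x‖ + 2 * N) * ε ^ (1 + η) * ε := by
  set p := deriv γ x
  set f := iteratedDeriv 2 γ x
  have hP : 0 < ‖p‖ := norm_pos_iff.2 hx
  have hN0 : 0 ≤ N := by
    have := (norm_nonneg _).trans (hN 1 0)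
    simpa using this
  have hc := abs_arcLen_sub_le.continuous_norm_deriv_add' hγ x
  have hc' : Continuous fun v => ‖deriv γ (x + -v)‖ := hc.comp continuous_neg
  have h2 : arcLen γ x ε - arcLen γ x (-ε) - 2 * ε * ‖p‖ =
      ∫ v in (0 : ℝ)..ε, (‖deriv γ (x + v)‖ + ‖deriv γ (x + -v)‖ - 2 * ‖p‖) := by
    have h3 := intervalIntegral.integral_comp_neg (a := 0) (b := ε) fun v => ‖deriv γ (x + v)‖
    rw [intervalIntegral.integral_sub ((hc.fun_add hc').intervalIntegrable _ _)
        intervalIntegrable_const, intervalIntegral.integral_add (hc.intervalIntegrable _ _) (hc'.intervalIntegrable _ _),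
      intervalIntegral.integral_const, h3, neg_zero, arcLen, arcLen,
      intervalIntegral.integral_symm (-ε), sub_zero, smul_eq_mul]
    ring
  rw [h2, ← Real.norm_eq_abs]
  have := intervalIntegral.norm_integral_le_of_norm_le_const (a := 0) (b := ε)
    (C := (M ^ 2 / ‖p‖ + 2 * N) * ε ^ (1 + η))
    (f := fun v => ‖deriv γ (x + v)‖ + ‖deriv γ (x + -v)‖ - 2 * ‖p‖) fun v hv => ?_
  · rwa [sub_zero, abs_of_pos h0] at this
  rw [Set.uIoc_of_le h0.le] at hv
  -- First order Taylor expansion of `γ'`, with the oscillation of `γ''` between `x` and `x + v`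
  -- bounded by `N |v|^η`.
  have hstep : ∀ v : ℝ, |‖deriv γ (x + v)‖ - ‖p + v • f‖| ≤ N * |v| ^ (1 + η) := fun v => by
    rcases eq_or_ne v 0 with rfl | hv0
    · simp [p, Real.zero_rpow (by linarith : (1 + η) ≠ 0)]
    refine (abs_norm_sub_norm_le _ _).trans ?_
    have h4 := norm_taylor_deriv_le hγ (x := x) (w := v) (M := N * |v| ^ η) (fun z hz => ?_)
      (x + v) Set.right_mem_uIcc
    · rw [add_sub_cancel_left] at h4
      rw [← sub_sub, Real.rpow_add (abs_pos.2 hv0), Real.rpow_one]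
      exact h4.trans (le_of_eq (by ring))
    · refine (hN z x).trans ?_
      have := Set.abs_sub_left_of_mem_uIcc hz
      rw [add_sub_cancel_left] at this
      exact mul_le_mul_of_nonneg_left (Real.rpow_le_rpow (abs_nonneg _) this hη.le) hN0
  have h5 := hstep v
  have h6 := hstep (-v)
  rw [abs_neg, abs_of_pos hv.1, neg_smul, ← sub_eq_add_neg p] at h6
  rw [abs_of_pos hv.1] at h5
  have h7 := norm_add_norm_sub_le (p := p) (f := v • f) hx
  have h8 : ‖v • f‖ ^ 2 / ‖p‖ ≤ M ^ 2 / ‖p‖ * v ^ (1 + η) := by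
    rw [norm_smul, mul_pow, Real.norm_eq_abs, abs_of_pos hv.1, div_mul_eq_mul_div, mul_comm]
    gcongr
    · exact hM x
    · rw [← Real.rpow_two]
      exact Real.rpow_le_rpow_of_exponent_ge hv.1 (by linarith [hv.2]) (by linarith)
  have h9 : v ^ (1 + η) ≤ ε ^ (1 + η) := Real.rpow_le_rpow hv.1.le hv.2 (by linarith)
  have h10 : (M ^ 2 / ‖p‖ + 2 * N) * v ^ (1 + η) ≤ (M ^ 2 / ‖p‖ + 2 * N) * ε ^ (1 + η) :=
    mul_le_mul_of_nonneg_left h9 (by positivity)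
  rw [Real.norm_eq_abs]
  refine abs_le.2 ⟨?_, ?_⟩ <;>
  linarith [abs_le.1 h5 |>.1, abs_le.1 h5 |>.2, abs_le.1 h6 |>.1, abs_le.1 h6 |>.2,
    abs_le.1 h7 |>.1, abs_le.1 h7 |>.2]

/-- The asymptotic cancellation of the two ends of the arc length integral. -/
theorem tendsto_arcLen_rpow {M : ℝ} (hα : α ∈ Set.Ioo (2 : ℝ) 3) (hγ : ContDiff ℝ 2 γ)
    (hM : ∀ y, ‖iteratedDeriv 2 γ y‖ ≤ M) (hη : α - 2 < η) (hη1 : η ≤ 1)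
    (hN : ∀ y z, ‖iteratedDeriv 2 γ y - iteratedDeriv 2 γ z‖ ≤ N * |y - z| ^ η)
    (hreg : ∀ x, deriv γ x ≠ 0) (x : ℝ) :
    Tendsto (fun ε => arcLen γ x ε ^ (1 - α) + (-arcLen γ x (-ε)) ^ (1 - α)
      - 2 * ‖deriv γ x‖ ^ (1 - α) * ε ^ (1 - α)) (𝓝[>] 0) (𝓝 0) := by
  set P := ‖deriv γ x‖ with hPdef
  have hP : 0 < P := norm_pos_iff.2 (hreg x)
  have hM0 : 0 ≤ M := (norm_nonneg _).trans (hM x)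
  have hN0 : 0 ≤ N := by
    have := (norm_nonneg _).trans (hN 1 0)
    simpa using this
  set q := 1 - α with hq
  set K := |q| * (|q - 1| * ((P / 2) ^ (q - 1 - 1) + (2 * P) ^ (q - 1 - 1))) with hK
  have hK0 : 0 ≤ K := by positivity
  -- The first summand comes from the linear Taylor term of `z^q` at `P`, where only the symmetric
  -- combination `a + b - 2P` enters; the second from the two quadratic errors with the constant
  -- `K`.
  set C := |q| * P ^ (q - 1) * (M ^ 2 / P + 2 * N) + 2 * (K * M ^ 2) with hC
  have hlim : Tendsto (fun ε : ℝ => C * ε ^ (2 - α + η)) (𝓝[>] 0) (𝓝 0) := by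
    have h1 : Tendsto (fun ε : ℝ => C * ε ^ (2 - α + η)) (𝓝 0) (𝓝 (C * 0 ^ (2 - α + η))) :=
      ((Real.continuousAt_rpow_const 0 _ (Or.inr (by linarith))).tendsto).const_mul C
    rw [Real.zero_rpow (by linarith), mul_zero] at h1
    exact h1.mono_left nhdsWithin_le_nhds
  refine squeeze_zero_norm' ?_ hlim
  have hsmall : ∀ᶠ ε : ℝ in 𝓝[>] 0, M * ε < P / 2 := by
    have : Tendsto (fun ε : ℝ => M * ε) (𝓝[>] 0) (𝓝 (M * 0)) :=
      (tendsto_id.const_mul M).mono_left nhdsWithin_le_nhds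
    rw [mul_zero] at this
    exact this.eventually_lt_const (by positivity)
  filter_upwards [eventually_trunc, hsmall] with ε ⟨h0, h1⟩ h2
  have ha := abs_arcLen_sub_le hγ hM x ε
  have hb := abs_arcLen_sub_le hγ hM x (-ε)
  have hab := abs_arcLen_sub_arcLen_neg_le hγ hM (by linarith [hα.1]) hη1 hN (hreg x) h0 h1
  rw [← hPdef] at ha hb hab
  rw [abs_neg] at hb
  rw [abs_of_pos h0] at ha hb
  set A := arcLen γ x ε
  set B := arcLen γ x (-ε)
  -- Rescaling: `a` and `b` are mean speeds over the two halves, both within `M ε` of `P`. A factor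
  -- `ε^{1-α}` comes out, against which `a^q + b^q - 2P^q = O(ε^{1+η})` wins since `2 - α + η > 0`.
  obtain ⟨a, hAa⟩ : ∃ a, A = ε * a := ⟨A / ε, by field_simp⟩
  obtain ⟨b, hBb⟩ : ∃ b, -B = ε * b := ⟨-B / ε, by field_simp⟩
  have ha' : |a - P| ≤ M * ε := by
    rw [hAa, ← mul_sub, abs_mul, abs_of_pos h0, mul_comm] at ha
    exact le_of_mul_le_mul_right ha h0
  have hb' : |b - P| ≤ M * ε := by
    rw [show B - -ε * P = -(ε * (b - P)) by rw [mul_sub, ← hBb]; ring, abs_neg, abs_mul,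
      abs_of_pos h0, mul_comm] at hb
    exact le_of_mul_le_mul_right hb h0
  have hab' : |a + b - 2 * P| ≤ (M ^ 2 / P + 2 * N) * ε ^ (1 + η) := by
    rw [show A - B - 2 * ε * P = ε * (a + b - 2 * P) by
      rw [sub_eq_add_neg A B, hAa, hBb]; ring, abs_mul, abs_of_pos h0, mul_comm] at hab
    exact le_of_mul_le_mul_right hab h0
  have ha0 : 0 < a := by linarith [(abs_le.1 ha').1]
  have hb0 : 0 < b := by linarith [(abs_le.1 hb').1]
  have hta := abs_rpow_taylor_le (q := q) hP (ha'.trans h2.le)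
  have htb := abs_rpow_taylor_le (q := q) hP (hb'.trans h2.le)
  rw [← hK] at hta htb
  have hsq : ∀ y : ℝ, |y| ≤ M * ε → K * |y| ^ 2 ≤ K * M ^ 2 * ε ^ (1 + η) := fun y hy => by
    rw [mul_assoc K (M ^ 2)]
    refine mul_le_mul_of_nonneg_left ?_ hK0
    calc |y| ^ 2 ≤ (M * ε) ^ 2 := by gcongr
      _ = M ^ 2 * ε ^ (2 : ℝ) := by rw [mul_pow, Real.rpow_two]
      _ ≤ M ^ 2 * ε ^ (1 + η) := mul_le_mul_of_nonneg_left
        (Real.rpow_le_rpow_of_exponent_ge h0 (by linarith) (by linarith)) (sq_nonneg _)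
  have hmain : |a ^ q + b ^ q - 2 * P ^ q| ≤ C * ε ^ (1 + η) := by
    have e1 : |q * P ^ (q - 1) * (a + b - 2 * P)| ≤
        |q| * P ^ (q - 1) * ((M ^ 2 / P + 2 * N) * ε ^ (1 + η)) := by
      rw [abs_mul, abs_mul, abs_of_pos (Real.rpow_pos_of_pos hP _)]
      gcongr
    have e2 := hsq _ ha'
    have e3 := hsq _ hb'
    have e4 : a ^ q + b ^ q - 2 * P ^ q = (a ^ q - P ^ q - q * P ^ (q - 1) * (a - P)) +
      (b ^ q - P ^ q - q * P ^ (q - 1) * (b - P)) + q * P ^ (q - 1) * (a + b - 2 * P) := by ring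
    rw [e4]
    refine (abs_add_three _ _ _).trans ?_
    rw [hC]
    linarith
  rw [hAa, hBb, Real.mul_rpow h0.le ha0.le, Real.mul_rpow h0.le hb0.le,
    show ε ^ q * a ^ q + ε ^ q * b ^ q - 2 * P ^ q * ε ^ q =
      ε ^ q * (a ^ q + b ^ q - 2 * P ^ q) by ring, Real.norm_eq_abs, abs_mul,
    abs_of_pos (Real.rpow_pos_of_pos h0 _), show 2 - α + η = q + (1 + η) by rw [hq]; ring,
    Real.rpow_add h0]
  have := mul_le_mul_of_nonneg_left hmain (Real.rpow_nonneg h0.le q)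
  linarith

/-- Both integrals are explicit. The divergent endpoint terms cancel by `tendsto_arcLen_rpow`; what
stays are the contributions `(L/2)^{1-α}` of the antipodal point and `(|γ'|/2)^{1-α}` of the ends `w
= ±1/2`. -/
theorem tendsto_integral_arcDist {M : ℝ} (hα : α ∈ Set.Ioo (2 : ℝ) 3) (hγ : ContDiff ℝ 2 γ)
    (hp : Function.Periodic γ 1)
    (hM : ∀ y, ‖iteratedDeriv 2 γ y‖ ≤ M) (hη : α - 2 < η) (hη1 : η ≤ 1)
    (hN : ∀ y z, ‖iteratedDeriv 2 γ y - iteratedDeriv 2 γ z‖ ≤ N * |y - z| ^ η)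
    (hreg : ∀ x, deriv γ x ≠ 0) (x : ℝ) :
    Tendsto (fun ε => ∫ w in trunc ε, (‖deriv γ x‖ ^ (1 - α) * |w| ^ (-α) -
      ‖deriv γ (x + w)‖ * (arcDist γ (x + w) x) ^ (-α))) (𝓝[>] 0)
      (𝓝 (2 ^ α / (α - 1) * ((∫ t in (0 : ℝ)..1, ‖deriv γ t‖) ^ (1 - α) -
        ‖deriv γ x‖ ^ (1 - α)))) := by
  have hγ1 : ContDiff ℝ 1 γ := hγ.of_le (by norm_num)
  set L := ∫ t in (0 : ℝ)..1, ‖deriv γ t‖ with hL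
  set P := ‖deriv γ x‖ with hP
  have hP0 : 0 < P := norm_pos_iff.2 (hreg x)
  have hL0 : 0 < L := by
    have h := arcLen_mem_Ioo hγ1 hp hreg x (w := 1 / 2) ⟨by norm_num, by norm_num⟩
    exact h.1.trans h.2
  have hlim := ((tendsto_arcLen_rpow hα hγ hM hη hη1 hN hreg x).neg.div_const (α - 1)).add_const
    (2 ^ α / (α - 1) * (L ^ (1 - α) - P ^ (1 - α)))
  rw [neg_zero, zero_div, zero_add] at hlim
  have hs1 : ∀ᶠ ε : ℝ in 𝓝[>] 0, arcLen γ x ε < L / 2 := by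
    have : Tendsto (arcLen γ x) (𝓝[>] 0) (𝓝 0) :=
      ((continuous_arcLen hγ1 x).tendsto' 0 0 (arcLen_zero x)).mono_left nhdsWithin_le_nhds
    exact this.eventually_lt_const (by positivity)
  have hs2 : ∀ᶠ ε : ℝ in 𝓝[>] 0, -(L / 2) < arcLen γ x (-ε) := by
    have : Tendsto (fun ε => arcLen γ x (-ε)) (𝓝[>] 0) (𝓝 0) :=
      (((continuous_arcLen hγ1 x).comp continuous_neg).tendsto' 0 0
        (by simp [arcLen_zero])).mono_left nhdsWithin_le_nhds
    exact this.eventually_const_lt (by linarith)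
  refine hlim.congr' ?_
  filter_upwards [eventually_trunc, hs1, hs2] with ε ⟨h0, h1⟩ h2 h3
  have hA : 0 < arcLen γ x ε := (arcLen_mem_Ioo hγ1 hp hreg x ⟨h0, by linarith⟩).1
  have hB : arcLen γ x (-ε) < 0 := by
    rw [← arcLen_zero (γ := γ) x]
    exact strictMono_arcLen hγ1 hreg x (by linarith)
  have hα1 : α - 1 ≠ 0 := by linarith [hα.1]
  -- The factor `2` counts the two halves and `(1/2)^{1-α}` comes from halving both lengths.
  have h2α : (2 : ℝ) ^ α = 2 * (1 / 2) ^ (1 - α) := by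
    rw [one_div, Real.inv_rpow zero_le_two, ← Real.rpow_neg zero_le_two, neg_sub,
      Real.rpow_sub_one two_ne_zero]
    ring
  rw [integral_sub ((integrableOn_trunc_of_continuousOn h0 h1 (continuousOn_abs_rpow _)).const_mul _)
    (integrableOn_trunc_arcDist hγ1 hp hreg x h0 h1), integral_const_mul,
    integral_trunc_abs_rpow hα.1 h0 h1, integral_trunc_arcDist hγ1 hp hreg x h0 h1, ← hL,
    integral_min_rpow (by linarith [hα.1]) hA h2.le (by linarith) (by linarith), h2α,
    show L / 2 = L * (1 / 2) by ring, Real.mul_rpow hL0.le (by norm_num),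
    show L - (L + arcLen γ x (-ε)) = -arcLen γ x (-ε) by ring]
  field_simp
  ring

end Asymptotics

/-! ### Normal projection and curvature -/

section Projection

variable {n : ℕ}

/-- `normalProj v` as a continuous linear map. -/
noncomputable def normalProjL (v : Eucl n) : Eucl n →L[ℝ] Eucl n :=
  ContinuousLinearMap.id ℝ _ - (innerSL ℝ (‖v‖⁻¹ • v)).smulRight (‖v‖⁻¹ • v)

theorem normalProjL_apply (v y : Eucl n) : normalProjL v y = normalProj v y := by
  simp [normalProjL, normalProj, real_inner_comm, inner_smul_right]

theorem normalProj_eq (v y : Eucl n) :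
    normalProj v y = y - (‖v‖ ^ 2)⁻¹ • ⟪v, y⟫_ℝ • v := by
  rw [normalProj, inner_smul_right, smul_smul, smul_smul, real_inner_comm]
  congr 2
  rw [← inv_pow]
  ring

theorem normalProj_self {v : Eucl n} (hv : v ≠ 0) : normalProj v v = 0 := by
  rw [normalProj_eq, real_inner_self_eq_norm_sq, smul_smul, inv_mul_cancel₀, one_smul, sub_self]
  exact pow_ne_zero 2 (norm_ne_zero_iff.2 hv)

theorem inner_eq_sum (v y : Eucl n) : ⟪v, y⟫_ℝ = ∑ j, v j * y j := by
  rw [PiLp.inner_apply]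
  exact Finset.sum_congr rfl fun j _ => by simp [mul_comm]

theorem hasDerivAt_norm_inv {g : ℝ → Eucl n} {g' : Eucl n} {x : ℝ} (h : HasDerivAt g g' x)
    (hg : g x ≠ 0) :
    HasDerivAt (fun t => ‖g t‖⁻¹) (-(‖g x‖ ^ 2)⁻¹ * ‖g x‖⁻¹ * ⟪g x, g'⟫_ℝ) x := by
  have hP : 0 < ‖g x‖ := norm_pos_iff.2 hg
  have h1 := (h.norm_sq.sqrt (by positivity)).inv (by positivity)
  have h2 : (fun t => ‖g t‖⁻¹) = fun t => (Real.sqrt (‖g t‖ ^ 2))⁻¹ :=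
    funext fun t => by rw [Real.sqrt_sq (norm_nonneg _)]
  rw [h2]
  refine h1.congr_deriv ?_
  rw [Real.sqrt_sq hP.le]
  field_simp

/-- The derivative of `|γ'|⁻¹` contributes a multiple of `γ'`, exactly the one that turns `γ''` into
its normal part. -/
theorem curvature_eq {γ : ℝ → Eucl n} (h : ContDiff ℝ 2 γ) {x : ℝ} (hx : deriv γ x ≠ 0) :
    curvature γ x = (‖deriv γ x‖ ^ 2)⁻¹ • normalProj (deriv γ x) (iteratedDeriv 2 γ x) := by
  have h1 := hasDerivAt_deriv_of_contDiff_two h x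
  have h2 := ((hasDerivAt_norm_inv h1 hx).smul h1).deriv
  have h3 : deriv (fun t => ‖deriv γ t‖⁻¹ • deriv γ t) x = _ := h2
  rw [curvature, h3, normalProj_eq]
  have hP : ‖deriv γ x‖ ≠ 0 := norm_ne_zero_iff.2 hx
  simp only [smul_sub, smul_add, smul_smul]
  rw [sub_eq_add_neg, ← neg_smul]
  congr 2 <;> field_simp

end Projection

/-! ### Taylor's formula for products of powers along a segment -/

section SegmentPowers

variable {V X Y a c : ℝ}

theorem segment_pos (hV : 0 < V) (hX : 0 < V + X) {t : ℝ} (ht : t ∈ Set.Icc (0 : ℝ) 1) :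
    0 < V + t * X := by
  rcases eq_or_lt_of_le ht.2 with h | h
  · rw [h, one_mul]; exact hX
  · nlinarith [mul_nonneg ht.1 hX.le, mul_pos (sub_pos.2 h) hV]

/-- The product of powers along a pair of segments. -/
noncomputable def segPow (V X Y a c t : ℝ) : ℝ := (V + t * X) ^ a * (V + t * Y) ^ c

/-- The derivative of `segPow`. -/
noncomputable def segPow' (V X Y a c t : ℝ) : ℝ :=
  a * X * segPow V X Y (a - 1) c t + c * Y * segPow V X Y a (c - 1) t

/-- The second derivative of `segPow`. -/
noncomputable def segPow'' (V X Y a c t : ℝ) : ℝ :=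
  a * X * segPow' V X Y (a - 1) c t + c * Y * segPow' V X Y a (c - 1) t

variable (hV : 0 < V) (hX : 0 < V + X) (hY : 0 < V + Y)

include hV hX hY

theorem hasDerivAt_segPow (a c : ℝ) {t : ℝ} (ht : t ∈ Set.Icc (0 : ℝ) 1) :
    HasDerivAt (segPow V X Y a c) (segPow' V X Y a c t) t := by
  have hlin : ∀ Z : ℝ, HasDerivAt (fun t => V + t * Z) Z t := fun Z => by
    simpa using ((hasDerivAt_id t).mul_const Z).const_add V
  have h1 := (hlin X).rpow_const (p := a) (Or.inl (segment_pos hV hX ht).ne')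
  have h2 := (hlin Y).rpow_const (p := c) (Or.inl (segment_pos hV hY ht).ne')
  refine (h1.mul h2).congr_deriv ?_
  simp only [segPow', segPow]
  ring

theorem hasDerivAt_segPow' (a c : ℝ) {t : ℝ} (ht : t ∈ Set.Icc (0 : ℝ) 1) :
    HasDerivAt (segPow' V X Y a c) (segPow'' V X Y a c t) t :=
  ((hasDerivAt_segPow hV hX hY (a - 1) c ht).const_mul _).add
    ((hasDerivAt_segPow hV hX hY a (c - 1) ht).const_mul _)

theorem continuousOn_segPow (a c : ℝ) : ContinuousOn (segPow V X Y a c) (Set.Icc 0 1) :=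
  fun _ ht => (hasDerivAt_segPow hV hX hY a c ht).continuousAt.continuousWithinAt

theorem continuousOn_segPow' (a c : ℝ) : ContinuousOn (segPow' V X Y a c) (Set.Icc 0 1) :=
  ((continuousOn_segPow hV hX hY _ _).const_mul _).add
    ((continuousOn_segPow hV hX hY _ _).const_mul _)

theorem continuousOn_segPow'' (a c : ℝ) : ContinuousOn (segPow'' V X Y a c) (Set.Icc 0 1) :=
  ((continuousOn_segPow' hV hX hY _ _).const_mul _).add
    ((continuousOn_segPow' hV hX hY _ _).const_mul _)

theorem segPow_sub (a c : ℝ) :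
    (V + X) ^ a * (V + Y) ^ c - V ^ (a + c) = ∫ t in Set.Icc (0 : ℝ) 1, segPow' V X Y a c t := by
  rw [integral_Icc_eq_integral_Ioc, ← intervalIntegral.integral_of_le zero_le_one,
    intervalIntegral.integral_eq_sub_of_hasDerivAt (f := segPow V X Y a c)]
  · simp [segPow, Real.rpow_add hV]
  · rw [Set.uIcc_of_le zero_le_one]
    exact fun t ht => hasDerivAt_segPow hV hX hY a c ht
  · refine ContinuousOn.intervalIntegrable ?_
    rw [Set.uIcc_of_le zero_le_one]
    exact continuousOn_segPow' hV hX hY a c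

/-- The function `(1 - t) f' + f` has derivative `(1 - t) f''`, so the fundamental theorem of
calculus on `[0, 1]` gives Taylor's formula of second order with integral remainder. -/
theorem segPow_taylor (a c : ℝ) :
    (V + X) ^ a * (V + Y) ^ c = V ^ (a + c) + (a * X + c * Y) * V ^ (a + c - 1) +
      ∫ t in Set.Icc (0 : ℝ) 1, (1 - t) * segPow'' V X Y a c t := by
  rw [integral_Icc_eq_integral_Ioc, ← intervalIntegral.integral_of_le zero_le_one,
    intervalIntegral.integral_eq_sub_of_hasDerivAt
      (f := fun t => (1 - t) * segPow' V X Y a c t + segPow V X Y a c t)]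
  · simp only [segPow', segPow, one_mul, zero_mul, add_zero, sub_self, sub_zero, zero_add]
    rw [← Real.rpow_add hV, ← Real.rpow_add hV, ← Real.rpow_add hV,
      show a - 1 + c = a + c - 1 by ring, show a + (c - 1) = a + c - 1 by ring]
    ring
  · rw [Set.uIcc_of_le zero_le_one]
    intro t ht
    have h1 : HasDerivAt (fun t : ℝ => 1 - t) (-1) t := by
      simpa using (hasDerivAt_id t).const_sub 1
    refine ((h1.mul (hasDerivAt_segPow' hV hX hY a c ht)).add
      (hasDerivAt_segPow hV hX hY a c ht)).congr_deriv ?_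
    ring
  · refine ContinuousOn.intervalIntegrable ?_
    rw [Set.uIcc_of_le zero_le_one]
    exact (by fun_prop : ContinuousOn (fun t : ℝ => 1 - t) _).mul
      (continuousOn_segPow'' hV hX hY a c)

end SegmentPowers

/-! ### Integrating out the Taylor parameter -/

section Averages

variable {b : ℝ}

/-- The average over the second parameter. -/
noncomputable def avg (a : UH Param b) (x w : ℝ) : ℝ := ∫ s in Set.Icc (0 : ℝ) 1, a.toFun (w, s) x

theorem parW_mk {w : ℝ} (hw : w ≠ 0) (hw2 : |w| ≤ 1 / 2) (s : ℝ) : parW (w, s) = w := by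
  rw [parW, if_pos ⟨hw, hw2⟩]

theorem parT_mk (w : ℝ) {s : ℝ} (hs : s ∈ Set.Icc (0 : ℝ) 1) : parT (w, s) = s := by
  rw [parT, if_pos (show (0 : ℝ) ≤ (w, s).2 ∧ (w, s).2 ≤ 1 from hs)]

theorem ae_parW_ne : ∀ᵐ w ∂(volume.restrict symInterval), w ≠ 0 ∧ |w| ≤ 1 / 2 := by
  filter_upwards [ae_restrict_mem measurableSet_Icc,
    Measure.ae_ne (volume.restrict symInterval) 0] with w hw hw0
  exact ⟨hw0, abs_le.2 hw⟩

theorem integrableOn_avg_mul {a : UH Param b} {x : ℝ} {k : ℝ → ℝ}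
    (h : Integrable (fun t => a.toFun t x * k (parW t)) paramMeasure) :
    IntegrableOn (fun w => avg a x w * k w) symInterval := by
  have := Integrable.integral_prod_left h
  refine this.congr ?_
  filter_upwards [ae_parW_ne] with w hw
  simp only [parW_mk hw.1 hw.2, integral_mul_const, avg]

/-- Fubini: the operators on families integrate over `(w, t)`, whereas the integrand of the problem
depends on `w` only, through averages over `t`. -/
theorem integral_avg_mul {a : UH Param b} {x : ℝ} {k : ℝ → ℝ}
    (h : Integrable (fun t => a.toFun t x * k (parW t)) paramMeasure) :
    ∫ w in symInterval, avg a x w * k w = ∫ t, a.toFun t x * k (parW t) ∂paramMeasure := by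
  rw [paramMeasure, integral_prod _ h]
  refine integral_congr_ae ?_
  filter_upwards [ae_parW_ne] with w hw
  simp only [parW_mk hw.1 hw.2, integral_mul_const, avg]

theorem avg_of_const {a : UH Param b} {x w r : ℝ}
    (h : ∀ s ∈ Set.Icc (0 : ℝ) 1, a.toFun (w, s) x = r) : avg a x w = r := by
  rw [avg, setIntegral_congr_fun measurableSet_Icc h]
  simp

theorem integrable_avg (a : UH Param b) (x w : ℝ) :
    IntegrableOn (fun s => a.toFun (w, s) x) (Set.Icc (0 : ℝ) 1) := by
  refine Integrable.mono' (integrable_const ‖a‖)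
    ((a.isUH.measurable x).comp measurable_prodMk_left).aestronglyMeasurable
    (Eventually.of_forall fun s => a.abs_apply_le _ x)

theorem avg_sub (a a' : UH Param b) (x w : ℝ) : avg (a - a') x w = avg a x w - avg a' x w :=
  integral_sub (integrable_avg a x w) (integrable_avg a' x w)

theorem avg_smul (c : ℝ) (a : UH Param b) (x w : ℝ) : avg (c • a) x w = c * avg a x w :=
  integral_const_mul _ _

theorem tendsto_integral_trunc {E : Type*} [NormedAddCommGroup E] [NormedSpace ℝ E] {g : ℝ → E}
    (hg : IntegrableOn g symInterval) :
    Tendsto (fun ε => ∫ w in trunc ε, g w) (𝓝[>] 0) (𝓝 (∫ w in symInterval, g w)) := by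
  have h1 : ∀ ε, ∫ w in trunc ε, g w =
      ∫ w in symInterval, Set.indicator (Set.Icc (-ε) ε)ᶜ g w := fun ε => by
    rw [setIntegral_indicator measurableSet_Icc.compl]
    rfl
  simp only [h1]
  refine tendsto_integral_filter_of_dominated_convergence (fun w => ‖g w‖)
    (Eventually.of_forall fun ε => hg.aestronglyMeasurable.indicator measurableSet_Icc.compl)
    (Eventually.of_forall fun ε => Eventually.of_forall fun w => norm_indicator_le_norm_self _ _)
    hg.norm ?_
  filter_upwards [ae_parW_ne] with w hw
  refine tendsto_const_nhds.congr' ?_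
  filter_upwards [Ioo_mem_nhdsGT (abs_pos.2 hw.1)] with ε hε
  rw [Set.indicator_of_mem]
  exact fun h => (abs_le.2 h).not_gt hε.2

end Averages

/-! ### Algebra of the integrands -/

section Integrands

variable {n : ℕ}

/-- The integrand of `H^α`. -/
noncomputable def hIntegrand (α : ℝ) (γ : ℝ → Eucl n) (x w : ℝ) : Eucl n :=
  ‖deriv γ (x + w)‖ • normalProj (deriv γ x)
    ((2 * α / ‖γ (x + w) - γ x‖ ^ (2 + α)) • (γ (x + w) - γ x)
      - ((α - 2) / arcDist γ (x + w) x ^ α) • curvature γ x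
      - (2 / ‖γ (x + w) - γ x‖ ^ α) • curvature γ x)

/-- The integrand of `Q^α`. -/
noncomputable def qIntegrand (α : ℝ) (γ : ℝ → Eucl n) (x w : ℝ) : Eucl n :=
  (1 / |w| ^ α) • remR γ x w

/-- The integrand of the lower order term. -/
noncomputable def dIntegrand (α : ℝ) (γ : ℝ → Eucl n) (x w : ℝ) : Eucl n :=
  hIntegrand α γ x w -
    (α / ‖deriv γ x‖ ^ (α + 1)) • normalProj (deriv γ x) (qIntegrand α γ x w)

theorem normalProj_normalProj {v : Eucl n} (hv : v ≠ 0) (y : Eucl n) :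
    normalProj v (normalProj v y) = normalProj v y := by
  rw [normalProj_eq v y, ← normalProjL_apply, map_sub, map_smul, map_smul, normalProjL_apply,
    normalProjL_apply, normalProj_self hv, smul_zero, smul_zero, sub_zero, normalProj_eq]

theorem arcDist_nonneg {γ : ℝ → Eucl n} (hγ : ContDiff ℝ 1 γ) (hp : Function.Periodic γ 1)
    (hreg : ∀ x, deriv γ x ≠ 0) (x : ℝ) {w : ℝ} (hw : w ≠ 0) (hw2 : |w| ≤ 1 / 2) :
    0 ≤ arcDist γ (x + w) x := by
  have h := abs_le.1 hw2
  rcases lt_or_gt_of_ne hw with h0 | h0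
  · rw [arcDist_of_neg hγ hp x ⟨by linarith, h0⟩]
    have := arcLen_mem_Ioo hγ hp hreg x (w := w + 1) ⟨by linarith, by linarith⟩
    exact le_min this.1.le (by linarith [this.2])
  · rw [arcDist_of_pos hγ hp x ⟨h0, by linarith⟩]
    have := arcLen_mem_Ioo hγ hp hreg x (w := w) ⟨h0, by linarith⟩
    exact le_min this.1.le (by linarith [this.2])

/-- The chord is `w` times the difference quotient and its normal part is `(w²/2) P^⊥(γ'' + remR)`;
the curvature has normal part `|γ'|⁻² P^⊥γ''`. Collecting the coefficients of the two normal
vectors, and adding and subtracting `(α-2) |γ'|^{-α-1} |w|^{-α}`, leaves both the powers and the arc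
length term with a cancellation at `w = 0`. -/
theorem dIntegrand_eq {α : ℝ} {γ : ℝ → Eucl n} (hγ : ContDiff ℝ 2 γ) (hp : Function.Periodic γ 1)
    (hreg : ∀ x, deriv γ x ≠ 0) (x : ℝ) {w : ℝ} (hw : w ≠ 0) (hw2 : |w| ≤ 1 / 2) :
    dIntegrand α γ x w =
      (α * |w| ^ (-α) * (‖deriv γ (x + w)‖ * (‖quot γ x w‖ ^ 2) ^ (-(2 + α) / 2) -
        (‖deriv γ x‖ ^ 2) ^ (1 / 2 + -(2 + α) / 2))) •
          normalProj (deriv γ x) (remR γ x w) +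
      (|w| ^ (-α) * (α * (‖deriv γ (x + w)‖ * (‖quot γ x w‖ ^ 2) ^ (-(2 + α) / 2)) -
        2 * (‖deriv γ x‖ ^ 2)⁻¹ * (‖deriv γ (x + w)‖ * (‖quot γ x w‖ ^ 2) ^ (-α / 2)) -
        (α - 2) * (‖deriv γ x‖ ^ 2) ^ (1 / 2 + -(2 + α) / 2)) +
        (α - 2) * (‖deriv γ x‖ ^ 2)⁻¹ * (‖deriv γ x‖ ^ (1 - α) * |w| ^ (-α) -
          ‖deriv γ (x + w)‖ * arcDist γ (x + w) x ^ (-α))) •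
            normalProj (deriv γ x) (iteratedDeriv 2 γ x) := by
  have hd := arcDist_nonneg (hγ.of_le (by norm_num)) hp hreg x hw hw2
  have hP : 0 < ‖deriv γ x‖ := norm_pos_iff.2 (hreg x)
  have hw' : 0 < |w| := abs_pos.2 hw
  have hΔ : γ (x + w) - γ x = w • quot γ x w := by
    rw [quot, smul_smul, mul_inv_cancel₀ hw, one_smul]
  have hNΔ : normalProjL (deriv γ x) (γ (x + w) - γ x) = (w ^ 2 / 2) •
      (normalProjL (deriv γ x) (iteratedDeriv 2 γ x) + normalProjL (deriv γ x) (remR γ x w)) := by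
    rw [hΔ, quot_eq x hw]
    simp only [map_smul, map_add]
    rw [normalProjL_apply _ (deriv γ x), normalProj_self (hreg x), zero_add, smul_smul, smul_smul]
    congr 1; ring
  have hNκ : normalProjL (deriv γ x) (curvature γ x) =
      (‖deriv γ x‖ ^ 2)⁻¹ • normalProjL (deriv γ x) (iteratedDeriv 2 γ x) := by
    rw [curvature_eq hγ (hreg x), map_smul, normalProjL_apply, normalProjL_apply,
      normalProj_normalProj (hreg x)]
  have hn : ∀ r : ℝ, ‖γ (x + w) - γ x‖ ^ r = |w| ^ r * (‖quot γ x w‖ ^ 2) ^ (r / 2) := fun r => by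
    rw [hΔ, norm_smul, Real.norm_eq_abs, Real.mul_rpow (abs_nonneg _) (norm_nonneg _),
      ← Real.rpow_two, ← Real.rpow_mul (norm_nonneg _)]
    congr 2; ring
  have hPr : (‖deriv γ x‖ ^ 2) ^ (1 / 2 + -(2 + α) / 2) = (‖deriv γ x‖ ^ (α + 1))⁻¹ := by
    rw [← Real.rpow_two, ← Real.rpow_mul hP.le, ← Real.rpow_neg hP.le]
    congr 1; ring
  have hPr2 : ‖deriv γ x‖ ^ (1 - α) = ‖deriv γ x‖ ^ 2 * (‖deriv γ x‖ ^ (α + 1))⁻¹ := by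
    rw [← Real.rpow_neg hP.le, ← Real.rpow_two, ← Real.rpow_add hP]
    congr 1; ring
  have hwr : |w| ^ (2 + α) = w ^ 2 * |w| ^ α := by
    rw [Real.rpow_add hw', Real.rpow_two, sq_abs]
  rw [dIntegrand, hIntegrand, qIntegrand, ← normalProjL_apply, ← normalProjL_apply,
    ← normalProjL_apply, ← normalProjL_apply, map_sub, map_sub, map_smul, map_smul, map_smul,
    map_smul, hNΔ, hNκ, hn, hn, hPr, hPr2, hwr, Real.rpow_neg hw'.le, Real.rpow_neg hd,
    show -(2 + α) / 2 = -((2 + α) / 2) by ring, show -α / 2 = -(α / 2) by ring,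
    Real.rpow_neg (by positivity), Real.rpow_neg (by positivity)]
  set F := normalProjL (deriv γ x) (iteratedDeriv 2 γ x)
  set G := normalProjL (deriv γ x) (remR γ x w)
  set W := |w| ^ α
  set D := arcDist γ (x + w) x ^ α
  set A := (‖quot γ x w‖ ^ 2) ^ ((2 + α) / 2)
  set B := (‖quot γ x w‖ ^ 2) ^ (α / 2)
  set E := ‖deriv γ x‖ ^ (α + 1)
  set P := ‖deriv γ x‖
  set ρ := ‖deriv γ (x + w)‖
  have e1 : 2 * α / (w ^ 2 * W * A) * (w ^ 2 / 2) = α * W⁻¹ * A⁻¹ := by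
    have hw3 : w ^ 2 * (w ^ 2)⁻¹ = 1 := mul_inv_cancel₀ (by positivity)
    simp only [div_eq_mul_inv, mul_inv]
    linear_combination (α * W⁻¹ * A⁻¹) * hw3
  rw [smul_smul (2 * α / (w ^ 2 * W * A)), e1]
  simp only [smul_add, smul_sub, smul_smul, div_eq_mul_inv, mul_inv, one_mul]
  have hP2 : P ^ 2 * (P ^ 2)⁻¹ = 1 := mul_inv_cancel₀ (by positivity)
  rw [show (α - 2) * (P ^ 2)⁻¹ * (P ^ 2 * E⁻¹ * W⁻¹ - ρ * D⁻¹) =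
    (P ^ 2 * (P ^ 2)⁻¹) * ((α - 2) * E⁻¹ * W⁻¹) - (α - 2) * (P ^ 2)⁻¹ * (ρ * D⁻¹) by ring, hP2]
  module

end Integrands

/-! ### Splitting into an integrable, an odd and an arc length part -/

section Decomposition

variable {n : ℕ} {α b : ℝ} (hα : α ∈ Set.Ioo (2 : ℝ) 3) (hb : b ∈ Set.Ioo (0 : ℝ) 1)
  (u : HolderSpace n (α + b))

theorem toFun_opR (i : Fin n) (a : UH Param b) (t₀ : Param) (x : ℝ) :
    (opR hα hb i u a).toFun t₀ x =
      ∫ t, a.toFun t x * (oddWeight α (parW t) * remR u.toFun x (parW t) i) ∂paramMeasure := rfl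

theorem toFun_opS (i : Fin n) (a : UH Param b) (t₀ : Param) (x : ℝ) :
    (opS hα hb i u a).toFun t₀ x =
      ∫ t, a.toFun t x * (oddWeight α (parW t) * remS u.toFun x (parW t) i) ∂paramMeasure := rfl

include hα hb in
theorem integrableOn_remR (i : Fin n) (x : ℝ) :
    IntegrableOn (fun w => oddWeight α w * remR u.toFun x w i) symInterval :=
  (u.remKernel_remR hα hb i).integrableOn (lt_expH hα hb) (expZ_lt hα hb) x

include hα hb in
theorem integrableOn_remS (i : Fin n) (x : ℝ) :
    IntegrableOn (fun w => oddWeight α w * remS u.toFun x w i) symInterval :=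
  (u.remKernel_remS hα hb i).integrableOn (lt_expH hα hb) (expZ_lt hα hb) x

include hα hb in
theorem integrable_mul_remR (i : Fin n) (a : UH Param b) (x : ℝ) :
    Integrable (fun t => a.toFun t x * (oddWeight α (parW t) * remR u.toFun x (parW t) i))
      paramMeasure :=
  (integrable_param_parW (integrableOn_remR hα hb u i x)).bdd_mul
    (a.isUH.measurable x).aestronglyMeasurable (Eventually.of_forall fun t => a.abs_apply_le t x)

theorem toFun_eR1 (t : Param) (x : ℝ) : (eR1 hα hb u).toFun t x =
    2 * ⟪deriv u.toFun x, iteratedDeriv 2 u.toFun x⟫_ℝ +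
      2 * (∑ j, deriv u.toFun x j * remS u.toFun x (parW t) j) +
      parW t * (∑ j, eS hα hb u j ^ 2).toFun t x := by
  rw [eR1, UH.toFun_sum, UH.toFun_sum, inner_eq_sum, Finset.mul_sum, Finset.mul_sum,
    Finset.mul_sum, ← Finset.sum_add_distrib, ← Finset.sum_add_distrib]
  refine Finset.sum_congr rfl fun j _ => ?_
  simp only [UH.toFun_mul, UH.toFun_add, UH.toFun_pow, UH.toFun_smul, toFun_cP, toFun_eS, toFun_eW]
  ring

theorem toFun_eV1 (t : Param) (x : ℝ) : (eV1 hα hb u).toFun t x =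
    ⟪deriv u.toFun x, iteratedDeriv 2 u.toFun x⟫_ℝ +
      (∑ j, deriv u.toFun x j * remR u.toFun x (parW t) j) +
      parW t * (∑ j, eC hα hb u j ^ 2).toFun t x := by
  rw [eV1, UH.toFun_sum, UH.toFun_sum, inner_eq_sum, Finset.mul_sum, ← Finset.sum_add_distrib,
    ← Finset.sum_add_distrib]
  refine Finset.sum_congr rfl fun j _ => ?_
  simp only [UH.toFun_mul, UH.toFun_add, UH.toFun_pow, UH.toFun_smul, toFun_cP, toFun_eC, toFun_eW]
  ring

variable {c : ℝ} (hc : 0 < c)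
  (hu : ∀ x w, |w| ≤ 1 / 2 → c * |w| ≤ ‖u.toFun (x + w) - u.toFun x‖)

/-- The values of `eR1` at the parameter `w`. -/
noncomputable def valR1 (x w : ℝ) : ℝ := (eR1 hα hb u).toFun (w, 0) x

/-- The values of `eV1` at the parameter `w`. -/
noncomputable def valV1 (x w : ℝ) : ℝ := (eV1 hα hb u).toFun (w, 0) x

theorem toFun_eR1_mk (x w s : ℝ) : (eR1 hα hb u).toFun (w, s) x = valR1 hα hb u x w := by
  rw [valR1, eR1, UH.toFun_sum, UH.toFun_sum]; rfl

theorem toFun_eV1_mk (x w s : ℝ) : (eV1 hα hb u).toFun (w, s) x = valV1 hα hb u x w := by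
  rw [valV1, eV1, UH.toFun_sum, UH.toFun_sum]; rfl

section
include hc hu

theorem toFun_ePow {w : ℝ} (hw : w ≠ 0) (hw2 : |w| ≤ 1 / 2) (x : ℝ) {s : ℝ}
    (hs : s ∈ Set.Icc (0 : ℝ) 1) (p q : ℝ) :
    (ePow hα hb u p q).toFun (w, s) x =
      segPow (‖deriv u.toFun x‖ ^ 2) (w * valR1 hα hb u x w) (w * valV1 hα hb u x w) p q s := by
  rw [ePow, UH.toFun_mul, UH.toFun_rpow (pow_pos hc 2) (le_eR hα hb hc hu),
    UH.toFun_rpow (pow_pos hc 2) (le_eV hα hb hc hu), toFun_eR, toFun_eV, toFun_eV0, parT_mk _ hs,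
    parW_mk hw hw2, toFun_eR1_mk, toFun_eV1_mk, segPow]

theorem mul_toFun_eM {w : ℝ} (hw : w ≠ 0) (hw2 : |w| ≤ 1 / 2) (x : ℝ) {s : ℝ}
    (hs : s ∈ Set.Icc (0 : ℝ) 1) (p q : ℝ) :
    w * (eM hα hb u p q).toFun (w, s) x =
      segPow' (‖deriv u.toFun x‖ ^ 2) (w * valR1 hα hb u x w) (w * valV1 hα hb u x w) p q s := by
  simp only [eM, UH.toFun_add, UH.toFun_smul, UH.toFun_mul,
    toFun_ePow hα hb u hc hu hw hw2 x hs, toFun_eR1_mk, toFun_eV1_mk, segPow']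
  ring

theorem mul_toFun_eD {w : ℝ} (hw : w ≠ 0) (hw2 : |w| ≤ 1 / 2) (x : ℝ) {s : ℝ}
    (hs : s ∈ Set.Icc (0 : ℝ) 1) (p q : ℝ) :
    w ^ 2 * (eD hα hb u p q).toFun (w, s) x =
      segPow'' (‖deriv u.toFun x‖ ^ 2) (w * valR1 hα hb u x w) (w * valV1 hα hb u x w) p q s := by
  simp only [eD, UH.toFun_add, UH.toFun_smul, UH.toFun_mul, UH.toFun_pow,
    toFun_ePow hα hb u hc hu hw hw2 x hs, toFun_eR1_mk, toFun_eV1_mk, segPow'', segPow']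
  rw [show p - 1 - 1 = p - 2 by ring, show q - 1 - 1 = q - 2 by ring]
  ring

theorem deriv_pow_identities {w : ℝ} (hw : w ≠ 0) (hw2 : |w| ≤ 1 / 2) (x : ℝ) :
    0 < ‖deriv u.toFun x‖ ^ 2 ∧
    0 < ‖deriv u.toFun x‖ ^ 2 + w * valR1 hα hb u x w ∧
    0 < ‖deriv u.toFun x‖ ^ 2 + w * valV1 hα hb u x w ∧
    ‖deriv u.toFun x‖ ^ 2 + w * valR1 hα hb u x w = ‖deriv u.toFun (x + w)‖ ^ 2 ∧
    ‖deriv u.toFun x‖ ^ 2 + w * valV1 hα hb u x w = ‖quot u.toFun x w‖ ^ 2 := by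
  have h1 := eV0_add_eR1 hα hb u (w, 0) x
  have h2 := eV0_add_eV1 hα hb u (w, 0) x
  have h3 := le_norm_quot hu (w, 0) x
  rw [toFun_eV0, parW_mk hw hw2, toFun_eR1_mk] at h1
  rw [toFun_eV0, parW_mk hw hw2, toFun_eV1_mk] at h2
  rw [parW_mk hw hw2] at h3
  have hreg : ∀ y, 0 < ‖deriv u.toFun y‖ := fun y => hc.trans_le
    (le_norm_deriv_of_biLip hu ((u.contDiff_two hα hb).differentiable (by norm_num) y))
  refine ⟨by have := hreg x; positivity, ?_, ?_, h1, h2⟩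
  · rw [h1]; have := hreg (x + w); positivity
  · rw [h2]; have := hc.trans_le h3; positivity

/-- The fundamental theorem of calculus along the segments from `|γ'(x)|²` to `|γ'(x+w)|²` and to
the squared norm of the difference quotient. It exhibits the factor `w` that reduces the singularity
in front of `remR`. -/
theorem mul_avg_eM {w : ℝ} (hw : w ≠ 0) (hw2 : |w| ≤ 1 / 2) (x q : ℝ) :
    ‖deriv u.toFun (x + w)‖ * (‖quot u.toFun x w‖ ^ 2) ^ q -
      (‖deriv u.toFun x‖ ^ 2) ^ (1 / 2 + q) = w * avg (eM hα hb u (1 / 2) q) x w := by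
  obtain ⟨h1, h2, h3, h4, h5⟩ := deriv_pow_identities hα hb u hc hu hw hw2 x
  have h := segPow_sub h1 h2 h3 (1 / 2) q
  rw [h4, h5, ← Real.sqrt_eq_rpow, Real.sqrt_sq (norm_nonneg _)] at h
  rw [h, avg, ← integral_const_mul]
  exact setIntegral_congr_fun measurableSet_Icc fun s hs =>
    (mul_toFun_eM hα hb u hc hu hw hw2 x hs _ _).symm

theorem sq_mul_avg_eD {w : ℝ} (hw : w ≠ 0) (hw2 : |w| ≤ 1 / 2) (x q : ℝ) :
    ‖deriv u.toFun (x + w)‖ * (‖quot u.toFun x w‖ ^ 2) ^ q =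
      (‖deriv u.toFun x‖ ^ 2) ^ (1 / 2 + q) +
      w * (1 / 2 * valR1 hα hb u x w + q * valV1 hα hb u x w) *
        (‖deriv u.toFun x‖ ^ 2) ^ (1 / 2 + q - 1) +
      w ^ 2 * avg ((1 - eT) * eD hα hb u (1 / 2) q) x w := by
  obtain ⟨h1, h2, h3, h4, h5⟩ := deriv_pow_identities hα hb u hc hu hw hw2 x
  have h := segPow_taylor h1 h2 h3 (1 / 2) q
  rw [h4, h5, ← Real.sqrt_eq_rpow, Real.sqrt_sq (norm_nonneg _)] at h
  rw [h, avg, ← integral_const_mul]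
  congr 1
  · ring
  · refine setIntegral_congr_fun measurableSet_Icc fun s hs => ?_
    simp only [UH.toFun_mul, UH.toFun_sub, UH.toFun_one, toFun_eT, parT_mk w hs]
    rw [← mul_toFun_eD hα hb u hc hu hw hw2 x hs]
    ring

end

/-- The regularized scalar factor of the curvature. -/
noncomputable def regX (x w : ℝ) : ℝ :=
  (‖deriv u.toFun x‖ ^ 2) ^ (-(3 + α) / 2) *
    ((∑ j, deriv u.toFun x j * ((α - 2) * (oddWeight α w * remS u.toFun x w j) -
        α ^ 2 / 2 * (oddWeight α w * remR u.toFun x w j))) +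
      (α - 2) / 2 * (avg (∑ j, eS hα hb u j ^ 2) x w * evenWeight α w) -
      α ^ 2 / 2 * (avg (∑ j, eC hα hb u j ^ 2) x w * evenWeight α w)) +
  avg ((1 - eT) * (α • eD hα hb u (1 / 2) (-(2 + α) / 2) -
      (2 : ℝ) • (UH.rpow (-1) (eV0 hα hb u) * eD hα hb u (1 / 2) (-α / 2)))) x w * evenWeight α w

/-- The regularized integrand before projection. -/
noncomputable def regVec (x w : ℝ) : Eucl n :=
  (α * (avg (eM hα hb u (1 / 2) (-(2 + α) / 2)) x w * oddWeight α w)) • remR u.toFun x w +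
    regX hα hb u x w • iteratedDeriv 2 u.toFun x

include hc hu

/-- The terms of order zero cancel since their coefficients are `α`, `-2` and `-(α-2)`. In the terms
of order one the constant parts of `valR1` and `valV1` are separated: they form the odd function on
the right, with coefficient `α - 2 - α²/2`. -/
theorem regX_eq {w : ℝ} (hw : w ≠ 0) (hw2 : |w| ≤ 1 / 2) (x : ℝ) :
    |w| ^ (-α) * (α * (‖deriv u.toFun (x + w)‖ * (‖quot u.toFun x w‖ ^ 2) ^ (-(2 + α) / 2)) -
        2 * (‖deriv u.toFun x‖ ^ 2)⁻¹ *
          (‖deriv u.toFun (x + w)‖ * (‖quot u.toFun x w‖ ^ 2) ^ (-α / 2)) -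
        (α - 2) * (‖deriv u.toFun x‖ ^ 2) ^ (1 / 2 + -(2 + α) / 2)) =
      regX hα hb u x w + (‖deriv u.toFun x‖ ^ 2) ^ (-(3 + α) / 2) *
        ((α - 2 - α ^ 2 / 2) * ⟪deriv u.toFun x, iteratedDeriv 2 u.toFun x⟫_ℝ) * oddWeight α w := by
  have hV := (deriv_pow_identities hα hb u hc hu hw hw2 x).1
  rw [sq_mul_avg_eD hα hb u hc hu hw hw2 x, sq_mul_avg_eD hα hb u hc hu hw hw2 x]
  have hr : valR1 hα hb u x w = _ := toFun_eR1 hα hb u (w, 0) x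
  have hv : valV1 hα hb u x w = _ := toFun_eV1 hα hb u (w, 0) x
  have hS : avg (∑ j, eS hα hb u j ^ 2) x w = (∑ j, eS hα hb u j ^ 2).toFun (w, 0) x :=
    avg_of_const fun s _ => by rw [UH.toFun_sum, UH.toFun_sum]; rfl
  have hC : avg (∑ j, eC hα hb u j ^ 2) x w = (∑ j, eC hα hb u j ^ 2).toFun (w, 0) x :=
    avg_of_const fun s _ => by rw [UH.toFun_sum, UH.toFun_sum]; rfl
  have hD : avg ((1 - eT) * (α • eD hα hb u (1 / 2) (-(2 + α) / 2) -
      (2 : ℝ) • (UH.rpow (-1) (eV0 hα hb u) * eD hα hb u (1 / 2) (-α / 2)))) x w =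
      α * avg ((1 - eT) * eD hα hb u (1 / 2) (-(2 + α) / 2)) x w -
      2 * (‖deriv u.toFun x‖ ^ 2)⁻¹ * avg ((1 - eT) * eD hα hb u (1 / 2) (-α / 2)) x w := by
    rw [← avg_smul, ← avg_smul, ← avg_sub]
    refine setIntegral_congr_fun measurableSet_Icc fun s hs => ?_
    simp only [UH.toFun_mul, UH.toFun_sub, UH.toFun_smul, UH.toFun_one,
      UH.toFun_rpow (pow_pos hc 2) (le_eV0 hα hb hc hu), toFun_eV0, Real.rpow_neg_one]
    ring
  rw [parW_mk hw hw2] at hr hv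
  rw [regX, hS, hC, hD, hr, hv]
  set V := ‖deriv u.toFun x‖ ^ 2
  have e1 : V ^ (1 / 2 + -(2 + α) / 2 - 1) = V ^ (-(3 + α) / 2) := by congr 1; ring
  have e2 : V⁻¹ * V ^ (1 / 2 + -α / 2 - 1) = V ^ (-(3 + α) / 2) := by
    rw [← Real.rpow_neg_one, ← Real.rpow_add hV]; congr 1; ring
  have e3 : V⁻¹ * V ^ (1 / 2 + -α / 2) = V ^ (1 / 2 + -(2 + α) / 2) := by
    rw [← Real.rpow_neg_one, ← Real.rpow_add hV]; congr 1; ring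
  have e4 : ∑ j, deriv u.toFun x j * ((α - 2) * (oddWeight α w * remS u.toFun x w j) -
        α ^ 2 / 2 * (oddWeight α w * remR u.toFun x w j)) =
      oddWeight α w * ((α - 2) * (∑ j, deriv u.toFun x j * remS u.toFun x w j) -
        α ^ 2 / 2 * ∑ j, deriv u.toFun x j * remR u.toFun x w j) := by
    rw [Finset.mul_sum, Finset.mul_sum, ← Finset.sum_sub_distrib, Finset.mul_sum]
    exact Finset.sum_congr rfl fun j _ => by ring
  rw [e1, e4, oddWeight, evenWeight]
  set SR := ∑ j, deriv u.toFun x j * remR u.toFun x w j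
  set SS := ∑ j, deriv u.toFun x j * remS u.toFun x w j
  set Q := (∑ j, eS hα hb u j ^ 2).toFun (w, 0) x
  set Q' := (∑ j, eC hα hb u j ^ 2).toFun (w, 0) x
  set D1 := avg ((1 - eT) * eD hα hb u (1 / 2) (-(2 + α) / 2)) x w
  set D2 := avg ((1 - eT) * eD hα hb u (1 / 2) (-α / 2)) x w
  set I := ⟪deriv u.toFun x, iteratedDeriv 2 u.toFun x⟫_ℝ
  set R := 2 * I + 2 * SS + w * Q
  set Z := I + SR + w * Q'
  have key : 2 * V⁻¹ * (V ^ (1 / 2 + -α / 2) + w * (1 / 2 * R + -α / 2 * Z) *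
      V ^ (1 / 2 + -α / 2 - 1) + w ^ 2 * D2) =
      2 * V ^ (1 / 2 + -(2 + α) / 2) + 2 * w * (1 / 2 * R + -α / 2 * Z) * V ^ (-(3 + α) / 2) +
      2 * V⁻¹ * w ^ 2 * D2 := by
    rw [← e2, ← e3]; ring
  rw [key]
  ring

/-- The three summands are treated differently: the first is absolutely integrable, the second is
odd in `w`, and the third is the arc length term with an explicit limit. -/
theorem dIntegrand_eq_reg {w : ℝ} (hw : w ≠ 0) (hw2 : |w| ≤ 1 / 2) (x : ℝ) :
    dIntegrand α u.toFun x w = normalProjL (deriv u.toFun x) (regVec hα hb u x w) +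
      ((‖deriv u.toFun x‖ ^ 2) ^ (-(3 + α) / 2) *
        ((α - 2 - α ^ 2 / 2) * ⟪deriv u.toFun x, iteratedDeriv 2 u.toFun x⟫_ℝ) * oddWeight α w) •
          normalProj (deriv u.toFun x) (iteratedDeriv 2 u.toFun x) +
      ((α - 2) * (‖deriv u.toFun x‖ ^ 2)⁻¹ * (‖deriv u.toFun x‖ ^ (1 - α) * |w| ^ (-α) -
          ‖deriv u.toFun (x + w)‖ * arcDist u.toFun (x + w) x ^ (-α))) •
          normalProj (deriv u.toFun x) (iteratedDeriv 2 u.toFun x) := by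
  have hreg : ∀ y, deriv u.toFun y ≠ 0 := fun y => norm_pos_iff.1 (hc.trans_le
    (le_norm_deriv_of_biLip hu ((u.contDiff_two hα hb).differentiable (by norm_num) y)))
  rw [dIntegrand_eq (u.contDiff_two hα hb) u.memC.periodic hreg x hw hw2,
    regX_eq hα hb u hc hu hw hw2, mul_avg_eM hα hb u hc hu hw hw2, regVec, map_add, map_smul,
    map_smul, normalProjL_apply, normalProjL_apply, oddWeight]
  module

end Decomposition

/-! ### Bookkeeping for integrals over the symmetric interval -/

section HasInt

/-- `g` is integrable over `[-1/2, 1/2]` with integral `v`. -/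
def HasInt (g : ℝ → ℝ) (v : ℝ) : Prop :=
  IntegrableOn g symInterval ∧ ∫ w in symInterval, g w = v

variable {f g : ℝ → ℝ} {v v' : ℝ}

theorem HasInt.add (hf : HasInt f v) (hg : HasInt g v') : HasInt (fun w => f w + g w) (v + v') :=
  ⟨hf.1.add hg.1, by rw [integral_add hf.1 hg.1, hf.2, hg.2]⟩

theorem HasInt.sub (hf : HasInt f v) (hg : HasInt g v') : HasInt (fun w => f w - g w) (v - v') :=
  ⟨hf.1.sub hg.1, by rw [integral_sub hf.1 hg.1, hf.2, hg.2]⟩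

theorem HasInt.const_mul (c : ℝ) (hf : HasInt f v) : HasInt (fun w => c * f w) (c * v) :=
  ⟨hf.1.const_mul c, by rw [integral_const_mul, hf.2]⟩

theorem HasInt.sum {ι : Type*} (s : Finset ι) {f : ι → ℝ → ℝ} {v : ι → ℝ}
    (h : ∀ i ∈ s, HasInt (f i) (v i)) : HasInt (fun w => ∑ i ∈ s, f i w) (∑ i ∈ s, v i) :=
  ⟨integrable_finsetSum _ fun i hi => (h i hi).1, by
    rw [integral_finsetSum _ fun i hi => (h i hi).1]
    exact Finset.sum_congr rfl fun i hi => (h i hi).2⟩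

end HasInt

/-! ### Convergence of the truncated integrals to the analytic expression -/

section PrincipalValue

variable {n : ℕ} {α b : ℝ} (hα : α ∈ Set.Ioo (2 : ℝ) 3) (hb : b ∈ Set.Ioo (0 : ℝ) 1)
  (u : HolderSpace n (α + b))

theorem hasInt_opR (i : Fin n) (a : UH Param b) (t : Param) (x : ℝ) :
    HasInt (fun w => avg a x w * (oddWeight α w * remR u.toFun x w i))
      ((opR hα hb i u a).toFun t x) :=
  ⟨integrableOn_avg_mul (integrable_mul_remR hα hb u i a x), by
    rw [integral_avg_mul (k := fun w => oddWeight α w * remR u.toFun x w i)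
      (integrable_mul_remR hα hb u i a x), toFun_opR]⟩

theorem hasInt_opR_one (i : Fin n) (t : Param) (x : ℝ) :
    HasInt (fun w => oddWeight α w * remR u.toFun x w i) ((opR hα hb i u 1).toFun t x) :=
  ⟨integrableOn_remR hα hb u i x, by
    rw [toFun_opR]
    simp only [UH.toFun_one, one_mul]
    rw [integral_param_parW fun w => oddWeight α w * remR u.toFun x w i]⟩

theorem hasInt_opS_one (i : Fin n) (t : Param) (x : ℝ) :
    HasInt (fun w => oddWeight α w * remS u.toFun x w i) ((opS hα hb i u 1).toFun t x) :=
  ⟨integrableOn_remS hα hb u i x, by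
    rw [toFun_opS]
    simp only [UH.toFun_one, one_mul]
    rw [integral_param_parW fun w => oddWeight α w * remS u.toFun x w i]⟩

theorem hasInt_evenOp (a : UH Param b) (t : Param) (x : ℝ) :
    HasInt (fun w => avg a x w * evenWeight α w) ((evenOp hα a).toFun t x) :=
  ⟨integrableOn_avg_mul (UH.integrable_mul_evenWeight hα a x), by
    rw [integral_avg_mul (UH.integrable_mul_evenWeight hα a x), toFun_evenOp]⟩

variable {c : ℝ} (hc : 0 < c)
  (hu : ∀ x w, |w| ≤ 1 / 2 → c * |w| ≤ ‖u.toFun (x + w) - u.toFun x‖)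

/-- The constant part of the scalar factor of the curvature. -/
noncomputable def arcTerm (α : ℝ) (γ : ℝ → Eucl n) (x : ℝ) : ℝ :=
  (α - 2) * (‖deriv γ x‖ ^ 2)⁻¹ * (2 ^ α / (α - 1) *
    ((∫ t in (0 : ℝ)..1, ‖deriv γ t‖) ^ (1 - α) - ‖deriv γ x‖ ^ (1 - α)))

include hc hu

/-- `eX` also contains the limit of the arc length term, which is not part of the absolutely
convergent integral; hence the subtraction of `arcTerm`. -/
theorem hasInt_regX (t : Param) (x : ℝ) :
    HasInt (regX hα hb u x) ((eX hα hb u).toFun t x - arcTerm α u.toFun x) := by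
  have hV := UH.toFun_rpow (pow_pos hc 2) (le_eV0 hα hb hc hu)
  have hL := UH.toFun_rpow hc (le_eLen hα hb hc hu)
  have h := (((HasInt.sum Finset.univ fun j _ => (((hasInt_opS_one hα hb u j t x).const_mul
    (α - 2)).sub ((hasInt_opR_one hα hb u j t x).const_mul (α ^ 2 / 2))).const_mul
      (deriv u.toFun x j)).add ((hasInt_evenOp hα (∑ j, eS hα hb u j ^ 2) t x).const_mul
        ((α - 2) / 2))).sub ((hasInt_evenOp hα (∑ j, eC hα hb u j ^ 2) t x).const_mul
          (α ^ 2 / 2))).const_mul ((‖deriv u.toFun x‖ ^ 2) ^ (-(3 + α) / 2))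
  have h' := h.add (hasInt_evenOp hα ((1 - eT) * (α • eD hα hb u (1 / 2) (-(2 + α) / 2) -
      (2 : ℝ) • (UH.rpow (-1) (eV0 hα hb u) * eD hα hb u (1 / 2) (-α / 2)))) t x)
  refine ⟨h'.1, h'.2.trans ?_⟩
  have hP : (‖deriv u.toFun x‖ ^ 2) ^ ((1 - α) / 2) = ‖deriv u.toFun x‖ ^ (1 - α) := by
    rw [← Real.rpow_two, ← Real.rpow_mul (norm_nonneg _)]
    congr 1; ring
  rw [eX, arcTerm]
  simp only [UH.toFun_add, UH.toFun_sub, UH.toFun_mul, UH.toFun_smul, UH.toFun_sum, hV, hL,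
    toFun_eV0, toFun_cP, toFun_eLen hα hb hc hu, Real.rpow_neg_one, hP]
  ring

theorem hasInt_regVec (i : Fin n) (t : Param) (x : ℝ) :
    HasInt (fun w => regVec hα hb u x w i) ((eY hα hb u i).toFun t x -
      iteratedDeriv 2 u.toFun x i * arcTerm α u.toFun x) := by
  have h := ((hasInt_opR hα hb u i (eM hα hb u (1 / 2) (-(2 + α) / 2)) t x).const_mul α).add
    ((hasInt_regX hα hb u hc hu t x).const_mul (iteratedDeriv 2 u.toFun x i))
  have h1 : (fun w => regVec hα hb u x w i) = fun w =>
      α * (avg (eM hα hb u (1 / 2) (-(2 + α) / 2)) x w * (oddWeight α w * remR u.toFun x w i)) +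
        iteratedDeriv 2 u.toFun x i * regX hα hb u x w := funext fun w => by
    simp only [regVec, PiLp.add_apply, PiLp.smul_apply, smul_eq_mul]
    ring
  rw [h1]
  refine ⟨h.1, h.2.trans ?_⟩
  rw [eY]
  simp only [UH.toFun_add, UH.toFun_mul, UH.toFun_smul, toFun_cF]
  ring

include hα hb in
theorem deriv_ne_zero_of_biLip (y : ℝ) : deriv u.toFun y ≠ 0 := norm_pos_iff.1 (hc.trans_le
    (le_norm_deriv_of_biLip hu ((u.contDiff_two hα hb).differentiable (by norm_num) y)))

omit hc hu in
theorem integral_regVec_aux (y : Fin n → ℝ) (g : ℝ → Eucl n)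
    (h : ∀ i, HasInt (fun w => g w i) (y i)) :
    IntegrableOn g symInterval ∧ ∫ w in symInterval, g w = WithLp.toLp 2 y := by
  refine ⟨Integrable.of_eval_piLp fun i => (h i).1, ?_⟩
  ext i
  rw [eval_integral_piLp fun i => (h i).1, (h i).2]

theorem toFun_baseMap (x : ℝ) : (baseMap hα hb u).toFun x =
    normalProj (deriv u.toFun x) (WithLp.toLp 2 fun i => (eY hα hb u i).toFun (0, 0) x) := by
  ext i
  rw [baseMap, toFun_toHolder, eZ, normalProj_eq, inner_eq_sum]
  simp only [UH.toFun_sub, UH.toFun_mul, UH.toFun_sum, UH.toFun_rpow (pow_pos hc 2)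
    (le_eV0 hα hb hc hu), toFun_eV0, toFun_cP, Real.rpow_neg_one, PiLp.sub_apply, PiLp.smul_apply,
    smul_eq_mul]
  ring

/-- Integrability gives the limit of the regular part, the odd part integrates to zero for every
`ε`, and the arc length part has the limit found in `tendsto_integral_arcDist`. Integrability on
each truncated domain is recorded because `H^α` and `Q^α` are later separated there. -/
theorem integrableOn_dIntegrand_and_tendsto (x : ℝ) :
    (∀ ε, 0 < ε → ε < 1 / 2 → IntegrableOn (dIntegrand α u.toFun x) (trunc ε)) ∧
      HasPV (dIntegrand α u.toFun x) ((baseMap hα hb u).toFun x) := by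
  have hreg := deriv_ne_zero_of_biLip hα hb u hc hu
  have hγ := u.contDiff_two hα hb
  obtain ⟨hi, hv⟩ := integral_regVec_aux _ (regVec hα hb u x)
    fun i => hasInt_regVec hα hb u hc hu i (0, 0) x
  have hi' : IntegrableOn (fun w => normalProjL (deriv u.toFun x) (regVec hα hb u x w))
    symInterval := (normalProjL (deriv u.toFun x)).integrable_comp hi
  set lam := (‖deriv u.toFun x‖ ^ 2) ^ (-(3 + α) / 2) *
        ((α - 2 - α ^ 2 / 2) * ⟪deriv u.toFun x, iteratedDeriv 2 u.toFun x⟫_ℝ) with hlam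
  set F := normalProj (deriv u.toFun x) (iteratedDeriv 2 u.toFun x) with hF
  set μ := (α - 2) * (‖deriv u.toFun x‖ ^ 2)⁻¹ with hμ
  set A := fun w => ‖deriv u.toFun x‖ ^ (1 - α) * |w| ^ (-α) -
          ‖deriv u.toFun (x + w)‖ * arcDist u.toFun (x + w) x ^ (-α) with hA
  have hodd : ContinuousOn (oddWeight α) {0}ᶜ := continuousOn_id.mul (continuousOn_abs_rpow _)
  have hAi : ∀ ε, 0 < ε → ε < 1 / 2 → IntegrableOn A (trunc ε) := fun ε h0 h1 =>
    ((integrableOn_trunc_of_continuousOn h0 h1 (continuousOn_abs_rpow _)).const_mul _).sub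
      (integrableOn_trunc_arcDist (hγ.of_le (by norm_num)) u.memC.periodic hreg x h0 h1)
  have hOi : ∀ ε, 0 < ε → ε < 1 / 2 → IntegrableOn (fun w => lam * oddWeight α w) (trunc ε) :=
    fun ε h0 h1 => (integrableOn_trunc_of_continuousOn h0 h1 hodd).const_mul _
  have hsub : ∀ ε, trunc ε ⊆ symInterval := fun ε => Set.sdiff_subset
  have heq : ∀ ε, 0 < ε → ∀ w ∈ trunc ε, dIntegrand α u.toFun x w =
      normalProjL (deriv u.toFun x) (regVec hα hb u x w) + (lam * oddWeight α w) • F +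
        (μ * A w) • F := fun ε h0 w hw =>
    dIntegrand_eq_reg hα hb u hc hu (abs_pos.1 (h0.trans (abs_pos_of_mem_trunc hw)))
      (abs_le.2 hw.1) x
  have hint : ∀ ε, 0 < ε → ε < 1 / 2 → IntegrableOn (fun w =>
      normalProjL (deriv u.toFun x) (regVec hα hb u x w) + (lam * oddWeight α w) • F +
        (μ * A w) • F) (trunc ε) := fun ε h0 h1 =>
    ((hi'.mono_set (hsub ε)).add ((hOi ε h0 h1).smul_const F)).add
      (((hAi ε h0 h1).const_mul μ).smul_const F)
  refine ⟨fun ε h0 h1 => (hint ε h0 h1).congr_fun (fun w hw => (heq ε h0 w hw).symm)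
    (measurableSet_trunc ε), ?_⟩
  have hlim := (tendsto_integral_trunc hi').add
    (((tendsto_integral_arcDist hα hγ u.memC.periodic (u.norm_iteratedDeriv_two_le hα hb)
      (lt_expH hα hb) expH_le_one (u.norm_iteratedDeriv_two_sub_le hα hb) hreg x).const_mul
        μ).smul_const F)
  have hval : (∫ w in symInterval, normalProjL (deriv u.toFun x) (regVec hα hb u x w)) +
      (μ * (2 ^ α / (α - 1) * ((∫ t in (0 : ℝ)..1, ‖deriv u.toFun t‖) ^ (1 - α) -
        ‖deriv u.toFun x‖ ^ (1 - α)))) • F = (baseMap hα hb u).toFun x := by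
    rw [(normalProjL (deriv u.toFun x)).integral_comp_comm hi, hv, toFun_baseMap hα hb u hc hu,
      hF, ← normalProjL_apply, ← normalProjL_apply, ← map_smul, ← map_add]
    congr 1
    ext i
    simp only [PiLp.add_apply, PiLp.smul_apply, smul_eq_mul, arcTerm, hμ]
    ring
  rw [hval] at hlim
  refine hlim.congr' ?_
  filter_upwards [eventually_trunc] with ε ⟨h0, h1⟩
  rw [setIntegral_congr_fun (measurableSet_trunc ε) (heq ε h0),
    integral_add (Integrable.fun_add (hi'.mono_set (hsub ε)) ((hOi ε h0 h1).smul_const F))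
      (((hAi ε h0 h1).const_mul μ).smul_const F),
    integral_add (hi'.mono_set (hsub ε)) ((hOi ε h0 h1).smul_const F), integral_smul_const,
    integral_smul_const, integral_const_mul, integral_const_mul,
    integral_trunc_odd h0 h1 hodd (fun w => by simp [oddWeight]), mul_zero, zero_smul, add_zero]

end PrincipalValue

/-! ### The lower order term as a pointwise limit -/

section LowerOrder

variable {n : ℕ}

/-- The lower order term `F^α γ`. -/
noncomputable def lowerOrder (α : ℝ) (γ : ℝ → Eucl n) (x : ℝ) : Eucl n :=
  limUnder (𝓝[>] (0 : ℝ)) fun ε => ∫ w in trunc ε, dIntegrand α γ x w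

theorem lowerOrder_eq {α : ℝ} {γ : ℝ → Eucl n} {x : ℝ} {v : Eucl n}
    (h : HasPV (dIntegrand α γ x) v) : lowerOrder α γ x = v :=
  h.limUnder_eq

/-- A pointwise limit knows nothing of `b`. Hence the maps obtained for different `b` are
restrictions of one and the same map. -/
theorem toFun_baseMap_eq_lowerOrder {α b : ℝ} (hα : α ∈ Set.Ioo (2 : ℝ) 3)
    (hb : b ∈ Set.Ioo (0 : ℝ) 1) {u : HolderSpace n (α + b)} (hu : IsBiLip u.toFun) :
    (baseMap hα hb u).toFun = lowerOrder α u.toFun := by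
  obtain ⟨c, hc, hu⟩ := hu
  exact funext fun x =>
    (lowerOrder_eq (integrableOn_dIntegrand_and_tendsto hα hb u hc hu x).2).symm

theorem arcDist_translate {γ : ℝ → Eucl n} (hp : Function.Periodic γ 1) (h x y : ℝ) :
    arcDist (fun z => γ (z + h)) x y = arcDist γ (x + h) (y + h) := by
  have hper : Function.Periodic (fun t => ‖deriv γ t‖) 1 := fun t => by
    simp only [periodic_deriv_of_periodic hp t]
  have h1 : ∀ a b : ℝ, ∫ t in a..b, ‖deriv (fun z => γ (z + h)) t‖ =
      ∫ t in (a + h)..(b + h), ‖deriv γ t‖ := fun a b => by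
    rw [← intervalIntegral.integral_comp_add_right (fun t => ‖deriv γ t‖) h]
    simp only [deriv_comp_add_const]
  rw [arcDist, arcDist, h1, h1, add_sub_add_right_eq_sub, add_right_comm x h, zero_add,
    add_comm 1 h, hper.intervalIntegral_add_eq h 0, zero_add]

theorem dIntegrand_translate (α : ℝ) {γ : ℝ → Eucl n} (hp : Function.Periodic γ 1) (h x w : ℝ) :
    dIntegrand α (fun z => γ (z + h)) x w = dIntegrand α γ (x + h) w := by
  have h1 : deriv (fun z => γ (z + h)) = fun z => deriv γ (z + h) :=
    funext fun z => deriv_comp_add_const γ h z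
  have h2 : iteratedDeriv 2 (fun z => γ (z + h)) x = iteratedDeriv 2 γ (x + h) :=
    congrFun (iteratedDeriv_comp_add_const 2 γ h) x
  have h3 : curvature (fun z => γ (z + h)) x = curvature γ (x + h) := by
    rw [curvature, curvature, h1]
    exact congrArg _ (deriv_comp_add_const (fun t => ‖deriv γ t‖⁻¹ • deriv γ t) h x)
  rw [dIntegrand, dIntegrand, hIntegrand, hIntegrand, qIntegrand, qIntegrand, remR, remR, h2, h3,
    arcDist_translate hp, h1]
  simp only [add_right_comm x w h]

/-- The integrand is expressed intrinsically in the curve, so moving the base point and translating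
the parametrization agree. This symmetry is the source of all higher regularity. -/
theorem lowerOrder_translate (α : ℝ) {γ : ℝ → Eucl n} (hp : Function.Periodic γ 1) (h x : ℝ) :
    lowerOrder α (fun z => γ (z + h)) x = lowerOrder α γ (x + h) := by
  simp only [lowerOrder, dIntegrand_translate α hp]

end LowerOrder

/-! ### Differentiability of translations in Hölder norms -/

section Translations

variable {n : ℕ} {α b b' : ℝ}

/-- Evaluation at a point. -/
noncomputable def HolderSpace.evalAt {s : ℝ} (x : ℝ) : HolderSpace n s →L[ℝ] Eucl n :=
  LinearMap.mkContinuous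
    { toFun := fun u => u.toFun x
      map_add' := fun _ _ => rfl
      map_smul' := fun _ _ => rfl } 1 fun u => by
    rw [one_mul]; exact u.norm_apply_le x

/-- Mean value inequality in the increment. Taking the difference at two base points turns it into
an estimate for the Hölder seminorm of the error of linearization. -/
theorem norm_increment_le {g g' : ℝ → Eucl n} (hg : ∀ z, HasDerivAt g (g' z) z) {x y h C : ℝ}
    (hC : ∀ k, |k| ≤ |h| → ‖g' (x + k) - g' (y + k) - (g' x - g' y)‖ ≤ C) :
    ‖g (x + h) - g (y + h) - (g x - g y) - h • (g' x - g' y)‖ ≤ C * |h| := by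
  have hd : ∀ k ∈ Set.uIcc 0 h, HasDerivWithinAt
      (fun k => g (x + k) - g (y + k) - k • (g' x - g' y))
      (g' (x + k) - g' (y + k) - (g' x - g' y)) (Set.uIcc 0 h) k := fun k _ => by
    have h1 := ((hg (x + k)).comp_const_add x k).sub ((hg (y + k)).comp_const_add y k)
    have h2 := h1.sub ((hasDerivAt_id k).smul_const (g' x - g' y))
    rw [one_smul] at h2
    exact h2.hasDerivWithinAt
  have := Convex.norm_image_sub_le_of_norm_hasDerivWithin_le (C := C) hd (fun k hk => hC k (by
    simpa using Set.abs_sub_left_of_mem_uIcc hk)) (convex_uIcc _ _) Set.left_mem_uIcc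
    Set.right_mem_uIcc
  rw [sub_zero, Real.norm_eq_abs] at this
  refine le_trans (le_of_eq ?_) this
  congr 1
  simp only [add_zero, zero_smul, sub_zero]
  abel

theorem norm_increment_le' {g g' : ℝ → Eucl n} (hg : ∀ z, HasDerivAt g (g' z) z) {x h C : ℝ}
    (hC : ∀ k, |k| ≤ |h| → ‖g' (x + k) - g' x‖ ≤ C) :
    ‖g (x + h) - g x - h • g' x‖ ≤ C * |h| := by
  have hd : ∀ k ∈ Set.uIcc 0 h, HasDerivWithinAt
      (fun k => g (x + k) - k • g' x) (g' (x + k) - g' x) (Set.uIcc 0 h) k := fun k _ => by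
    have h2 := ((hg (x + k)).comp_const_add x k).sub ((hasDerivAt_id k).smul_const (g' x))
    rw [one_smul] at h2
    exact h2.hasDerivWithinAt
  have := Convex.norm_image_sub_le_of_norm_hasDerivWithin_le (C := C) hd (fun k hk => hC k (by
    simpa using Set.abs_sub_left_of_mem_uIcc hk)) (convex_uIcc _ _) Set.left_mem_uIcc
    Set.right_mem_uIcc
  rw [sub_zero, Real.norm_eq_abs] at this
  refine le_trans (le_of_eq ?_) this
  congr 1
  simp only [add_zero, zero_smul, sub_zero]
  abel

/-- Translations of a smoother curve are differentiable with respect to the translation. -/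
theorem hasDerivAt_translate (hα : α ∈ Set.Ioo (2 : ℝ) 3) (hb : b ∈ Set.Ioo (0 : ℝ) 1)
    (hbb : b < b') (hb' : b' ∈ Set.Ioo (0 : ℝ) 1) (hαb' : α + b' < 3)
    (v : HolderSpace n (α + b)) (v' : HolderSpace n (α + b')) (hv : ContDiff ℝ 3 v.toFun)
    (hvv : v'.toFun = deriv v.toFun) :
    HasDerivAt (fun h : ℝ => HolderSpace.translate h v)
      (HolderSpace.incl (by linarith [hα.1, hb.1]) (by linarith) v') 0 := by
  obtain ⟨f1, f2, -⟩ := floor_fract_of_lt hα hb (by linarith)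
  obtain ⟨f1', f2', -⟩ := floor_fract_of_lt hα hb' hαb'
  have he : expH α b = α - 2 + b := min_eq_right (by linarith)
  have he' : expH α b' = α - 2 + b' := min_eq_right (by linarith)
  have hder : ∀ j ≤ 2, ∀ z, HasDerivAt (iteratedDeriv j v.toFun) (iteratedDeriv j v'.toFun z) z := by
    intro j hj z
    have h1 : Differentiable ℝ (iteratedDeriv j v.toFun) :=
      hv.differentiable_iteratedDeriv j (by exact_mod_cast (by omega : j < 3))
    have h2 := (h1 z).hasDerivAt
    rwa [← iteratedDeriv_succ, iteratedDeriv_succ', ← hvv] at h2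
  have hN : 0 ≤ ‖v'‖ := norm_nonneg _
  have hosc : ∀ j ≤ 2, ∀ z k h : ℝ, |k| ≤ |h| → |h| ≤ 1 →
      ‖iteratedDeriv j v'.toFun (z + k) - iteratedDeriv j v'.toFun z‖ ≤
        ‖v'‖ * |h| ^ (α - 2 + b') := by
    intro j hj z k h hk hh
    have hpow : |k| ^ (α - 2 + b') ≤ |h| ^ (α - 2 + b') :=
      Real.rpow_le_rpow (abs_nonneg _) hk (by linarith [hα.1, hb'.1])
    refine le_trans ?_ (mul_le_mul_of_nonneg_left hpow hN)
    rcases hj.eq_or_lt with rfl | hj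
    · have := v'.norm_iteratedDeriv_sub_le (z + k) z
      rwa [f1', f2', he', add_sub_cancel_left] at this
    · have := norm_sub_le_of_iteratedDeriv_bound (j := j) (M := ‖v'‖)
        ((v'.contDiff_two hα hb').of_le (by exact_mod_cast (by omega : j + 1 ≤ 2)))
        (fun y => v'.norm_iteratedDeriv_le (by rw [f1']; omega) y) (z + k) z
      rw [add_sub_cancel_left] at this
      refine this.trans (mul_le_mul_of_nonneg_left ?_ hN)
      conv_lhs => rw [← Real.rpow_one |k|]
      rcases eq_or_ne k 0 with rfl | hk0
      · rw [abs_zero, Real.zero_rpow one_ne_zero]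
        positivity
      · exact Real.rpow_le_rpow_of_exponent_ge (abs_pos.2 hk0) (hk.trans hh)
          (by linarith)
  -- Interpolation of the exponent `α - 2 + b'`: if `|x - y| ≤ |h|`, the Hölder bound in `x - y` is
  -- used and the surplus `b' - b` is passed to `|h|`; otherwise the bound in `h` is used and the
  -- part `α - 2 + b` is passed to `|x - y|`. The gain `|h|^{b'-b}` is why the target norm has to be
  -- weaker.
  have hosc2 : ∀ x y k h : ℝ, |k| ≤ |h| → |h| ≤ 1 →
      ‖iteratedDeriv 2 v'.toFun (x + k) - iteratedDeriv 2 v'.toFun (y + k) -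
        (iteratedDeriv 2 v'.toFun x - iteratedDeriv 2 v'.toFun y)‖ ≤
        2 * ‖v'‖ * |h| ^ (b' - b) * |x - y| ^ (α - 2 + b) := by
    intro x y k h hk hh
    have e1 := v'.norm_iteratedDeriv_sub_le (x + k) (y + k)
    have e2 := v'.norm_iteratedDeriv_sub_le x y
    rw [f1', f2', he'] at e1 e2
    rw [add_sub_add_right_eq_sub] at e1
    have e3 := hosc 2 le_rfl x k h hk hh
    have e4 := hosc 2 le_rfl y k h hk hh
    rcases eq_or_ne h 0 with rfl | hh0
    · rw [abs_zero] at hk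
      have : k = 0 := abs_eq_zero.1 (le_antisymm hk (abs_nonneg _))
      rw [this, add_zero, add_zero, sub_self, norm_zero]
      positivity
    have hh0' : 0 < |h| := abs_pos.2 hh0
    rcases le_total |x - y| |h| with hxy | hxy
    · rcases eq_or_ne x y with rfl | hxy0
      · rw [sub_self, sub_self, sub_self, norm_zero]
        positivity
      have hxy0' : 0 < |x - y| := abs_pos.2 (sub_ne_zero.2 hxy0)
      refine (norm_sub_le _ _).trans ((add_le_add e1 e2).trans ?_)
      rw [show α - 2 + b' = (b' - b) + (α - 2 + b) by ring, Real.rpow_add hxy0']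
      have : |x - y| ^ (b' - b) ≤ |h| ^ (b' - b) :=
        Real.rpow_le_rpow (abs_nonneg _) hxy (by linarith)
      have h5 : 0 ≤ |x - y| ^ (α - 2 + b) := by positivity
      have h6 := mul_le_mul_of_nonneg_right this h5
      nlinarith
    · refine le_trans (le_of_eq ?_) ((norm_sub_le _ _).trans ((add_le_add e3 e4).trans ?_))
      · congr 1; abel
      rw [show α - 2 + b' = (b' - b) + (α - 2 + b) by ring, Real.rpow_add hh0']
      have : |h| ^ (α - 2 + b) ≤ |x - y| ^ (α - 2 + b) :=
        Real.rpow_le_rpow (abs_nonneg _) hxy (by linarith [hα.1, hb.1])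
      have h5 : 0 ≤ |h| ^ (b' - b) := by positivity
      have h6 := mul_le_mul_of_nonneg_left this h5
      nlinarith
  have hiter : ∀ (h : ℝ), ∀ j ≤ 2, ∀ x,
      iteratedDeriv j (fun x => v.toFun (x + h) - v.toFun x - h • v'.toFun x) x =
        iteratedDeriv j v.toFun (x + h) - iteratedDeriv j v.toFun x -
          h • iteratedDeriv j v'.toFun x := by
    intro h j hj x
    have c1 : ContDiff ℝ j v.toFun := hv.of_le (by exact_mod_cast (by omega : j ≤ 3))
    have c2 : ContDiff ℝ j v'.toFun :=
      (v'.contDiff_two hα hb').of_le (by exact_mod_cast hj)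
    have c3 : ContDiff ℝ j fun x => v.toFun (x + h) := c1.comp (contDiff_id.add contDiff_const)
    have c4 : ContDiff ℝ j fun x => h • v'.toFun x := ContDiff.fun_smul contDiff_const c2
    rw [iteratedDeriv_fun_sub (c3.sub c1).contDiffAt c4.contDiffAt,
      iteratedDeriv_fun_sub c3.contDiffAt c1.contDiffAt,
      iteratedDeriv_fun_const_smul c2.contDiffAt, iteratedDeriv_comp_add_const]
  rw [hasDerivAt_iff_isLittleO_nhds_zero]
  refine Asymptotics.IsLittleO.of_bound fun ε hε => ?_
  have hlim : Tendsto (fun h : ℝ => 3 * (‖v'‖ * |h| ^ (α - 2 + b')) + 2 * ‖v'‖ * |h| ^ (b' - b))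
      (𝓝 0) (𝓝 0) := by
    have h1 : ∀ p : ℝ, 0 < p → Tendsto (fun h : ℝ => |h| ^ p) (𝓝 0) (𝓝 0) := fun p hp => by
      have := (continuous_abs.rpow_const (p := p) fun _ => Or.inr hp.le).tendsto (0 : ℝ)
      simpa [Real.zero_rpow hp.ne'] using this
    have := (((h1 (α - 2 + b') (by linarith [hα.1, hb'.1])).const_mul ‖v'‖).const_mul 3).add
      ((h1 (b' - b) (by linarith)).const_mul (2 * ‖v'‖))
    simpa using this
  have hle1 : ∀ᶠ h : ℝ in 𝓝 0, |h| < 1 :=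
    (continuous_abs.tendsto' (0 : ℝ) 0 abs_zero).eventually_lt_const one_pos
  filter_upwards [hlim.eventually_lt_const hε, hle1] with h hh hh1
  have hfun : (HolderSpace.translate (0 + h) v - HolderSpace.translate 0 v -
      h • HolderSpace.incl (by linarith [hα.1, hb.1]) (by linarith) v').toFun =
      fun x => v.toFun (x + h) - v.toFun x - h • v'.toFun x := by
    funext x
    simp [HolderSpace.toFun_sub, HolderSpace.toFun_smul, HolderSpace.translate]
  rw [HolderSpace.norm_def, hfun]
  refine (holderNorm_le (M := ‖v'‖ * |h| ^ (α - 2 + b') * |h|)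
    (K := 2 * ‖v'‖ * |h| ^ (b' - b) * |h|) (by positivity) (fun j hj x => ?_)
    fun x y => ?_).trans ?_
  · rw [f1] at hj
    rw [hiter h j hj]
    exact norm_increment_le' (hder j hj) fun k hk => hosc j hj x k h hk hh1.le
  · rw [f1, f2, he, hiter h 2 le_rfl, hiter h 2 le_rfl]
    have := norm_increment_le (hder 2 le_rfl) (x := x) (y := y) (h := h)
      fun k hk => hosc2 x y k h hk hh1.le
    refine le_trans (le_of_eq ?_) (this.trans (le_of_eq (by ring)))
    congr 1
    module
  · rw [f1, Real.norm_eq_abs]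
    have := mul_le_mul_of_nonneg_right hh.le (abs_nonneg h)
    push_cast
    linarith

end Translations

/-! ### Induction on the regularity -/

section Induction

variable {n : ℕ} {α : ℝ}

/-- The lower order term is an analytic map from `C^s` to `C^β`. -/
def IsAnalyticLowerOrder (n : ℕ) (α s β : ℝ) : Prop :=
  ∃ G : HolderSpace n s → HolderSpace n β,
    (∀ u : HolderSpace n s, IsBiLip u.toFun → (G u).toFun = lowerOrder α u.toFun) ∧
      AnalyticOnNhd ℝ G {u | IsBiLip u.toFun}

theorem isAnalyticLowerOrder_base (hα : α ∈ Set.Ioo (2 : ℝ) 3) {b : ℝ}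
    (hb : b ∈ Set.Ioo (0 : ℝ) 1) : IsAnalyticLowerOrder n α (α + b) b :=
  ⟨baseMap hα hb, fun _ hu => toFun_baseMap_eq_lowerOrder hα hb hu,
    fun _ hu => analyticAt_baseMap hα hb hu⟩

/-- Differentiating `F(v(· + h)) = (Fv)(· + h)` at `h = 0` gives `(Fv)' = DF(v) v'`. Translations
are shown to be differentiable only in a weaker norm, so the chain rule is applied to `baseMap` from
`C^{α+b}` to `C^b` with small `b`. The result is carried back to `G` because both maps agree near
`v` and derivatives are unique. -/
theorem hasDerivAt_lowerOrder (hα : α ∈ Set.Ioo (2 : ℝ) 3) {s β : ℝ} (hβ : 0 < β)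
    (hs : s = α + β) {G : HolderSpace n s → HolderSpace n β}
    (hG : ∀ u : HolderSpace n s, IsBiLip u.toFun → (G u).toFun = lowerOrder α u.toFun)
    (hGa : AnalyticOnNhd ℝ G {u | IsBiLip u.toFun}) {v w : HolderSpace n s}
    (hv : IsBiLip v.toFun) (hv3 : ContDiff ℝ 3 v.toFun) (hw : w.toFun = deriv v.toFun) (x : ℝ) :
    HasDerivAt (lowerOrder α v.toFun) ((fderiv ℝ G v w).toFun x) x := by
  -- `b' < β` lets `v'` be regarded as an element of `C^{α+b'}`, and `b' < 3 - α` keeps `⌊α + b'⌋ =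
  -- 2`, the range of `hasDerivAt_translate`. A smaller `b > 0` then supplies the weaker target
  -- norm.
  obtain ⟨b', hb', hb'β⟩ : ∃ b', 0 < b' ∧ b' < min β (3 - α) := exists_between
    (lt_min hβ (by linarith [hα.2]))
  have hb'3 : α + b' < 3 := by linarith [hb'β.trans_le (min_le_right _ _)]
  have hb'm : b' ∈ Set.Ioo (0 : ℝ) 1 := ⟨hb', by linarith [hα.1]⟩
  have hb'β : b' < β := hb'β.trans_le (min_le_left _ _)
  obtain ⟨b, hb0, hbb⟩ := exists_between hb'
  have hbm : b ∈ Set.Ioo (0 : ℝ) 1 := ⟨hb0, by linarith [hb'm.2]⟩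
  have h0 : 0 ≤ α + b := by linarith [hα.1]
  set ι : HolderSpace n s →L[ℝ] HolderSpace n (α + b) := HolderSpace.incl h0 (by linarith) with hι
  set j : HolderSpace n β →L[ℝ] HolderSpace n b := HolderSpace.incl hb0.le (by linarith) with hj
  have hcomm : (fun u => j (G u)) =ᶠ[𝓝 v] fun u => baseMap hα hbm (ι u) := by
    filter_upwards [(isOpen_isBiLip (n := n) (s := s) (by linarith [hα.1])).mem_nhds hv]
      with u hu
    refine HolderSpace.ext fun y => ?_
    rw [hj, HolderSpace.toFun_incl, hG u hu, toFun_baseMap_eq_lowerOrder hα hbm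
      (by rw [hι, HolderSpace.toFun_incl]; exact hu), hι, HolderSpace.toFun_incl]
  have hBd := (analyticAt_baseMap hα hbm (u := ι v)
    (by rw [hι, HolderSpace.toFun_incl]; exact hv)).differentiableAt.hasFDerivAt
  have hGd := (hGa v hv).differentiableAt.hasFDerivAt
  have hd1 : HasFDerivAt (fun u => j (G u)) (j ∘L fderiv ℝ G v) v :=
    j.hasFDerivAt.comp v hGd
  have hd2 : HasFDerivAt (fun u => baseMap hα hbm (ι u))
      (fderiv ℝ (baseMap hα hbm) (ι v) ∘L ι) v := hBd.comp v ι.hasFDerivAt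
  have heq := DFunLike.congr_fun ((hd1.congr_of_eventuallyEq hcomm.symm).unique hd2) w
  have htr := hasDerivAt_translate hα hbm hbb hb'm hb'3 (ι v)
    (HolderSpace.incl (by linarith [hα.1]) (by linarith) w)
    (by rw [hι, HolderSpace.toFun_incl]; exact hv3)
    (by rw [hι, HolderSpace.toFun_incl, HolderSpace.toFun_incl]; exact hw)
  have htv : HolderSpace.translate 0 (ι v) = ι v :=
    HolderSpace.ext fun y => by simp [HolderSpace.translate]
  rw [← htv] at hBd
  have hcomp := (HolderSpace.evalAt (n := n) (s := b) x).hasFDerivAt.comp_hasDerivAt (0 : ℝ)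
    (hBd.comp_hasDerivAt (0 : ℝ) htr)
  have hfun : (fun h => lowerOrder α v.toFun (x + h)) = fun h =>
      HolderSpace.evalAt x (baseMap hα hbm (HolderSpace.translate h (ι v))) := by
    funext h
    have hbl : IsBiLip (HolderSpace.translate h (ι v)).toFun := by
      obtain ⟨c, hc, hcv⟩ := hv
      refine ⟨c, hc, fun y w hw => ?_⟩
      have := hcv (y + h) w hw
      rw [add_right_comm] at this
      exact this
    have h1 : (HolderSpace.translate h (ι v)).toFun = fun z => v.toFun (z + h) := rfl
    change _ = (baseMap hα hbm (HolderSpace.translate h (ι v))).toFun x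
    rw [toFun_baseMap_eq_lowerOrder hα hbm hbl, h1, lowerOrder_translate α v.memC.periodic]
  have hval : HolderSpace.evalAt x (fderiv ℝ (baseMap hα hbm) (HolderSpace.translate 0 (ι v))
      (HolderSpace.incl (by linarith [hα.1]) (by linarith)
        (HolderSpace.incl (s' := α + b') (by linarith [hα.1]) (by linarith) w))) =
      (fderiv ℝ G v w).toFun x := by
    rw [htv]
    have h1 : HolderSpace.incl (s := α + b') (s' := α + b) (by linarith [hα.1]) (by linarith)
        (HolderSpace.incl (s' := α + b') (by linarith [hα.1]) (by linarith) w) = ι w :=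
      HolderSpace.ext fun y => rfl
    rw [h1]
    exact congrArg (fun z : HolderSpace n b => z.toFun x) heq.symm
  rw [hval] at hcomp
  have h2 : HasDerivAt (fun h => lowerOrder α v.toFun (x + h)) ((fderiv ℝ G v w).toFun x) 0 := by
    rw [hfun]
    exact hcomp
  have h3 : HasDerivAt (fun y => y - x) 1 x := (hasDerivAt_id x).sub_const x
  have h4 := HasDerivAt.scomp (h := fun y => y - x) x (by rw [sub_self]; exact h2) h3
  rw [one_smul] at h4
  refine h4.congr_of_eventuallyEq (Eventually.of_forall fun y => ?_)
  simp

/-- By `hasDerivAt_lowerOrder` the derivative of `Fu` is `DG(u) u'`, which is analytic in `u ∈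
C^{s+1}` with values in `C^β`. Since `primitiveL` is bounded and linear, reassembling `Fu` from `Fu`
and its derivative gains one order and keeps analyticity. -/
theorem isAnalyticLowerOrder_succ (hα : α ∈ Set.Ioo (2 : ℝ) 3) {s β : ℝ} (hβ : 0 < β)
    (hs : s = α + β) (h : IsAnalyticLowerOrder n α s β) :
    IsAnalyticLowerOrder n α (s + 1) (β + 1) := by
  obtain ⟨G, hG, hGa⟩ := h
  have hs0 : 0 ≤ s := by linarith [hα.1]
  set ι : HolderSpace n (s + 1) →L[ℝ] HolderSpace n s := HolderSpace.incl hs0 (by linarith) with hι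
  have hιf : ∀ u, (ι u).toFun = u.toFun := fun u => HolderSpace.toFun_incl _ _ u
  set D : HolderSpace n (s + 1) →L[ℝ] HolderSpace n s := HolderSpace.derivL hs0
  refine ⟨fun u => HolderSpace.primitiveL hβ.le (G (ι u), fderiv ℝ G (ι u) (D u)),
    fun u hu => ?_, fun u hu => ?_⟩
  · have hu' : IsBiLip (ι u).toFun := by rwa [hιf]
    have h3 : ContDiff ℝ 3 (ι u).toFun := by
      rw [hιf]
      refine u.memC.contDiff.of_le ?_
      have : 3 ≤ ⌊s + 1⌋₊ := Nat.le_floor (by push_cast; linarith [hα.1])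
      exact_mod_cast this
    have hd := hasDerivAt_lowerOrder hα hβ hs hG hGa (w := D u) hu' h3
      (by rw [hιf]; exact HolderSpace.toFun_derivL hs0 u)
    rw [HolderSpace.toFun_primitiveL]
    simp only
    rw [hG (ι u) hu', hιf] at *
    refine primitive_eq_of_hasDerivAt (HolderSpace.continuous _) (fun x => ?_) hd
    have h4 := (G (ι u)).memC.periodic x
    rwa [hG (ι u) hu', hιf] at h4
  · have hu' : ι u ∈ {u : HolderSpace n s | IsBiLip u.toFun} := by
      change IsBiLip (ι u).toFun
      rwa [hιf]
    have h1 : AnalyticAt ℝ (fun u => G (ι u)) u := (hGa _ hu').fun_comp (ι.analyticAt u)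
    have h2 : AnalyticAt ℝ (fun u => fderiv ℝ G (ι u)) u :=
      (hGa.fderiv_of_isOpen (isOpen_isBiLip (by linarith [hα.1])) _ hu').fun_comp (ι.analyticAt u)
    have h3 : AnalyticAt ℝ (fun u => fderiv ℝ G (ι u) (D u)) u :=
      ((ContinuousLinearMap.id ℝ (HolderSpace n s →L[ℝ] HolderSpace n β)).analyticAt_bilinear
        (fderiv ℝ G (ι u), D u)).comp₂ h2 (D.analyticAt u)
    exact ((HolderSpace.primitiveL hβ.le).analyticAt _).fun_comp (h1.prod h3)

theorem isAnalyticLowerOrder (hα : α ∈ Set.Ioo (2 : ℝ) 3) {β : ℝ} (hβ : 0 < β)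
    (hβn : ∀ m : ℕ, β ≠ m) : IsAnalyticLowerOrder n α (α + β) β := by
  have hk : ∀ (b : ℝ), b ∈ Set.Ioo (0 : ℝ) 1 → ∀ k : ℕ,
      IsAnalyticLowerOrder n α (α + (b + k)) (b + k) := by
    intro b hb k
    induction k with
    | zero => simpa using isAnalyticLowerOrder_base hα hb
    | succ k ih =>
      have := isAnalyticLowerOrder_succ hα (by linarith [hb.1, k.cast_nonneg (α := ℝ)]) rfl ih
      rwa [show α + (b + k) + 1 = α + (b + (k + 1 : ℕ)) by push_cast; ring,
        show b + k + 1 = b + (k + 1 : ℕ) by push_cast; ring] at this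
  have h1 : (⌊β⌋₊ : ℝ) ≤ β := Nat.floor_le hβ.le
  have h2 : β < ⌊β⌋₊ + 1 := Nat.lt_floor_add_one β
  have := hk (β - ⌊β⌋₊) ⟨sub_pos.2 (lt_of_le_of_ne h1 (hβn _).symm), by linarith⟩ ⌊β⌋₊
  rwa [sub_add_cancel] at this

end Induction

/-! ### Characters of the circle and Parseval's formula -/

section Exponentials

/-- The angular frequency `2πk`. -/
noncomputable def freq (k : ℤ) : ℝ := 2 * Real.pi * k

/-- The character `x ↦ exp(2πikx)` of the circle. -/
noncomputable def expo (k : ℤ) (x : ℝ) : ℂ := Complex.exp ((freq k * x : ℝ) * Complex.I)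

theorem norm_expo (k : ℤ) (x : ℝ) : ‖expo k x‖ = 1 := Complex.norm_exp_ofReal_mul_I _

theorem expo_add (k : ℤ) (x y : ℝ) : expo k (x + y) = expo k x * expo k y := by
  rw [expo, expo, expo, ← Complex.exp_add]
  congr 1
  push_cast
  ring

theorem expo_eq_cos_add (k : ℤ) (w : ℝ) :
    expo k w = Real.cos (freq k * w) + Real.sin (freq k * w) * Complex.I := by
  rw [expo, Complex.exp_mul_I, Complex.ofReal_cos, Complex.ofReal_sin]

theorem expo_neg_eq (k : ℤ) (w : ℝ) :
    expo k (-w) = Real.cos (freq k * w) - Real.sin (freq k * w) * Complex.I := by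
  rw [expo_eq_cos_add, mul_neg, Real.cos_neg, Real.sin_neg]
  push_cast
  ring

theorem expo_mul_conj (k l : ℤ) (x : ℝ) :
    expo k x * (starRingEnd ℂ) (expo l x) = expo (k - l) x := by
  rw [expo, expo, expo, ← Complex.exp_conj, ← Complex.exp_add]
  congr 1
  simp only [map_mul, Complex.conj_ofReal, Complex.conj_I, freq]
  push_cast
  ring

theorem continuous_expo (k : ℤ) : Continuous (expo k) := by
  unfold expo; fun_prop

theorem hasDerivAt_expo (k : ℤ) (x : ℝ) :
    HasDerivAt (expo k) (freq k * Complex.I * expo k x) x := by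
  have h1 : HasDerivAt (fun x : ℝ => freq k * x) (freq k) x := by
    simpa using (hasDerivAt_id x).const_mul (freq k)
  have h2 := (h1.ofReal_comp.mul_const Complex.I).cexp
  refine h2.congr_deriv ?_
  rw [expo, mul_comm]

theorem norm_expo_sub_le (k : ℤ) (x y : ℝ) : ‖expo k x - expo k y‖ ≤ |freq k| * |x - y| := by
  have h1 : expo k x - expo k y = expo k y * (Complex.exp (Complex.I * (freq k * (x - y) : ℝ)) - 1) := by
    rw [mul_sub, mul_one, mul_comm Complex.I, show Complex.exp ((freq k * (x - y) : ℝ) * Complex.I)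
      = expo k (x - y) from rfl, ← expo_add, add_sub_cancel]
  rw [h1, norm_mul, norm_expo, one_mul]
  refine (Real.norm_exp_I_mul_ofReal_sub_one_le).trans ?_
  rw [Real.norm_eq_abs, abs_mul]

/-- Interpolation between the Lipschitz bound `|freq k| |x - y|` and the trivial bound `2`. -/
theorem norm_expo_sub_le_rpow {θ : ℝ} (h0 : 0 ≤ θ) (h1 : θ ≤ 1) (k : ℤ) (x y : ℝ) :
    ‖expo k x - expo k y‖ ≤ 2 * |freq k| ^ θ * |x - y| ^ θ := by
  rw [mul_assoc, ← Real.mul_rpow (abs_nonneg _) (abs_nonneg _)]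
  have hle := norm_expo_sub_le k x y
  set t := |freq k| * |x - y|
  have ht : 0 ≤ t := by positivity
  rcases le_total t 1 with h | h
  · have := Real.rpow_le_rpow_of_exponent_ge' ht h h0 h1
    rw [Real.rpow_one] at this
    linarith
  · have h2 : ‖expo k x - expo k y‖ ≤ 2 := by
      refine (norm_sub_le _ _).trans ?_
      rw [norm_expo, norm_expo]; norm_num
    have := Real.one_le_rpow h h0
    linarith

theorem fourier_eq_expo (k : ℤ) (x : ℝ) : (fourier k (x : AddCircle (1 : ℝ)) : ℂ) = expo k x := by
  rw [fourier_coe_apply, expo, freq]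
  congr 1
  push_cast
  ring

theorem freq_zero : freq 0 = 0 := by simp [freq]

theorem one_le_abs_freq {k : ℤ} (hk : k ≠ 0) : 1 ≤ |freq k| := by
  have h1 : (1 : ℝ) ≤ |(k : ℝ)| := by exact_mod_cast Int.one_le_abs hk
  rw [freq, abs_mul, abs_of_pos Real.two_pi_pos]
  nlinarith [Real.two_le_pi]

theorem integral_expo (k : ℤ) : ∫ x in (0 : ℝ)..1, expo k x = if k = 0 then 1 else 0 := by
  split_ifs with h
  · simp [h, expo, freq]
  · have hf : freq k ≠ 0 := fun h0 => by
      have := one_le_abs_freq h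
      rw [h0, abs_zero] at this
      linarith
    have h1 : ∀ x ∈ Set.uIcc (0 : ℝ) 1,
        HasDerivAt (fun x => expo k x / (freq k * Complex.I)) (expo k x) x := fun x _ => by
      have := (hasDerivAt_expo k x).div_const (freq k * Complex.I)
      rwa [mul_div_cancel_left₀] at this
      exact mul_ne_zero (by exact_mod_cast hf) Complex.I_ne_zero
    rw [intervalIntegral.integral_eq_sub_of_hasDerivAt h1 ((continuous_expo k).intervalIntegrable _ _)]
    have h2 : expo k 1 = expo k 0 := by
      rw [expo, expo, Complex.exp_eq_exp_iff_exists_int]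
      exact ⟨k, by rw [freq]; push_cast; ring⟩
    rw [h2, sub_self]

theorem integral_norm_sq_sum (S : Finset ℤ) (a : ℤ → ℂ) :
    ∫ x in (0 : ℝ)..1, ‖∑ k ∈ S, a k * expo k x‖ ^ 2 = ∑ k ∈ S, ‖a k‖ ^ 2 := by
  have h1 : ∀ x, ((‖∑ k ∈ S, a k * expo k x‖ ^ 2 : ℝ) : ℂ) =
      ∑ k ∈ S, ∑ l ∈ S, a k * (starRingEnd ℂ) (a l) * expo (k - l) x := fun x => by
    rw [Complex.ofReal_pow, ← Complex.mul_conj', map_sum, Finset.sum_mul_sum]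
    refine Finset.sum_congr rfl fun k _ => Finset.sum_congr rfl fun l _ => ?_
    rw [map_mul, ← expo_mul_conj]
    ring
  have h2 : ((∫ x in (0 : ℝ)..1, ‖∑ k ∈ S, a k * expo k x‖ ^ 2 : ℝ) : ℂ) =
      ((∑ k ∈ S, ‖a k‖ ^ 2 : ℝ) : ℂ) := by
    rw [← intervalIntegral.integral_ofReal]
    simp only [h1]
    have hc : ∀ k l, Continuous fun x => a k * (starRingEnd ℂ) (a l) * expo (k - l) x :=
      fun k l => continuous_const.mul (continuous_expo _)
    rw [intervalIntegral.integral_finsetSum fun k _ =>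
      (continuous_finsetSum _ fun l _ => hc k l).intervalIntegrable _ _]
    push_cast
    refine Finset.sum_congr rfl fun k hk => ?_
    rw [intervalIntegral.integral_finsetSum fun l _ => (hc k l).intervalIntegrable _ _,
      Finset.sum_eq_single k]
    · rw [intervalIntegral.integral_const_mul, sub_self, integral_expo, if_pos rfl, mul_one,
        Complex.mul_conj']
    · intro l _ hl
      rw [intervalIntegral.integral_const_mul, integral_expo, if_neg (sub_ne_zero.2 hl.symm),
        mul_zero]
    · exact fun h => (h hk).elim
  exact_mod_cast h2

/-- Parseval for trigonometric polynomials together with Fatou's lemma; this direction of Parseval's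
formula suffices. -/
theorem lintegral_tsum_expo_le {a : ℤ → ℂ} (ha : Summable fun k => ‖a k‖) :
    ∫⁻ x in Set.Ioc (0 : ℝ) 1, ‖∑' k, a k * expo k x‖ₑ ^ 2 ≤ ∑' k, ‖a k‖ₑ ^ 2 := by
  have hc : ∀ S : Finset ℤ, Continuous fun x => ∑ k ∈ S, a k * expo k x := fun S =>
    continuous_finsetSum _ fun k _ => continuous_const.mul (continuous_expo k)
  have hfin : ∀ S : Finset ℤ, ∫⁻ x in Set.Ioc (0 : ℝ) 1, ‖∑ k ∈ S, a k * expo k x‖ₑ ^ 2 =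
      ∑ k ∈ S, ‖a k‖ₑ ^ 2 := fun S => by
    have h1 := integral_norm_sq_sum S a
    rw [intervalIntegral.integral_of_le zero_le_one] at h1
    have h2 := ofReal_integral_eq_lintegral_ofReal (μ := volume.restrict (Set.Ioc (0 : ℝ) 1))
      (f := fun x => ‖∑ k ∈ S, a k * expo k x‖ ^ 2)
      ((hc S).norm.fun_pow 2).integrableOn_Ioc (Eventually.of_forall fun x => by positivity)
    rw [h1, ENNReal.ofReal_sum_of_nonneg fun _ _ => by positivity] at h2
    simp only [ENNReal.ofReal_pow (norm_nonneg _), ofReal_norm] at h2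
    exact h2.symm
  have hlim : ∀ x, Tendsto (fun S : Finset ℤ => ‖∑ k ∈ S, a k * expo k x‖ₑ ^ 2) atTop
      (𝓝 (‖∑' k, a k * expo k x‖ₑ ^ 2)) := fun x => by
    have hs : Summable fun k => a k * expo k x := Summable.of_norm_bounded ha fun k => by
      rw [norm_mul, norm_expo, mul_one]
    exact ((ENNReal.continuous_pow 2).tendsto _).comp hs.hasSum.enorm
  calc ∫⁻ x in Set.Ioc (0 : ℝ) 1, ‖∑' k, a k * expo k x‖ₑ ^ 2
      = ∫⁻ x in Set.Ioc (0 : ℝ) 1, liminf (fun S : Finset ℤ =>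
          ‖∑ k ∈ S, a k * expo k x‖ₑ ^ 2) atTop := by
        simp only [(hlim _).liminf_eq]
    _ ≤ liminf (fun S : Finset ℤ => ∫⁻ x in Set.Ioc (0 : ℝ) 1,
          ‖∑ k ∈ S, a k * expo k x‖ₑ ^ 2) atTop :=
        lintegral_liminf_le' fun S => ((hc S).measurable.enorm.pow_const 2).aemeasurable
    _ ≤ ∑' k, ‖a k‖ₑ ^ 2 := by
        simp only [hfin]
        exact (ENNReal.summable.hasSum (f := fun k => ‖a k‖ₑ ^ 2)).liminf_eq.le

end Exponentials

/-! ### Sobolev decay of Fourier coefficients -/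

section Coefficients

/-- Decay of Fourier coefficients that corresponds to the Sobolev space `H^{α+1}`. -/
def SobolevCoeff (α : ℝ) (c : ℤ → ℂ) : Prop :=
  Summable fun k => |freq k| ^ (2 * (α + 1)) * ‖c k‖ ^ 2

variable {α : ℝ} {c : ℤ → ℂ}

/-- The inequality `xy ≤ (x² + y²)/2` in place of Cauchy–Schwarz: the square of `|freq k|^{α+1} ‖c
k‖` is summable by assumption, and that of `|freq k|^{r-α-1}` because `2(α + 1) - 2r > 1`. -/
theorem SobolevCoeff.summable (h : SobolevCoeff α c) {r : ℝ} (hr : r < α + 1 / 2) :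
    Summable fun k => |freq k| ^ r * ‖c k‖ := by
  have h1 : Summable fun k : ℤ => |freq k| ^ (-(2 * (α + 1) - 2 * r)) := by
    have := (Real.summable_abs_int_rpow (b := 2 * (α + 1) - 2 * r) (by linarith)).mul_left
      ((2 * Real.pi) ^ (-(2 * (α + 1) - 2 * r)))
    refine this.congr fun k => ?_
    rw [freq, abs_mul, abs_of_pos Real.two_pi_pos,
      Real.mul_rpow Real.two_pi_pos.le (abs_nonneg _)]
  refine Summable.of_norm_bounded_eventually ((Summable.add h h1).mul_left (1 / 2)) ?_
  -- The frequency `0` is excluded, since the rules for real powers fail at base `0`; one term does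
  -- not matter for summability.
  refine (Set.finite_singleton (0 : ℤ)).subset fun k hk => ?_
  by_contra hk0
  apply hk
  have hf : 0 < |freq k| := one_pos.trans_le (one_le_abs_freq hk0)
  have e1 : |freq k| ^ (2 * (α + 1)) = (|freq k| ^ (α + 1)) ^ 2 := by
    rw [← Real.rpow_two, ← Real.rpow_mul hf.le]; congr 1; ring
  have e2 : |freq k| ^ (-(2 * (α + 1) - 2 * r)) = (|freq k| ^ (r - (α + 1))) ^ 2 := by
    rw [← Real.rpow_two, ← Real.rpow_mul hf.le]; congr 1; ring
  have e3 : |freq k| ^ r = |freq k| ^ (α + 1) * |freq k| ^ (r - (α + 1)) := by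
    rw [← Real.rpow_add hf]; congr 1; ring
  change ‖|freq k| ^ r * ‖c k‖‖ ≤ 1 / 2 * (|freq k| ^ (2 * (α + 1)) * ‖c k‖ ^ 2 +
    |freq k| ^ (-(2 * (α + 1) - 2 * r)))
  rw [Real.norm_of_nonneg (by positivity), e1, e2, e3]
  nlinarith [sq_nonneg (|freq k| ^ (α + 1) * ‖c k‖ - |freq k| ^ (r - (α + 1)))]

theorem SobolevCoeff.summable_pow (h : SobolevCoeff α c) (hα : 2 < α) {m : ℕ} (hm : m ≤ 2) :
    Summable fun k => |freq k| ^ m * ‖c k‖ := by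
  have hm' : (m : ℝ) ≤ 2 := by exact_mod_cast hm
  simpa using h.summable (r := m) (by linarith)

/-- The `m`-th derivative of the trigonometric series with coefficients `c`. -/
noncomputable def series (c : ℤ → ℂ) (m : ℕ) (x : ℝ) : ℂ :=
  ∑' k, (freq k * Complex.I) ^ m * c k * expo k x

theorem norm_series_term (c : ℤ → ℂ) (m : ℕ) (k : ℤ) (x : ℝ) :
    ‖(freq k * Complex.I) ^ m * c k * expo k x‖ = |freq k| ^ m * ‖c k‖ := by
  rw [norm_mul, norm_expo, mul_one, norm_mul, norm_pow, norm_mul, Complex.norm_I, mul_one,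
    Complex.norm_real, Real.norm_eq_abs]

theorem SobolevCoeff.hasSum_series (h : SobolevCoeff α c) (hα : 2 < α) {m : ℕ} (hm : m ≤ 2)
    (x : ℝ) : HasSum (fun k => (freq k * Complex.I) ^ m * c k * expo k x) (series c m x) :=
  (Summable.of_norm_bounded (h.summable_pow hα hm) fun k => (norm_series_term c m k x).le).hasSum

theorem SobolevCoeff.hasDerivAt_series (h : SobolevCoeff α c) (hα : 2 < α) {m : ℕ} (hm : m < 2)
    (x : ℝ) : HasDerivAt (series c m) (series c (m + 1) x) x := by
  refine hasDerivAt_tsum (h.summable_pow hα (m := m + 1) (by omega)) (fun k y => ?_)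
    (fun k y => (norm_series_term c (m + 1) k y).le)
    (h.hasSum_series hα (by omega) 0).summable x
  have := (hasDerivAt_expo k y).const_mul ((freq k * Complex.I) ^ m * c k)
  refine this.congr_deriv ?_
  ring

theorem SobolevCoeff.norm_series_two_sub_le (h : SobolevCoeff α c) (hα : 2 < α) {θ : ℝ}
    (h0 : 0 ≤ θ) (h1 : θ ≤ 1) (hθ : 2 + θ < α + 1 / 2) (x y : ℝ) :
    ‖series c 2 x - series c 2 y‖ ≤
      (∑' k, 2 * (|freq k| ^ (2 + θ) * ‖c k‖)) * |x - y| ^ θ := by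
  have hs := (h.hasSum_series hα le_rfl x).sub (h.hasSum_series hα le_rfl y)
  rw [← hs.tsum_eq, ← tsum_mul_right]
  refine tsum_of_norm_bounded (((h.summable hθ).mul_left 2).mul_right (|x - y| ^ θ)).hasSum
    fun k => ?_
  rw [← mul_sub, norm_mul, norm_mul, norm_pow, norm_mul, Complex.norm_I, mul_one,
    Complex.norm_real, Real.norm_eq_abs]
  have h2 := norm_expo_sub_le_rpow h0 h1 k x y
  have h3 : |freq k| ^ (2 + θ) = |freq k| ^ 2 * |freq k| ^ θ := by
    rcases eq_or_ne k 0 with rfl | hk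
    · rw [freq_zero, abs_zero, Real.zero_rpow (by linarith)]; simp
    · rw [Real.rpow_add (one_pos.trans_le (one_le_abs_freq hk)), Real.rpow_two]
  rw [h3]
  refine (mul_le_mul_of_nonneg_left h2 (by positivity)).trans (le_of_eq (by ring))

end Coefficients

/-! ### Embedding of Sobolev curves into Hölder spaces -/

section SobolevCurves

variable {n : ℕ} {α : ℝ} {γ : ℝ → Eucl n}

/-- The Fourier coefficients of a coordinate of a curve. -/
noncomputable def coordCoeff (γ : ℝ → Eucl n) (i : Fin n) (k : ℤ) : ℂ :=
  fourierCoeffOn (zero_lt_one : (0 : ℝ) < 1) (fun x => ((γ x i : ℝ) : ℂ)) k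

theorem sobolevCoeff_coordCoeff (hα : 2 < α) (h : MemSobolev (α + 1) γ) (i : Fin n) :
    SobolevCoeff α (coordCoeff γ i) := by
  refine Summable.of_nonneg_of_le (fun k => by positivity) (fun k => ?_)
    ((h.summable i).mul_left ((2 * Real.pi) ^ (2 * (α + 1))))
  rw [← mul_assoc]
  refine mul_le_mul_of_nonneg_right ?_ (by positivity)
  have h1 : |freq k| ^ (2 * (α + 1)) = (2 * Real.pi) ^ (2 * (α + 1)) * ((k : ℝ) ^ 2) ^ (α + 1) := by
    rw [freq, abs_mul, abs_of_pos Real.two_pi_pos, Real.mul_rpow Real.two_pi_pos.le (abs_nonneg _),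
      ← sq_abs (k : ℝ), ← Real.rpow_two, ← Real.rpow_mul (abs_nonneg _)]
  rw [h1]
  gcongr
  linarith

/-- A continuous function with absolutely summable Fourier coefficients is the sum of its Fourier
series at every point. Sobolev membership thus becomes information on actual derivatives. -/
theorem ofReal_eq_series (hα : 2 < α) (hc : Continuous γ) (h : MemSobolev (α + 1) γ) (i : Fin n)
    (x : ℝ) : ((γ x i : ℝ) : ℂ) = series (coordCoeff γ i) 0 x := by
  have : Fact ((0 : ℝ) < 1) := ⟨zero_lt_one⟩
  have hp : Function.Periodic (fun x => ((γ x i : ℝ) : ℂ)) 1 := fun x => by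
    simp only [h.periodic x]
  have hci : Continuous fun x => ((γ x i : ℝ) : ℂ) :=
    Complex.continuous_ofReal.comp ((EuclideanSpace.proj i).continuous.comp hc)
  set f : C(AddCircle (1 : ℝ), ℂ) := ⟨hp.lift, continuous_coinduced_dom.2 hci⟩ with hf
  have hfx : ∀ y : ℝ, f (y : AddCircle (1 : ℝ)) = ((γ y i : ℝ) : ℂ) := fun y => rfl
  have hcoeff : ∀ k, fourierCoeff f k = coordCoeff γ i k := fun k => by
    rw [fourierCoeff_eq_intervalIntegral f k 0, coordCoeff, fourierCoeffOn_eq_integral]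
    simp only [hfx, zero_add, fourier_coe_apply, sub_zero]
  have hsum : Summable (fourierCoeff f) := by
    have h1 := (sobolevCoeff_coordCoeff hα h i).summable_pow hα (m := 0) (by norm_num)
    simp only [pow_zero, one_mul] at h1
    refine Summable.of_norm_bounded h1 fun k => by rw [hcoeff]
  have h2 := has_pointwise_sum_fourier_series_of_summable hsum (x : AddCircle (1 : ℝ))
  rw [← hfx, ← h2.tsum_eq, series]
  refine tsum_congr fun k => ?_
  rw [hcoeff, fourier_eq_expo, pow_zero, one_mul, smul_eq_mul]

theorem hasDerivAt_coord (hα : 2 < α) (hc : Continuous γ) (h : MemSobolev (α + 1) γ) (i : Fin n)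
    (x : ℝ) : HasDerivAt (fun x => γ x i) (series (coordCoeff γ i) 1 x).re x := by
  have h1 := ((sobolevCoeff_coordCoeff hα h i).hasDerivAt_series hα (m := 0) (by norm_num) x)
  have h2 : HasDerivAt (fun x => ((γ x i : ℝ) : ℂ)) (series (coordCoeff γ i) 1 x) x :=
    h1.congr_of_eventuallyEq (Eventually.of_forall fun y => ofReal_eq_series hα hc h i y)
  exact (Complex.reCLM.hasFDerivAt.comp_hasDerivAt x h2)

theorem hasDerivAt_re_series {c : ℤ → ℂ} (hα : 2 < α) (hc : SobolevCoeff α c) (x : ℝ) :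
    HasDerivAt (fun x => (series c 1 x).re) (series c 2 x).re x :=
  Complex.reCLM.hasFDerivAt.comp_hasDerivAt x (hc.hasDerivAt_series hα (m := 1) (by norm_num) x)

theorem hasDerivAt_eucl {g : ℝ → Eucl n} {g' : Eucl n} {x : ℝ}
    (h : ∀ i, HasDerivAt (fun x => g x i) (g' i) x) : HasDerivAt g g' x := by
  have h1 : HasDerivAt (fun x => WithLp.ofLp (g x)) (WithLp.ofLp g') x := hasDerivAt_pi.2 h
  exact (PiLp.continuousLinearEquiv 2 ℝ (fun _ : Fin n => ℝ)).symm.hasFDerivAt.comp_hasDerivAt x h1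

theorem deriv_eq_series (hα : 2 < α) (hc : Continuous γ) (h : MemSobolev (α + 1) γ) (x : ℝ) :
    HasDerivAt γ (WithLp.toLp 2 fun i => (series (coordCoeff γ i) 1 x).re) x :=
  hasDerivAt_eucl fun i => hasDerivAt_coord hα hc h i x

theorem deriv_two_eq_series (hα : 2 < α) (hc : Continuous γ) (h : MemSobolev (α + 1) γ) (x : ℝ) :
    HasDerivAt (deriv γ) (WithLp.toLp 2 fun i => (series (coordCoeff γ i) 2 x).re) x := by
  rw [funext fun y => (deriv_eq_series hα hc h y).deriv]
  exact hasDerivAt_eucl fun i => hasDerivAt_re_series hα (sobolevCoeff_coordCoeff hα h i) x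

theorem iteratedDeriv_two_eq_series (hα : 2 < α) (hc : Continuous γ) (h : MemSobolev (α + 1) γ)
    (x : ℝ) : iteratedDeriv 2 γ x = WithLp.toLp 2 fun i => (series (coordCoeff γ i) 2 x).re := by
  rw [iteratedDeriv_succ, iteratedDeriv_one]
  exact (deriv_two_eq_series hα hc h x).deriv

theorem norm_iteratedDeriv_two_sub_le_of_sobolev (hα : 2 < α) (hc : Continuous γ)
    (h : MemSobolev (α + 1) γ) {θ : ℝ} (h0 : 0 ≤ θ) (h1 : θ ≤ 1) (hθ : 2 + θ < α + 1 / 2) :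
    ∃ K, 0 ≤ K ∧ ∀ x y, ‖iteratedDeriv 2 γ x - iteratedDeriv 2 γ y‖ ≤ K * |x - y| ^ θ := by
  refine ⟨∑ i, ∑' k, 2 * (|freq k| ^ (2 + θ) * ‖coordCoeff γ i k‖),
    Finset.sum_nonneg fun i _ => tsum_nonneg fun k => by positivity, fun x y => ?_⟩
  rw [Finset.sum_mul]
  refine (norm_le_sum_abs _).trans (Finset.sum_le_sum fun i _ => ?_)
  rw [iteratedDeriv_two_eq_series hα hc h, iteratedDeriv_two_eq_series hα hc h, PiLp.sub_apply]
  simp only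
  rw [← Complex.sub_re]
  exact (Complex.abs_re_le_norm _).trans
    ((sobolevCoeff_coordCoeff hα h i).norm_series_two_sub_le hα h0 h1 hθ x y)

/-- The embedding of `H^{α+1}` into `C^{α+b}` for `b < 1/2`: the coefficients remain summable
against `|freq k|^{α+b}`, which makes the twice differentiated series Hölder continuous with
exponent `α - 2 + b`. -/
theorem memC_of_sobolev (hα : α ∈ Set.Ioo (2 : ℝ) 3) (hc : Continuous γ)
    (h : MemSobolev (α + 1) γ) {b : ℝ} (hb : b ∈ Set.Ioo (0 : ℝ) 1) (hb2 : b < 1 / 2)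
    (hb3 : α + b < 3) : MemC (α + b) γ := by
  obtain ⟨f1, f2, -⟩ := floor_fract_of_lt hα hb hb3
  have he : expH α b = α - 2 + b := min_eq_right (by linarith)
  obtain ⟨K, hK, hKb⟩ := norm_iteratedDeriv_two_sub_le_of_sobolev hα.1 hc h (θ := α - 2 + b)
    (by linarith [hα.1, hb.1]) (by linarith) (by linarith)
  refine memC_of_bounds (K := K) h.periodic ?_ hK ?_
  · rw [f1]
    have hcd : Continuous (iteratedDeriv 2 γ) := by
      have : HolderWith K.toNNReal (Real.toNNReal (α - 2 + b)) (iteratedDeriv 2 γ) := fun x y => by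
        have := hKb x y
        rw [edist_dist, edist_dist, ← ENNReal.ofReal_coe_nnreal, Real.coe_toNNReal _ hK,
          Real.coe_toNNReal _ (by linarith [hα.1, hb.1] : 0 ≤ α - 2 + b),
          ENNReal.ofReal_rpow_of_nonneg dist_nonneg (by linarith [hα.1, hb.1]),
          ← ENNReal.ofReal_mul hK, dist_eq_norm, Real.dist_eq]
        exact ENNReal.ofReal_le_ofReal this
      exact this.continuous (Real.toNNReal_pos.2 (by linarith [hα.1, hb.1]))
    have hd : iteratedDeriv 2 γ = deriv (deriv γ) := by
      rw [iteratedDeriv_succ, iteratedDeriv_one]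
    rw [show ((2 : ℕ) : WithTop ℕ∞) = 1 + 1 by norm_num, contDiff_succ_iff_deriv]
    refine ⟨fun x => (deriv_eq_series hα.1 hc h x).differentiableAt, by simp, ?_⟩
    rw [contDiff_one_iff_deriv]
    exact ⟨fun x => (deriv_two_eq_series hα.1 hc h x).differentiableAt, hd ▸ hcd⟩
  · rw [f1, f2, he]
    exact hKb

end SobolevCurves

/-! ### Square functions of Fourier multipliers -/

section SquareFunction

variable {α C : ℝ} {c : ℤ → ℂ} {u : ℤ → ℝ → ℂ}

/-- The decay of multipliers: `t^{3-α}` for `t ≤ 1` and `t⁻¹` for `t > 1`. -/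
noncomputable def decay (α t : ℝ) : ℝ := if t ≤ 1 then t ^ (3 - α) else t⁻¹

theorem decay_nonneg {t : ℝ} (ht : 0 ≤ t) : 0 ≤ decay α t := by
  unfold decay; split_ifs <;> positivity

theorem decay_le_inv (hα : α < 3) {t : ℝ} (ht : 0 < t) : decay α t ≤ t⁻¹ := by
  unfold decay; split_ifs with h
  · exact (Real.rpow_le_one ht.le h (by linarith)).trans ((one_le_inv₀ ht).2 h)
  · exact le_rfl

/-- Families of multipliers with a bound adapted to `H^{α+1}` at all scales. -/
structure IsMultiplier (α C : ℝ) (u : ℤ → ℝ → ℂ) : Prop where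
  nonneg : 0 ≤ C
  measurable : ∀ k, Measurable (u k)
  eq_zero : ∀ k ε, ε ∉ Set.Ioc (0 : ℝ) (1 / 2) → u k ε = 0
  bound : ∀ k, ∀ ε ∈ Set.Ioc (0 : ℝ) (1 / 2),
    ‖u k ε‖ ≤ C * |freq k| ^ (α + 1) * decay α (|freq k| * ε)

/-- The multiplier operator at scale `ε`. -/
noncomputable def multOp (c : ℤ → ℂ) (u : ℤ → ℝ → ℂ) (ε x : ℝ) : ℂ :=
  ∑' k, c k * u k ε * expo k x

/-- At a fixed scale the decay `t⁻¹` removes one power of the frequency, and `α < α + 1/2` is in the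
range of absolute summability. Estimates uniform in the scale are available only in the square mean.
-/
theorem IsMultiplier.summable (hα : α ∈ Set.Ioo (2 : ℝ) 3) (hu : IsMultiplier α C u)
    (hc : SobolevCoeff α c) (ε : ℝ) : Summable fun k => ‖c k * u k ε‖ := by
  by_cases hε : ε ∈ Set.Ioc (0 : ℝ) (1 / 2)
  · refine Summable.of_nonneg_of_le (fun k => norm_nonneg _) (fun k => ?_)
      ((hc.summable (r := α) (by linarith)).mul_left (C * ε⁻¹))
    rw [norm_mul]
    have h1 := hu.bound k ε hε
    have h2 : |freq k| ^ (α + 1) * decay α (|freq k| * ε) ≤ ε⁻¹ * |freq k| ^ α := by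
      rcases eq_or_ne k 0 with rfl | hk
      · rw [freq_zero, abs_zero, Real.zero_rpow (by linarith [hα.1]),
          Real.zero_rpow (by linarith [hα.1])]
        simp
      · have hf : 0 < |freq k| := one_pos.trans_le (one_le_abs_freq hk)
        refine (mul_le_mul_of_nonneg_left (decay_le_inv hα.2 (mul_pos hf hε.1))
          (by positivity)).trans (le_of_eq ?_)
        rw [mul_inv, Real.rpow_add hf, Real.rpow_one]
        field_simp
    calc ‖c k‖ * ‖u k ε‖ ≤ ‖c k‖ * (C * (ε⁻¹ * |freq k| ^ α)) := by
          refine mul_le_mul_of_nonneg_left (h1.trans ?_) (norm_nonneg _)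
          rw [mul_assoc]
          exact mul_le_mul_of_nonneg_left h2 hu.nonneg
      _ = C * ε⁻¹ * (|freq k| ^ α * ‖c k‖) := by ring
  · simp only [hu.eq_zero _ ε hε, mul_zero, norm_zero]
    exact summable_zero

theorem IsMultiplier.hasSum (hα : α ∈ Set.Ioo (2 : ℝ) 3) (hu : IsMultiplier α C u)
    (hc : SobolevCoeff α c) (ε x : ℝ) :
    HasSum (fun k => c k * u k ε * expo k x) (multOp c u ε x) :=
  (Summable.of_norm_bounded (hu.summable hα hc ε) fun k => by
    rw [norm_mul _ (expo k x), norm_expo, mul_one]).hasSum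

theorem IsMultiplier.measurable_multOp (hα : α ∈ Set.Ioo (2 : ℝ) 3) (hu : IsMultiplier α C u)
    (hc : SobolevCoeff α c) : Measurable (Function.uncurry (multOp c u)) := by
  refine measurable_of_tendsto_metrizable' (atTop : Filter (Finset ℤ))
    (f := fun S p => ∑ k ∈ S, c k * u k p.1 * expo k p.2) (fun S => ?_) ?_
  · refine Finset.measurable_sum _ fun k _ => ?_
    exact (((hu.measurable k).comp measurable_fst).const_mul _).mul
      ((continuous_expo k).measurable.comp measurable_snd)
  · exact tendsto_pi_nhds.2 fun p => hu.hasSum hα hc p.1 p.2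

theorem decay_sq_mul_inv_le {τ : ℝ} (hτ : 0 < τ) {ε : ℝ} (hε : 0 < ε) :
    decay α (τ * ε) ^ 2 * ε⁻¹ =
      splitPower (τ ^ (2 * (3 - α))) (τ ^ (-2 : ℝ)) (2 * (3 - α) - 1) (-3) τ⁻¹ |ε| := by
  rw [abs_of_pos hε, decay, splitPower]
  have hiff : τ * ε ≤ 1 ↔ ε ≤ τ⁻¹ := by rw [← one_div, le_div_iff₀' hτ]
  by_cases h : τ * ε ≤ 1
  · rw [if_pos h, if_pos (hiff.1 h), Real.mul_rpow hτ.le hε.le, mul_pow, ← Real.rpow_mul_natCast hτ.le,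
      ← Real.rpow_mul_natCast hε.le, Real.rpow_sub_one hε.ne', div_eq_mul_inv, mul_assoc]
    push_cast
    rw [mul_comm (3 - α)]
  · rw [if_neg h, if_neg (fun h' => h (hiff.2 h')), Real.rpow_neg hτ.le, Real.rpow_neg hε.le,
      Real.rpow_two, show (3 : ℝ) = (3 : ℕ) by norm_num, Real.rpow_natCast]
    field_simp

/-- The measure `dε/ε` is invariant under scaling, so the integral of `decay(τ ε)²` does not depend
on the frequency `τ`. It is finite at `0` because `α < 3` and at infinity because of the decay
`t⁻¹`. -/
theorem IsMultiplier.lintegral_bound (hα : α ∈ Set.Ioo (2 : ℝ) 3) (hu : IsMultiplier α C u)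
    (k : ℤ) : ∫⁻ ε in Set.Ioc (0 : ℝ) (1 / 2), ‖c k * u k ε‖ₑ ^ 2 * ENNReal.ofReal ε⁻¹ ≤
      ENNReal.ofReal (C ^ 2 * (1 / (3 - α) + 1) * (|freq k| ^ (2 * (α + 1)) * ‖c k‖ ^ 2)) := by
  rcases eq_or_ne k 0 with rfl | hk
  · have h0 : ∀ ε ∈ Set.Ioc (0 : ℝ) (1 / 2), u 0 ε = 0 := fun ε hε => by
      have := hu.bound 0 ε hε
      rw [freq_zero, abs_zero, Real.zero_rpow (by linarith [hα.1]), mul_zero, zero_mul] at this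
      exact norm_le_zero_iff.1 this
    rw [setLIntegral_congr_fun measurableSet_Ioc (g := fun _ => 0) fun ε hε => by
      simp [h0 ε hε]]
    simp
  · set τ := |freq k| with hτdef
    have hτ : 0 < τ := one_pos.trans_le (one_le_abs_freq hk)
    set sp := fun ε => splitPower (τ ^ (2 * (3 - α))) (τ ^ (-2 : ℝ)) (2 * (3 - α) - 1) (-3) τ⁻¹ |ε|
    have hsp := splitPower_integral (A := τ ^ (2 * (3 - α))) (B := τ ^ (-2 : ℝ))
      (p := 2 * (3 - α) - 1) (p' := -3) (κ := τ⁻¹) (by linarith [hα.2]) (by norm_num)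
      (inv_pos.2 hτ)
    have hspn : ∀ ε, 0 ≤ sp ε := fun ε => by
      simp only [sp, splitPower]; split_ifs <;> positivity
    -- All powers of `τ` cancel. The integral is over the whole line and so twice that over the half
    -- line, `1/(2(3-α)) + 1/2`.
    have hval : ∫ ε, sp ε = 1 / (3 - α) + 1 := by
      rw [hsp.2, Real.inv_rpow hτ.le, Real.inv_rpow hτ.le, ← Real.rpow_neg hτ.le,
        ← Real.rpow_neg hτ.le, mul_div_assoc', mul_div_assoc', ← Real.rpow_add hτ,
        ← Real.rpow_add hτ, show 2 * (3 - α) + -(2 * (3 - α) - 1 + 1) = 0 by ring,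
        show (-2 : ℝ) + -(-3 + 1) = 0 by norm_num, Real.rpow_zero]
      have : 3 - α ≠ 0 := by linarith [hα.2]
      field_simp
      ring
    set K := C ^ 2 * (τ ^ (2 * (α + 1)) * ‖c k‖ ^ 2) with hK
    calc ∫⁻ ε in Set.Ioc (0 : ℝ) (1 / 2), ‖c k * u k ε‖ₑ ^ 2 * ENNReal.ofReal ε⁻¹
        ≤ ∫⁻ ε in Set.Ioc (0 : ℝ) (1 / 2), ENNReal.ofReal (K * sp ε) := by
          refine setLIntegral_mono' measurableSet_Ioc fun ε hε => ?_
          rw [← ofReal_norm, ← ENNReal.ofReal_pow (norm_nonneg _),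
            ← ENNReal.ofReal_mul (by positivity)]
          refine ENNReal.ofReal_le_ofReal ?_
          simp only [sp]
          rw [← decay_sq_mul_inv_le hτ hε.1, ← mul_assoc]
          have hb := hu.bound k ε hε
          have hd := decay_nonneg (α := α) (mul_pos hτ hε.1).le
          refine mul_le_mul_of_nonneg_right ?_ (inv_pos.2 hε.1).le
          have h2 : τ ^ (2 * (α + 1)) = (τ ^ (α + 1)) ^ 2 := by
            rw [← Real.rpow_mul_natCast hτ.le]; congr 1; push_cast; ring
          rw [norm_mul, mul_pow, hK, h2]
          calc ‖c k‖ ^ 2 * ‖u k ε‖ ^ 2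
              ≤ ‖c k‖ ^ 2 * (C * τ ^ (α + 1) * decay α (τ * ε)) ^ 2 := by gcongr
            _ = _ := by ring
      _ ≤ ∫⁻ ε, ENNReal.ofReal (K * sp ε) := setLIntegral_le_lintegral _ _
      _ = ENNReal.ofReal (∫ ε, K * sp ε) :=
          (ofReal_integral_eq_lintegral_ofReal (hsp.1.const_mul K)
            (Eventually.of_forall fun ε => mul_nonneg (by positivity) (hspn ε))).symm
      _ = _ := by
          rw [integral_const_mul, hval]
          congr 1
          rw [hK]
          ring

/-- Parseval in `x` at each scale, Tonelli, and the frequency-wise bound. The right side is a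
multiple of the Sobolev sum, hence finite. -/
theorem IsMultiplier.lintegral_lintegral_le (hα : α ∈ Set.Ioo (2 : ℝ) 3)
    (hu : IsMultiplier α C u) (hc : SobolevCoeff α c) :
    ∫⁻ ε in Set.Ioc (0 : ℝ) (1 / 2), ∫⁻ x in Set.Ioc (0 : ℝ) 1,
      ‖multOp c u ε x‖ₑ ^ 2 * ENNReal.ofReal ε⁻¹ ≤ ∑' k, ENNReal.ofReal
        (C ^ 2 * (1 / (3 - α) + 1) * (|freq k| ^ (2 * (α + 1)) * ‖c k‖ ^ 2)) := by
  calc ∫⁻ ε in Set.Ioc (0 : ℝ) (1 / 2), ∫⁻ x in Set.Ioc (0 : ℝ) 1,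
        ‖multOp c u ε x‖ₑ ^ 2 * ENNReal.ofReal ε⁻¹
      ≤ ∫⁻ ε in Set.Ioc (0 : ℝ) (1 / 2), ∑' k, ‖c k * u k ε‖ₑ ^ 2 * ENNReal.ofReal ε⁻¹ := by
        refine setLIntegral_mono' measurableSet_Ioc fun ε hε => ?_
        rw [lintegral_mul_const' _ _ ENNReal.ofReal_ne_top, ENNReal.tsum_mul_right]
        exact mul_le_mul_left (lintegral_tsum_expo_le (hu.summable hα hc ε)) _
    _ = ∑' k, ∫⁻ ε in Set.Ioc (0 : ℝ) (1 / 2), ‖c k * u k ε‖ₑ ^ 2 * ENNReal.ofReal ε⁻¹ := by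
        refine lintegral_tsum fun k => ?_
        exact ((((hu.measurable k).const_mul (c k)).enorm.pow_const 2).mul
          measurable_id.inv.ennreal_ofReal).aemeasurable
    _ ≤ _ := ENNReal.tsum_le_tsum fun k => hu.lintegral_bound hα k

theorem IsMultiplier.ae_lintegral_lt_top (hα : α ∈ Set.Ioo (2 : ℝ) 3) (hu : IsMultiplier α C u)
    (hc : SobolevCoeff α c) : ∀ᵐ x ∂(volume.restrict (Set.Ioc (0 : ℝ) 1)),
      ∫⁻ ε in Set.Ioc (0 : ℝ) (1 / 2), ‖multOp c u ε x‖ₑ ^ 2 * ENNReal.ofReal ε⁻¹ < ∞ := by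
  have hu' := hu.measurable_multOp hα hc
  have hm : Measurable fun p : ℝ × ℝ => ‖multOp c u p.1 p.2‖ₑ ^ 2 * ENNReal.ofReal p.1⁻¹ := by
    refine Measurable.fun_mul ?_ ?_
    · exact Measurable.pow_const (β := ℝ≥0∞) hu'.enorm 2
    · exact Measurable.ennreal_ofReal (Measurable.inv measurable_fst)
  have hm' : Measurable fun p : ℝ × ℝ => ‖multOp c u p.2 p.1‖ₑ ^ 2 * ENNReal.ofReal p.2⁻¹ := by
    refine Measurable.fun_mul ?_ ?_
    · exact Measurable.pow_const (β := ℝ≥0∞) (Measurable.enorm (hu'.comp measurable_swap)) 2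
    · exact Measurable.ennreal_ofReal (Measurable.inv measurable_snd)
  have h3 : 0 ≤ C ^ 2 * (1 / (3 - α) + 1) :=
    mul_nonneg (sq_nonneg _) (add_nonneg (one_div_nonneg.2 (by linarith [hα.2])) zero_le_one)
  have hfin : ∑' k, ENNReal.ofReal
      (C ^ 2 * (1 / (3 - α) + 1) * (|freq k| ^ (2 * (α + 1)) * ‖c k‖ ^ 2)) ≠ ∞ := by
    rw [← ENNReal.ofReal_tsum_of_nonneg (fun k => mul_nonneg h3 (by positivity))
      (Summable.mul_left _ hc)]
    exact ENNReal.ofReal_ne_top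
  have hsw := lintegral_lintegral_swap (μ := volume.restrict (Set.Ioc (0 : ℝ) (1 / 2)))
    (ν := volume.restrict (Set.Ioc (0 : ℝ) 1))
    (f := fun ε x => ‖multOp c u ε x‖ₑ ^ 2 * ENNReal.ofReal ε⁻¹) hm.aemeasurable
  have hne : ∫⁻ x in Set.Ioc (0 : ℝ) 1, ∫⁻ ε in Set.Ioc (0 : ℝ) (1 / 2),
      ‖multOp c u ε x‖ₑ ^ 2 * ENNReal.ofReal ε⁻¹ ≠ ∞ := by
    rw [← hsw]
    exact ne_top_of_le_ne_top hfin (hu.lintegral_lintegral_le hα hc)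
  have hmm : Measurable fun x => ∫⁻ ε in Set.Ioc (0 : ℝ) (1 / 2),
      ‖multOp c u ε x‖ₑ ^ 2 * ENNReal.ofReal ε⁻¹ :=
    Measurable.lintegral_prod_right' (f := fun p : ℝ × ℝ =>
      ‖multOp c u p.2 p.1‖ₑ ^ 2 * ENNReal.ofReal p.2⁻¹) hm'
  exact ae_lt_top hmm hne

/-- Almost everywhere square integrability of a multiplier operator over all scales. -/
theorem IsMultiplier.ae_integrableOn (hα : α ∈ Set.Ioo (2 : ℝ) 3) (hu : IsMultiplier α C u)
    (hc : SobolevCoeff α c) : ∀ᵐ x ∂(volume.restrict (Set.Ioc (0 : ℝ) 1)),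
      IntegrableOn (fun ε => ‖multOp c u ε x‖ ^ 2 * ε⁻¹) (Set.Ioc (0 : ℝ) (1 / 2)) := by
  filter_upwards [hu.ae_lintegral_lt_top hα hc] with x hx
  have hm : Measurable fun ε => multOp c u ε x :=
    (hu.measurable_multOp hα hc).comp (measurable_id.prodMk measurable_const)
  refine ⟨((hm.norm.pow_const 2).mul measurable_id.inv).aestronglyMeasurable, ?_⟩
  rw [hasFiniteIntegral_iff_enorm]
  refine lt_of_eq_of_lt (setLIntegral_congr_fun measurableSet_Ioc fun ε hε => ?_) hx
  rw [← ofReal_norm, ← ofReal_norm, ← ENNReal.ofReal_pow (norm_nonneg _),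
    ← ENNReal.ofReal_mul (by positivity), Real.norm_of_nonneg]
  have := hε.1
  positivity

end SquareFunction

/-! ### The symbol of `Q^α` and its truncations -/

section Multipliers

variable {α : ℝ}

/-- The symbol of the sum of the integrands of `Q^α` at `w` and `-w`. -/
noncomputable def symbolDensity (α σ w : ℝ) : ℝ :=
  |w| ^ (-α) * (4 * (Real.cos (σ * w) - 1) / w ^ 2 + 2 * σ ^ 2)

theorem symbolDensity_zero_left (α w : ℝ) : symbolDensity α 0 w = 0 := by
  simp [symbolDensity]

/-- This is `cos t ≥ 1 - t²/2`. The fixed sign makes symbols monotone in the truncation and lets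
bounds be obtained by enlarging the domain of integration. -/
theorem symbolDensity_nonneg (α σ w : ℝ) : 0 ≤ symbolDensity α σ w := by
  refine mul_nonneg (Real.rpow_nonneg (abs_nonneg _) _) ?_
  rcases eq_or_ne w 0 with rfl | hw
  · simp; positivity
  · have h := Real.one_sub_sq_div_two_le_cos (x := σ * w)
    have h2 : 4 * (Real.cos (σ * w) - 1) / w ^ 2 + 2 * σ ^ 2 =
        4 * (Real.cos (σ * w) - (1 - (σ * w) ^ 2 / 2)) / w ^ 2 := by field_simp; ring
    rw [h2]
    exact div_nonneg (mul_nonneg (by norm_num) (sub_nonneg.2 h)) (sq_nonneg _)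

theorem symbolDensity_le_far (α σ w : ℝ) : symbolDensity α σ w ≤ 2 * σ ^ 2 * |w| ^ (-α) := by
  rw [mul_comm _ (|w| ^ (-α))]
  refine mul_le_mul_of_nonneg_left ?_ (Real.rpow_nonneg (abs_nonneg _) _)
  have h := div_nonneg (mul_nonneg (by norm_num : (0 : ℝ) ≤ 4)
    (sub_nonneg.2 (Real.cos_le_one (σ * w)))) (sq_nonneg w)
  have h2 : 4 * (Real.cos (σ * w) - 1) / w ^ 2 = -(4 * (1 - Real.cos (σ * w)) / w ^ 2) := by ring
  rw [h2]
  linarith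

/-- Fourth order Taylor bound for the cosine; the quadratic term is exactly compensated by `2σ²`,
the contribution of `-γ''`. -/
theorem symbolDensity_le_near {σ w : ℝ} (hw : w ≠ 0) (h : |σ * w| ≤ 1) :
    symbolDensity α σ w ≤ 2 * σ ^ 4 * |w| ^ (2 - α) := by
  have hw' : 0 < |w| := abs_pos.2 hw
  have h2 : |w| ^ (2 - α) = |w| ^ (-α) * w ^ 2 := by
    rw [← sq_abs w, ← Real.rpow_two, ← Real.rpow_add hw']; congr 1; ring
  rw [h2, show 2 * σ ^ 4 * (|w| ^ (-α) * w ^ 2) = |w| ^ (-α) * (2 * σ ^ 4 * w ^ 2) by ring]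
  refine mul_le_mul_of_nonneg_left ?_ (Real.rpow_nonneg (abs_nonneg _) _)
  have h3 := (abs_le.1 (Real.cos_bound h)).2
  have h4 : |σ * w| ^ 4 = (σ * w) ^ 4 := by rw [← abs_pow, abs_of_nonneg (by positivity)]
  rw [h4] at h3
  have hw2 : 0 < w ^ 2 := by positivity
  have h5 : 4 * (Real.cos (σ * w) - 1) / w ^ 2 ≤ 2 * σ ^ 4 * w ^ 2 - 2 * σ ^ 2 := by
    rw [div_le_iff₀ hw2]
    have : 0 ≤ (σ * w) ^ 4 := by positivity
    nlinarith
  linarith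

theorem continuousOn_symbolDensity (α σ : ℝ) : ContinuousOn (symbolDensity α σ) {0}ᶜ := by
  refine (continuousOn_abs_rpow _).mul (ContinuousOn.add ?_ continuousOn_const)
  exact ContinuousOn.div (by fun_prop) (by fun_prop) fun w hw => pow_ne_zero 2 hw

theorem measurable_symbolDensity (α σ : ℝ) : Measurable (symbolDensity α σ) := by
  unfold symbolDensity; fun_prop

theorem symbolDensity_le_splitPower {σ : ℝ} (hσ : σ ≠ 0) {w : ℝ} (hw : w ≠ 0) :
    symbolDensity α σ w ≤
      splitPower (2 * |σ| ^ 4) (2 * |σ| ^ 2) (2 - α) (-α) |σ|⁻¹ |w| := by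
  have hs : 0 < |σ| := abs_pos.2 hσ
  have h4 : |σ| ^ 4 = σ ^ 4 := by rw [← abs_pow, abs_of_nonneg (by positivity)]
  rw [splitPower]
  split_ifs with h
  · rw [h4]
    refine symbolDensity_le_near hw ?_
    rw [abs_mul]
    rwa [← one_div, le_div_iff₀' hs] at h
  · rw [sq_abs]
    exact symbolDensity_le_far α σ w

theorem integrable_symbolDensity (hα : α ∈ Set.Ioo (2 : ℝ) 3) (σ : ℝ) :
    Integrable (symbolDensity α σ) := by
  rcases eq_or_ne σ 0 with rfl | hσ
  · simp [funext (symbolDensity_zero_left α)]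
  · refine Integrable.mono' (splitPower_integral (A := 2 * |σ| ^ 4) (B := 2 * |σ| ^ 2)
      (p := 2 - α) (p' := -α) (κ := |σ|⁻¹) (by linarith [hα.2]) (by linarith [hα.1])
      (inv_pos.2 (abs_pos.2 hσ))).1 (measurable_symbolDensity α σ).aestronglyMeasurable ?_
    filter_upwards [compl_mem_ae_iff.2 (measure_singleton (0 : ℝ))] with w hw
    rw [Real.norm_of_nonneg (symbolDensity_nonneg α σ w)]
    exact symbolDensity_le_splitPower hσ hw

/-- The symbol of `Q^α`. -/
noncomputable def symbolMass (α σ : ℝ) : ℝ := ∫ w in (0 : ℝ)..(1 / 2), symbolDensity α σ w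

/-- The symbol of `Q^α` truncated at `ε`. -/
noncomputable def symbolTail (α σ ε : ℝ) : ℝ := ∫ w in ε..(1 / 2), symbolDensity α σ w

theorem symbolMass_nonneg (α σ : ℝ) : 0 ≤ symbolMass α σ :=
  intervalIntegral.integral_nonneg (by norm_num) fun w _ => symbolDensity_nonneg α σ w

/-- The fourth order bound below `|w| = |σ|⁻¹` and the trivial bound above it both integrate to a
multiple of `|σ|^{α+1}`: `Q^α` is an operator of order `α + 1`. -/
theorem symbolMass_le (hα : α ∈ Set.Ioo (2 : ℝ) 3) (σ : ℝ) :
    symbolMass α σ ≤ 4 * (1 / (3 - α) + 1) * |σ| ^ (α + 1) := by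
  have h3 : 0 < 3 - α := by linarith [hα.2]
  rcases eq_or_ne σ 0 with rfl | hσ
  · simp only [symbolMass, symbolDensity_zero_left, intervalIntegral.integral_zero]
    positivity
  · have hs : 0 < |σ| := abs_pos.2 hσ
    have hsp := splitPower_integral (A := 2 * |σ| ^ 4) (B := 2 * |σ| ^ 2)
      (p := 2 - α) (p' := -α) (κ := |σ|⁻¹) (by linarith [hα.2]) (by linarith [hα.1])
      (inv_pos.2 hs)
    have h1 : symbolMass α σ ≤ ∫ w, symbolDensity α σ w := by
      rw [symbolMass, intervalIntegral.integral_of_le (by norm_num)]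
      exact setIntegral_le_integral (integrable_symbolDensity hα σ)
        (Eventually.of_forall (symbolDensity_nonneg α σ))
    have h2 := integral_mono_ae (integrable_symbolDensity hα σ) hsp.1 (by
      filter_upwards [compl_mem_ae_iff.2 (measure_singleton (0 : ℝ))] with w hw
      exact symbolDensity_le_splitPower hσ hw)
    refine h1.trans (h2.trans ?_)
    rw [hsp.2, Real.inv_rpow hs.le, Real.inv_rpow hs.le, ← Real.rpow_neg hs.le,
      ← Real.rpow_neg hs.le]
    have e1 : |σ| ^ 4 * |σ| ^ (-(2 - α + 1)) = |σ| ^ (α + 1) := by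
      rw [← Real.rpow_natCast, ← Real.rpow_add hs]; congr 1; push_cast; ring
    have e2 : |σ| ^ 2 * |σ| ^ (-(-α + 1)) = |σ| ^ (α + 1) := by
      rw [← Real.rpow_natCast, ← Real.rpow_add hs]; congr 1; push_cast; ring
    have e3 : 2 * (2 * |σ| ^ 4 * (|σ| ^ (-(2 - α + 1)) / (2 - α + 1)) +
        2 * |σ| ^ 2 * (|σ| ^ (-(-α + 1)) / (-(-α + 1)))) =
        4 * ((|σ| ^ 4 * |σ| ^ (-(2 - α + 1))) * (1 / (3 - α)) +
          (|σ| ^ 2 * |σ| ^ (-(-α + 1))) * (1 / (α - 1))) := by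
      rw [show 2 - α + 1 = 3 - α by ring, show -(-α + 1) = α - 1 by ring]
      ring
    rw [e3, e1, e2]
    have h5 : 1 / (α - 1) ≤ 1 := by rw [div_le_one] <;> linarith [hα.1]
    have := mul_le_mul_of_nonneg_left h5 (Real.rpow_nonneg hs.le (α + 1))
    linarith

theorem mass_sub_head (hα : α ∈ Set.Ioo (2 : ℝ) 3) (σ ε : ℝ) :
    symbolTail α σ ε = symbolMass α σ - ∫ w in (0 : ℝ)..ε, symbolDensity α σ w := by
  have h : ∀ a b, IntervalIntegrable (symbolDensity α σ) volume a b := fun a b =>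
    (integrable_symbolDensity hα σ).intervalIntegrable
  rw [symbolTail, symbolMass, ← intervalIntegral.integral_add_adjacent_intervals
    (h 0 ε) (h ε (1 / 2)), add_sub_cancel_left]

theorem near_scaling {τ ε : ℝ} (hτ : 0 < τ) (hε : 0 < ε) :
    τ ^ 4 * ε ^ (3 - α) = τ ^ (α + 1) * (τ * ε) ^ (3 - α) := by
  rw [Real.mul_rpow hτ.le hε.le, ← mul_assoc, ← Real.rpow_add hτ, ← Real.rpow_natCast]
  congr 2; push_cast; ring

theorem far_scaling (hα : 2 ≤ α) {τ ε : ℝ} (hτ : 0 < τ) (hε : 0 < ε) (h : 1 ≤ τ * ε) :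
    τ ^ 2 * ε ^ (1 - α) ≤ τ ^ (α + 1) * (τ * ε)⁻¹ := by
  have h1 : τ ^ 2 * ε ^ (1 - α) = τ ^ (α + 1) * (τ * ε) ^ (1 - α) := by
    rw [Real.mul_rpow hτ.le hε.le, ← mul_assoc, ← Real.rpow_add hτ, ← Real.rpow_natCast]
    congr 2; push_cast; ring
  rw [h1, ← Real.rpow_neg_one]
  exact mul_le_mul_of_nonneg_left (Real.rpow_le_rpow_of_exponent_le h (by linarith))
    (Real.rpow_nonneg hτ.le _)

theorem integral_symbolDensity_near_le (hα : α ∈ Set.Ioo (2 : ℝ) 3) {σ ε : ℝ} (hσ : σ ≠ 0)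
    (hε : 0 < ε) (h : |σ| * ε ≤ 1) : ∫ w in (0 : ℝ)..ε, symbolDensity α σ w ≤
      2 / (3 - α) * (|σ| ^ (α + 1) * (|σ| * ε) ^ (3 - α)) := by
  have hs : 0 < |σ| := abs_pos.2 hσ
  have h4 : |σ| ^ 4 = σ ^ 4 := by rw [← abs_pow, abs_of_nonneg (by positivity)]
  have hp : (-1 : ℝ) < 2 - α := by linarith [hα.2]
  have hint : ∫ w in (0 : ℝ)..ε, 2 * σ ^ 4 * w ^ (2 - α) =
      2 / (3 - α) * (|σ| ^ (α + 1) * (|σ| * ε) ^ (3 - α)) := by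
    rw [intervalIntegral.integral_const_mul, integral_rpow (Or.inl hp),
      show 2 - α + 1 = 3 - α by ring, Real.zero_rpow (by linarith [hα.2]), ← near_scaling hs hε, h4]
    ring
  rw [← hint]
  refine intervalIntegral.integral_mono_on_of_le_Ioo hε.le
    (integrable_symbolDensity hα σ).intervalIntegrable
    ((intervalIntegral.intervalIntegrable_rpow' hp).const_mul _) fun w hw => ?_
  have := symbolDensity_le_near (α := α) (σ := σ) hw.1.ne' (by
    rw [abs_mul, abs_of_pos hw.1]
    exact (mul_le_mul_of_nonneg_left hw.2.le hs.le).trans h)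
  rwa [abs_of_pos hw.1] at this

theorem symbolTail_far_le (hα : α ∈ Set.Ioo (2 : ℝ) 3) {σ ε : ℝ} (hσ : σ ≠ 0)
    (hε : ε ∈ Set.Ioc (0 : ℝ) (1 / 2)) (h : 1 ≤ |σ| * ε) :
    symbolTail α σ ε ≤ 2 * (|σ| ^ (α + 1) * (|σ| * ε)⁻¹) := by
  have hs : 0 < |σ| := abs_pos.2 hσ
  have h0 : (0 : ℝ) ∉ Set.uIcc ε (1 / 2) := by
    rw [Set.uIcc_of_le hε.2]; exact fun h => absurd h.1 (not_le.2 hε.1)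
  have hint : ∫ w in ε..(1 / 2), 2 * σ ^ 2 * w ^ (-α) =
      2 * σ ^ 2 * ((ε ^ (1 - α) - (1 / 2) ^ (1 - α)) / (α - 1)) := by
    rw [intervalIntegral.integral_const_mul, integral_rpow (Or.inr ⟨by linarith [hα.1], h0⟩),
      show -α + 1 = -(α - 1) by ring, div_neg, show -(α - 1) = 1 - α by ring]
    ring
  have h1 : symbolTail α σ ε ≤ ∫ w in ε..(1 / 2), 2 * σ ^ 2 * w ^ (-α) := by
    refine intervalIntegral.integral_mono_on hε.2
      (integrable_symbolDensity hα σ).intervalIntegrable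
      ((intervalIntegral.intervalIntegrable_rpow (Or.inr h0)).const_mul _) fun w hw => ?_
    have := symbolDensity_le_far α σ w
    rwa [abs_of_pos (hε.1.trans_le hw.1)] at this
  have h2 : (ε ^ (1 - α) - (1 / 2) ^ (1 - α)) / (α - 1) ≤ ε ^ (1 - α) := by
    have h3 : 0 ≤ ((1 : ℝ) / 2) ^ (1 - α) := by positivity
    have h4 : 0 ≤ ε ^ (1 - α) := Real.rpow_nonneg hε.1.le _
    rw [div_le_iff₀ (by linarith [hα.1])]
    nlinarith [hα.1]
  have h3 := far_scaling hα.1.le hs hε.1 h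
  rw [sq_abs] at h3
  have := mul_le_mul_of_nonneg_left h2 (by positivity : 0 ≤ 2 * σ ^ 2)
  linarith

theorem abs_one_sub_sinc_le (t : ℝ) : |1 - Real.sinc t| ≤ t ^ 2 := by
  wlog ht : 0 < t generalizing t
  · rcases (not_lt.1 ht).eq_or_lt with rfl | h
    · simp
    · have := this (-t) (by linarith)
      rwa [Real.sinc_neg, neg_sq] at this
  · rw [abs_of_nonneg (sub_nonneg.2 (Real.sinc_le_one t)), Real.sinc_of_ne_zero ht.ne']
    have h1 := Real.sin_gt_sub_cube ht
    have h2 : 1 - t ^ 2 ≤ Real.sin t / t := by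
      rw [le_div_iff₀ ht]
      have : 0 < t ^ 3 := by positivity
      nlinarith
    linarith

theorem abs_sinc_le_inv {t : ℝ} (ht : t ≠ 0) : |Real.sinc t| ≤ |t|⁻¹ := by
  rw [Real.sinc_of_ne_zero ht, abs_div, div_eq_mul_inv]
  exact mul_le_of_le_one_left (by positivity) (Real.abs_sin_le_one t)

/-- The difference between the truncated symbol and a symmetric difference quotient. -/
noncomputable def tailMultiplier (α : ℝ) (k : ℤ) : ℝ → ℂ :=
  (Set.Ioc (0 : ℝ) (1 / 2)).indicator fun ε =>
    ((symbolTail α (freq k) ε - symbolMass α (freq k) * Real.sinc (freq k * ε) : ℝ) : ℂ)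

/-- The logarithmic derivative of the truncated symbol in the scale. -/
noncomputable def densityMultiplier (α : ℝ) (k : ℤ) : ℝ → ℂ :=
  (Set.Ioc (0 : ℝ) (1 / 2)).indicator fun w => ((w * symbolDensity α (freq k) w : ℝ) : ℂ)

/-- The two bounds for the density, rescaled to `t = |σ| w`: up to the factor `2|σ|^{α+1}` they read
`t^{3-α}` for `t ≤ 1`, and `t^{1-α} ≤ t⁻¹` for `t > 1` since `α ≥ 2`. -/
theorem isMultiplier_density (hα : α ∈ Set.Ioo (2 : ℝ) 3) :
    IsMultiplier α 2 (densityMultiplier α) where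
  nonneg := by norm_num
  measurable k := by
    refine Measurable.indicator ?_ measurableSet_Ioc
    exact Complex.measurable_ofReal.comp (measurable_id.mul (measurable_symbolDensity α _))
  eq_zero k ε hε := Set.indicator_of_notMem hε _
  bound k w hw := by
    rw [densityMultiplier, Set.indicator_of_mem hw, Complex.norm_real, Real.norm_of_nonneg
      (mul_nonneg hw.1.le (symbolDensity_nonneg α _ w))]
    rcases eq_or_ne (freq k) 0 with h0 | hσ
    · rw [h0, symbolDensity_zero_left, mul_zero]
      exact mul_nonneg (by positivity) (decay_nonneg (by simp))
    set σ := freq k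
    have hs : 0 < |σ| := abs_pos.2 hσ
    have h4 : |σ| ^ 4 = σ ^ 4 := by rw [← abs_pow, abs_of_nonneg (by positivity)]
    rw [decay, mul_assoc]
    split_ifs with h
    · have h1 := symbolDensity_le_near (α := α) (σ := σ) hw.1.ne' (by
        rwa [abs_mul, abs_of_pos hw.1])
      rw [← near_scaling hs hw.1, h4]
      refine (mul_le_mul_of_nonneg_left h1 hw.1.le).trans (le_of_eq ?_)
      rw [abs_of_pos hw.1, show 3 - α = 2 - α + 1 by ring, Real.rpow_add_one hw.1.ne']
      ring
    · have h1 := far_scaling hα.1.le hs hw.1 (not_le.1 h).le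
      rw [sq_abs] at h1
      refine (mul_le_mul_of_nonneg_left (symbolDensity_le_far α σ w) hw.1.le).trans ?_
      refine le_trans (le_of_eq ?_) (mul_le_mul_of_nonneg_left h1 (by norm_num))
      rw [abs_of_pos hw.1, show 1 - α = -α + 1 by ring, Real.rpow_add_one hw.1.ne']
      ring

/-- For `t = |σ|ε ≤ 1` both symbols are close to the mass: the missing head integral is a multiple
of `t^{3-α}`, and `|1 - sinc| ≤ t² ≤ t^{3-α}`. For `t > 1` each of them is by itself a multiple of
`t⁻¹`. -/
theorem isMultiplier_tail (hα : α ∈ Set.Ioo (2 : ℝ) 3) :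
    IsMultiplier α (4 * (1 / (3 - α) + 1) + 2 / (3 - α)) (tailMultiplier α) where
  nonneg := by have : 0 < 3 - α := by linarith [hα.2]
               positivity
  measurable k := by
    refine Measurable.indicator ?_ measurableSet_Ioc
    refine Complex.measurable_ofReal.comp ?_
    have h1 : Continuous fun ε => ∫ w in (0 : ℝ)..ε, symbolDensity α (freq k) w :=
      intervalIntegral.continuous_primitive
        (fun a b => (integrable_symbolDensity hα (freq k)).intervalIntegrable) 0
    simp only [mass_sub_head hα]
    exact ((continuous_const.sub h1).sub (continuous_const.mul
      (Real.continuous_sinc.comp (continuous_const.mul continuous_id)))).measurable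
  eq_zero k ε hε := Set.indicator_of_notMem hε _
  bound k ε hε := by
    have h3 : 0 < 3 - α := by linarith [hα.2]
    rw [tailMultiplier, Set.indicator_of_mem hε, Complex.norm_real, Real.norm_eq_abs]
    rcases eq_or_ne (freq k) 0 with h0 | hσ
    · rw [h0, symbolMass, symbolTail]
      simp only [symbolDensity_zero_left, intervalIntegral.integral_zero, zero_mul, sub_zero,
        abs_zero]
      exact mul_nonneg (by positivity) (decay_nonneg le_rfl)
    set σ := freq k
    have hs : 0 < |σ| := abs_pos.2 hσ
    have hm := symbolMass_le hα σ
    have hm0 := symbolMass_nonneg α σ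
    have hp : 0 ≤ |σ| ^ (α + 1) := by positivity
    have ht : 0 < |σ| * ε := mul_pos hs hε.1
    have habs : |σ * ε| = |σ| * ε := by rw [abs_mul, abs_of_pos hε.1]
    rw [decay, mul_assoc, add_mul]
    split_ifs with h
    · have h1 := integral_symbolDensity_near_le hα hσ hε.1 h
      have h2 : 0 ≤ ∫ w in (0 : ℝ)..ε, symbolDensity α σ w :=
        intervalIntegral.integral_nonneg hε.1.le fun w _ => symbolDensity_nonneg α σ w
      have h5 : |1 - Real.sinc (σ * ε)| ≤ (|σ| * ε) ^ (3 - α) := by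
        refine (abs_one_sub_sinc_le _).trans ?_
        rw [← sq_abs, habs, ← Real.rpow_two]
        exact Real.rpow_le_rpow_of_exponent_ge ht h (by linarith [hα.1])
      rw [mass_sub_head hα, show ∀ a b c : ℝ, a - b - a * c = a * (1 - c) - b by intros; ring]
      refine (abs_sub _ _).trans (add_le_add ?_ ((abs_of_nonneg h2).trans_le h1))
      rw [abs_mul, abs_of_nonneg hm0, ← mul_assoc]
      exact mul_le_mul hm h5 (abs_nonneg _) (hm0.trans hm)
    · have h1 := symbolTail_far_le hα hσ hε (not_le.1 h).le
      have h2 : 0 ≤ symbolTail α σ ε :=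
        intervalIntegral.integral_nonneg hε.2 fun w _ => symbolDensity_nonneg α σ w
      have h5 := abs_sinc_le_inv (mul_ne_zero hσ hε.1.ne')
      rw [habs] at h5
      have h6 : (2 : ℝ) ≤ 2 / (3 - α) := by rw [le_div_iff₀ h3]; linarith [hα.1]
      rw [add_comm]
      refine (abs_sub _ _).trans (add_le_add ?_ ?_)
      · rw [abs_of_nonneg h2]
        exact h1.trans (mul_le_mul_of_nonneg_right h6 (by positivity))
      · rw [abs_mul, abs_of_nonneg hm0, ← mul_assoc]
        exact mul_le_mul hm h5 (abs_nonneg _) (hm0.trans hm)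

end Multipliers

/-! ### Convergence from square functions -/

section LogarithmicScales

theorem tendsto_integral_dyadic {g : ℝ → ℝ} (hg : IntegrableOn g (Set.Ioc (0 : ℝ) (1 / 2))) :
    Tendsto (fun ε => ∫ w in Set.Ioc ε (2 * ε), g w) (𝓝[>] (0 : ℝ)) (𝓝 0) := by
  have h1 : Tendsto ((volume.restrict (Set.Ioc (0 : ℝ) (1 / 2))) ∘ fun ε => Set.Ioc ε (2 * ε))
      (𝓝[>] (0 : ℝ)) (𝓝 0) := by
    have h2 : Tendsto (fun ε : ℝ => ENNReal.ofReal ε) (𝓝[>] (0 : ℝ)) (𝓝 0) := by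
      rw [← ENNReal.ofReal_zero]
      exact (ENNReal.continuous_ofReal.tendsto 0).mono_left nhdsWithin_le_nhds
    refine tendsto_of_tendsto_of_tendsto_of_le_of_le tendsto_const_nhds h2
      (fun _ => zero_le) fun ε => ?_
    refine (Measure.restrict_apply_le _ _).trans ?_
    rw [Real.volume_Ioc, show 2 * ε - ε = ε by ring]
  refine (hg.tendsto_setIntegral_nhds_zero h1).congr' ?_
  filter_upwards [self_mem_nhdsWithin, mem_nhdsWithin_of_mem_nhds
    (Iio_mem_nhds (by norm_num : (0 : ℝ) < 1 / 4))] with ε h0 h4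
  rw [Measure.restrict_restrict_of_subset]
  intro w hw
  exact ⟨lt_trans h0 hw.1, hw.2.trans (by linarith [Set.mem_Iio.1 h4])⟩

theorem integral_const_Ioc_dyadic (a : ℝ) {ε : ℝ} (hε : 0 < ε) :
    ∫ _ in Set.Ioc ε (2 * ε), a = ε * a := by
  rw [setIntegral_const, smul_eq_mul, Measure.real, Real.volume_Ioc, show 2 * ε - ε = ε by ring,
    ENNReal.toReal_ofReal hε.le]

/-- A Littlewood–Paley argument: `T` converges if it is close to `A` and varies slowly in the sense
of square functions, and `A` converges. -/
theorem tendsto_of_square_functions {T A V : ℝ → ℂ} {L : ℂ}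
    (hA : Tendsto A (𝓝[>] (0 : ℝ)) (𝓝 L))
    (hU : IntegrableOn (fun ε => ‖T ε - A ε‖ ^ 2 * ε⁻¹) (Set.Ioc (0 : ℝ) (1 / 2)))
    (hV : IntegrableOn (fun w => ‖V w‖ ^ 2 * w⁻¹) (Set.Ioc (0 : ℝ) (1 / 2)))
    (hT : ∀ ε ε', 0 < ε → ε ≤ ε' → ε' ≤ 1 / 2 →
      ‖T ε - T ε'‖ ≤ ∫ w in Set.Ioc ε ε', ‖V w‖ * w⁻¹) :
    Tendsto T (𝓝[>] (0 : ℝ)) (𝓝 L) := by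
  rw [Metric.tendsto_nhds]
  intro η hη
  -- Three errors, none exceeding `δ`, are added at the end.
  set δ := η / 4 with hδ
  have hδ0 : 0 < δ := by positivity
  have hA' := Metric.tendsto_nhds.1 hA δ hδ0
  obtain ⟨r, hr0, hr⟩ := mem_nhdsGT_iff_exists_Ioo_subset.1 hA'
  rw [Set.mem_Ioi] at hr0
  filter_upwards [(tendsto_integral_dyadic hU).eventually_lt_const (by positivity : 0 < δ ^ 2 / 2),
    (tendsto_integral_dyadic hV).eventually_lt_const (by positivity : 0 < δ ^ 2 / 2),
    self_mem_nhdsWithin, mem_nhdsWithin_of_mem_nhds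
    (Iio_mem_nhds (by positivity : (0 : ℝ) < min (1 / 4) (r / 4)))] with ε hUε hVε h0 h4
  rw [Set.mem_Ioi] at h0
  rw [Set.mem_Iio, lt_min_iff] at h4
  have hsub : Set.Ioc ε (2 * ε) ⊆ Set.Ioc (0 : ℝ) (1 / 2) := fun w hw =>
    ⟨h0.trans hw.1, hw.2.trans (by linarith)⟩
  -- A good scale in `(ε, 2ε]` exists by Chebyshev's inequality: if `‖T - A‖ ≥ δ` throughout, then
  -- the integral against `dw/w` is at least `ε · δ²/(2ε) = δ²/2`.
  obtain ⟨ε', hε', hsmall⟩ : ∃ ε' ∈ Set.Ioc ε (2 * ε), ‖T ε' - A ε'‖ < δ := by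
    by_contra! hcon
    have h5 : ∫ _ in Set.Ioc ε (2 * ε), δ ^ 2 * (2 * ε)⁻¹ ≤
        ∫ w in Set.Ioc ε (2 * ε), ‖T w - A w‖ ^ 2 * w⁻¹ := by
      refine setIntegral_mono_on (integrableOn_const (by simp)) (hU.mono_set hsub)
        measurableSet_Ioc fun w hw => ?_
      have hw0 : 0 < w := h0.trans hw.1
      exact mul_le_mul (pow_le_pow_left₀ hδ0.le (hcon w hw) 2) (inv_anti₀ hw0 hw.2)
        (by positivity) (by positivity)
    rw [integral_const_Ioc_dyadic _ h0] at h5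
    have h6 : ε * (δ ^ 2 * (2 * ε)⁻¹) = δ ^ 2 / 2 := by field_simp
    linarith
  have hTT : ‖T ε - T ε'‖ ≤ δ := by
    refine (hT ε ε' h0 hε'.1.le (hsub hε').2).trans ?_
    have hint : IntegrableOn (fun w => 1 / (2 * δ) * (‖V w‖ ^ 2 * w⁻¹) + δ / 2 * ε⁻¹)
        (Set.Ioc ε (2 * ε)) := by
      refine Integrable.fun_add ((hV.mono_set hsub).const_mul _) ?_
      exact integrableOn_const (by simp)
    have h5 : ∫ w in Set.Ioc ε ε', ‖V w‖ * w⁻¹ ≤ ∫ w in Set.Ioc ε ε',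
        (1 / (2 * δ) * (‖V w‖ ^ 2 * w⁻¹) + δ / 2 * ε⁻¹) := by
      refine integral_mono_of_nonneg ?_ (hint.mono_set (Set.Ioc_subset_Ioc_right hε'.2)) ?_
      · filter_upwards [ae_restrict_mem measurableSet_Ioc] with w hw
        have : 0 < w := h0.trans hw.1
        positivity
      · filter_upwards [ae_restrict_mem measurableSet_Ioc] with w hw
        have hw0 : 0 < w := h0.trans hw.1
        have h7 : w⁻¹ ≤ ε⁻¹ := inv_anti₀ h0 hw.1.le
        -- Young's inequality in place of Cauchy–Schwarz: a small square integral over a dyadic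
        -- block controls the first power, with total error `δ/4 + δ/2`.
        have h8 : ‖V w‖ ≤ 1 / (2 * δ) * ‖V w‖ ^ 2 + δ / 2 := by
          have : 0 ≤ (‖V w‖ - δ) ^ 2 / (2 * δ) := by positivity
          have h9 : (‖V w‖ - δ) ^ 2 / (2 * δ) = 1 / (2 * δ) * ‖V w‖ ^ 2 + δ / 2 - ‖V w‖ := by
            field_simp; ring
          linarith
        have h10 := mul_le_mul_of_nonneg_right h8 (inv_nonneg.2 hw0.le)
        have h11 := mul_le_mul_of_nonneg_left h7 (by positivity : 0 ≤ δ / 2)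
        change ‖V w‖ * w⁻¹ ≤ 1 / (2 * δ) * (‖V w‖ ^ 2 * w⁻¹) + δ / 2 * ε⁻¹
        linarith
    have h6 : ∫ w in Set.Ioc ε ε', (1 / (2 * δ) * (‖V w‖ ^ 2 * w⁻¹) + δ / 2 * ε⁻¹) ≤
        ∫ w in Set.Ioc ε (2 * ε), (1 / (2 * δ) * (‖V w‖ ^ 2 * w⁻¹) + δ / 2 * ε⁻¹) := by
      refine setIntegral_mono_set hint ?_ (Set.Ioc_subset_Ioc_right hε'.2).eventuallyLE
      filter_upwards [ae_restrict_mem measurableSet_Ioc] with w hw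
      have : 0 < w := h0.trans hw.1
      positivity
    have h7 : ∫ w in Set.Ioc ε (2 * ε), (1 / (2 * δ) * (‖V w‖ ^ 2 * w⁻¹) + δ / 2 * ε⁻¹) =
        1 / (2 * δ) * (∫ w in Set.Ioc ε (2 * ε), ‖V w‖ ^ 2 * w⁻¹) + δ / 2 := by
      rw [integral_add ((hV.mono_set hsub).const_mul _) (integrableOn_const (by simp)),
        integral_const_mul, integral_const_Ioc_dyadic _ h0]
      field_simp
    have h8 : 1 / (2 * δ) * (∫ w in Set.Ioc ε (2 * ε), ‖V w‖ ^ 2 * w⁻¹) ≤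
        1 / (2 * δ) * (δ ^ 2 / 2) := mul_le_mul_of_nonneg_left hVε.le (by positivity)
    have h9 : 1 / (2 * δ) * (δ ^ 2 / 2) = δ / 4 := by field_simp; ring
    linarith
  have hAL : ‖A ε' - L‖ < δ := by
    rw [← dist_eq_norm]
    exact hr ⟨h0.trans hε'.1, hε'.2.trans_lt (by linarith)⟩
  rw [dist_eq_norm]
  calc ‖T ε - L‖ = ‖(T ε - T ε') + (T ε' - A ε') + (A ε' - L)‖ := by congr 1; ring
    _ ≤ ‖T ε - T ε'‖ + ‖T ε' - A ε'‖ + ‖A ε' - L‖ := norm_add₃_le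
    _ < η := by linarith

end LogarithmicScales

/-! ### Functions of bounded variation and symmetric difference quotients -/

section BoundedVariation

theorem eVariationOn_le_integral {f f' : ℝ → ℂ} (hf : ∀ x, HasDerivAt f (f' x) x)
    (hf' : Continuous f') {a b : ℝ} :
    eVariationOn f (Set.Icc a b) ≤ ENNReal.ofReal (∫ x in a..b, ‖f' x‖) := by
  refine iSup_le fun p => ?_
  obtain ⟨n, u, hu, hus⟩ := p
  have h1 : ∀ i, dist (f (u (i + 1))) (f (u i)) ≤ ∫ x in (u i)..(u (i + 1)), ‖f' x‖ := fun i => by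
    rw [dist_eq_norm, ← intervalIntegral.integral_eq_sub_of_hasDerivAt (fun x _ => hf x)
      (hf'.intervalIntegrable _ _)]
    exact intervalIntegral.norm_integral_le_integral_norm (hu (Nat.le_succ i))
  simp only [edist_dist]
  rw [← ENNReal.ofReal_sum_of_nonneg fun _ _ => dist_nonneg]
  refine ENNReal.ofReal_le_ofReal ((Finset.sum_le_sum fun i _ => h1 i).trans ?_)
  rw [intervalIntegral.sum_integral_adjacent_intervals fun k _ =>
    hf'.norm.intervalIntegrable _ _]
  exact intervalIntegral.integral_mono_interval (hus 0).1 (hu (Nat.zero_le n)) (hus n).2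
    (Eventually.of_forall fun x => norm_nonneg _) (hf'.norm.intervalIntegrable _ _)

/-- The variation of a partial sum is at most the integral of the norm of its derivative, which
Parseval bounds uniformly. Variation is lower semicontinuous under pointwise convergence. Bounded
variation is all that is needed for differentiability almost everywhere. -/
theorem boundedVariationOn_tsum_expo {d : ℤ → ℂ} (hd : Summable fun k => ‖d k‖)
    (hd2 : Summable fun k => (|freq k| * ‖d k‖) ^ 2) :
    BoundedVariationOn (fun x => ∑' k, d k * expo k x) (Set.Icc 0 1) := by
  set F : Finset ℤ → ℝ → ℂ := fun S x => ∑ k ∈ S, d k * expo k x with hF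
  set F' : Finset ℤ → ℝ → ℂ := fun S x => ∑ k ∈ S, (d k * (freq k * Complex.I)) * expo k x with hF'
  have hderiv : ∀ S x, HasDerivAt (F S) (F' S x) x := fun S x => by
    refine HasDerivAt.fun_sum fun k _ => ?_
    rw [mul_assoc]
    exact (hasDerivAt_expo k x).const_mul (d k)
  have hcont : ∀ S, Continuous (F' S) := fun S =>
    continuous_finsetSum _ fun k _ => continuous_const.mul (continuous_expo k)
  have hle : ∀ S, eVariationOn (F S) (Set.Icc 0 1) ≤
      ENNReal.ofReal (1 + ∑' k, (|freq k| * ‖d k‖) ^ 2) := fun S => by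
    refine (eVariationOn_le_integral (hderiv S) (hcont S)).trans (ENNReal.ofReal_le_ofReal ?_)
    have h1 : ∫ x in (0 : ℝ)..1, ‖F' S x‖ ≤ ∫ x in (0 : ℝ)..1, (1 + ‖F' S x‖ ^ 2) := by
      refine intervalIntegral.integral_mono_on zero_le_one ((hcont S).norm.intervalIntegrable _ _)
        ((continuous_const.add ((hcont S).norm.fun_pow 2)).intervalIntegrable _ _) fun x _ => ?_
      -- This is `y ≤ 1 + y²`, which passes from the `L¹` to the `L²` norm of the derivative.
      nlinarith [sq_nonneg (‖F' S x‖ - 1), sq_nonneg ‖F' S x‖]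
    refine h1.trans ?_
    rw [intervalIntegral.integral_add intervalIntegrable_const
      (((hcont S).norm.fun_pow 2).intervalIntegrable _ _), integral_norm_sq_sum]
    simp only [intervalIntegral.integral_const, sub_zero, smul_eq_mul, mul_one]
    have h2 : ∀ k, ‖d k * (freq k * Complex.I)‖ ^ 2 = (|freq k| * ‖d k‖) ^ 2 := fun k => by
      rw [norm_mul, norm_mul, Complex.norm_I, mul_one, Complex.norm_real, Real.norm_eq_abs,
        mul_comm]
    simp only [h2]
    have := hd2.sum_le_tsum S fun k _ => by positivity
    linarith
  have hlim : ∀ x ∈ Set.Icc (0 : ℝ) 1, Tendsto (fun S => F S x) atTop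
      (𝓝 (∑' k, d k * expo k x)) := fun x _ =>
    (Summable.of_norm_bounded hd fun k => by rw [norm_mul, norm_expo, mul_one]).hasSum
  have hfin : eVariationOn (fun x => ∑' k, d k * expo k x) (Set.Icc 0 1) ≤
      ENNReal.ofReal (1 + ∑' k, (|freq k| * ‖d k‖) ^ 2) := by
    refine le_of_not_gt fun hlt => ?_
    obtain ⟨S, hS⟩ := (eVariationOn.lowerSemicontinuous_aux hlim hlt).exists
    exact absurd (hle S) (not_le.2 hS)
  exact ne_top_of_le_ne_top ENNReal.ofReal_ne_top hfin

theorem tendsto_symm_slope {f : ℝ → ℂ} {L : ℂ} {x : ℝ} (hf : HasDerivAt f L x) :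
    Tendsto (fun ε : ℝ => (2 * ε)⁻¹ • (f (x + ε) - f (x - ε))) (𝓝[>] 0) (𝓝 L) := by
  have h1 : HasDerivAt (fun ε => f (x + ε) - f (x - ε)) (L + L) 0 := by
    have ha : HasDerivAt (fun ε : ℝ => x + ε) 1 0 := (hasDerivAt_id (0 : ℝ)).const_add x
    have hb : HasDerivAt (fun ε : ℝ => x - ε) (-1) 0 := (hasDerivAt_id (0 : ℝ)).const_sub x
    have h2 := HasDerivAt.scomp (h := fun ε : ℝ => x + ε) (0 : ℝ)
      (by simpa using hf : HasDerivAt f L (x + 0)) ha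
    have h3 := HasDerivAt.scomp (h := fun ε : ℝ => x - ε) (0 : ℝ)
      (by simpa using hf : HasDerivAt f L (x - 0)) hb
    have h4 := h2.fun_sub h3
    simpa [Function.comp_def] using h4
  have h2 := h1.tendsto_slope_zero_right.const_smul (2⁻¹ : ℝ)
  have hL : (2⁻¹ : ℝ) • (L + L) = L := by
    rw [← two_smul ℝ L, smul_smul]; norm_num
  rw [hL] at h2
  refine h2.congr fun ε => ?_
  simp only [zero_add, add_zero, sub_zero, sub_self, smul_smul, mul_inv]

end BoundedVariation

/-! ### Almost everywhere convergence on the Fourier side -/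

section SymbolSeries

variable {α : ℝ} {c : ℤ → ℂ}

/-- The series of the symmetric difference quotients of a primitive of `Q^α`. -/
noncomputable def massSeries (α : ℝ) (c : ℤ → ℂ) (ε x : ℝ) : ℂ :=
  ∑' k, c k * (symbolMass α (freq k) * Real.sinc (freq k * ε) : ℝ) * expo k x

/-- The Fourier coefficients of a primitive of `Q^α`. -/
noncomputable def primCoeff (α : ℝ) (c : ℤ → ℂ) (k : ℤ) : ℂ :=
  c k * symbolMass α (freq k) / (freq k * Complex.I)

theorem norm_primCoeff_le (hα : α ∈ Set.Ioo (2 : ℝ) 3) (k : ℤ) :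
    ‖primCoeff α c k‖ ≤ 4 * (1 / (3 - α) + 1) * (|freq k| ^ α * ‖c k‖) := by
  rw [primCoeff, norm_div, norm_mul, norm_mul, Complex.norm_I, mul_one, Complex.norm_real,
    Complex.norm_real, Real.norm_of_nonneg (symbolMass_nonneg _ _), Real.norm_eq_abs]
  have h3 : 0 < 3 - α := by linarith [hα.2]
  rcases eq_or_ne (freq k) 0 with h0 | hσ
  · rw [h0, abs_zero, div_zero]; positivity
  · have hs : 0 < |freq k| := abs_pos.2 hσ
    rw [div_le_iff₀ hs]
    have h1 := mul_le_mul_of_nonneg_left (symbolMass_le hα (freq k)) (norm_nonneg (c k))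
    rw [Real.rpow_add_one hs.ne'] at h1
    linarith

theorem summable_primCoeff (hα : α ∈ Set.Ioo (2 : ℝ) 3) (hc : SobolevCoeff α c) :
    Summable fun k => ‖primCoeff α c k‖ :=
  Summable.of_nonneg_of_le (fun _ => norm_nonneg _) (norm_primCoeff_le hα)
    ((hc.summable (by linarith)).mul_left _)

theorem summable_primCoeff_sq (hα : α ∈ Set.Ioo (2 : ℝ) 3) (hc : SobolevCoeff α c) :
    Summable fun k => (|freq k| * ‖primCoeff α c k‖) ^ 2 := by
  have h3 : 0 < 3 - α := by linarith [hα.2]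
  refine Summable.of_nonneg_of_le (fun _ => sq_nonneg _) (fun k => ?_)
    (Summable.mul_left ((4 * (1 / (3 - α) + 1)) ^ 2) hc)
  have h1 := mul_le_mul_of_nonneg_left (norm_primCoeff_le (c := c) hα k) (abs_nonneg (freq k))
  refine (pow_le_pow_left₀ (by positivity) h1 2).trans (le_of_eq ?_)
  rcases eq_or_ne (freq k) 0 with h0 | hσ
  · rw [h0, abs_zero, Real.zero_rpow (by linarith [hα.1] : 2 * (α + 1) ≠ 0)]; ring
  · have hs : 0 < |freq k| := abs_pos.2 hσ
    have h2 : |freq k| ^ (2 * (α + 1)) = (|freq k| ^ α * |freq k|) ^ 2 := by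
      rw [← Real.rpow_add_one hs.ne', ← Real.rpow_mul_natCast hs.le]; congr 1; push_cast; ring
    rw [h2]; ring

/-- Termwise, `e(x + ε) - e(x - ε) = 2i sin(σε) e(x)`. Dividing by `2ε` and by the `iσ` in
`primCoeff` yields `sinc(σε)`. -/
theorem hasSum_massSeries (hα : α ∈ Set.Ioo (2 : ℝ) 3) (hc : SobolevCoeff α c) {ε : ℝ}
    (hε : ε ≠ 0) (x : ℝ) :
    HasSum (fun k => c k * (symbolMass α (freq k) * Real.sinc (freq k * ε) : ℝ) * expo k x)
      ((2 * ε)⁻¹ • ((∑' k, primCoeff α c k * expo k (x + ε)) -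
        ∑' k, primCoeff α c k * expo k (x - ε))) := by
  have hs : ∀ y, HasSum (fun k => primCoeff α c k * expo k y)
      (∑' k, primCoeff α c k * expo k y) := fun y =>
    (Summable.of_norm_bounded (summable_primCoeff hα hc) fun k => by
      rw [norm_mul, norm_expo, mul_one]).hasSum
  refine (((hs (x + ε)).sub (hs (x - ε))).const_smul (2 * ε)⁻¹).congr_fun fun k => ?_
  rw [sub_eq_add_neg x, expo_add, expo_add, expo_neg_eq, expo_eq_cos_add k ε, primCoeff,
    Complex.real_smul]
  rcases eq_or_ne (freq k) 0 with h0 | hσ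
  -- At frequency zero the mass vanishes, in accordance with the value `0` of the division by zero
  -- in `primCoeff`.
  · simp [h0, symbolMass, symbolDensity_zero_left]
  · rw [Real.sinc_of_ne_zero (mul_ne_zero hσ hε)]
    have h1 : (freq k : ℂ) ≠ 0 := by exact_mod_cast hσ
    have h2 : (ε : ℂ) ≠ 0 := by exact_mod_cast hε
    push_cast
    field_simp
    ring

/-- By `hasSum_massSeries` this series is a symmetric difference quotient of a function of bounded
variation, which is differentiable almost everywhere. -/
theorem ae_tendsto_massSeries (hα : α ∈ Set.Ioo (2 : ℝ) 3) (hc : SobolevCoeff α c) :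
    ∀ᵐ x, x ∈ Set.Icc (0 : ℝ) 1 →
      ∃ L, Tendsto (fun ε => massSeries α c ε x) (𝓝[>] (0 : ℝ)) (𝓝 L) := by
  have h := boundedVariationOn_tsum_expo (summable_primCoeff hα hc) (summable_primCoeff_sq hα hc)
  rw [← Set.uIcc_of_le zero_le_one] at h ⊢
  filter_upwards [h.ae_differentiableAt_of_mem_uIcc] with x hx hx1
  refine ⟨_, (tendsto_symm_slope (hx hx1).hasDerivAt).congr' ?_⟩
  filter_upwards [self_mem_nhdsWithin] with ε hε
  exact (hasSum_massSeries hα hc (ne_of_gt hε) x).tsum_eq.symm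

/-- The sum of the integrands of `Q^α` at `w` and `-w`, as a series. -/
noncomputable def densitySeries (α : ℝ) (c : ℤ → ℂ) (w x : ℝ) : ℂ :=
  ∑' k, c k * symbolDensity α (freq k) w * expo k x

theorem norm_densitySeries_term_le (hα : α ∈ Set.Ioo (2 : ℝ) 3) {ε w : ℝ} (hε : 0 < ε)
    (hw : ε ≤ w) (k : ℤ) (x : ℝ) : ‖c k * symbolDensity α (freq k) w * expo k x‖ ≤
      2 * ε ^ (-α) * (|freq k| ^ 2 * ‖c k‖) := by
  rw [norm_mul, norm_expo, mul_one, norm_mul, Complex.norm_real,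
    Real.norm_of_nonneg (symbolDensity_nonneg _ _ _), sq_abs]
  have h1 := symbolDensity_le_far α (freq k) w
  rw [abs_of_pos (hε.trans_le hw)] at h1
  have h2 : w ^ (-α) ≤ ε ^ (-α) := Real.rpow_le_rpow_of_nonpos hε hw (by linarith [hα.1])
  have h3 := mul_le_mul_of_nonneg_left h2 (by positivity : 0 ≤ 2 * freq k ^ 2)
  have := mul_le_mul_of_nonneg_left (h1.trans h3) (norm_nonneg (c k))
  linarith

theorem hasSum_densitySeries (hα : α ∈ Set.Ioo (2 : ℝ) 3) (hc : SobolevCoeff α c) {w : ℝ}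
    (hw : 0 < w) (x : ℝ) :
    HasSum (fun k => c k * symbolDensity α (freq k) w * expo k x) (densitySeries α c w x) :=
  (Summable.of_norm_bounded ((hc.summable_pow hα.1 le_rfl).mul_left _) fun k =>
    norm_densitySeries_term_le hα hw le_rfl k x).hasSum

theorem hasSum_integral_densitySeries (hα : α ∈ Set.Ioo (2 : ℝ) 3) (hc : SobolevCoeff α c)
    {ε ε' : ℝ} (hε : 0 < ε) (h : ε ≤ ε') (x : ℝ) :
    HasSum (fun k => c k * (∫ w in ε..ε', symbolDensity α (freq k) w : ℝ) * expo k x)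
      (∫ w in ε..ε', densitySeries α c w x) := by
  have hs := (hc.summable_pow hα.1 le_rfl).mul_left (2 * ε ^ (-α))
  have h1 := intervalIntegral.hasSum_integral_of_dominated_convergence (μ := volume)
    (a := ε) (b := ε') (f := fun w => densitySeries α c w x)
    (F := fun k w => c k * symbolDensity α (freq k) w * expo k x)
    (fun k _ => 2 * ε ^ (-α) * (|freq k| ^ 2 * ‖c k‖))
    (fun k => (((Complex.measurable_ofReal.comp (measurable_symbolDensity α _)).const_mul _).mul_const
      _).aestronglyMeasurable)
    (fun k => Eventually.of_forall fun w hw => by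
      rw [Set.uIoc_of_le h] at hw
      exact norm_densitySeries_term_le hα hε hw.1.le k x)
    (Eventually.of_forall fun w _ => hs) intervalIntegrable_const
    (Eventually.of_forall fun w hw => by
      rw [Set.uIoc_of_le h] at hw
      exact hasSum_densitySeries hα hc (hε.trans hw.1) x)
  refine h1.congr_fun fun k => ?_
  rw [intervalIntegral.integral_mul_const, intervalIntegral.integral_const_mul,
    intervalIntegral.integral_ofReal]

theorem multOp_density (α : ℝ) (c : ℤ → ℂ) {w : ℝ} (hw : w ∈ Set.Ioc (0 : ℝ) (1 / 2)) (x : ℝ) :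
    multOp c (densityMultiplier α) w x = w * densitySeries α c w x := by
  rw [multOp, densitySeries, ← tsum_mul_left]
  refine tsum_congr fun k => ?_
  rw [densityMultiplier, Set.indicator_of_mem hw]
  push_cast
  ring

theorem multOp_tail (hα : α ∈ Set.Ioo (2 : ℝ) 3) (hc : SobolevCoeff α c) {ε : ℝ}
    (hε : ε ∈ Set.Ioc (0 : ℝ) (1 / 2)) (x : ℝ) : multOp c (tailMultiplier α) ε x =
      (∫ w in ε..(1 / 2), densitySeries α c w x) - massSeries α c ε x := by
  have h2 : massSeries α c ε x = _ := (hasSum_massSeries hα hc hε.1.ne' x).tsum_eq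
  have h3 := (hasSum_integral_densitySeries hα hc hε.1 hε.2 x).sub
    (hasSum_massSeries hα hc hε.1.ne' x)
  rw [h2, multOp, ← h3.tsum_eq]
  refine tsum_congr fun k => ?_
  rw [tailMultiplier, Set.indicator_of_mem hε, symbolTail]
  push_cast
  ring

theorem integral_densitySeries_sub (hα : α ∈ Set.Ioo (2 : ℝ) 3) (hc : SobolevCoeff α c)
    {ε ε' : ℝ} (hε : 0 < ε) (h : ε ≤ ε') (h' : ε' ≤ 1 / 2) (x : ℝ) :
    (∫ w in ε..(1 / 2), densitySeries α c w x) - ∫ w in ε'..(1 / 2), densitySeries α c w x =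
      ∫ w in ε..ε', densitySeries α c w x := by
  have h3 := (hasSum_integral_densitySeries hα hc hε (h.trans h') x).sub
    (hasSum_integral_densitySeries hα hc (hε.trans_le h) h' x)
  rw [← h3.tsum_eq, ← (hasSum_integral_densitySeries hα hc hε h x).tsum_eq]
  refine tsum_congr fun k => ?_
  have hi : ∀ a b, IntervalIntegrable (symbolDensity α (freq k)) volume a b := fun a b =>
    (integrable_symbolDensity hα _).intervalIntegrable
  rw [← intervalIntegral.integral_add_adjacent_intervals (hi ε ε') (hi ε' (1 / 2))]
  push_cast
  ring

/-- Almost everywhere convergence of the truncations of `Q^α`, on the Fourier side. -/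
theorem ae_tendsto_integral_densitySeries (hα : α ∈ Set.Ioo (2 : ℝ) 3) (hc : SobolevCoeff α c) :
    ∀ᵐ x ∂(volume.restrict (Set.Ioc (0 : ℝ) 1)), ∃ L, Tendsto
      (fun ε => ∫ w in ε..(1 / 2), densitySeries α c w x) (𝓝[>] (0 : ℝ)) (𝓝 L) := by
  filter_upwards [(isMultiplier_tail hα).ae_integrableOn hα hc,
    (isMultiplier_density hα).ae_integrableOn hα hc,
    ae_restrict_of_ae (ae_tendsto_massSeries hα hc), ae_restrict_mem measurableSet_Ioc]
    with x hU hV hA hx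
  obtain ⟨L, hL⟩ := hA (Set.Ioc_subset_Icc_self hx)
  refine ⟨L, tendsto_of_square_functions hL (hU.congr_fun (fun ε hε => ?_) measurableSet_Ioc) hV
    fun ε ε' h0 h h' => ?_⟩
  · simp only [multOp_tail hα hc hε]
  · rw [integral_densitySeries_sub hα hc h0 h h']
    refine (intervalIntegral.norm_integral_le_integral_norm h).trans (le_of_eq ?_)
    rw [intervalIntegral.integral_of_le h]
    refine setIntegral_congr_fun measurableSet_Ioc fun w hw => ?_
    have hw0 : 0 < w := h0.trans hw.1
    simp only [multOp_density α c ⟨hw0, hw.2.trans h'⟩ x]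
    rw [norm_mul, Complex.norm_real, Real.norm_of_nonneg hw0.le, mul_comm w, mul_assoc,
      mul_inv_cancel₀ hw0.ne', mul_one]

end SymbolSeries

/-! ### Almost everywhere existence of `Q^α` -/

section AlmostEverywhere

variable {n : ℕ} {α : ℝ} {γ : ℝ → Eucl n} {c : ℤ → ℂ}

theorem densitySeries_eq (hα : 2 < α) (hc : SobolevCoeff α c) {w : ℝ} (hw : w ≠ 0) (x : ℝ) :
    densitySeries α c w x = ((|w| ^ (-α) : ℝ) : ℂ) * (((2 / w ^ 2 : ℝ) : ℂ) *
      (series c 0 (x + w) + series c 0 (x - w) - 2 * series c 0 x) - 2 * series c 2 x) := by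
  have h0 := fun y => hc.hasSum_series hα (m := 0) (by norm_num) y
  have h2 := hc.hasSum_series hα le_rfl x
  have h := (((((h0 (x + w)).add (h0 (x - w))).sub ((h0 x).mul_left 2)).mul_left
    ((2 / w ^ 2 : ℝ) : ℂ)).sub (h2.mul_left 2)).mul_left ((|w| ^ (-α) : ℝ) : ℂ)
  rw [← h.tsum_eq, densitySeries]
  refine tsum_congr fun k => ?_
  rw [sub_eq_add_neg x, expo_add, expo_add, expo_neg_eq, expo_eq_cos_add k w, symbolDensity,
    pow_zero, mul_pow, Complex.I_sq]
  have hw' : (w : ℂ) ≠ 0 := by exact_mod_cast hw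
  push_cast
  field_simp
  ring

theorem continuousOn_densitySeries (hα : α ∈ Set.Ioo (2 : ℝ) 3) (hc : SobolevCoeff α c) {ε : ℝ}
    (hε : 0 < ε) (x : ℝ) : ContinuousOn (fun w => densitySeries α c w x) (Set.Ici ε) := by
  refine continuousOn_tsum (fun k => ?_) ((hc.summable_pow hα.1 le_rfl).mul_left (2 * ε ^ (-α)))
    fun k w hw => norm_densitySeries_term_le hα hε hw k x
  refine ContinuousOn.mul (continuousOn_const.mul ?_) continuousOn_const
  exact Complex.continuous_ofReal.comp_continuousOn ((continuousOn_symbolDensity α _).mono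
    fun w hw => (hε.trans_le hw).ne')

theorem continuousOn_qIntegrand (hγ : Continuous γ) (x : ℝ) :
    ContinuousOn (qIntegrand α γ x) {0}ᶜ := by
  have h1 : ContinuousOn (fun w : ℝ => 1 / |w| ^ α) {0}ᶜ :=
    continuousOn_const.div (continuousOn_abs_rpow α) fun w hw =>
      (Real.rpow_pos_of_pos (abs_pos.2 hw) α).ne'
  have h2 : ContinuousOn (fun w : ℝ => 2 / w ^ 2) {0}ᶜ :=
    continuousOn_const.div (by fun_prop) fun w hw => pow_ne_zero 2 hw
  exact h1.smul ((h2.smul (by fun_prop : Continuous fun w =>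
    γ (x + w) - γ x - w • deriv γ x).continuousOn).sub continuousOn_const)

/-- The term `w γ'(x)` cancels between `w` and `-w`. What remains is an even second difference, and
its action on characters is the real symbol `symbolDensity`. -/
theorem qIntegrand_add_neg (hα : 2 < α) (hc : Continuous γ) (h : MemSobolev (α + 1) γ) {w : ℝ}
    (hw : w ≠ 0) (x : ℝ) (i : Fin n) :
    (qIntegrand α γ x w + qIntegrand α γ x (-w)) i =
      (densitySeries α (coordCoeff γ i) w x).re := by
  have hre : ∀ y, (series (coordCoeff γ i) 0 y).re = γ y i := fun y => by
    rw [← ofReal_eq_series hα hc h, Complex.ofReal_re]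
  rw [densitySeries_eq hα (sobolevCoeff_coordCoeff hα h i) hw, Complex.re_ofReal_mul,
    Complex.sub_re, Complex.re_ofReal_mul, Complex.sub_re, Complex.add_re,
    ← Complex.ofReal_ofNat 2, Complex.re_ofReal_mul, Complex.re_ofReal_mul, hre, hre, hre]
  simp only [qIntegrand, remR, iteratedDeriv_two_eq_series hα hc h, PiLp.add_apply,
    PiLp.smul_apply, PiLp.sub_apply, smul_eq_mul, abs_neg, neg_sq, ← sub_eq_add_neg,
    Real.rpow_neg (abs_nonneg w)]
  ring

theorem integral_trunc_qIntegrand (hα : α ∈ Set.Ioo (2 : ℝ) 3) (hc : Continuous γ)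
    (h : MemSobolev (α + 1) γ) {ε : ℝ} (h0 : 0 < ε) (h1 : ε < 1 / 2) (x : ℝ) (i : Fin n) :
    (∫ w in trunc ε, qIntegrand α γ x w) i =
      (∫ w in ε..(1 / 2), densitySeries α (coordCoeff γ i) w x).re := by
  have hcq := continuousOn_qIntegrand (α := α) hc x
  have hl : IntervalIntegrable (qIntegrand α γ x) volume (-(1 / 2)) (-ε) := by
    refine (hcq.mono fun w hw => ?_).intervalIntegrable
    rw [Set.uIcc_of_le (by linarith)] at hw
    exact (by linarith [hw.2] : w < 0).ne
  have hr : IntervalIntegrable (qIntegrand α γ x) volume ε (1 / 2) := by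
    refine (hcq.mono fun w hw => ?_).intervalIntegrable
    rw [Set.uIcc_of_le h1.le] at hw
    exact (h0.trans_le hw.1).ne'
  have hl' : IntervalIntegrable (fun w => qIntegrand α γ x (-w)) volume ε (1 / 2) := by
    refine (hcq.comp continuous_neg.continuousOn fun w hw => ?_).intervalIntegrable
    rw [Set.uIcc_of_le h1.le] at hw
    exact neg_ne_zero.2 (h0.trans_le hw.1).ne'
  have hd : IntervalIntegrable (fun w => densitySeries α (coordCoeff γ i) w x) volume ε (1 / 2) :=
    ((continuousOn_densitySeries hα (sobolevCoeff_coordCoeff hα.1 h i) h0 x).mono fun w hw => by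
      rw [Set.uIcc_of_le h1.le] at hw; exact hw.1).intervalIntegrable
  rw [integral_trunc h0 h1 hl hr, ← intervalIntegral.integral_comp_neg,
    ← intervalIntegral.integral_add hl' hr]
  have e1 := (EuclideanSpace.proj (𝕜 := ℝ) i : Eucl n →L[ℝ] ℝ).intervalIntegral_comp_comm
    (hl'.add hr)
  have e2 := Complex.reCLM.intervalIntegral_comp_comm hd
  refine e1.symm.trans (Eq.trans ?_ e2)
  refine intervalIntegral.integral_congr fun w hw => ?_
  rw [Set.uIcc_of_le h1.le] at hw
  have := qIntegrand_add_neg hα.1 hc h (h0.trans_le hw.1).ne' x i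
  rw [add_comm] at this
  exact this

theorem tendsto_eucl {ι : Type*} {l : Filter ι} {f : ι → Eucl n} {v : Fin n → ℝ}
    (h : ∀ i, Tendsto (fun t => f t i) l (𝓝 (v i))) : Tendsto f l (𝓝 (WithLp.toLp 2 v)) :=
  ((PiLp.continuousLinearEquiv 2 ℝ (fun _ : Fin n => ℝ)).symm.continuous.tendsto v).comp
    (tendsto_pi_nhds.2 h)

theorem ae_of_ae_restrict_Ioc {P : ℝ → Prop} (hP : ∀ x (m : ℤ), P (x + m) → P x)
    (h : ∀ᵐ x ∂(volume.restrict (Set.Ioc (0 : ℝ) 1)), P x) : ∀ᵐ x, P x := by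
  rw [ae_restrict_iff' measurableSet_Ioc] at h
  have h1 : ∀ m : ℤ, ∀ᵐ x : ℝ, x + m ∈ Set.Ioc (0 : ℝ) 1 → P (x + m) := fun m =>
    (measurePreserving_add_right volume (m : ℝ)).quasiMeasurePreserving.ae h
  filter_upwards [ae_all_iff.2 h1] with x hx
  obtain ⟨m, hm, -⟩ := existsUnique_add_zsmul_mem_Ioc (zero_lt_one' ℝ) x 0
  simp only [zsmul_eq_mul, mul_one, zero_add] at hm
  exact hP x m (hx m hm)

theorem qIntegrand_add_int (hp : Function.Periodic γ 1) (x : ℝ) (m : ℤ) :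
    qIntegrand α γ (x + m) = qIntegrand α γ x := by
  have hm : ∀ {f : ℝ → Eucl n}, Function.Periodic f 1 → ∀ y, f (y + m) = f y := fun hf y => by
    simpa using hf.int_mul m y
  have hd : Function.Periodic (deriv γ) 1 := by
    have := periodic_iteratedDeriv hp 1
    rwa [iteratedDeriv_one] at this
  funext w
  simp only [qIntegrand, remR]
  rw [add_right_comm, hm hp, hm hp, hm hd, hm (periodic_iteratedDeriv hp 2)]

/-- For a curve in `H^{α+1}`, the principal value that defines `Q^α` exists almost everywhere. -/
theorem ae_hasQ (hα : α ∈ Set.Ioo (2 : ℝ) 3) (hc : Continuous γ) (h : MemSobolev (α + 1) γ) :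
    ∀ᵐ x : ℝ, ∃ q, HasQ α γ x q := by
  refine ae_of_ae_restrict_Ioc (fun x m ⟨q, hq⟩ => ⟨q, ?_⟩) ?_
  · change HasPV (qIntegrand α γ (x + m)) q at hq
    rwa [qIntegrand_add_int h.periodic] at hq
  · filter_upwards [ae_all_iff.2 fun i => ae_tendsto_integral_densitySeries hα
      (sobolevCoeff_coordCoeff hα.1 h i)] with x hx
    choose L hL using hx
    refine ⟨WithLp.toLp 2 fun i => (L i).re, tendsto_eucl fun i => ?_⟩
    refine ((Complex.continuous_re.tendsto _).comp (hL i)).congr' ?_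
    filter_upwards [eventually_trunc] with ε hε
    exact (integral_trunc_qIntegrand hα hc h hε.1 hε.2 x i).symm

end AlmostEverywhere

/-! ### The decomposition of `H^α` -/

section Decomposition

variable {n : ℕ} {α : ℝ} {γ : ℝ → Eucl n}

/-- On each truncated domain the integrand of `H^α` is the projected multiple of that of `Q^α` plus
`dIntegrand`, all of them integrable there; the projection is continuous and linear, so the limits
add up. -/
theorem hasPV_hIntegrand (hγ : Continuous γ) {x : ℝ} {q v : Eucl n}
    (hD : ∀ ε, 0 < ε → ε < 1 / 2 → IntegrableOn (dIntegrand α γ x) (trunc ε))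
    (hv : HasPV (dIntegrand α γ x) v) (hq : HasPV (qIntegrand α γ x) q) :
    HasPV (hIntegrand α γ x)
      ((α / ‖deriv γ x‖ ^ (α + 1)) • normalProj (deriv γ x) q + v) := by
  set lam := α / ‖deriv γ x‖ ^ (α + 1)
  have h1 : Tendsto (fun ε => lam • normalProjL (deriv γ x) (∫ w in trunc ε, qIntegrand α γ x w) +
      ∫ w in trunc ε, dIntegrand α γ x w) (𝓝[>] 0)
      (𝓝 (lam • normalProjL (deriv γ x) q + v)) :=
    ((((normalProjL (deriv γ x)).continuous.tendsto q).comp hq).const_smul lam).add hv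
  rw [normalProjL_apply] at h1
  refine h1.congr' ?_
  filter_upwards [eventually_trunc] with ε hε
  have hQ := integrableOn_trunc_of_continuousOn hε.1 hε.2 (continuousOn_qIntegrand (α := α) hγ x)
  have hPQ := ((normalProjL (deriv γ x)).integrable_comp hQ).fun_smul lam
  rw [← (normalProjL (deriv γ x)).integral_comp_comm hQ, ← integral_smul,
    ← integral_add hPQ (hD ε hε.1 hε.2)]
  refine integral_congr_ae (Eventually.of_forall fun w => ?_)
  simp only [dIntegrand, normalProjL_apply, lam]
  abel

/-- With `b < min (1/2) (3 - α)` the Sobolev curve lies in `C^{α+b}`, so the lower order limit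
exists at every `x`. Existence of `H^α` at `x` then requires nothing beyond existence of `Q^α` at
that point. -/
theorem hasH_of_hasQ (hα : α ∈ Set.Ioo (2 : ℝ) 3) (hγ : IsInjRegular γ)
    (h : MemSobolev (α + 1) γ) {x : ℝ} {q : Eucl n} (hq : HasQ α γ x q) :
    HasH α γ x
      ((α / ‖deriv γ x‖ ^ (α + 1)) • normalProj (deriv γ x) q + lowerOrder α γ x) := by
  obtain ⟨b, hb0, hb1⟩ : ∃ b, 0 < b ∧ b < min (1 / 2) (3 - α) :=
    exists_between (lt_min (by norm_num) (by linarith [hα.2]))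
  have hb2 := hb1.trans_le (min_le_left _ _)
  have hb3 := hb1.trans_le (min_le_right _ _)
  have hb : b ∈ Set.Ioo (0 : ℝ) 1 := ⟨hb0, by linarith⟩
  set u : HolderSpace n (α + b) :=
    .ofFun γ (memC_of_sobolev hα hγ.contDiff.continuous h hb hb2 (by linarith))
  obtain ⟨c, hc, hu⟩ : IsBiLip u.toFun := hγ.isBiLip
  obtain ⟨hD, hv⟩ := integrableOn_dIntegrand_and_tendsto hα hb u hc hu x
  have hlow := lowerOrder_eq hv
  rw [HolderSpace.toFun_ofFun] at hD hv hlow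
  rw [hlow]
  exact hasPV_hIntegrand hγ.contDiff.continuous hD hv hq

end Decomposition

end OHara

theorem mainTheorem7 (n : ℕ) (α : ℝ) (hα : α ∈ Set.Ioo (2 : ℝ) 3) :
    ∃ F : (ℝ → OHara.Eucl n) → (ℝ → OHara.Eucl n),
      (∀ β : ℝ, 0 < β → (∀ m : ℕ, β ≠ m) →
        ∃ G : OHara.HolderSpace n (α + β) → OHara.HolderSpace n β,
          (∀ u ∈ OHara.injRegular n (α + β), (G u).toFun = F u.toFun) ∧
          AnalyticOnNhd ℝ G (OHara.injRegular n (α + β))) ∧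
      ∀ γ : ℝ → OHara.Eucl n, OHara.IsInjRegular γ → OHara.MemSobolev (α + 1) γ →
        (∀ᵐ x : ℝ, ∃ q, OHara.HasQ α γ x q) ∧
        ∀ x q, OHara.HasQ α γ x q →
          OHara.HasH α γ x
            ((α / ‖deriv γ x‖ ^ (α + 1)) • OHara.normalProj (deriv γ x) q + F γ x) := by
  refine ⟨OHara.lowerOrder α, fun β hβ hβn => ?_, fun γ hγ h =>
    ⟨OHara.ae_hasQ hα hγ.contDiff.continuous h, fun x q hq => OHara.hasH_of_hasQ hα hγ h hq⟩⟩
  obtain ⟨G, hG, hGa⟩ := OHara.isAnalyticLowerOrder (n := n) hα hβ hβn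
  -- Injective regular curves are bi-Lipschitz, so both properties of `G` restrict to them.
  exact ⟨G, fun u hu => hG u hu.isBiLip, hGa.mono fun u hu => hu.isBiLip⟩
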